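/- Let $d\ge 2$, $\alpha=\frac{d-1}{2}$, and let $\nu$ be a parameter of the principal series ($\nu\in\mathbb{R}$) or of the complementary series ($i\nu\in(0,\alpha)$) of $SO^\uparrow(d,1)$. Write $X\cdot Y=X_0Y_0-\sum_{i=1}^d X_iY_i$ on $\mathbb{R}^{d+1}$, $C_d^+=\{P: P\cdot P=0,\ P_0>0\}$, $\mathrm{dS}_d=\{X: X\cdot X=-1\}$ with its invariant volume $d\mu$, and integrate in $P$ over $B=\{P\in C_d^+:P_0=1\}\cong S^{d-1}$. *Hilbert space.* Let $\mathcal{H}_1=L^2(\mathbb{R},d\theta)\otimes\mathcal{K}_\nu$, where $\mathcal{K}_\nu$ is the completion of the functions on $C_d^+$ homogeneous of degree $-\alpha-i\nu$ for the inner product $\int_B\overline{\psi_1}\psi_2$ (principal series), respectively $(2\pi)^{-\alpha}\frac{\Gamma(\alpha-i\nu)}{\Gamma(i\nu)}\int_B\int_B\overline{\psi_1(P)}(P\cdot Q)^{-\alpha+i\nu}\psi_2(Q)$ (complementary series). On $\mathcal{H}_1^{\otimes n}$, whose vectors are given by functions $\Psi_n(\theta_1,P_1,\dots,\theta_n,P_n)$,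 let $$(V(x,\lambda,\Lambda)\Psi_n)(\theta_1,P_1,\dots)=e^{ix\sum_je^{\theta_j}}\,\Psi_n(\theta_1-\lambda,\Lambda^{-1}P_1,\dots),$$ where $(x,\lambda)\in\mathcal{P}_o$, the group with product $(x,\lambda)(x',\lambda')=(x+e^{-\lambda}x',\lambda+\lambda')$, and $\Lambda\in SO^\uparrow(d,1)$. Let $\tilde R_\theta=\sigma(-\tfrac{\alpha}{\pi}\theta)\,R_{-\frac{\alpha}{\pi}\theta}$, where $R_\theta$ has the integral kernel $$\frac{\Gamma(\alpha-i\theta)^2}{(2\pi)^{d-1}\Gamma(i\theta)^2}(P_1\cdot P_2)^{-i\theta-i\nu}(P_1\cdot P_1')^{-\alpha+i\theta}(P_2\cdot P_2')^{-\alpha+i\theta}(P_1'\cdot P_2')^{-i\theta+i\nu}$$ (boundary value of $\theta-i\varepsilon$, $\varepsilon\downarrow0$), and, with $\epsilon=0$ (principal) or $\epsilon=i\nu$ (complementary), $\nu_{12}^{+}=i\nu$, $\nu_{12}^-=0$, $$\sigma(\theta)=\frac{\Gamma(\alpha+\epsilon-i\theta)^2}{\Gamma(\alpha+\epsilon+i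\theta)^2}\prod_{n=0}^\infty\Big\{\frac{\Gamma(i\theta+\alpha(2n+1)-\epsilon)^2\,\Gamma(-i\theta+\alpha(2n-1)-\epsilon)^2}{\Gamma(-i\theta+\alpha(2n+1)-\epsilon)^2\,\Gamma(i\theta+\alpha(2n-1)-\epsilon)^2}\prod_{p,q=\pm}\frac{\Gamma(i\theta+\alpha(2n+1)-p\nu_{12}^q)\,\Gamma(-i\theta+\alpha(2n+2)-p\nu_{12}^q)}{\Gamma(-i\theta+\alpha(2n+1)-p\nu_{12}^q)\,\Gamma(i\theta+\alpha(2n+2)-p\nu_{12}^q)}\Big\}.$$ Let $\mathcal{H}_n^R\subset\mathcal{H}_1^{\otimes n}$ be the closed subspace of the $\Psi_n$ that satisfy, for $1\le j\le n-1$, $$\Psi_n(\dots,\theta_j,P_j,\theta_{j+1},P_{j+1},\dots)=\int_B\int_B\tilde R_{\theta_j-\theta_{j+1}}(P_j,P_{j+1};P',P'')\,\Psi_n(\dots,\theta_{j+1},P',\theta_j,P'',\dots),$$ $P_n^R$ the orthogonal projection onto it, $\mathcal{H}^R=\bigoplus_{n\ge0}\mathcal{H}_n^R$, and $\mathcal{D}\subset\mathcal{H}^R$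 the subspace of vectors of finite particle number. On $\mathcal{D}$ let $z_R^\dagger(\xi)\Psi_n=\sqrt{n+1}\,P_{n+1}^R(\xi\otimes\Psi_n)$ for $\xi\in\mathcal{H}_1$, and $z_R(\xi)=z_R^\dagger(\xi)^*$. *Field.* For $f\in\mathcal{S}(\mathbb{R})$ and $F\in C_0^\infty(\mathrm{dS}_d)$ put $f^\pm(\theta)=\pm ie^\theta\int e^{\pm iue^\theta}f(u)\,du$, $F_-(X)=F(-X)$, $$F^+_\nu(P)=\lim_{\varepsilon\downarrow0}\int_{\mathrm{dS}_d}F(X)\,\big(X\cdot P+i\varepsilon P_0\big)^{-\alpha-i\nu}\,d\mu(X),$$ $$\phi_R(f\otimes F)=z_R^\dagger(f^+\otimes F_\nu^+)+z_R\big(\overline{f^-}\otimes(\overline{F_-})_\nu^+\big)\quad\text{on }\mathcal{D}.$$ **Proposition.** The limits $F_\nu^+(P)$ exist, $f^+\otimes F^+_\nu$ and $\overline{f^-}\otimes F^+_\nu$ lie in $\mathcal{H}_1$, and $\phi_R$ is an operator-valued distribution on $\mathcal{S}(\mathbb{R})\times C_0^\infty(\mathrm{dS}_d)$ with dense invariant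 domain $\mathcal{D}$: it is bilinear in $(f,F)$, and for all $\Psi\in\mathcal{D}$ and all compact $K\subset\mathrm{dS}_d$ there are a constant, a Schwartz seminorm and an $N$ such that $\|\phi_R(f\otimes F)\Psi\|$ is bounded by the constant times the seminorm of $f$ times the $C^N$-norm of $F$, for all $F$ supported in $K$. Moreover: a) $\phi_R(u,X)^*=\phi_R(u,-X)$ on $\mathcal{D}$, that is, $\phi_R(\overline f\otimes\overline{F_-})\subset\phi_R(f\otimes F)^*$. b) $V$ defines a unitary representation of $\mathcal{P}_o\times SO^\uparrow(d,1)$ on $\mathcal{H}^R$ that leaves $\mathcal{D}$ invariant, and $V(x,\lambda,\Lambda)\phi_R(u,X)V(x,\lambda,\Lambda)^{-1}=e^{-\lambda}\phi_R(e^{-\lambda}u+x,\Lambda X)$, that is, on $\mathcal{D}$, $$V(x,\lambda,\Lambda)\,\phi_R(f\otimes F)\,V(x,\lambda,\Lambda)^{-1}=e^{-\lambda}\phi_R(f_{x,\lambda}\otimes F\circ\Lambda^{-1}),\qquad f_{x,\lambda}(u)=e^{\lambda}f(e^\lambda(u-x)).$$ c) $(\square_X+m^2)\phi_R(u,X)=0$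 with $m^2=\alpha^2+\nu^2$, that is, $\phi_R(f\otimes(\square+m^2)F)=0$, where $\square$ is the d'Alembert operator of $\mathrm{dS}_d$ for the metric of signature $(+,-,\dots,-)$ induced by $X\cdot Y$. -/

import Mathlib

open MeasureTheory Metric Set Filter Topology


abbrev Euc (d : ℕ) : Type := EuclideanSpace ℝ (Fin d)

theorem choose_nonneg_aux (a : ℝ) (ha : 0 < a) (n : ℕ) : 0 ≤ Ring.choose (a + n - 1) n := by
  have h := Ring.descPochhammer_eq_factorial_smul_choose (a + n - 1) n
  have h2 : 0 ≤ (descPochhammer ℤ n).smeval (a + n - 1) := by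
    rw [Polynomial.descPochhammer_smeval_eq_ascPochhammer]
    rw [show a + n - 1 - n + 1 = a by ring]
    rw [Polynomial.ascPochhammer_smeval_eq_eval]
    exact (ascPochhammer_pos n a ha).le
  rw [h, nsmul_eq_mul] at h2
  exact nonneg_of_mul_nonneg_right h2 (by positivity)

theorem hasSum_aux (b : ℝ) (x : ℝ) (hx : |x| < 1) :
    HasSum (fun n : ℕ => Ring.choose (b + n - 1) n * x ^ n) ((1 - x) ^ (-b)) := by
  have h := (Real.one_div_one_sub_rpow_hasFPowerSeriesOnBall_zero b).hasSum (y := x) (by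
    simpa [enorm_eq_nnnorm] using! hx)
  have h1 : (0:ℝ) ≤ 1 - x := by linarith [(abs_lt.mp hx).2]
  simpa [Real.rpow_neg h1, FormalMultilinearSeries.ofScalars_apply_eq, mul_comm] using h

/-- On the unit sphere of `ℝ^(m+1)`, the kernel `(1 - p·q)^(-β)` is integrable in `q`,
uniformly in `p`, if `0 < β < m / 2`. -/
theorem sphere_lintegral_aux (m : ℕ) (b : ℝ) (hb : 0 < b) (hbm : 2 * b < m) :
    ∃ C : ENNReal, C ≠ ⊤ ∧ ∀ p : sphere (0 : Euc (m + 1)) 1,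
      ∫⁻ q, (ENNReal.ofReal (1 - inner ℝ (p : Euc (m + 1)) q)) ^ (-b)
        ∂(volume : Measure (Euc (m + 1))).toSphere ≤ C := by
  have hm : 1 ≤ m := by
    by_contra h
    have : m = 0 := by omega
    subst this; simp at hbm; linarith
  -- the comparison function
  let H : (Fin m → ℝ) → ENNReal := fun z => (ENNReal.ofReal (‖z‖ ^ 2 / 2)) ^ (-b)
  have hH : ∫⁻ z in ball (0 : Fin m → ℝ) 1, H z ≠ ⊤ := by
    have hint : IntegrableOn (fun z : Fin m → ℝ => (2:ℝ) ^ b * ‖z‖ ^ (-(2 * b))) (ball 0 1)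
        volume := by
      refine integrableOn_ball_of_norm_le_rpow (C := 2 ^ b) (α := 2 * b) (by simpa using hm)
        (by simpa using hbm) ?_ ?_
      · refine Eventually.of_forall fun x => ?_
        rw [Real.norm_of_nonneg (by positivity)]
      · exact ((measurable_norm.pow_const _).const_mul _).aestronglyMeasurable
    have h2 := hint.lintegral_lt_top
    refine ne_of_lt (lt_of_le_of_lt (le_of_eq ?_) h2)
    have : Nonempty (Fin m) := ⟨⟨0, hm⟩⟩
    have hne : ∀ᵐ z : Fin m → ℝ ∂(volume.restrict (ball 0 1)), z ≠ 0 := by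
      refine ae_restrict_of_ae ?_
      simp [ae_iff]
    refine lintegral_congr_ae ?_
    filter_upwards [hne] with z hz
    have hz' : 0 < ‖z‖ := norm_pos_iff.mpr hz
    simp only [H]
    rw [ENNReal.ofReal_rpow_of_pos (by positivity)]
    congr 1
    rw [Real.div_rpow (by positivity) (by norm_num), ← Real.rpow_natCast, ← Real.rpow_mul hz'.le,
      Real.rpow_neg (by norm_num : (0:ℝ) ≤ 2), div_inv_eq_mul, mul_comm]
    congr 2
    push_cast; ring
  have hHm : Measurable H := by
    refine Measurable.pow_const ?_ _
    exact ENNReal.measurable_ofReal.comp ((measurable_norm.pow_const 2).div_const 2)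
  refine ⟨(m + 1 : ENNReal) * (2 * ∫⁻ z in ball (0 : Fin m → ℝ) 1, H z), ?_, fun p => ?_⟩
  · exact ENNReal.mul_ne_top (by simp) (ENNReal.mul_ne_top (by simp) hH)
  set h : sphere (0 : (Euc (m + 1))) 1 → ENNReal :=
    fun q => (ENNReal.ofReal (1 - inner ℝ (p : (Euc (m + 1))) q)) ^ (-b) with hh
  have hhm : Measurable h := by
    refine Measurable.pow_const ?_ _
    exact ENNReal.measurable_ofReal.comp
      ((continuous_const.sub (continuous_const.inner continuous_subtype_val)).measurable)
  -- polar coordinates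
  have hpol := (volume : Measure (Euc (m + 1))).measurePreserving_homeomorphUnitSphereProd
  have hdim : Module.finrank ℝ (Euc (m + 1)) = m + 1 := by simp
  let I1 : Ioi (0:ℝ) → ENNReal := (Iio (⟨1, by simp⟩ : Ioi (0:ℝ))).indicator 1
  have h1 : ∫⁻ y, h y.1 * I1 y.2 ∂((volume : Measure (Euc (m + 1))).toSphere.prod
      (Measure.volumeIoiPow (Module.finrank ℝ (Euc (m + 1)) - 1))) =
      (∫⁻ q, h q ∂(volume : Measure (Euc (m + 1))).toSphere) * (m + 1 : ENNReal)⁻¹ := by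
    rw [lintegral_prod_mul hhm.aemeasurable
      ((measurable_one.indicator measurableSet_Iio).aemeasurable)]
    congr 1
    rw [lintegral_indicator_one measurableSet_Iio, Measure.volumeIoiPow_apply_Iio, hdim]
    simp only [one_pow, one_div]
    rw [ENNReal.ofReal_inv_of_pos (by positivity)]
    congr 1
    simp
    norm_cast
  have h2 : ∫⁻ y, h y.1 * I1 y.2 ∂((volume : Measure (Euc (m + 1))).toSphere.prod
      (Measure.volumeIoiPow (Module.finrank ℝ (Euc (m + 1)) - 1))) =
      ∫⁻ x : ({0}ᶜ : Set (Euc (m + 1))), h (homeomorphUnitSphereProd (Euc (m + 1)) x).1 *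
        I1 (homeomorphUnitSphereProd (Euc (m + 1)) x).2 ∂((volume : Measure (Euc (m + 1))).comap Subtype.val) := by
    rw [← hpol.lintegral_comp]
    exact (hhm.comp measurable_fst).mul
      ((measurable_one.indicator measurableSet_Iio).comp measurable_snd)
  let G : (Euc (m + 1)) → ENNReal := fun x => (ball (0:(Euc (m + 1))) 1).indicator
    (fun x => (ENNReal.ofReal ((‖x‖ ^ 2 - (inner ℝ (p : (Euc (m + 1))) x) ^ 2) / 2)) ^ (-b)) x
  have h3 : ∫⁻ x : ({0}ᶜ : Set (Euc (m + 1))), h (homeomorphUnitSphereProd (Euc (m + 1)) x).1 *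
        I1 (homeomorphUnitSphereProd (Euc (m + 1)) x).2 ∂((volume : Measure (Euc (m + 1))).comap Subtype.val) ≤
      ∫⁻ x : ({0}ᶜ : Set (Euc (m + 1))), G x ∂((volume : Measure (Euc (m + 1))).comap Subtype.val) := by
    refine lintegral_mono fun x => ?_
    have hx0 : 0 < ‖(x:(Euc (m + 1)))‖ := norm_pos_iff.mpr x.2
    by_cases hx : ‖(x:(Euc (m + 1)))‖ < 1
    · have hI : I1 (homeomorphUnitSphereProd (Euc (m + 1)) x).2 = 1 := by
        simp only [I1]
        rw [indicator_of_mem]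
        · rfl
        · simpa [← Subtype.coe_lt_coe] using hx
      have hG : G x = (ENNReal.ofReal ((‖(x:(Euc (m + 1)))‖ ^ 2 - (inner ℝ (p : (Euc (m + 1))) (x:(Euc (m + 1)))) ^ 2) / 2)) ^ (-b) := by
        simp only [G]
        rw [indicator_of_mem (by simpa using hx)]
      rw [hI, mul_one, hG]
      simp only [hh]
      rw [ENNReal.rpow_neg, ENNReal.rpow_neg, ENNReal.inv_le_inv]
      refine ENNReal.rpow_le_rpow (ENNReal.ofReal_le_ofReal ?_) hb.le
      have hq : ((homeomorphUnitSphereProd (Euc (m + 1)) x).1 : (Euc (m + 1))) = ‖(x:(Euc (m + 1)))‖⁻¹ • (x:(Euc (m + 1))) := by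
        simp [homeomorphUnitSphereProd_apply_fst_coe]
      rw [hq, inner_smul_right]
      set t := inner ℝ (p:(Euc (m + 1))) (x:(Euc (m + 1)))
      set s := ‖(x:(Euc (m + 1)))‖
      have ht : |t| ≤ s := by
        have := abs_real_inner_le_norm (p:(Euc (m + 1))) (x:(Euc (m + 1)))
        have hp : ‖(p:(Euc (m + 1)))‖ = 1 := by simpa using p.2
        rwa [hp, one_mul] at this
      have hts : |s⁻¹ * t| ≤ 1 := by
        rw [abs_mul, abs_of_pos (inv_pos.mpr hx0), inv_mul_le_iff₀ hx0]; simpa using ht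
      set u := s⁻¹ * t
      have htu : t = s * u := by simp only [u]; field_simp
      rw [htu]
      have hu := abs_le.mp hts
      nlinarith [mul_nonneg (by nlinarith : (0:ℝ) ≤ 1 - s^2) (by nlinarith : (0:ℝ) ≤ 1 - u^2), sq_nonneg (1-u)]
    · have hI : I1 (homeomorphUnitSphereProd (Euc (m + 1)) x).2 = 0 := by
        simp only [I1]
        rw [indicator_of_notMem]
        simpa [← Subtype.coe_lt_coe] using hx
      rw [hI, mul_zero]; exact zero_le
  have h4 : ∫⁻ x : ({0}ᶜ : Set (Euc (m + 1))), G x ∂((volume : Measure (Euc (m + 1))).comap Subtype.val) ≤ ∫⁻ x : (Euc (m + 1)), G x := by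
    rw [lintegral_subtype_comap (measurableSet_singleton (0:(Euc (m + 1)))).compl]
    exact setLIntegral_le_lintegral _ _
  have h5 : ∫⁻ x : (Euc (m + 1)), G x ≤ 2 * ∫⁻ z in ball (0 : Fin m → ℝ) 1, H z := by
    let e0 : (Euc (m + 1)) := EuclideanSpace.single 0 1
    let A : (Euc (m + 1)) ≃ₗᵢ[ℝ] (Euc (m + 1)) := (Submodule.span ℝ {(p : (Euc (m + 1))) - e0})ᗮ.reflection
    have hA : A p = e0 := by
      apply Submodule.reflection_sub
      have hp : ‖(p:(Euc (m + 1)))‖ = 1 := by simpa using p.2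
      rw [hp]; simp [e0]
    let G0 : (Euc (m + 1)) → ENNReal := fun x => (ball (0:(Euc (m + 1))) 1).indicator
      (fun x => (ENNReal.ofReal ((‖x‖ ^ 2 - (x 0) ^ 2) / 2)) ^ (-b)) x
    have hG0m : Measurable G0 := by
      refine Measurable.indicator ?_ measurableSet_ball
      refine Measurable.pow_const (ENNReal.measurable_ofReal.comp ?_) _
      have : Continuous fun x : Euc (m + 1) => (‖x‖ ^ 2 - (x 0) ^ 2) / 2 := by fun_prop
      exact this.measurable
    have hGA : ∀ x, G x = G0 (A x) := by
      intro x
      have hin : inner ℝ (p:(Euc (m + 1))) x = (A x) 0 := by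
        rw [← A.inner_map_map, hA]
        simp [e0, EuclideanSpace.inner_single_left]
      simp only [G, G0, indicator, mem_ball_zero_iff, LinearIsometryEquiv.norm_map, hin]
    have k1 : ∫⁻ x : (Euc (m + 1)), G x = ∫⁻ x : (Euc (m + 1)), G0 x := by
      simp_rw [hGA]
      exact A.measurePreserving.lintegral_comp hG0m
    let G1 : ℝ × (Fin m → ℝ) → ENNReal := fun y =>
      (Ioo (-1:ℝ) 1).indicator 1 y.1 * (ball (0 : Fin m → ℝ) 1).indicator H y.2
    have hG1m : Measurable G1 := 
      ((measurable_one.indicator measurableSet_Ioo).comp measurable_fst).mul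
        ((hHm.indicator measurableSet_ball).comp measurable_snd)
    have k2 : ∀ x : (Euc (m + 1)), G0 x ≤ G1 (x 0, fun i => x i.succ) := by
      intro x
      by_cases hx : ‖x‖ < 1
      · have hn : ‖x‖ ^ 2 = (x 0) ^ 2 + ∑ i : Fin m, (x i.succ) ^ 2 := by
          rw [EuclideanSpace.real_norm_sq_eq, Fin.sum_univ_succ]
        have hsum : 0 ≤ ∑ i : Fin m, (x i.succ) ^ 2 := Finset.sum_nonneg fun i _ => sq_nonneg _
        have hx2 : ‖x‖ ^ 2 < 1 := by nlinarith [norm_nonneg x]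
        have htl : ‖fun i : Fin m => x i.succ‖ ^ 2 ≤ ∑ i : Fin m, (x i.succ) ^ 2 := by
          have : ‖fun i : Fin m => x i.succ‖ ≤ √(∑ i : Fin m, (x i.succ) ^ 2) := by
            rw [pi_norm_le_iff_of_nonneg (Real.sqrt_nonneg _)]
            intro i
            rw [Real.norm_eq_abs]
            apply Real.abs_le_sqrt
            exact Finset.single_le_sum (f := fun i : Fin m => (x i.succ) ^ 2)
              (fun i _ => sq_nonneg _) (Finset.mem_univ i)
          calc _ ≤ (√(∑ i : Fin m, (x i.succ) ^ 2)) ^ 2 := by gcongr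
            _ = _ := Real.sq_sqrt hsum
        have h0 : x 0 ∈ Ioo (-1:ℝ) 1 := by
          constructor <;> nlinarith
        have h1' : (fun i : Fin m => x i.succ) ∈ ball (0 : Fin m → ℝ) 1 := by
          rw [mem_ball_zero_iff]
          nlinarith [sq_nonneg (x 0), norm_nonneg (fun i : Fin m => x i.succ)]
        simp only [G0, G1]
        rw [indicator_of_mem (by simpa using hx), indicator_of_mem h0, indicator_of_mem h1',
          Pi.one_apply, one_mul]
        simp only [H]
        rw [ENNReal.rpow_neg, ENNReal.rpow_neg, ENNReal.inv_le_inv]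
        refine ENNReal.rpow_le_rpow (ENNReal.ofReal_le_ofReal ?_) hb.le
        linarith
      · simp only [G0]
        rw [indicator_of_notMem (by simpa using hx)]
        exact zero_le
    have k3 : ∫⁻ x : (Euc (m + 1)), G1 (x 0, fun i => x i.succ) = ∫⁻ y, G1 y := by
      have e1 := (EuclideanSpace.volume_preserving_symm_measurableEquiv_toLp (Fin (m + 1)))
      have e2 := volume_preserving_piFinSuccAbove (fun _ : Fin (m + 1) => ℝ) 0
      have e3 := e2.comp e1
      rw [← e3.lintegral_comp hG1m]
      rfl
    rw [k1]
    refine (lintegral_mono k2).trans ?_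
    rw [k3]
    change ∫⁻ y, G1 y ∂(volume.prod volume) ≤ _
    simp only [G1]
    rw [lintegral_prod_mul (measurable_one.indicator measurableSet_Ioo).aemeasurable
      (hHm.indicator measurableSet_ball).aemeasurable, lintegral_indicator_one measurableSet_Ioo,
      lintegral_indicator measurableSet_ball]
    gcongr
    rw [Real.volume_Ioo]; norm_num
  have h6 : (∫⁻ q, h q ∂(volume : Measure (Euc (m + 1))).toSphere) * (m + 1 : ENNReal)⁻¹ ≤
      2 * ∫⁻ z in ball (0 : Fin m → ℝ) 1, H z := by
    rw [← h1, h2]; exact h3.trans (h4.trans h5)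
  calc (∫⁻ q, h q ∂(volume : Measure (Euc (m + 1))).toSphere)
      = (m + 1 : ENNReal) * ((∫⁻ q, h q ∂(volume : Measure (Euc (m + 1))).toSphere) * (m + 1 : ENNReal)⁻¹) := by
        rw [mul_comm, mul_assoc, ENNReal.inv_mul_cancel (by simp) (by simp), mul_one]
    _ ≤ _ := by gcongr

/-- Minkowski space `ℝ^{d+1}`; the coordinate `0` is time. -/
abbrev Mink (d : ℕ) : Type := Fin (d + 1) → ℝ

/-- The Minkowski product `X₀Y₀ - X₁Y₁ - ⋯ - X_dY_d`. -/
def mdot {d : ℕ} (X Y : Mink d) : ℝ := X 0 * Y 0 - ∑ i : Fin d, X i.succ * Y i.succ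

/-- `α = (d-1)/2`. -/
noncomputable def alpha (d : ℕ) : ℝ := ((d : ℝ) - 1) / 2

/-- The future light cone `C_d^+ = {P · P = 0, P₀ > 0}`. -/
def Cone (d : ℕ) : Set (Mink d) := {P | mdot P P = 0 ∧ 0 < P 0}

/-- The unit sphere `S^{d-1}` in `ℝ^d`. -/
abbrev Sph (d : ℕ) : Type := Metric.sphere (0 : Euc d) 1

/-- The surface measure of `S^{d-1}`; this is `ω` on the spherical orbital base. -/
noncomputable def sphMeas (d : ℕ) : Measure (Sph d) := (volume : Measure (Euc d)).toSphere

instance (d : ℕ) : IsFiniteMeasure (sphMeas d) := by unfold sphMeas; infer_instance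

theorem mdot_smul_smul {d : ℕ} (t : ℝ) (X : Mink d) : mdot (t • X) (t • X) = t ^ 2 * mdot X X := by
  simp only [mdot, Pi.smul_apply, smul_eq_mul, mul_sub, Finset.mul_sum]
  congr 1
  · ring
  · exact Finset.sum_congr rfl fun i _ => by ring

/-- The dilation `P ↦ t P` of the cone, `t > 0`. -/
def Cone.scale {d : ℕ} (t : ℝ) (ht : 0 < t) (P : Cone d) : Cone d :=
  ⟨t • (P : Mink d), by rw [mdot_smul_smul, P.2.1, mul_zero], mul_pos ht P.2.2⟩

/-- The point `(1, p)` of the spherical orbital base `{P ∈ C_d^+ : P₀ = 1}`. -/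
def basePt {d : ℕ} (p : Sph d) : Cone d :=
  ⟨Fin.cons 1 (fun i => (p : Euc d) i), by
    have hp : ‖(p : Euc d)‖ ^ 2 = 1 := by
      have : ‖(p : Euc d)‖ = 1 := by simp
      rw [this, one_pow]
    rw [EuclideanSpace.real_norm_sq_eq] at hp
    constructor
    · simp only [mdot, Fin.cons_zero, Fin.cons_succ]
      simp only [pow_two] at hp
      rw [hp]; norm_num
    · simp⟩

theorem continuous_basePt {d : ℕ} : Continuous (basePt : Sph d → Cone d) := by
  refine Continuous.subtype_mk ?_ _
  refine continuous_pi fun i => ?_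
  refine Fin.cases ?_ (fun j => ?_) i
  · simpa using continuous_const
  · simp only [Fin.cons_succ]; fun_prop

theorem mdot_basePt {d : ℕ} (p q : Sph d) :
    mdot (basePt p : Mink d) (basePt q) = 1 - inner ℝ (p : Euc d) q := by
  simp only [mdot, basePt, Fin.cons_zero, Fin.cons_succ, PiLp.inner_apply]
  simp [mul_comm]

theorem Cone.exists_base {d : ℕ} (P : Cone d) :
    ∃ p : Sph d, P = Cone.scale ((P : Mink d) 0) P.2.2 (basePt p) := by
  obtain ⟨P, hP, hP0⟩ := P
  refine ⟨⟨WithLp.toLp 2 fun i => (P 0)⁻¹ * P i.succ, ?_⟩, ?_⟩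
  · rw [mem_sphere_zero_iff_norm, EuclideanSpace.norm_eq, Real.sqrt_eq_one]
    simp only [Real.norm_eq_abs, sq_abs, mul_pow, ← Finset.mul_sum]
    simp only [mdot] at hP
    have : ∑ i : Fin d, P i.succ ^ 2 = P 0 ^ 2 := by simp only [pow_two]; linarith
    rw [this]; field_simp
  · apply Subtype.ext
    funext i
    simp only [Cone.scale, basePt, Pi.smul_apply, smul_eq_mul]
    refine Fin.cases ?_ (fun j => ?_) i
    · simp
    · simp only [Fin.cons_succ]
      field_simp

/-- The parameters of the spin-0 principal series (`ν ∈ ℝ`). -/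
def IsPrincipal (ν : ℂ) : Prop := ν.im = 0

/-- The parameters of the spin-0 complementary series (`iν ∈ (0, α)`). -/
def IsComplementary (d : ℕ) (ν : ℂ) : Prop := ν.re = 0 ∧ -alpha d < ν.im ∧ ν.im < 0

/-- A parameter `ν` of the principal or of the complementary series. -/
structure SeriesParam (d : ℕ) where
  ν : ℂ
  adm : IsPrincipal ν ∨ IsComplementary d ν

/-- The degree of homogeneity `-α - iν`. -/
noncomputable def deg (d : ℕ) (ν : ℂ) : ℂ := -(alpha d : ℂ) - Complex.I * ν

open Classical in
/-- The measure on `S^{d-1} × S^{d-1}` that gives the inner product of `𝒦_ν`: the inner product of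
`ψ₁, ψ₂` is `∫ conj (ψ₁ (1,p)) ψ₂ (1,q)` with respect to this measure. For the principal series
it is the surface measure on the diagonal, that is `∫ conj ψ₁ ψ₂ ω`; for the complementary series
it has density `(2π)^{-α} Γ(α-iν)/Γ(iν) (P · Q)^{-α+iν}`, that is `∫ conj ψ₁ (I_ν ψ₂) ω`;
here `iν = -Im ν` is real. -/
noncomputable def pairMeas (d : ℕ) (ν : ℂ) : Measure (Sph d × Sph d) :=
  if IsPrincipal ν then (sphMeas d).map fun p => (p, p)
  else ((sphMeas d).prod (sphMeas d)).withDensity fun y => ENNReal.ofReal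
    ((2 * Real.pi) ^ (-alpha d) * (Real.Gamma (alpha d + ν.im) / Real.Gamma (-ν.im)) *
      (mdot (basePt y.1 : Mink d) (basePt y.2)) ^ (-alpha d - ν.im))

/-- `n`-particle momentum variables `(θ₁, P₁, …, θ_n, P_n)`. -/
abbrev Mom (d n : ℕ) : Type := Fin n → ℝ × Cone d

/-- Pairs of `n`-particle variables with common rapidities. -/
abbrev PairMom (d n : ℕ) : Type := Fin n → ℝ × (Sph d × Sph d)

/-- The measure on `PairMom d n` that gives the inner product of `n`-particle wave functions. -/
noncomputable def pairMomMeas (d n : ℕ) (ν : ℂ) : Measure (PairMom d n) :=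
  Measure.pi fun _ => (volume : Measure ℝ).prod (pairMeas d ν)

def leftMom {d n : ℕ} (y : PairMom d n) : Mom d n := fun i => ((y i).1, basePt (y i).2.1)
def rightMom {d n : ℕ} (y : PairMom d n) : Mom d n := fun i => ((y i).1, basePt (y i).2.2)

/-- The inner product of `n`-particle wave functions:
`∫ dθ ∫ conj (Ψ (θ, P)) Φ (θ, P)` for the principal series,
`∫ dθ ∫ conj (Ψ (θ, P)) (I_ν^{⊗ n} Φ) (θ, P)` for the complementary series. -/
noncomputable def waveForm {d n : ℕ} (ν : ℂ) (Ψ Φ : Mom d n → ℂ) : ℂ :=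
  ∫ y, (starRingEnd ℂ) (Ψ (leftMom y)) * Φ (rightMom y) ∂pairMomMeas d n ν

/-- `n`-particle wave functions: measurable functions of `(θ₁, P₁, …, θ_n, P_n)`, homogeneous of
degree `-α - iν` in each `P_j`, bounded in the `P_j ∈ B` by a square integrable function of the
`θ_j`. -/
structure IsWave {d n : ℕ} (ν : ℂ) (Ψ : Mom d n → ℂ) : Prop where
  meas : Measurable Ψ
  homog : ∀ (t : Fin n → ℝ) (ht : ∀ i, 0 < t i) (y : Mom d n),
    Ψ (fun i => ((y i).1, Cone.scale (t i) (ht i) (y i).2)) = (∏ i, (t i : ℂ) ^ deg d ν) * Ψ y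
  dom : ∃ g : (Fin n → ℝ) → ℝ, MemLp g 2 volume ∧
    ∀ (θ : Fin n → ℝ) (p : Fin n → Sph d), ‖Ψ fun i => (θ i, basePt (p i))‖ ≤ g θ

theorem IsWave.add {d n : ℕ} {ν : ℂ} {Ψ Φ : Mom d n → ℂ} (h : IsWave ν Ψ) (k : IsWave ν Φ) :
    IsWave ν (Ψ + Φ) := by
  obtain ⟨g, hg, hg'⟩ := h.dom
  obtain ⟨g₁, hg₁, hg₁'⟩ := k.dom
  refine ⟨h.meas.add k.meas, fun t ht y => ?_, g + g₁, hg.add hg₁, fun θ p => ?_⟩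
  · simp only [Pi.add_apply]; rw [h.homog t ht y, k.homog t ht y, mul_add]
  · exact (norm_add_le _ _).trans (add_le_add (hg' θ p) (hg₁' θ p))

theorem IsWave.smul {d n : ℕ} {ν : ℂ} {Ψ : Mom d n → ℂ} (c : ℂ) (h : IsWave ν Ψ) :
    IsWave ν (c • Ψ) := by
  obtain ⟨g, hg, hg'⟩ := h.dom
  refine ⟨h.meas.const_smul c, fun t ht y => ?_, fun θ => ‖c‖ * g θ, hg.const_mul _, fun θ p => ?_⟩
  · simp only [Pi.smul_apply, smul_eq_mul]; rw [h.homog t ht y]; ring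
  · simp only [Pi.smul_apply, norm_smul]
    exact mul_le_mul_of_nonneg_left (hg' θ p) (norm_nonneg c)

/-- The space of `n`-particle wave functions. -/
def waveSub (d n : ℕ) (ν : ℂ) : Submodule ℂ (Mom d n → ℂ) where
  carrier := {Ψ | IsWave ν Ψ}
  add_mem' := IsWave.add
  zero_mem' := ⟨measurable_const, fun _ _ _ => by simp, 0, MemLp.zero, fun _ _ => by simp⟩
  smul_mem' := fun c _ h => h.smul c

theorem pairMeas_finite {d : ℕ} (par : SeriesParam d) : IsFiniteMeasure (pairMeas d par.ν) := by
  by_cases h : IsPrincipal par.ν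
  · rw [pairMeas, if_pos h]; infer_instance
  · obtain ⟨h1, h2, h3⟩ := par.adm.resolve_left h
    rw [pairMeas, if_neg h]
    set ν := par.ν
    set b : ℝ := alpha d + ν.im with hb
    have hb0 : 0 < b := by linarith
    obtain ⟨m, rfl⟩ : ∃ m, d = m + 1 := by
      rcases d with _ | m
      · exfalso; simp [alpha] at hb; linarith
      · exact ⟨m, rfl⟩
    have hbm : 2 * b < m := by
      simp only [hb, alpha]; push_cast; linarith
    obtain ⟨C, hC, hC'⟩ := sphere_lintegral_aux m b hb0 hbm
    set c : ℝ := (2 * Real.pi) ^ (-alpha (m + 1)) * (Real.Gamma b / Real.Gamma (-ν.im))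
    refine isFiniteMeasure_withDensity ?_
    have hle : ∀ y : Sph (m + 1) × Sph (m + 1),
        ENNReal.ofReal (c * (mdot (basePt y.1 : Mink (m + 1)) (basePt y.2)) ^
          (-alpha (m + 1) - ν.im)) ≤ ENNReal.ofReal c *
          (ENNReal.ofReal (1 - inner ℝ (y.1 : Euc (m + 1)) y.2)) ^ (-b) := by
      intro y
      rw [mdot_basePt, show -alpha (m + 1) - ν.im = -b by simp only [hb]; ring]
      have hx : 0 ≤ 1 - inner ℝ (y.1 : Euc (m + 1)) y.2 := by
        have := real_inner_le_norm (y.1 : Euc (m + 1)) y.2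
        simp at this; linarith
      rw [ENNReal.ofReal_mul' (Real.rpow_nonneg hx _)]
      gcongr
      rcases hx.eq_or_lt with hx | hx
      · rw [← hx, Real.zero_rpow (by linarith)]; simp
      · rw [ENNReal.ofReal_rpow_of_pos hx]
    refine ne_of_lt (lt_of_le_of_lt (lintegral_mono hle) ?_)
    have hmeas : Measurable fun y : Sph (m + 1) × Sph (m + 1) =>
        (ENNReal.ofReal (1 - inner ℝ (y.1 : Euc (m + 1)) y.2)) ^ (-b) := by
      refine Measurable.pow_const (ENNReal.measurable_ofReal.comp ?_) _
      refine Continuous.measurable ?_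
      exact continuous_const.sub ((continuous_subtype_val.comp continuous_fst).inner
        (continuous_subtype_val.comp continuous_snd))
    rw [lintegral_const_mul _ hmeas]
    refine ENNReal.mul_lt_top ENNReal.ofReal_lt_top ?_
    rw [lintegral_prod _ hmeas.aemeasurable]
    refine lt_of_le_of_lt (lintegral_mono fun p => hC' p) ?_
    rw [lintegral_const]
    exact ENNReal.mul_lt_top hC.lt_top (measure_lt_top _ _)

theorem measurable_leftMom {d n : ℕ} : Measurable (leftMom : PairMom d n → Mom d n) := by
  refine measurable_pi_lambda _ fun i => ?_
  exact ((measurable_pi_apply i).fst).prodMk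
    (continuous_basePt.measurable.comp (measurable_pi_apply i).snd.fst)

theorem measurable_rightMom {d n : ℕ} : Measurable (rightMom : PairMom d n → Mom d n) := by
  refine measurable_pi_lambda _ fun i => ?_
  exact ((measurable_pi_apply i).fst).prodMk
    (continuous_basePt.measurable.comp (measurable_pi_apply i).snd.snd)

/-- A function of the rapidities alone is integrable on `PairMom` if it is integrable. -/
theorem integrable_rapidity {d n : ℕ} (τ : Measure (Sph d × Sph d)) [IsFiniteMeasure τ]
    {h : (Fin n → ℝ) → ℝ} (hh : Integrable h volume) :
    Integrable (fun y : PairMom d n => h fun i => (y i).1)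
      (Measure.pi fun _ => (volume : Measure ℝ).prod τ) := by
  have e := measurePreserving_arrowProdEquivProdArrow ℝ (Sph d × Sph d) (Fin n)
    (fun _ => volume) (fun _ => τ)
  have h1 : Integrable (fun z : (Fin n → ℝ) × (Fin n → Sph d × Sph d) => h z.1)
      ((Measure.pi fun _ => volume).prod (Measure.pi fun _ => τ)) := by
    have := hh.mul_prod (ν := Measure.pi fun _ : Fin n => τ) (integrable_const (1:ℝ))
    simp only [mul_one] at this
    exact this
  exact (e.integrable_comp_emb (MeasurableEquiv.measurableEmbedding _)).mpr h1

theorem integrable_pair {d n : ℕ} {ν : ℂ} (τ : Measure (Sph d × Sph d)) [IsFiniteMeasure τ]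
    {Ψ Φ : Mom d n → ℂ} (h : IsWave ν Ψ) (k : IsWave ν Φ) :
    Integrable (fun y : PairMom d n => (starRingEnd ℂ) (Ψ (leftMom y)) * Φ (rightMom y))
      (Measure.pi fun _ => (volume : Measure ℝ).prod τ) := by
  obtain ⟨g, hg, hg'⟩ := h.dom
  obtain ⟨g₁, hg₁, hg₁'⟩ := k.dom
  refine (integrable_rapidity τ (hg.integrable_mul hg₁)).mono' ?_ (Eventually.of_forall fun y => ?_)
  · exact ((Complex.continuous_conj.measurable.comp (h.meas.comp measurable_leftMom)).mul
      (k.meas.comp measurable_rightMom)).aestronglyMeasurable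
  · rw [norm_mul, RCLike.norm_conj]
    exact mul_le_mul (hg' _ _) (hg₁' _ _) (norm_nonneg _) ((norm_nonneg _).trans (hg' _ fun i => (y i).2.1))

theorem wave_pos_one {d n : ℕ} {ν : ℂ} {Ψ : Mom d n → ℂ} (h : IsWave ν Ψ) :
    0 ≤ (∫ y : PairMom d n, (starRingEnd ℂ) (Ψ (leftMom y)) * Ψ (rightMom y)
      ∂(Measure.pi fun _ => (volume : Measure ℝ).prod ((sphMeas d).prod (sphMeas d)))).re := by
  have e := measurePreserving_arrowProdEquivProdArrow ℝ (Sph d × Sph d) (Fin n)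
    (fun _ => volume) (fun _ => (sphMeas d).prod (sphMeas d))
  have e' := measurePreserving_arrowProdEquivProdArrow (Sph d) (Sph d) (Fin n)
    (fun _ => sphMeas d) (fun _ => sphMeas d)
  let u : (Fin n → ℝ) → (Fin n → Sph d) → ℂ := fun θ p => Ψ fun i => (θ i, basePt (p i))
  have hint := integrable_pair ((sphMeas d).prod (sphMeas d)) h h
  let G : (Fin n → ℝ) × (Fin n → Sph d × Sph d) → ℂ := fun z =>
    (starRingEnd ℂ) (u z.1 fun i => (z.2 i).1) * u z.1 fun i => (z.2 i).2
  have hG : Integrable G ((Measure.pi fun _ => volume).prod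
      (Measure.pi fun _ => (sphMeas d).prod (sphMeas d))) :=
    (e.integrable_comp_emb (MeasurableEquiv.measurableEmbedding _)).mp hint
  have h1 : (∫ y : PairMom d n, (starRingEnd ℂ) (Ψ (leftMom y)) * Ψ (rightMom y)
      ∂(Measure.pi fun _ => (volume : Measure ℝ).prod ((sphMeas d).prod (sphMeas d)))) =
      ∫ z, G z ∂((Measure.pi fun _ => volume).prod
        (Measure.pi fun _ => (sphMeas d).prod (sphMeas d))) :=
    e.integral_comp (MeasurableEquiv.measurableEmbedding _) G
  rw [h1, integral_prod _ hG]
  have h2 : ∀ θ : Fin n → ℝ, ∫ q, G (θ, q) ∂(Measure.pi fun _ => (sphMeas d).prod (sphMeas d)) =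
      ((Complex.normSq (∫ p, u θ p ∂(Measure.pi fun _ => sphMeas d)) : ℝ) : ℂ) := by
    intro θ
    have h3 := e'.integral_comp (MeasurableEquiv.measurableEmbedding _)
      (fun z : (Fin n → Sph d) × (Fin n → Sph d) => (starRingEnd ℂ) (u θ z.1) * u θ z.2)
    refine Eq.trans h3 ?_
    rw [integral_prod_mul (fun p => (starRingEnd ℂ) (u θ p)) (u θ), integral_conj,
      Complex.normSq_eq_conj_mul_self]
  simp_rw [h2]
  rw [integral_complex_ofReal, Complex.ofReal_re]
  exact integral_nonneg fun θ => Complex.normSq_nonneg _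

/-- Bounded kernels that give positive semidefinite forms on wave functions. -/
structure PosKer {d n : ℕ} (ν : ℂ) (K : PairMom d n → ℝ) : Prop where
  meas : Measurable K
  bdd : ∃ C : ℝ, ∀ y, |K y| ≤ C
  pos : ∀ Ψ : Mom d n → ℂ, IsWave ν Ψ → 0 ≤ (∫ y : PairMom d n, (K y : ℂ) *
    ((starRingEnd ℂ) (Ψ (leftMom y)) * Ψ (rightMom y))
      ∂(Measure.pi fun _ => (volume : Measure ℝ).prod ((sphMeas d).prod (sphMeas d)))).re

theorem integrable_ker {d n : ℕ} {ν : ℂ} {K : PairMom d n → ℝ} (hK : Measurable K) {C : ℝ}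
    (hC : ∀ y, |K y| ≤ C) {Ψ Φ : Mom d n → ℂ} (h : IsWave ν Ψ) (k : IsWave ν Φ) :
    Integrable (fun y : PairMom d n => (K y : ℂ) *
      ((starRingEnd ℂ) (Ψ (leftMom y)) * Φ (rightMom y)))
      (Measure.pi fun _ => (volume : Measure ℝ).prod ((sphMeas d).prod (sphMeas d))) := by
  refine (integrable_pair ((sphMeas d).prod (sphMeas d)) h k).bdd_mul (c := C) ?_ ?_
  · exact (Complex.measurable_ofReal.comp hK).aestronglyMeasurable
  · exact Eventually.of_forall fun y => by simpa using hC y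

theorem PosKer.one {d n : ℕ} (ν : ℂ) : PosKer ν (fun _ : PairMom d n => (1:ℝ)) :=
  ⟨measurable_const, ⟨1, fun _ => by simp⟩, fun Ψ h => by simpa using wave_pos_one h⟩

theorem PosKer.add {d n : ℕ} {ν : ℂ} {K L : PairMom d n → ℝ} (hK : PosKer ν K) (hL : PosKer ν L) :
    PosKer ν (fun y => K y + L y) := by
  obtain ⟨C, hC⟩ := hK.bdd
  obtain ⟨C', hC'⟩ := hL.bdd
  refine ⟨hK.meas.add hL.meas, ⟨C + C', fun y => (abs_add_le _ _).trans (add_le_add (hC y) (hC' y))⟩,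
    fun Ψ h => ?_⟩
  simp only [Complex.ofReal_add, add_mul]
  rw [integral_add (integrable_ker hK.meas hC h h) (integrable_ker hL.meas hC' h h), Complex.add_re]
  exact add_nonneg (hK.pos Ψ h) (hL.pos Ψ h)

theorem PosKer.const_mul {d n : ℕ} {ν : ℂ} {K : PairMom d n → ℝ} (hK : PosKer ν K) {c : ℝ}
    (hc : 0 ≤ c) : PosKer ν (fun y => c * K y) := by
  obtain ⟨C, hC⟩ := hK.bdd
  refine ⟨hK.meas.const_mul c, ⟨c * C, fun y => ?_⟩, fun Ψ h => ?_⟩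
  · rw [abs_mul, abs_of_nonneg hc]; exact mul_le_mul_of_nonneg_left (hC y) hc
  · simp only [Complex.ofReal_mul, mul_assoc]
    rw [integral_const_mul, Complex.re_ofReal_mul]
    exact mul_nonneg hc (hK.pos Ψ h)

theorem PosKer.sum {d n : ℕ} {ν : ℂ} {ι : Type*} (s : Finset ι) {K : ι → PairMom d n → ℝ}
    (hK : ∀ i, PosKer ν (K i)) : PosKer ν (fun y => ∑ i ∈ s, K i y) := by
  classical
  induction s using Finset.induction_on with
  | empty =>
    simpa using (PosKer.one (d := d) (n := n) ν).const_mul le_rfl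
  | insert a s ha ih =>
    simp only [Finset.sum_insert ha]
    exact (hK a).add ih

theorem PosKer.coord {d n : ℕ} {ν : ℂ} {K : PairMom d n → ℝ} (hK : PosKer ν K) (i : Fin n)
    (j : Fin d) : PosKer ν (fun y => ((y i).2.1 : Euc d) j * ((y i).2.2 : Euc d) j * K y) := by
  have hb : ∀ p : Sph d, |(p : Euc d) j| ≤ 1 := fun p => by
    have := PiLp.norm_apply_le (p : Euc d) j
    simpa using this
  obtain ⟨C, hC⟩ := hK.bdd
  refine ⟨?_, ⟨C, fun y => ?_⟩, fun Ψ h => ?_⟩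
  · refine Measurable.mul (Measurable.mul ?_ ?_) hK.meas
    · have : Continuous fun p : Sph d => (p : Euc d) j := by fun_prop
      exact this.measurable.comp (measurable_pi_apply i).snd.fst
    · have : Continuous fun p : Sph d => (p : Euc d) j := by fun_prop
      exact this.measurable.comp (measurable_pi_apply i).snd.snd
  · rw [abs_mul, abs_mul]
    calc _ ≤ 1 * 1 * C := by
          gcongr
          · exact hb _
          · exact hb _
          · exact hC y
      _ = C := by ring
  · let Φ : Mom d n → ℂ := fun y =>
      ((((y i).2 : Mink d) j.succ / ((y i).2 : Mink d) 0 : ℝ) : ℂ) * Ψ y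
    have hΦ : IsWave ν Φ := by
      refine ⟨?_, fun t ht y => ?_, ?_⟩
      · refine (Complex.measurable_ofReal.comp (Measurable.div ?_ ?_)).mul h.meas
        · exact (measurable_pi_apply _).comp (measurable_subtype_coe.comp (measurable_pi_apply i).snd)
        · exact (measurable_pi_apply _).comp (measurable_subtype_coe.comp (measurable_pi_apply i).snd)
      · simp only [Φ]
        rw [h.homog t ht y]
        have : ((Cone.scale (t i) (ht i) (y i).2 : Cone d) : Mink d) j.succ /
            ((Cone.scale (t i) (ht i) (y i).2 : Cone d) : Mink d) 0 =
            ((y i).2 : Mink d) j.succ / ((y i).2 : Mink d) 0 := by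
          simp only [Cone.scale, Pi.smul_apply, smul_eq_mul]
          exact mul_div_mul_left _ _ (ht i).ne'
        rw [this]; ring
      · obtain ⟨g, hg, hg'⟩ := h.dom
        refine ⟨g, hg, fun θ p => ?_⟩
        simp only [Φ, norm_mul]
        calc _ ≤ 1 * g θ := by
              gcongr
              · simpa [basePt] using hb (p i)
              · exact hg' θ p
          _ = g θ := one_mul _
    have := hK.pos Φ hΦ
    convert this using 4 with y
    simp only [Φ, leftMom, rightMom, basePt, Fin.cons_zero, Fin.cons_succ, div_one, map_mul,
      Complex.conj_ofReal, Complex.ofReal_mul]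
    ring

theorem PosKer.mulInner {d n : ℕ} {ν : ℂ} {K : PairMom d n → ℝ} (hK : PosKer ν K) (i : Fin n) :
    PosKer ν (fun y => inner ℝ ((y i).2.1 : Euc d) ((y i).2.2 : Euc d) * K y) := by
  have := PosKer.sum Finset.univ fun j => hK.coord i j
  convert this using 2 with y
  rw [← Finset.sum_mul]
  congr 1
  simp [PiLp.inner_apply, mul_comm]

theorem PosKer.pow {d n : ℕ} {ν : ℂ} {K : PairMom d n → ℝ} (hK : PosKer ν K) (i : Fin n) (m : ℕ) :
    PosKer ν (fun y => inner ℝ ((y i).2.1 : Euc d) ((y i).2.2 : Euc d) ^ m * K y) := by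
  induction m with
  | zero => simpa using hK
  | succ m ih =>
    convert ih.mulInner i using 2 with y
    ring

theorem PosKer.limit {d n : ℕ} {ν : ℂ} {K : ℕ → PairMom d n → ℝ} {L : PairMom d n → ℝ}
    (hK : ∀ m, PosKer ν (K m)) (hL : Measurable L) {C : ℝ} (hC : ∀ m y, |K m y| ≤ C)
    (hlim : ∀ y, Tendsto (fun m => K m y) atTop (𝓝 (L y))) : PosKer ν L := by
  refine ⟨hL, ⟨C, fun y => le_of_tendsto (hlim y).abs (Eventually.of_forall fun m => hC m y)⟩,
    fun Ψ h => ?_⟩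
  have ht := tendsto_integral_of_dominated_convergence
    (F := fun m (y : PairMom d n) => (K m y : ℂ) *
      ((starRingEnd ℂ) (Ψ (leftMom y)) * Ψ (rightMom y)))
    (f := fun y => (L y : ℂ) * ((starRingEnd ℂ) (Ψ (leftMom y)) * Ψ (rightMom y)))
    (μ := Measure.pi fun _ => (volume : Measure ℝ).prod ((sphMeas d).prod (sphMeas d)))
    (fun y => C * ‖(starRingEnd ℂ) (Ψ (leftMom y)) * Ψ (rightMom y)‖)
    (fun m => (integrable_ker (hK m).meas (hC m) h h).aestronglyMeasurable)
    ((integrable_pair ((sphMeas d).prod (sphMeas d)) h h).norm.const_mul C)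
    (fun m => Eventually.of_forall fun y => by
      rw [norm_mul]
      gcongr
      simpa using hC m y)
    (Eventually.of_forall fun y =>
      ((Complex.continuous_ofReal.tendsto _).comp (hlim y)).mul_const _)
  exact ge_of_tendsto ((Complex.continuous_re.tendsto _).comp ht)
    (Eventually.of_forall fun m => (hK m).pos Ψ h)

theorem abs_inner_sph {d : ℕ} (p q : Sph d) : |inner ℝ (p : Euc d) (q : Euc d)| ≤ 1 := by
  have := abs_real_inner_le_norm (p : Euc d) q
  simpa using this

theorem measurable_innerSph {d n : ℕ} (i : Fin n) : Measurable fun y : PairMom d n =>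
    inner ℝ ((y i).2.1 : Euc d) ((y i).2.2 : Euc d) :=
  ((measurable_subtype_coe.comp (measurable_pi_apply i).snd.fst).inner
    (measurable_subtype_coe.comp (measurable_pi_apply i).snd.snd))

theorem PosKer.rpow {d n : ℕ} {ν : ℂ} {K : PairMom d n → ℝ} (hK : PosKer ν K) (i : Fin n)
    {b r : ℝ} (hb : 0 < b) (hr : 0 ≤ r) (hr1 : r < 1) :
    PosKer ν (fun y => (1 - r * inner ℝ ((y i).2.1 : Euc d) ((y i).2.2 : Euc d)) ^ (-b) * K y) := by
  obtain ⟨C, hC⟩ := hK.bdd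
  have hS := hasSum_aux b r (by rw [abs_of_nonneg hr]; exact hr1)
  refine PosKer.limit (K := fun M y => ∑ m ∈ Finset.range M, (Ring.choose (b + m - 1) m * r ^ m) *
    (inner ℝ ((y i).2.1 : Euc d) ((y i).2.2 : Euc d) ^ m * K y))
    (fun M => PosKer.sum _ fun m => (hK.pow i m).const_mul
      (mul_nonneg (choose_nonneg_aux b hb m) (pow_nonneg hr m))) ?_
    (C := (1 - r) ^ (-b) * C) ?_ ?_
  · exact ((measurable_const.sub ((measurable_innerSph i).const_mul r)).pow_const _).mul hK.meas
  · intro M y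
    have hC0 : 0 ≤ C := (abs_nonneg _).trans (hC y)
    calc _ ≤ ∑ m ∈ Finset.range M, |(Ring.choose (b + m - 1) m * r ^ m) *
            (inner ℝ ((y i).2.1 : Euc d) ((y i).2.2 : Euc d) ^ m * K y)| :=
          Finset.abs_sum_le_sum_abs _ _
      _ ≤ ∑ m ∈ Finset.range M, (Ring.choose (b + m - 1) m * r ^ m) * C := by
          refine Finset.sum_le_sum fun m _ => ?_
          have h0 := mul_nonneg (choose_nonneg_aux b hb m) (pow_nonneg hr m)
          rw [abs_mul, abs_of_nonneg h0]
          refine mul_le_mul_of_nonneg_left ?_ h0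
          rw [abs_mul, abs_pow]
          calc _ ≤ 1 * C := by
                gcongr
                · exact pow_le_one₀ (abs_nonneg _) (abs_inner_sph _ _)
                · exact hC y
            _ = C := one_mul C
      _ ≤ _ := by
          rw [← Finset.sum_mul]
          refine mul_le_mul_of_nonneg_right ?_ hC0
          exact sum_le_hasSum _ (fun m _ => mul_nonneg (choose_nonneg_aux b hb m) (pow_nonneg hr m)) hS
  · intro y
    have hx : |r * inner ℝ ((y i).2.1 : Euc d) ((y i).2.2 : Euc d)| < 1 := by
      rw [abs_mul, abs_of_nonneg hr]
      calc _ ≤ r * 1 := by gcongr; exact abs_inner_sph _ _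
        _ < 1 := by linarith
    have := ((hasSum_aux b _ hx).mul_right (K y)).tendsto_sum_nat
    convert this using 2 with M
    refine Finset.sum_congr rfl fun m _ => ?_
    rw [mul_pow]; ring

theorem PosKer.prodRpow {d n : ℕ} (ν : ℂ) {b r : ℝ} (hb : 0 < b) (hr : 0 ≤ r) (hr1 : r < 1)
    (s : Finset (Fin n)) : PosKer ν (fun y : PairMom d n => ∏ i ∈ s,
      (1 - r * inner ℝ ((y i).2.1 : Euc d) ((y i).2.2 : Euc d)) ^ (-b)) := by
  classical
  induction s using Finset.induction_on with
  | empty => simpa using PosKer.one ν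
  | insert a s ha ih =>
    simp only [Finset.prod_insert ha]
    exact ih.rpow a hb hr hr1

theorem lintegral_pi_prod {X : Type*} [MeasurableSpace X] (μ : Measure X) [SigmaFinite μ] :
    ∀ (n : ℕ) (f : Fin n → X → ENNReal), (∀ i, Measurable (f i)) →
      ∫⁻ y, ∏ i, f i (y i) ∂(Measure.pi fun _ : Fin n => μ) = ∏ i, ∫⁻ x, f i x ∂μ := by
  intro n
  induction n with
  | zero => intro f _; simp
  | succ n ih =>
    intro f hf
    have e := measurePreserving_piFinSuccAbove (fun _ : Fin (n + 1) => μ) 0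
    have hm : Measurable fun z : X × (Fin n → X) => f 0 z.1 * ∏ i : Fin n, f i.succ (z.2 i) :=
      ((hf 0).comp measurable_fst).mul (Finset.measurable_prod _ fun i _ =>
        (hf i.succ).comp ((measurable_pi_apply i).comp measurable_snd))
    have h1 := e.lintegral_comp hm
    have h2 : ∫⁻ y, ∏ i, f i (y i) ∂(Measure.pi fun _ : Fin (n + 1) => μ) =
        ∫⁻ z, f 0 z.1 * ∏ i : Fin n, f i.succ (z.2 i) ∂(μ.prod (Measure.pi fun _ : Fin n => μ)) := by
      refine Eq.trans ?_ h1
      refine lintegral_congr fun y => ?_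
      rw [Fin.prod_univ_succ]
      rfl
    have h3 : Measurable fun z : Fin n → X => ∏ i : Fin n, f i.succ (z i) :=
      Finset.measurable_prod _ fun i _ => (hf i.succ).comp (measurable_pi_apply i)
    rw [h2, lintegral_prod_mul (f := f 0) (g := fun z : Fin n → X => ∏ i : Fin n, f i.succ (z i))
      (hf 0).aemeasurable h3.aemeasurable, ih (fun i => f i.succ) fun i => hf i.succ,
      Fin.prod_univ_succ]

theorem pi_withDensity {X : Type*} [MeasurableSpace X] (μ : Measure X) [SigmaFinite μ]
    (f : X → ENNReal) (hf : Measurable f) [SigmaFinite (μ.withDensity f)] (n : ℕ) :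
    (Measure.pi fun _ : Fin n => μ.withDensity f) =
      (Measure.pi fun _ : Fin n => μ).withDensity fun y => ∏ i, f (y i) := by
  refine Measure.pi_eq fun s hs => ?_
  rw [withDensity_apply _ (MeasurableSet.univ_pi hs), ← lintegral_indicator (MeasurableSet.univ_pi hs)]
  have : (fun y : Fin n → X => (univ.pi s).indicator (fun y => ∏ i, f (y i)) y) =
      fun y => ∏ i, (s i).indicator f (y i) := by
    funext y
    by_cases hy : y ∈ univ.pi s
    · rw [indicator_of_mem hy]
      exact Finset.prod_congr rfl fun i _ => (indicator_of_mem (hy i (mem_univ i)) _).symm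
    · rw [indicator_of_notMem hy]
      obtain ⟨i, hi⟩ : ∃ i, y i ∉ s i := by simpa using hy
      exact (Finset.prod_eq_zero (Finset.mem_univ i) (indicator_of_notMem hi _)).symm
  rw [this, lintegral_pi_prod μ n _ fun i => hf.indicator (hs i)]
  exact Finset.prod_congr rfl fun i _ => by
    rw [lintegral_indicator (hs i), withDensity_apply _ (hs i)]

theorem ae_inner_lt_one (m : ℕ) (hm : 1 ≤ m) : ∀ᵐ y ∂((sphMeas (m + 1)).prod (sphMeas (m + 1))),
    inner ℝ (y.1 : Euc (m + 1)) (y.2 : Euc (m + 1)) < 1 := by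
  obtain ⟨C, hC, hC'⟩ := sphere_lintegral_aux m (1 / 4) (by norm_num) (by
    have : (1:ℝ) ≤ m := by exact_mod_cast hm
    linarith)
  have hmeas : Measurable fun y : Sph (m + 1) × Sph (m + 1) =>
      (ENNReal.ofReal (1 - inner ℝ (y.1 : Euc (m + 1)) y.2)) ^ (-(1 / 4 : ℝ)) := by
    refine Measurable.pow_const (ENNReal.measurable_ofReal.comp ?_) _
    refine Continuous.measurable ?_
    exact continuous_const.sub ((continuous_subtype_val.comp continuous_fst).inner
      (continuous_subtype_val.comp continuous_snd))
  have hfin : ∫⁻ y, (ENNReal.ofReal (1 - inner ℝ (y.1 : Euc (m + 1)) y.2)) ^ (-(1 / 4 : ℝ))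
      ∂((sphMeas (m + 1)).prod (sphMeas (m + 1))) ≠ ⊤ := by
    rw [lintegral_prod _ hmeas.aemeasurable]
    refine ne_of_lt (lt_of_le_of_lt (lintegral_mono fun p => hC' p) ?_)
    rw [lintegral_const]
    exact ENNReal.mul_lt_top hC.lt_top (measure_lt_top _ _)
  filter_upwards [ae_lt_top hmeas hfin] with y hy
  by_contra hcon
  have : ENNReal.ofReal (1 - inner ℝ (y.1 : Euc (m + 1)) y.2) = 0 :=
    ENNReal.ofReal_of_nonpos (by linarith)
  rw [this, ENNReal.zero_rpow_of_neg (by norm_num)] at hy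
  exact lt_irrefl _ hy

theorem pairMom_withDensity {d n : ℕ} (S : Measure (Sph d × Sph d)) [IsFiniteMeasure S]
    (f : Sph d × Sph d → ENNReal) (hf : Measurable f) [IsFiniteMeasure (S.withDensity f)] :
    (Measure.pi fun _ : Fin n => (volume : Measure ℝ).prod (S.withDensity f)) =
      (Measure.pi fun _ : Fin n => (volume : Measure ℝ).prod S).withDensity
        fun y => ∏ i, f (y i).2 := by
  have h1 : (volume : Measure ℝ).prod (S.withDensity f) =
      ((volume : Measure ℝ).prod S).withDensity fun z => f z.2 := prod_withDensity_right hf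
  have h2 : SigmaFinite (((volume : Measure ℝ).prod S).withDensity fun z => f z.2) := by
    rw [← h1]; infer_instance
  simp only [h1]
  exact pi_withDensity ((volume : Measure ℝ).prod S) (fun z => f z.2) (hf.comp measurable_snd) n

theorem waveForm_nonneg {d n : ℕ} (par : SeriesParam d) {Ψ : Mom d n → ℂ} (h : IsWave par.ν Ψ) :
    0 ≤ (waveForm par.ν Ψ Ψ).re := by
  have hfin := pairMeas_finite par
  by_cases hp : IsPrincipal par.ν
  · have hae : ∀ᵐ y ∂pairMomMeas d n par.ν, leftMom y = rightMom y := by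
      have h1 : ∀ᵐ x ∂((volume : Measure ℝ).prod (pairMeas d par.ν)), x.2.1 = x.2.2 := by
        have h2 : ∀ᵐ q ∂(pairMeas d par.ν), q.1 = q.2 := by
          rw [pairMeas, if_pos hp]
          have hm : Measurable fun p : Sph d => (p, p) := measurable_id.prodMk measurable_id
          rw [ae_map_iff hm.aemeasurable (measurableSet_eq_fun measurable_fst measurable_snd)]
          exact Eventually.of_forall fun _ => rfl
        exact Measure.quasiMeasurePreserving_snd.ae h2
      have h3 : ∀ᵐ y ∂pairMomMeas d n par.ν, ∀ i, (y i).2.1 = (y i).2.2 :=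
        ae_all_iff.mpr fun i => (Measure.quasiMeasurePreserving_eval
          (fun _ : Fin n => (volume : Measure ℝ).prod (pairMeas d par.ν)) i).ae h1
      filter_upwards [h3] with y hy
      funext i
      simp only [leftMom, rightMom, hy i]
    have h4 : waveForm par.ν Ψ Ψ = ((∫ y, Complex.normSq (Ψ (rightMom y)) ∂pairMomMeas d n par.ν : ℝ) : ℂ) := by
      rw [← integral_complex_ofReal]
      refine integral_congr_ae ?_
      filter_upwards [hae] with y hy
      rw [hy, Complex.normSq_eq_conj_mul_self]
    rw [h4, Complex.ofReal_re]
    exact integral_nonneg fun _ => Complex.normSq_nonneg _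
  · obtain ⟨h1, h2, h3⟩ := par.adm.resolve_left hp
    set ν := par.ν
    set b : ℝ := alpha d + ν.im with hb
    have hb0 : 0 < b := by linarith
    obtain ⟨m, rfl⟩ : ∃ m, d = m + 1 := by
      rcases d with _ | m
      · exfalso; simp [alpha] at hb; linarith
      · exact ⟨m, rfl⟩
    have hm : 1 ≤ m := by
      rcases m with _ | m
      · exfalso; simp [alpha] at hb; linarith
      · omega
    set c : ℝ := (2 * Real.pi) ^ (-alpha (m + 1)) * (Real.Gamma b / Real.Gamma (-ν.im)) with hcdef
    have hc : 0 ≤ c := by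
      have := Real.Gamma_pos_of_pos hb0
      have := Real.Gamma_pos_of_pos (show 0 < -ν.im by linarith)
      positivity
    let S2 : Measure (Sph (m + 1) × Sph (m + 1)) := (sphMeas (m + 1)).prod (sphMeas (m + 1))
    let x : Sph (m + 1) × Sph (m + 1) → ℝ := fun q => inner ℝ (q.1 : Euc (m + 1)) q.2
    have hxm : Measurable x := ((measurable_subtype_coe.comp measurable_fst).inner
      (measurable_subtype_coe.comp measurable_snd))
    have hx1 : ∀ q, |x q| ≤ 1 := fun q => abs_inner_sph q.1 q.2
    let f : Sph (m + 1) × Sph (m + 1) → ENNReal := fun q => ENNReal.ofReal (c * (1 - x q) ^ (-b))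
    have hf : Measurable f :=
      ENNReal.measurable_ofReal.comp (((measurable_const.sub hxm).pow_const _).const_mul c)
    have hpair : pairMeas (m + 1) ν = S2.withDensity f := by
      rw [pairMeas, if_neg hp]
      congr 1
      funext q
      simp only [f, x]
      rw [mdot_basePt, show -alpha (m + 1) - ν.im = -b by simp only [hb]; ring]
    let B : Measure (PairMom (m + 1) n) := Measure.pi fun _ => (volume : Measure ℝ).prod S2
    let D : PairMom (m + 1) n → ENNReal := fun y => ∏ i, f (y i).2
    have hDm : Measurable D := Finset.measurable_prod _ fun i _ => hf.comp (measurable_pi_apply i).snd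
    have hfin' : IsFiniteMeasure (S2.withDensity f) := by rw [← hpair]; exact hfin
    have hmeas : pairMomMeas (m + 1) n ν = B.withDensity D := by
      unfold pairMomMeas
      rw [hpair]
      exact pairMom_withDensity S2 f hf
    have hDr : ∀ y, (D y).toReal = ∏ i, c * (1 - x (y i).2) ^ (-b) := fun y => by
      simp only [D, ENNReal.toReal_prod]
      refine Finset.prod_congr rfl fun i _ => ENNReal.toReal_ofReal ?_
      have := (abs_le.mp (hx1 (y i).2)).2
      exact mul_nonneg hc (Real.rpow_nonneg (by linarith) _)
    have hDlt : ∀ y, D y < ⊤ := fun y => ENNReal.prod_lt_top fun i _ => ENNReal.ofReal_lt_top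
    let G : PairMom (m + 1) n → ℂ := fun y => (starRingEnd ℂ) (Ψ (leftMom y)) * Ψ (rightMom y)
    have hGi : Integrable (fun y => (D y).toReal • G y) B := by
      rw [← integrable_withDensity_iff_integrable_smul' hDm (Eventually.of_forall hDlt), ← hmeas]
      exact integrable_pair (pairMeas (m + 1) ν) h h
    have hform : waveForm ν Ψ Ψ = ∫ y, (D y).toReal • G y ∂B := by
      unfold waveForm
      rw [hmeas, integral_withDensity_eq_integral_toReal_smul hDm (Eventually.of_forall hDlt)]
    have hae : ∀ᵐ y ∂B, ∀ i, x (y i).2 < 1 := by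
      refine ae_all_iff.mpr fun i => ?_
      have := Measure.quasiMeasurePreserving_snd (μ := (volume : Measure ℝ)) (ν := S2) |>.ae
        (ae_inner_lt_one m hm)
      exact (Measure.quasiMeasurePreserving_eval (fun _ : Fin n => (volume : Measure ℝ).prod S2) i).ae this
    let r : ℕ → ℝ := fun k => 1 - 1 / ((k : ℝ) + 1)
    have hr0 : ∀ k, 0 ≤ r k := fun k => by
      simp only [r, sub_nonneg]
      rw [div_le_one (by positivity)]; linarith [(Nat.cast_nonneg k : (0:ℝ) ≤ k)]
    have hr1 : ∀ k, r k < 1 := fun k => by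
      have : (0:ℝ) < 1 / ((k : ℝ) + 1) := by positivity
      simp only [r]; linarith
    have hrlim : Tendsto r atTop (𝓝 1) := by
      have := (tendsto_one_div_add_atTop_nhds_zero_nat (𝕜 := ℝ)).const_sub 1
      simpa [r] using this
    let K : ℕ → PairMom (m + 1) n → ℝ := fun k y => ∏ i, (1 - r k * x (y i).2) ^ (-b)
    have hK : ∀ k, PosKer ν (K k) := fun k =>
      PosKer.prodRpow ν hb0 (hr0 k) (hr1 k) Finset.univ
    have hlim := tendsto_integral_of_dominated_convergence
      (F := fun k (y : PairMom (m + 1) n) => (((c ^ n * K k y : ℝ)) : ℂ) * G y)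
      (f := fun y => (D y).toReal • G y) (μ := B)
      (fun y => (2 ^ b) ^ n * ‖(D y).toReal • G y‖)
      (fun k => by
        obtain ⟨C, hC⟩ := ((hK k).const_mul (pow_nonneg hc n)).bdd
        exact (integrable_ker ((hK k).const_mul (pow_nonneg hc n)).meas hC h h).aestronglyMeasurable)
      (hGi.norm.const_mul _)
      (fun k => by
        filter_upwards [hae] with y hy
        rw [norm_mul, norm_smul, ← mul_assoc]
        refine mul_le_mul_of_nonneg_right ?_ (norm_nonneg _)
        rw [Complex.norm_real, hDr, Real.norm_eq_abs, Real.norm_eq_abs, abs_mul,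
          abs_of_nonneg (pow_nonneg hc n), Finset.abs_prod, Finset.abs_prod]
        have e1 : c ^ n = ∏ _i : Fin n, c := by simp
        have e2 : ((2:ℝ) ^ b) ^ n = ∏ _i : Fin n, (2:ℝ) ^ b := by simp
        rw [e1, e2, ← Finset.prod_mul_distrib, ← Finset.prod_mul_distrib]
        refine Finset.prod_le_prod (fun i _ => mul_nonneg hc (abs_nonneg _)) fun i _ => ?_
        have hxa := abs_le.mp (hx1 (y i).2)
        have hpos : 0 < 1 - x (y i).2 := by linarith [hy i]
        have hge : (1 - x (y i).2) / 2 ≤ 1 - r k * x (y i).2 := by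
          nlinarith [hr0 k, hr1 k, hxa.1, hxa.2]
        rw [abs_mul, abs_of_nonneg hc, abs_of_nonneg (Real.rpow_nonneg (by linarith) _),
          abs_of_nonneg (Real.rpow_nonneg hpos.le _)]
        have h5 : (1 - r k * x (y i).2) ^ (-b) ≤ ((1 - x (y i).2) / 2) ^ (-b) :=
          Real.rpow_le_rpow_of_nonpos (by linarith) hge (by linarith)
        rw [Real.div_rpow hpos.le (by norm_num), Real.rpow_neg (by norm_num : (0:ℝ) ≤ 2),
          div_inv_eq_mul] at h5
        calc c * (1 - r k * x (y i).2) ^ (-b) ≤ c * ((1 - x (y i).2) ^ (-b) * 2 ^ b) := by gcongr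
          _ = _ := by ring)
      (by
        filter_upwards [hae] with y hy
        have h6 : (D y).toReal • G y = (((c ^ n * ∏ i, (1 - x (y i).2) ^ (-b) : ℝ)) : ℂ) * G y := by
          rw [hDr, Finset.prod_mul_distrib]
          simp
        rw [h6]
        refine Tendsto.mul_const _ ((Complex.continuous_ofReal.tendsto _).comp ?_)
        refine Tendsto.const_mul _ (tendsto_finsetProd _ fun i _ => ?_)
        have h7 : Tendsto (fun k => 1 - r k * x (y i).2) atTop (𝓝 (1 - 1 * x (y i).2)) :=
          (hrlim.mul_const _).const_sub 1
        rw [one_mul] at h7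
        exact h7.rpow_const (Or.inl (by linarith [hy i])))
    rw [hform]
    refine ge_of_tendsto ((Complex.continuous_re.tendsto _).comp hlim)
      (Eventually.of_forall fun k => ?_)
    exact ((hK k).const_mul (pow_nonneg hc n)).pos Ψ h

theorem waveForm_conj {d n : ℕ} (par : SeriesParam d) {Ψ Φ : Mom d n → ℂ} (h : IsWave par.ν Ψ)
    (k : IsWave par.ν Φ) : (starRingEnd ℂ) (waveForm par.ν Φ Ψ) = waveForm par.ν Ψ Φ := by
  have hfin := pairMeas_finite par
  have hsw : MeasurePreserving (Prod.swap : Sph d × Sph d → Sph d × Sph d)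
      (pairMeas d par.ν) (pairMeas d par.ν) := by
    refine ⟨measurable_swap, ?_⟩
    by_cases hp : IsPrincipal par.ν
    · have hm : Measurable fun p : Sph d => (p, p) := measurable_id.prodMk measurable_id
      rw [pairMeas, if_pos hp, Measure.map_map measurable_swap hm]
      rfl
    · rw [pairMeas, if_neg hp]
      ext s hs
      rw [Measure.map_apply measurable_swap hs, withDensity_apply _ (measurable_swap hs),
        withDensity_apply _ hs]
      have hsm := (Measure.measurePreserving_swap (μ := sphMeas d) (ν := sphMeas d))
      rw [← hsm.setLIntegral_comp_preimage_emb
        (MeasurableEquiv.prodComm (α := Sph d) (β := Sph d)).measurableEmbedding]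
      refine lintegral_congr fun y => ?_
      congr 3
      simp only [mdot, Prod.fst_swap, Prod.snd_swap]
      simp [mul_comm]
  have hsw1 : MeasurePreserving (fun z : ℝ × (Sph d × Sph d) => (z.1, z.2.swap))
      ((volume : Measure ℝ).prod (pairMeas d par.ν)) ((volume : Measure ℝ).prod (pairMeas d par.ν)) :=
    (MeasurePreserving.id _).prod hsw
  have hsw2 : MeasurePreserving (fun (y : PairMom d n) i => ((y i).1, (y i).2.swap))
      (pairMomMeas d n par.ν) (pairMomMeas d n par.ν) :=
    measurePreserving_pi _ _ fun _ => hsw1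
  have hm : AEStronglyMeasurable (fun y : PairMom d n =>
      (starRingEnd ℂ) (Ψ (leftMom y)) * Φ (rightMom y)) (pairMomMeas d n par.ν) :=
    (integrable_pair (pairMeas d par.ν) h k).aestronglyMeasurable
  unfold waveForm
  rw [← integral_conj]
  have h1 := integral_map hsw2.measurable.aemeasurable (by rw [hsw2.map_eq]; exact hm)
  rw [hsw2.map_eq] at h1
  rw [h1]
  refine integral_congr_ae (Eventually.of_forall fun y => ?_)
  simp only [map_mul, Complex.conj_conj]
  rw [mul_comm]
  rfl

/-- The space of `n`-particle wave functions, with the inner product `waveForm`. -/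
def WaveFn {d : ℕ} (par : SeriesParam d) (n : ℕ) : Type := waveSub d n par.ν

noncomputable instance {d : ℕ} (par : SeriesParam d) (n : ℕ) : AddCommGroup (WaveFn par n) :=
  inferInstanceAs (AddCommGroup (waveSub d n par.ν))

noncomputable instance {d : ℕ} (par : SeriesParam d) (n : ℕ) : Module ℂ (WaveFn par n) :=
  inferInstanceAs (Module ℂ (waveSub d n par.ν))

/-- The underlying function of a wave function. -/
def WaveFn.fn {d n : ℕ} {par : SeriesParam d} (Ψ : WaveFn par n) : Mom d n → ℂ := Subtype.val Ψ

theorem WaveFn.isWave {d n : ℕ} {par : SeriesParam d} (Ψ : WaveFn par n) : IsWave par.ν Ψ.fn :=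
  Subtype.property Ψ

/-- The semi-inner product of wave functions. -/
@[reducible]
noncomputable def waveCore {d : ℕ} (par : SeriesParam d) (n : ℕ) :
    PreInnerProductSpace.Core ℂ (WaveFn par n) where
  inner Ψ Φ := waveForm par.ν Ψ.fn Φ.fn
  conj_inner_symm Ψ Φ := waveForm_conj par Ψ.isWave Φ.isWave
  re_inner_nonneg Ψ := waveForm_nonneg par Ψ.isWave
  add_left Ψ Φ Χ := by
    have := pairMeas_finite par
    have e : waveForm par.ν (Ψ + Φ).fn Χ.fn =
        ∫ y, ((starRingEnd ℂ) (Ψ.fn (leftMom y)) * Χ.fn (rightMom y) +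
          (starRingEnd ℂ) (Φ.fn (leftMom y)) * Χ.fn (rightMom y)) ∂pairMomMeas d n par.ν := by
      refine integral_congr_ae (Eventually.of_forall fun y => ?_)
      change (starRingEnd ℂ) (Ψ.fn (leftMom y) + Φ.fn (leftMom y)) * _ = _
      simp only [map_add]; ring
    rw [e]
    exact integral_add (integrable_pair (pairMeas d par.ν) Ψ.isWave Χ.isWave)
      (integrable_pair (pairMeas d par.ν) Φ.isWave Χ.isWave)
  smul_left Ψ Φ c := by
    change waveForm par.ν (c • Ψ.fn) Φ.fn = _
    unfold waveForm
    rw [← integral_const_mul]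
    refine integral_congr_ae (Eventually.of_forall fun y => ?_)
    simp only [Pi.smul_apply, smul_eq_mul, map_mul]; ring

noncomputable instance {d : ℕ} (par : SeriesParam d) (n : ℕ) :
    SeminormedAddCommGroup (WaveFn par n) :=
  @InnerProductSpace.Core.toSeminormedAddCommGroup ℂ _ _ _ _ (waveCore par n)

noncomputable instance {d : ℕ} (par : SeriesParam d) (n : ℕ) : InnerProductSpace ℂ (WaveFn par n) :=
  InnerProductSpace.ofCore (waveCore par n)

theorem WaveFn.inner_def {d n : ℕ} {par : SeriesParam d} (Ψ Φ : WaveFn par n) :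
    inner ℂ Ψ Φ = waveForm par.ν Ψ.fn Φ.fn := rfl

/-- The unsymmetrized `n`-particle Hilbert space `ℋ₁^{⊗ n}`, with
`ℋ₁ = L²(ℝ, dθ) ⊗ 𝒦_ν`: the completion of the space of `n`-particle wave functions. -/
abbrev NPart {d : ℕ} (par : SeriesParam d) (n : ℕ) : Type := UniformSpace.Completion (WaveFn par n)

/-- `(ξ ⊗ Ψ)(θ₀, P₀, …, θ_n, P_n) = ξ(θ₀, P₀) Ψ(θ₁, P₁, …, θ_n, P_n)`. -/
def tensorFun {d n : ℕ} (ξ : Mom d 1 → ℂ) (Ψ : Mom d n → ℂ) : Mom d (n + 1) → ℂ :=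
  fun y => ξ (fun _ => y 0) * Ψ (fun i => y i.succ)

theorem IsWave.tensor {d n : ℕ} {ν : ℂ} {ξ : Mom d 1 → ℂ} {Ψ : Mom d n → ℂ}
    (h : IsWave ν ξ) (k : IsWave ν Ψ) : IsWave ν (tensorFun ξ Ψ) := by
  obtain ⟨g, hg, hg'⟩ := h.dom
  obtain ⟨g₁, hg₁, hg₁'⟩ := k.dom
  refine ⟨?_, fun t ht y => ?_, fun θ => g (fun _ => θ 0) * g₁ (fun i => θ i.succ), ?_, fun θ p => ?_⟩
  · refine (h.meas.comp ?_).mul (k.meas.comp ?_)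
    · exact measurable_pi_lambda _ fun _ => measurable_pi_apply 0
    · exact measurable_pi_lambda _ fun i => measurable_pi_apply i.succ
  · have h1 := h.homog (fun _ => t 0) (fun _ => ht 0) (fun _ => y 0)
    have h2 := k.homog (fun i => t i.succ) (fun i => ht i.succ) (fun i => y i.succ)
    simp only [tensorFun]
    rw [h1, h2, Fin.prod_univ_succ fun i => (t i : ℂ) ^ deg d ν]
    simp; ring
  · have e1 := volume_preserving_piFinSuccAbove (fun _ : Fin (n + 1) => ℝ) 0
    have e2 := (volume_preserving_funUnique (Fin 1) ℝ).symm
    have hg2 : MemLp (fun x : ℝ => g fun _ => x) 2 volume := hg.comp_measurePreserving e2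
    have h3 : MemLp (fun z : ℝ × (Fin n → ℝ) => g (fun _ => z.1) * g₁ z.2) 2
        (volume.prod volume) := by
      rw [memLp_two_iff_integrable_sq]
      · have := hg2.integrable_sq.mul_prod hg₁.integrable_sq
        simpa only [mul_pow] using this
      · exact (hg2.1.comp_fst).mul (hg₁.1.comp_snd)
    exact h3.comp_measurePreserving e1
  · simp only [tensorFun, norm_mul]
    exact mul_le_mul (hg' _ fun _ => p 0) (hg₁' _ fun i => p i.succ) (norm_nonneg _)
      ((norm_nonneg _).trans (hg' _ fun _ => p 0))

theorem waveForm_tensor {d n : ℕ} (par : SeriesParam d) (ξ η : Mom d 1 → ℂ) (Ψ Φ : Mom d n → ℂ) :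
    waveForm par.ν (tensorFun ξ Ψ) (tensorFun η Φ) =
      waveForm par.ν ξ η * waveForm par.ν Ψ Φ := by
  have := pairMeas_finite par
  set μ := (volume : Measure ℝ).prod (pairMeas d par.ν) with hμ
  have e1 := measurePreserving_piFinSuccAbove (fun _ : Fin (n + 1) => μ) 0
  have e2 := (measurePreserving_funUnique μ (Fin 1)).symm
  have h1 : waveForm par.ν ξ η = ∫ x, (starRingEnd ℂ) (ξ fun _ => (x.1, basePt x.2.1)) *
      η (fun _ => (x.1, basePt x.2.2)) ∂μ :=
    (e2.integral_comp (MeasurableEquiv.measurableEmbedding _) (fun y : PairMom d 1 =>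
      (starRingEnd ℂ) (ξ (leftMom y)) * η (rightMom y))).symm
  rw [h1]
  unfold waveForm
  rw [pairMomMeas, pairMomMeas, ← hμ, ← integral_prod_mul]
  refine Eq.trans ?_ (e1.integral_comp (MeasurableEquiv.measurableEmbedding _) _)
  refine integral_congr_ae (Eventually.of_forall fun y => ?_)
  simp only [tensorFun, map_mul]
  rw [mul_mul_mul_comm]
  rfl

/-- `Ψ ↦ ξ ⊗ Ψ` as a bounded map `ℋ₁^{⊗ n} → ℋ₁^{⊗ (n+1)}`, for a one-particle wave function. -/
noncomputable def tensorLeft {d : ℕ} {par : SeriesParam d} (ξ : WaveFn par 1) (n : ℕ) :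
    NPart par n →L[ℂ] NPart par (n + 1) :=
  ContinuousLinearMap.completion (LinearMap.mkContinuous
    { toFun := fun Ψ : WaveFn par n => (⟨tensorFun ξ.fn Ψ.fn, ξ.isWave.tensor Ψ.isWave⟩ : waveSub d (n + 1) par.ν)
      map_add' := fun Ψ Φ => Subtype.ext (funext fun y => by
        change ξ.fn _ * (Ψ.fn _ + Φ.fn _) = ξ.fn _ * Ψ.fn _ + ξ.fn _ * Φ.fn _
        ring)
      map_smul' := fun c Ψ => Subtype.ext (funext fun y => by
        change ξ.fn _ * (c * Ψ.fn _) = c * (ξ.fn _ * Ψ.fn _)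
        ring) : WaveFn par n →ₗ[ℂ] WaveFn par (n + 1) }
    ‖ξ‖ (fun Ψ => by
      have h : ∀ {k : ℕ} (Χ : WaveFn par k), ‖Χ‖ ^ 2 = (waveForm par.ν Χ.fn Χ.fn).re := fun Χ =>
        norm_sq_eq_re_inner (𝕜 := ℂ) Χ
      have him : (waveForm par.ν ξ.fn ξ.fn).im = 0 := inner_self_im (𝕜 := ℂ) ξ
      refine abs_le_of_sq_le_sq' ?_ (by positivity) |>.2
      rw [mul_pow, h, h, h]
      change (waveForm par.ν (tensorFun ξ.fn Ψ.fn) (tensorFun ξ.fn Ψ.fn)).re ≤ _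
      rw [waveForm_tensor, Complex.mul_re, him]
      simp))

/-- The translation-dilation group `𝒫_o` of the light ray; `(x, l)` acts by `u ↦ e^{-l} u + x`. -/
@[ext]
structure Po where
  x : ℝ
  l : ℝ

noncomputable instance : Mul Po := ⟨fun g h => ⟨g.x + Real.exp (-g.l) * h.x, g.l + h.l⟩⟩
noncomputable instance : One Po := ⟨⟨0, 0⟩⟩
noncomputable instance : Inv Po := ⟨fun g => ⟨-(Real.exp g.l * g.x), -g.l⟩⟩

noncomputable instance : Group Po := Group.ofLeftAxioms
  (fun a b c => by
    refine Po.ext ?_ ?_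
    · change (a.x + Real.exp (-a.l) * b.x) + Real.exp (-(a.l + b.l)) * c.x =
        a.x + Real.exp (-a.l) * (b.x + Real.exp (-b.l) * c.x)
      rw [neg_add, Real.exp_add]; ring
    · exact add_assoc a.l b.l c.l)
  (fun a => by
    refine Po.ext ?_ ?_
    · change 0 + Real.exp (-0) * a.x = a.x
      simp
    · exact zero_add a.l)
  (fun a => by
    refine Po.ext ?_ ?_
    · change -(Real.exp a.l * a.x) + Real.exp (-(-a.l)) * a.x = 0
      rw [neg_neg]; ring
    · exact neg_add_cancel a.l)

/-- The proper orthochronous Lorentz group `SO^↑(d,1)`. -/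
noncomputable def SOup (d : ℕ) : Subgroup (Mink d ≃ₗ[ℝ] Mink d) where
  carrier := {Λ | (∀ X Y, mdot (Λ X) (Λ Y) = mdot X Y) ∧ LinearEquiv.det Λ = 1 ∧
    ∀ P, Λ P ∈ Cone d ↔ P ∈ Cone d}
  mul_mem' := by
    rintro Λ M ⟨h1, h2, h3⟩ ⟨k1, k2, k3⟩
    refine ⟨fun X Y => ?_, by rw [map_mul, h2, k2, mul_one], fun P => ?_⟩
    · exact (h1 _ _).trans (k1 _ _)
    · exact (h3 _).trans (k3 _)
  one_mem' := ⟨fun _ _ => rfl, map_one _, fun _ => Iff.rfl⟩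
  inv_mem' := by
    rintro Λ ⟨h1, h2, h3⟩
    have e : ∀ X, Λ (Λ⁻¹ X) = X := fun X => Λ.apply_symm_apply X
    refine ⟨fun X Y => ?_, by rw [map_inv, h2, inv_one], fun P => ?_⟩
    · rw [← h1, e, e]
    · rw [← h3, e]

/-- The action of `SO^↑(d,1)` on the light cone. -/
def coneAct {d : ℕ} (Λ : SOup d) (P : Cone d) : Cone d :=
  ⟨Λ.1 P, (Λ.2.2.2 P).mpr P.2⟩

theorem continuous_coneAct {d : ℕ} (Λ : SOup d) : Continuous (coneAct Λ) :=
  ((LinearMap.continuous_of_finiteDimensional (Λ.1 : Mink d →ₗ[ℝ] Mink d)).comp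
    continuous_subtype_val).subtype_mk _

theorem coneAct_scale {d : ℕ} (Λ : SOup d) (t : ℝ) (ht : 0 < t) (P : Cone d) :
    coneAct Λ (Cone.scale t ht P) = Cone.scale t ht (coneAct Λ P) :=
  Subtype.ext (map_smul Λ.1 t (P : Mink d))

/-- `(V(x, λ, Λ)Ψ)(θ₁, P₁, …) = exp(i x Σ_j e^{θ_j}) Ψ(θ₁ - λ, Λ⁻¹ P₁, …)`. -/
noncomputable def actFun {d n : ℕ} (g : Po × SOup d) (Ψ : Mom d n → ℂ) : Mom d n → ℂ :=
  fun y => Complex.exp (Complex.I * ((g.1.x * ∑ j, Real.exp (y j).1 : ℝ) : ℂ)) *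
    Ψ fun j => ((y j).1 - g.1.l, coneAct g.2⁻¹ (y j).2)

theorem IsWave.act {d n : ℕ} {ν : ℂ} {Ψ : Mom d n → ℂ} (g : Po × SOup d) (h : IsWave ν Ψ) :
    IsWave ν (actFun g Ψ) := by
  have hc := continuous_coneAct g.2⁻¹
  refine ⟨?_, fun t ht y => ?_, ?_⟩
  · refine Measurable.mul ?_ (h.meas.comp ?_)
    · have : Measurable fun y : Mom d n => g.1.x * ∑ j, Real.exp (y j).1 :=
        (Finset.measurable_sum _ fun j _ => Real.measurable_exp.comp
          (measurable_pi_apply j).fst).const_mul _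
      exact Complex.measurable_exp.comp ((Complex.measurable_ofReal.comp this).const_mul _)
    · exact measurable_pi_lambda _ fun j => ((measurable_pi_apply j).fst.sub_const _).prodMk
        (hc.measurable.comp (measurable_pi_apply j).snd)
  · simp only [actFun, coneAct_scale]
    rw [h.homog t ht fun j => ((y j).1 - g.1.l, coneAct g.2⁻¹ (y j).2)]
    ring
  · obtain ⟨a, ha, ha'⟩ := h.dom
    set ρ : Sph d → ℝ := fun p => (coneAct g.2⁻¹ (basePt p) : Mink d) 0 with hρ
    have hρ0 : ∀ p, 0 < ρ p := fun p => (coneAct g.2⁻¹ (basePt p)).2.2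
    have hρc : Continuous ρ := (continuous_apply 0).comp
      (continuous_subtype_val.comp (hc.comp continuous_basePt))
    obtain ⟨M, hM⟩ := isCompact_univ.bddAbove_image (f := fun p => ρ p ^ (deg d ν).re)
      (hρc.rpow_const fun p => Or.inl (hρ0 p).ne').continuousOn
    have hM' : ∀ p, ρ p ^ (deg d ν).re ≤ M := fun p => hM ⟨p, mem_univ p, rfl⟩
    refine ⟨fun θ => M ^ n * a (fun i => θ i - g.1.l), ?_, fun θ p => ?_⟩
    · refine MemLp.const_mul ?_ _
      exact ha.comp_measurePreserving
        (measurePreserving_sub_right (volume : Measure (Fin n → ℝ)) (fun _ => g.1.l))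
    · choose q hq using fun i => Cone.exists_base (coneAct g.2⁻¹ (basePt (p i)))
      have e : actFun g Ψ (fun i => (θ i, basePt (p i))) =
          Complex.exp (Complex.I * ((g.1.x * ∑ j, Real.exp (θ j) : ℝ) : ℂ)) *
            ((∏ i, ((ρ (p i) : ℝ) : ℂ) ^ deg d ν) * Ψ fun i => (θ i - g.1.l, basePt (q i))) := by
        rw [← h.homog (fun i => ρ (p i)) (fun i => hρ0 (p i))
          (fun i => (θ i - g.1.l, basePt (q i)))]
        simp only [actFun]
        congr 2
        funext i
        exact Prod.ext rfl (hq i)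
      rw [e, norm_mul, norm_mul, mul_comm Complex.I, Complex.norm_exp_ofReal_mul_I, one_mul,
        norm_prod]
      have hb : ∏ i, ‖((ρ (p i) : ℝ) : ℂ) ^ deg d ν‖ ≤ M ^ n := by
        have h2 : ∏ _i : Fin n, M = M ^ n := by simp
        rw [← h2]
        refine Finset.prod_le_prod (fun i _ => norm_nonneg _) fun i _ => ?_
        rw [Complex.norm_cpow_eq_rpow_re_of_pos (hρ0 _)]
        exact hM' _
      exact mul_le_mul hb (ha' _ q) (norm_nonneg _)
        ((Finset.prod_nonneg fun i _ => norm_nonneg _).trans hb)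

/-- The action of `𝒫_o × SO^↑(d,1)` on wave functions. -/
noncomputable def waveAct {d n : ℕ} {par : SeriesParam d} (g : Po × SOup d) (Ψ : WaveFn par n) :
    WaveFn par n := (⟨actFun g Ψ.fn, Ψ.isWave.act g⟩ : waveSub d n par.ν)

/-- Its continuous extension to `ℋ₁^{⊗ n}`. -/
noncomputable def nAct {d : ℕ} {par : SeriesParam d} (g : Po × SOup d) (n : ℕ) :
    NPart par n → NPart par n := UniformSpace.Completion.map (waveAct g)

/-- De Sitter space `dS_d = {X ∈ ℝ^{d+1} : X · X = -1}`. -/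
def dS (d : ℕ) : Set (Mink d) := {X | mdot X X = -1}

theorem mdot_neg_neg {d : ℕ} (X : Mink d) : mdot (-X) (-X) = mdot X X := by simp [mdot]

/-- The reflection `X ↦ -X` of `dS_d`. -/
def dSneg {d : ℕ} (X : dS d) : dS d := ⟨-X, (mdot_neg_neg X.1).trans X.2⟩

/-- The action of `SO^↑(d,1)` on `dS_d`. -/
def dSact {d : ℕ} (Λ : SOup d) (X : dS d) : dS d := ⟨Λ.1 X, (Λ.2.1 X X).trans X.2⟩

/-- The radial projection of the spacelike vectors onto `dS_d`. -/
noncomputable def dSproj {d : ℕ} (X : {X : Mink d // mdot X X < 0}) : dS d :=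
  ⟨(√(-mdot X.1 X.1))⁻¹ • X.1, by
    have h : 0 < -mdot X.1 X.1 := neg_pos.mpr X.2
    change mdot _ _ = -1
    rw [mdot_smul_smul, inv_pow, Real.sq_sqrt h.le, inv_neg, neg_mul,
      inv_mul_cancel₀ X.2.ne]⟩

open Classical in
/-- The extension of a function on `dS_d` to the spacelike vectors that is homogeneous of
degree `0` (and `0` elsewhere). -/
noncomputable def hext {d : ℕ} (F : dS d → ℂ) (X : Mink d) : ℂ :=
  if h : mdot X X < 0 then F (dSproj ⟨X, h⟩) else 0

/-- The test functions `C_0^∞(dS_d)`. Smoothness on the submanifold `dS_d` is smoothness of the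
homogeneous extension to the open set of spacelike vectors. -/
def TestFn (d : ℕ) : Submodule ℂ (dS d → ℂ) where
  carrier := {F | ContDiffOn ℝ (⊤ : ℕ∞) (hext F) {X | mdot X X < 0} ∧ HasCompactSupport F}
  add_mem' := by
    rintro F G ⟨h1, h2⟩ ⟨k1, k2⟩
    refine ⟨?_, h2.add k2⟩
    have e : hext (F + G) = hext F + hext G := by
      funext X; by_cases hX : mdot X X < 0 <;> simp [hext, hX]
    rw [e]; exact h1.add k1
  zero_mem' := by
    have e : hext (0 : dS d → ℂ) = fun _ => 0 := by
      funext X; by_cases hX : mdot X X < 0 <;> simp [hext, hX]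
    refine ⟨?_, HasCompactSupport.zero⟩
    rw [e]; exact contDiffOn_const
  smul_mem' := by
    rintro c F ⟨h1, h2⟩
    have e : hext (c • F) = fun X => c • hext F X := by
      funext X; by_cases hX : mdot X X < 0 <;> simp [hext, hX]
    refine ⟨?_, ?_⟩
    · rw [e]; exact h1.const_smul c
    · exact h2.smul_left (f := fun _ => c)

/-- The invariant volume measure `dμ` of `dS_d`. As the vector `X` is the unit normal of `dS_d` at
`X`, the volume of a subset is `d + 1` times the Lebesgue measure of the cone over it. -/
noncomputable def dSmeas (d : ℕ) : Measure (dS d) :=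
  ((d + 1 : ℕ) : ENNReal) • (((volume : Measure (Mink d)).comap
    (Subtype.val : {X : Mink d // mdot X X < 0} → Mink d)).restrict
      {X | -1 < mdot X.1 X.1}).map dSproj

/-- The d'Alembert operator of `dS_d`, for the Lorentzian metric induced by the ambient product
of signature `(+, -, …, -)`: the restriction to `dS_d` of `∂₀² - ∂₁² - ⋯ - ∂_d²` applied to the
extension that is homogeneous of degree `0`. -/
noncomputable def box {d : ℕ} (F : dS d → ℂ) (X : dS d) : ℂ :=
  iteratedFDeriv ℝ 2 (hext F) X (fun _ => Pi.single 0 1) -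
    ∑ i : Fin d, iteratedFDeriv ℝ 2 (hext F) X (fun _ => Pi.single i.succ 1)

/-- The regularized transform `∫ F(X) [(X + iεe) · P]^{-α-iν} dμ(X)`, `e = (1, 0, …, 0)`. -/
noncomputable def fhReg {d : ℕ} (ν : ℂ) (F : dS d → ℂ) (P : Cone d) (ε : ℝ) : ℂ :=
  ∫ X : dS d, F X * (((mdot (X : Mink d) P : ℝ) : ℂ) + Complex.I * ((ε * (P : Mink d) 0 : ℝ) : ℂ))
    ^ deg d ν ∂dSmeas d

/-- The Fourier-Helgason transform `F_ν^+`. -/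
noncomputable def fourierHelgason {d : ℕ} (ν : ℂ) (F : dS d → ℂ) (P : Cone d) : ℂ :=
  limUnder (𝓝[>] (0 : ℝ)) (fhReg ν F P)

/-- `f^+(θ) = i e^θ ∫ e^{iue^θ} f(u) du`. -/
noncomputable def fPlus (f : ℝ → ℂ) (θ : ℝ) : ℂ :=
  Complex.I * (Real.exp θ : ℂ) * ∫ u : ℝ, Complex.exp (Complex.I * ((u * Real.exp θ : ℝ) : ℂ)) * f u

/-- `f^-(θ) = -i e^θ ∫ e^{-iue^θ} f(u) du`. -/
noncomputable def fMinus (f : ℝ → ℂ) (θ : ℝ) : ℂ :=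
  -Complex.I * (Real.exp θ : ℂ) *
    ∫ u : ℝ, Complex.exp (-Complex.I * ((u * Real.exp θ : ℝ) : ℂ)) * f u

open Classical in
/-- The parameter `ε` of the crossing factor: `0` for the principal, `iν` for the complementary
series. -/
noncomputable def crossEps (ν : ℂ) : ℂ := if IsPrincipal ν then 0 else Complex.I * ν

/-- `ν₁₂^± = (i/2)(ν₁ ± ν₂)`. -/
noncomputable def nuPM (ν₁ ν₂ : ℂ) (q : ℤˣ) : ℂ := Complex.I / 2 * (ν₁ + ((q : ℤ) : ℂ) * ν₂)

/-- The crossing factor `σ_{νν}(θ)`. -/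
noncomputable def crossFactor (d : ℕ) (ν : ℂ) (θ : ℝ) : ℂ :=
  let a : ℂ := (alpha d : ℂ)
  let ε : ℂ := crossEps ν
  let s : ℂ := Complex.I * (θ : ℂ)
  Complex.Gamma (a + ε - s) ^ 2 / Complex.Gamma (a + ε + s) ^ 2 *
  ∏' n : ℕ,
    ((Complex.Gamma (s + a * (2 * n + 1) - ε) ^ 2 * Complex.Gamma (-s + a * (2 * n - 1) - ε) ^ 2) /
      (Complex.Gamma (-s + a * (2 * n + 1) - ε) ^ 2 * Complex.Gamma (s + a * (2 * n - 1) - ε) ^ 2) *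
    ∏ p : ℤˣ, ∏ q : ℤˣ,
      (Complex.Gamma (s + a * (2 * n + 1) - ((p : ℤ) : ℂ) * nuPM ν ν q) *
        Complex.Gamma (-s + a * (2 * n + 2) - ((p : ℤ) : ℂ) * nuPM ν ν q)) /
      (Complex.Gamma (-s + a * (2 * n + 1) - ((p : ℤ) : ℂ) * nuPM ν ν q) *
        Complex.Gamma (s + a * (2 * n + 2) - ((p : ℤ) : ℂ) * nuPM ν ν q)))

/-- The integral kernel `R_θ^{νν}(P₁, P₂; P₁', P₂')`. -/
noncomputable def Rker {d : ℕ} (ν θ : ℂ) (P₁ P₂ P₁' P₂' : Cone d) : ℂ :=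
  let a : ℂ := (alpha d : ℂ)
  let m : Cone d → Cone d → ℂ := fun P Q => ((mdot (P : Mink d) Q : ℝ) : ℂ)
  (((2 * Real.pi) ^ (-((d : ℝ) - 1)) : ℝ) : ℂ) *
    (Complex.Gamma (a - Complex.I * θ) ^ 2 / Complex.Gamma (Complex.I * θ) ^ 2) *
    (m P₁ P₂ ^ (-Complex.I * θ - Complex.I * ν) * m P₁ P₁' ^ (-a + Complex.I * θ) *
      m P₂ P₂' ^ (-a + Complex.I * θ) * m P₁' P₂' ^ (-Complex.I * θ + Complex.I * ν))

/-- The right hand side of the `R`-symmetry condition in the variables `i, j`: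
`∫∫ R_{θ_i-θ_j}(P_i, P_j; P', P'') Ψ(…, θ_j, P', …, θ_i, P'', …)`, for the rescaled function
`σ_{νν}(-αθ/π) R^{νν}_{-αθ/π}`, with the argument `θ` of the kernel shifted to `θ - iε`. -/
noncomputable def applyReg {d n : ℕ} (ν : ℂ) (i j : Fin n) (Ψ : Mom d n → ℂ) (y : Mom d n)
    (ε : ℝ) : ℂ :=
  let t : ℝ := -(alpha d / Real.pi) * ((y i).1 - (y j).1)
  crossFactor d ν t * ∫ p : Sph d × Sph d,
    Rker ν ((t : ℂ) - Complex.I * (ε : ℂ)) (y i).2 (y j).2 (basePt p.1) (basePt p.2) *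
      Ψ (Function.update (Function.update y i ((y j).1, basePt p.1)) j ((y i).1, basePt p.2))
    ∂(sphMeas d).prod (sphMeas d)

/-- `χ` is the image of `Ψ` under `R` acting on the variables `i, j`. The singular kernel is the
boundary value from `θ - iε`, `ε ↓ 0`; the null set `θ_i = θ_j` or `P_i ∥ P_j` is left out. -/
def IsImageR {d n : ℕ} (ν : ℂ) (i j : Fin n) (Ψ χ : Mom d n → ℂ) : Prop :=
  ∀ y : Mom d n, (y i).1 ≠ (y j).1 → mdot ((y i).2 : Mink d) (y j).2 ≠ 0 →
    Tendsto (applyReg ν i j Ψ y) (𝓝[>] 0) (𝓝 (χ y))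

/-- Smooth wave functions with compact support in the `θ`'s that vanish near `P_i ∥ P_j`. -/
def IsRegularAt {d n : ℕ} (i j : Fin n) (Ψ : Mom d n → ℂ) : Prop :=
  (∃ (U : Set (Fin n → ℝ × Mink d)) (G : (Fin n → ℝ × Mink d) → ℂ), IsOpen U ∧
    ContDiffOn ℝ (⊤ : ℕ∞) G U ∧ ∀ (θ : Fin n → ℝ) (p : Fin n → Sph d),
      (fun k => (θ k, (basePt (p k) : Mink d))) ∈ U ∧
      Ψ (fun k => (θ k, basePt (p k))) = G fun k => (θ k, (basePt (p k) : Mink d))) ∧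
  ∃ M δ : ℝ, 0 < δ ∧ ∀ (θ : Fin n → ℝ) (p : Fin n → Sph d), Ψ (fun k => (θ k, basePt (p k))) ≠ 0 →
    (∀ k, |θ k| ≤ M) ∧ δ ≤ mdot (basePt (p i) : Mink d) (basePt (p j))

/-- The vector `v` of `ℋ₁^{⊗ n}` is given by the function `χ`. -/
def Represents {d n : ℕ} {par : SeriesParam d} (v : NPart par n) (χ : Mom d n → ℂ) : Prop :=
  ∀ Φ : WaveFn par n,
    Integrable (fun y => (starRingEnd ℂ) (Φ.fn (leftMom y)) * χ (rightMom y))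
      (pairMomMeas d n par.ν) ∧
    inner ℂ (Φ : NPart par n) v = waveForm par.ν Φ.fn χ

/-- The span of the vectors `R_j Ψ - Ψ`, where `R_j` acts on the variables `j, j+1` and `Ψ` runs
through the regular wave functions. -/
noncomputable def defect {d : ℕ} (par : SeriesParam d) (n : ℕ) : Submodule ℂ (NPart par n) :=
  Submodule.span ℂ {w | ∃ (i j : Fin n) (Ψ : WaveFn par n) (χ : Mom d n → ℂ) (v : NPart par n),
    (j : ℕ) = i + 1 ∧ IsRegularAt i j Ψ.fn ∧ IsImageR par.ν i j Ψ.fn χ ∧ Represents v χ ∧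
      w = v - Ψ}

/-- The `R`-symmetric `n`-particle space `ℋ_n^R`. Each `R_j` is a unitary involution, hence
selfadjoint, so that `R_j Φ = Φ` means that `Φ` is orthogonal to all `R_j Ψ - Ψ`, with `Ψ` in a
dense set. -/
noncomputable def HR {d : ℕ} (par : SeriesParam d) (n : ℕ) : Submodule ℂ (NPart par n) := (defect par n)ᗮ

instance {d : ℕ} (par : SeriesParam d) (n : ℕ) : CompleteSpace (HR par n) :=
  (Submodule.isClosed_orthogonal (defect par n)).completeSpace_coe

/-- The `R`-symmetric Fock space `ℋ^R`. -/
abbrev Fock {d : ℕ} (par : SeriesParam d) : Type := lp (fun n => HR par n) 2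

/-- The vectors of finite particle number. -/
def finDom {d : ℕ} (par : SeriesParam d) : Submodule ℂ (Fock par) where
  carrier := {Ψ | {n | Ψ n ≠ 0}.Finite}
  add_mem' := fun {Ψ Φ} h k => (Set.Finite.union h k).subset fun n hn => by
    by_contra hc
    simp only [mem_union, mem_ofPred_eq, not_or, not_not] at hc
    exact hn (by rw [lp.coeFn_add, Pi.add_apply, hc.1, hc.2, add_zero])
  zero_mem' := by simp
  smul_mem' := fun c Ψ h => Set.Finite.subset h fun n hn hc =>
    hn (by rw [lp.coeFn_smul, Pi.smul_apply, hc, smul_zero])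

/-- The vector of finite particle number with given components. -/
def mkFin {d : ℕ} {par : SeriesParam d} (ψ : ∀ n, HR par n) (h : {n | ψ n ≠ 0}.Finite) :
    finDom par :=
  ⟨⟨ψ, (memℓp_zero h).of_exponent_ge zero_le⟩, h⟩

theorem finDom_ext {d : ℕ} {par : SeriesParam d} {Ψ Φ : finDom par}
    (h : ∀ n, (Ψ : Fock par) n = (Φ : Fock par) n) : Ψ = Φ :=
  Subtype.ext (lp.ext (funext h))

/-- `Ψ_n ↦ √(n+1) P^R_{n+1}(ξ ⊗ Ψ_n)`. -/
noncomputable def create {d : ℕ} {par : SeriesParam d} (ξ : WaveFn par 1) (n : ℕ) :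
    HR par n →L[ℂ] HR par (n + 1) :=
  ((√((n : ℝ) + 1) : ℝ) : ℂ) • ((HR par (n + 1)).orthogonalProjectionOnto ∘L
    tensorLeft ξ n ∘L (HR par n).subtypeL)

/-- The adjoint of `create`. -/
noncomputable def annih {d : ℕ} {par : SeriesParam d} (ξ : WaveFn par 1) (n : ℕ) :
    HR par (n + 1) →L[ℂ] HR par n := ContinuousLinearMap.adjoint (create ξ n)

/-- The components of `z_R^†(ξ)Ψ`. -/
noncomputable def zDagFun {d : ℕ} {par : SeriesParam d} (ξ : WaveFn par 1) (ψ : ∀ n, HR par n) :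
    ∀ n, HR par n
  | 0 => 0
  | n + 1 => create ξ n (ψ n)

/-- The creation operator `z_R^†(ξ)` on the vectors of finite particle number. -/
noncomputable def zDag {d : ℕ} {par : SeriesParam d} (ξ : WaveFn par 1) :
    finDom par →ₗ[ℂ] finDom par where
  toFun Ψ := mkFin (zDagFun ξ fun n => (Ψ : Fock par) n)
    ((Ψ.2.image Nat.succ).subset fun n hn => by
      rcases n with _ | n
      · exact absurd rfl hn
      · refine ⟨n, fun hc => hn ?_, rfl⟩
        simp only [zDagFun]
        rw [hc, map_zero])
  map_add' Ψ Φ := finDom_ext fun n => by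
    rcases n with _ | n
    · exact (add_zero _).symm
    · exact map_add (create ξ n) _ _
  map_smul' c Ψ := finDom_ext fun n => by
    rcases n with _ | n
    · exact (smul_zero c).symm
    · exact map_smul (create ξ n) _ _

/-- The annihilation operator `z_R(ξ)` on the vectors of finite particle number. -/
noncomputable def zAnn {d : ℕ} {par : SeriesParam d} (ξ : WaveFn par 1) :
    finDom par →ₗ[ℂ] finDom par where
  toFun Ψ := mkFin (fun n => annih ξ n ((Ψ : Fock par) (n + 1)))
    ((Set.Finite.preimage (Nat.succ_injective.injOn) Ψ.2).subset fun n hn hc => hn (by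
      rw [hc, map_zero]))
  map_add' Ψ Φ := finDom_ext fun n => map_add (annih ξ n) _ _
  map_smul' c Ψ := finDom_ext fun n => map_smul (annih ξ n) _ _

/-- The function `(a ⊗ b)(θ, P) = a(θ) b(P)`. -/
def oneFun {d : ℕ} (a : ℝ → ℂ) (b : Cone d → ℂ) : Mom d 1 → ℂ := fun y => a (y 0).1 * b (y 0).2

open Classical in
/-- The one-particle wave function `a ⊗ b`; the value `0` for functions that are not wave functions
is a convention. -/
noncomputable def onePart {d : ℕ} (par : SeriesParam d) (a : ℝ → ℂ) (b : Cone d → ℂ) :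
    WaveFn par 1 :=
  if h : IsWave par.ν (oneFun a b) then (⟨oneFun a b, h⟩ : waveSub d 1 par.ν) else 0

/-- `conj F_- : X ↦ conj (F(-X))`. -/
def conjNeg {d : ℕ} (F : dS d → ℂ) : dS d → ℂ := fun X => (starRingEnd ℂ) (F (dSneg X))

/-- The field `φ_R(f ⊗ F) = z_R^†(f^+ ⊗ F_ν^+) + z_R(conj f^- ⊗ (conj F_-)_ν^+)` on the vectors of
finite particle number. -/
noncomputable def field {d : ℕ} (par : SeriesParam d) (f : ℝ → ℂ) (F : dS d → ℂ) :
    finDom par →ₗ[ℂ] finDom par :=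
  zDag (onePart par (fPlus f) (fourierHelgason par.ν F)) +
    zAnn (onePart par (fun θ => (starRingEnd ℂ) (fMinus f θ))
      (fourierHelgason par.ν (conjNeg F)))

/-- The field as an unbounded operator on the Fock space. -/
noncomputable def fieldOp {d : ℕ} (par : SeriesParam d) (f : ℝ → ℂ) (F : dS d → ℂ) :
    Fock par →ₗ.[ℂ] Fock par :=
  ⟨finDom par, (finDom par).subtype ∘ₗ field par f F⟩

/-- The transforms that enter the field exist: the defining limit of `F_ν^+` exists, and
`f^+ ⊗ F_ν^+` and `conj f^- ⊗ F_ν^+` are one-particle wave functions. -/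
def FieldWellDefined {d : ℕ} (par : SeriesParam d) : Prop :=
  (∀ F ∈ TestFn d, ∀ P : Cone d,
    (∀ ε > 0, Integrable (fun X : dS d => F X * (((mdot (X : Mink d) P : ℝ) : ℂ) +
      Complex.I * ((ε * (P : Mink d) 0 : ℝ) : ℂ)) ^ deg d par.ν) (dSmeas d)) ∧
    Tendsto (fhReg par.ν F P) (𝓝[>] 0) (𝓝 (fourierHelgason par.ν F P))) ∧
  ∀ f : SchwartzMap ℝ ℂ, ∀ F ∈ TestFn d,
    IsWave par.ν (oneFun (fPlus f) (fourierHelgason par.ν F)) ∧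
    IsWave par.ν (oneFun (fun θ => (starRingEnd ℂ) (fMinus f θ)) (fourierHelgason par.ν F))

/-- `φ` is an operator-valued distribution on `𝓢(ℝ) × C_0^∞(dS_d)`, with the dense invariant domain
`D`: it is bilinear, and for every vector `Ψ ∈ D` and every compact `K ⊆ dS_d` the map
`(f, F) ↦ φ(f ⊗ F)Ψ` is bounded by a Schwartz seminorm of `f` times a `C^N`-norm of `F`, for `F`
supported in `K`. -/
def IsOperatorValuedDistribution {d : ℕ} {H : Type} [NormedAddCommGroup H] [InnerProductSpace ℂ H]
    (D : Submodule ℂ H) (φ : (ℝ → ℂ) → (dS d → ℂ) → (D →ₗ[ℂ] D)) : Prop :=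
  Dense (D : Set H) ∧
  (∃ B : SchwartzMap ℝ ℂ →ₗ[ℂ] TestFn d →ₗ[ℂ] (D →ₗ[ℂ] D), ∀ f F, B f F = φ f F) ∧
  ∀ (Ψ : D) (K : Set (dS d)), IsCompact K → ∃ (C : ℝ) (k l N : ℕ),
    ∀ (f : SchwartzMap ℝ ℂ), ∀ F ∈ TestFn d, tsupport F ⊆ K → ∀ A : ℝ, 0 ≤ A →
      (∀ j ≤ N, ∀ X ∈ K, ‖iteratedFDeriv ℝ j (hext F) (X : Mink d)‖ ≤ A) →
      ‖φ f F Ψ‖ ≤ C * ((Finset.Iic (k, l)).sup (schwartzSeminormFamily ℂ ℝ ℂ)) f * A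

/-! ### The Minkowski product -/

/-! Calculus on `dS_d` is done in the ambient space. Functions are extended with degree `0`, the
volume is the angular part of Lebesgue measure in polar coordinates (`measurePreserving_polar`), and
the derivative in a constant direction of a function of degree `-d` has integral `0` over `dS_d`
(`integral_dS_fderiv_eq_zero`). This yields integration by parts against the kernel `(X · P + iη)^s`
(`integral_dS_by_parts`).

Boundary values: let `I_s(F)` be the integral of `F (X · P + iη)^s`. Its derivative in `η` is `i s
I_{s-1}(F)`. The tangential time derivative of `X · P` equals `P₀ = 1` at the singularity `X · P =
0`, so that integration by parts gives `s I_{s-1}(F) = -I_s(DF) + iη s I_{s-1}(X₀ F)` with a first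
order operator `D` (`regInt_by_parts`). If `I_s` is of order `η^{-b}` and `s I_{s-1}` of order
`η^{-b-1}`, then `s I_{s-1}` is of order `η^{-b}`, and integrating in `η` makes `I_s` of order
`η^{-b+1}`. Finitely many rounds bring the derivative to the integrable order `η^{-1/2}`
(`hasRate_deriv_half`). Hence the limit exists for every exponent `s`, bounded by a `C^N` norm of
`F`, uniformly on the base (`exists_tendsto_regInt`). Together with the decay of `f^±` in both
directions of the rapidity, and the bound `√(n+1) ‖ξ‖` for the creation operator on `n` particles,
this makes the field an operator-valued distribution.

Klein-Gordon equation: one integration by parts turns `□F` into the derivative of `F` in the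
direction `P`, a second one, with `P · P = 0`, gives back `I_s(F)` times `s (s + d - 1)`, up to
terms of order `η`. For `s = -α - iν` this number is `-(α² + ν²)`, so both one-particle functions in
the field vanish (`fourierHelgason_kleinGordon`).

Covariance: `Λ` acts on the base by conformal maps, with factor `c(p) = (Λp)₀` and Jacobian
`c^{-(d-1)}` (`lintegral_sphAct`). The latter is the invariance of `dx/|x|` on the light cone, a
determinant computation. The homogeneity factors of two wave functions compensate exactly the change
of the inner product measure, so `V` is unitary on `ℋ₁^{⊗ n}` (`waveForm_act`). The kernel of `R` is
Lorentz invariant, and the integrand in `P', P''` has degree `-(d-1)` in each, so the regularized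
image under `R` is covariant before the limit (`applyReg_act`). Thus `V` permutes the generators of
`defect` and leaves its orthogonal complement `HR` invariant (`nActL_mem_HR`); of `R` only this
covariance is used. It follows that `V` commutes with the projections, and intertwines the operators
`z_R^†(ξ)` and `z_R(ξ)` with those of the transformed `ξ`. The transformation of the one-particle
functions is a change of variables (`actFun_oneFun`).

Neutrality: `conj f^- = (conj f)^+`, so passing to `conj f` and `conj F_-` exchanges the two
one-particle functions in the field, while `z_R(ξ)` is the adjoint of `z_R^†(ξ)` (`inner_field`). -/

theorem mdot_comm {d : ℕ} (X Y : Mink d) : mdot X Y = mdot Y X := by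
  simp only [mdot, mul_comm]

theorem mdot_add_left {d : ℕ} (X Y Z : Mink d) : mdot (X + Y) Z = mdot X Z + mdot Y Z := by
  simp only [mdot, Pi.add_apply, add_mul, Finset.sum_add_distrib]; ring

theorem mdot_smul_left {d : ℕ} (c : ℝ) (X Y : Mink d) : mdot (c • X) Y = c * mdot X Y := by
  simp only [mdot, Pi.smul_apply, smul_eq_mul, mul_sub, Finset.mul_sum, mul_assoc]

theorem mdot_smul_right {d : ℕ} (c : ℝ) (X Y : Mink d) : mdot X (c • Y) = c * mdot X Y := by
  rw [mdot_comm, mdot_smul_left, mdot_comm]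

theorem contDiff_mdot_left {d : ℕ} (P : Mink d) {n : WithTop ℕ∞} :
    ContDiff ℝ n (fun X : Mink d => mdot X P) := by
  unfold mdot; fun_prop

theorem contDiff_mdot_self {d : ℕ} {n : WithTop ℕ∞} :
    ContDiff ℝ n (fun X : Mink d => mdot X X) := by
  unfold mdot; fun_prop

theorem continuous_mdot_self {d : ℕ} : Continuous (fun X : Mink d => mdot X X) :=
  (contDiff_mdot_self (n := 0)).continuous

theorem continuous_mdot {d : ℕ} : Continuous (fun Z : Mink d × Mink d => mdot Z.1 Z.2) := by
  unfold mdot; fun_prop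

theorem hasFDerivAt_mdot_left {d : ℕ} (P X : Mink d) : ∃ L : Mink d →L[ℝ] ℝ,
    HasFDerivAt (fun X : Mink d => mdot X P) L X ∧ ∀ v, L v = mdot v P := by
  let l : Mink d →ₗ[ℝ] ℝ :=
    { toFun := fun X => mdot X P
      map_add' := fun X Y => mdot_add_left X Y P
      map_smul' := fun c X => mdot_smul_left c X P }
  exact ⟨LinearMap.toContinuousLinearMap l, (LinearMap.toContinuousLinearMap l).hasFDerivAt,
    fun v => rfl⟩

theorem hasFDerivAt_mdot_self {d : ℕ} (X : Mink d) : ∃ L : Mink d →L[ℝ] ℝ,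
    HasFDerivAt (fun X : Mink d => mdot X X) L X ∧ ∀ v, L v = 2 * mdot X v := by
  have h0 := hasFDerivAt_apply (𝕜 := ℝ) (0 : Fin (d + 1)) X
  have hs := fun i : Fin d => hasFDerivAt_apply (𝕜 := ℝ) i.succ X
  refine ⟨_, (h0.mul h0).sub (HasFDerivAt.fun_sum (u := Finset.univ)
    fun i _ => (hs i).mul (hs i)), fun v => ?_⟩
  simp only [mdot, sub_apply, add_apply,
    smul_apply, ContinuousLinearMap.proj_apply, smul_eq_mul,
    sum_apply, Finset.sum_add_distrib]
  ring

/-! ### Polar coordinates on the spacelike vectors and the volume of de Sitter space. -/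

/-- The space of spacelike vectors. -/
abbrev Spacelike (d : ℕ) : Type := {X : Mink d // mdot X X < 0}

theorem isOpen_spacelike {d : ℕ} : IsOpen {X : Mink d | mdot X X < 0} :=
  isOpen_lt continuous_mdot_self continuous_const

/-- The spacelike radius `√(-X·X)`. -/
noncomputable def rad {d : ℕ} (X : Mink d) : ℝ := √(-mdot X X)

theorem rad_pos {d : ℕ} {X : Mink d} (h : mdot X X < 0) : 0 < rad X :=
  Real.sqrt_pos.mpr (neg_pos.mpr h)

theorem continuous_rad {d : ℕ} : Continuous (rad : Mink d → ℝ) := by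
  unfold rad; exact continuous_mdot_self.neg.sqrt

theorem rad_smul {d : ℕ} {c : ℝ} (hc : 0 < c) (X : Mink d) : rad (c • X) = c * rad X := by
  unfold rad
  rw [mdot_smul_smul, ← mul_neg, Real.sqrt_mul (sq_nonneg c), Real.sqrt_sq hc.le]

theorem rad_dS {d : ℕ} (X : dS d) : rad (X : Mink d) = 1 := by
  have : mdot (X : Mink d) X = -1 := X.2
  simp [rad, this]

theorem spacelike_dS {d : ℕ} (X : dS d) : mdot (X : Mink d) X < 0 := by
  have : mdot (X : Mink d) X = -1 := X.2
  rw [this]; norm_num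

theorem spacelike_smul {d : ℕ} {c : ℝ} (hc : 0 < c) {X : Mink d} (h : mdot X X < 0) :
    mdot (c • X) (c • X) < 0 := by
  rw [mdot_smul_smul]; exact mul_neg_of_pos_of_neg (by positivity) h

theorem dSproj_coe {d : ℕ} (X : Spacelike d) :
    (dSproj X : Mink d) = (rad X.1)⁻¹ • X.1 := rfl

theorem dSproj_smul {d : ℕ} {c : ℝ} (hc : 0 < c) (X : Spacelike d) :
    dSproj ⟨c • X.1, spacelike_smul hc X.2⟩ = dSproj X := by
  apply Subtype.ext
  rw [dSproj_coe, dSproj_coe, rad_smul hc, smul_smul, mul_inv, mul_assoc,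
    mul_comm (rad X.1)⁻¹ c, inv_mul_cancel_left₀ hc.ne']

theorem dSproj_dS {d : ℕ} (X : dS d) : dSproj ⟨X, spacelike_dS X⟩ = X := by
  apply Subtype.ext
  rw [dSproj_coe, rad_dS, inv_one, one_smul]

theorem continuous_dSproj {d : ℕ} : Continuous (dSproj : Spacelike d → dS d) := by
  refine Continuous.subtype_mk ?_ _
  exact ((continuous_rad.comp continuous_subtype_val).inv₀
    fun X => (rad_pos X.2).ne').smul continuous_subtype_val

theorem isClosed_dS {d : ℕ} : IsClosed (dS d) := isClosed_eq continuous_mdot_self continuous_const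

instance {d : ℕ} : LocallyCompactSpace (dS d) := isClosed_dS.isClosedEmbedding_subtypeVal.locallyCompactSpace

/-- Polar coordinates `X ↦ (X / r, r)` on the space of spacelike vectors. -/
noncomputable def polar (d : ℕ) : Spacelike d ≃ₜ dS d × Ioi (0 : ℝ) where
  toFun X := (dSproj X, ⟨rad X.1, rad_pos X.2⟩)
  invFun Z := ⟨Z.2.1 • Z.1.1, spacelike_smul Z.2.2 (spacelike_dS Z.1)⟩
  left_inv X := by
    apply Subtype.ext
    change rad X.1 • (dSproj X : Mink d) = X.1
    rw [dSproj_coe, smul_inv_smul₀ (rad_pos X.2).ne']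
  right_inv Z := by
    refine Prod.ext ?_ (Subtype.ext ?_)
    · exact (dSproj_smul Z.2.2 ⟨Z.1.1, spacelike_dS Z.1⟩).trans (dSproj_dS Z.1)
    · change rad (Z.2.1 • (Z.1 : Mink d)) = Z.2.1
      rw [rad_smul Z.2.2, rad_dS, mul_one]
  continuous_toFun := continuous_dSproj.prodMk
    ((continuous_rad.comp continuous_subtype_val).subtype_mk _)
  continuous_invFun := by fun_prop

theorem rad_lt_one_iff {d : ℕ} (X : Mink d) : rad X < 1 ↔ -1 < mdot X X := by
  rw [rad, Real.sqrt_lt' one_pos]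
  constructor <;> intro h <;> linarith

/-- The part of the cone over `A ⊆ dS_d` of radius less than `ρ`. -/
def sector {d : ℕ} (A : Set (dS d)) (ρ : ℝ) : Set (Mink d) :=
  Subtype.val '' {X : Spacelike d | dSproj X ∈ A ∧ rad X.1 < ρ}

theorem sector_eq_preimage {d : ℕ} (A : Set (dS d)) {ρ : ℝ} (hρ : 0 < ρ) :
    sector A ρ = (fun X => ρ⁻¹ • X) ⁻¹' sector A 1 := by
  ext X
  simp only [sector, mem_image, mem_preimage, mem_ofPred_eq]
  constructor
  · rintro ⟨Y, ⟨h1, h2⟩, rfl⟩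
    refine ⟨⟨ρ⁻¹ • Y.1, spacelike_smul (inv_pos.mpr hρ) Y.2⟩, ⟨?_, ?_⟩, rfl⟩
    · rwa [dSproj_smul (inv_pos.mpr hρ)]
    · rw [rad_smul (inv_pos.mpr hρ), inv_mul_lt_iff₀ hρ, mul_one]; exact h2
  · rintro ⟨Y, ⟨h1, h2⟩, h⟩
    have hX : X = ρ • Y.1 := by rw [h, smul_inv_smul₀ hρ.ne']
    refine ⟨⟨ρ • Y.1, spacelike_smul hρ Y.2⟩, ⟨?_, ?_⟩, hX.symm⟩
    · rwa [dSproj_smul hρ]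
    · rw [rad_smul hρ]; nlinarith

theorem volume_sector {d : ℕ} (A : Set (dS d)) {ρ : ℝ} (hρ : 0 < ρ) :
    volume (sector A ρ) = ENNReal.ofReal (ρ ^ (d + 1)) * volume (sector A 1) := by
  rw [sector_eq_preimage A hρ, Measure.addHaar_preimage_smul _ (inv_pos.mpr hρ).ne']
  congr 2
  rw [inv_pow, inv_inv, abs_of_pos (by simp; positivity)]
  simp

theorem measurableSet_spacelike {d : ℕ} : MeasurableSet {X : Mink d | mdot X X < 0} :=
  isOpen_spacelike.measurableSet

theorem dSmeas_apply {d : ℕ} {A : Set (dS d)} (hA : MeasurableSet A) :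
    dSmeas d A = ((d + 1 : ℕ) : ENNReal) * volume (sector A 1) := by
  have hA' : MeasurableSet (dSproj ⁻¹' A) := continuous_dSproj.measurable hA
  rw [dSmeas, Measure.smul_apply, Measure.map_apply continuous_dSproj.measurable hA,
    Measure.restrict_apply hA', comap_subtype_coe_apply measurableSet_spacelike, smul_eq_mul]
  congr 3
  ext X
  simp [rad_lt_one_iff]

/-- The truncated cone over a compact `K` lies in the image of `[0, 1] × K` under scaling, which is
compact. -/
instance {d : ℕ} : IsFiniteMeasureOnCompacts (dSmeas d) where
  lt_top_of_isCompact K hK := by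
    rw [dSmeas_apply hK.measurableSet]
    refine ENNReal.mul_lt_top (by simp) ?_
    have h1 : IsCompact ((fun z : ℝ × dS d => z.1 • (z.2 : Mink d)) '' (Icc 0 1 ×ˢ K)) :=
      (isCompact_Icc.prod hK).image (by fun_prop)
    refine lt_of_le_of_lt (measure_mono ?_) h1.measure_lt_top
    rintro _ ⟨X, ⟨hX, hr⟩, rfl⟩
    refine ⟨(rad X.1, dSproj X), ⟨⟨(rad_pos X.2).le, hr.le⟩, hX⟩, ?_⟩
    change rad X.1 • (dSproj X : Mink d) = X.1
    rw [dSproj_coe, smul_inv_smul₀ (rad_pos X.2).ne']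

/-- As for the Euclidean sphere, it suffices to compare the measures on the products of `s` with an
interval `(0, ρ)`. There the claim is the scaling law `volume_sector`: the factor `d + 1` in
`dSmeas` cancels the denominator of `ρ^(d+1) / (d+1)`. -/
theorem measurePreserving_polar (d : ℕ) :
    MeasurePreserving (polar d) ((volume : Measure (Mink d)).comap Subtype.val)
      ((dSmeas d).prod (Measure.volumeIoiPow d)) := by
  refine ⟨(polar d).measurable, .symm ?_⟩
  refine Measure.prod_eq_generateFrom MeasurableSpace.generateFrom_measurableSet
    ((borel_eq_generateFrom_Iio _).symm.trans BorelSpace.measurable_eq.symm)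
    MeasurableSpace.isPiSystem_measurableSet isPiSystem_Iio
    (dSmeas d).toFiniteSpanningSetsIn (Measure.finiteSpanningSetsIn_volumeIoiPow_range_Iio _)
    fun s hs ↦ forall_mem_range.2 fun ρ ↦ ?_
  rw [(polar d).measurableEmbedding.map_apply, comap_subtype_coe_apply measurableSet_spacelike]
  change volume (sector s ρ.1) = _
  rw [volume_sector s ρ.2, dSmeas_apply hs, Measure.volumeIoiPow_apply_Iio, mul_comm,
    mul_comm (((d + 1 : ℕ) : ENNReal)), mul_assoc]
  congr 1
  rw [← ENNReal.ofReal_natCast, ← ENNReal.ofReal_mul (by positivity)]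
  congr 1
  push_cast
  field_simp

/-! ### The divergence theorem on de Sitter space, by homogeneous functions on the ambient space. -/

theorem hasFDerivAt_rad {d : ℕ} {X : Mink d} (hX : mdot X X < 0) : ∃ L : Mink d →L[ℝ] ℝ,
    HasFDerivAt rad L X ∧ ∀ v, L v = -(mdot X v) / rad X := by
  obtain ⟨L, hL, hLv⟩ := hasFDerivAt_mdot_self X
  refine ⟨_, hL.neg.sqrt (neg_pos.mpr hX).ne', fun v => ?_⟩
  have := (rad_pos hX).ne'
  simp only [smul_apply, neg_apply, hLv, smul_eq_mul]
  change 1 / (2 * rad X) * _ = _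
  field_simp

theorem contDiffAt_rad {d : ℕ} {X : Mink d} (hX : mdot X X < 0) {n : WithTop ℕ∞} :
    ContDiffAt ℝ n rad X :=
  (contDiff_mdot_self.contDiffAt.neg).sqrt (neg_pos.mpr hX).ne'

theorem contDiffOn_rad {d : ℕ} {n : WithTop ℕ∞} :
    ContDiffOn ℝ n rad {X : Mink d | mdot X X < 0} :=
  fun _ hX => (contDiffAt_rad hX).contDiffWithinAt

theorem integral_volumeIoiPow (n : ℕ) (h : ℝ → ℂ) :
    ∫ ρ : Ioi (0 : ℝ), h ρ ∂Measure.volumeIoiPow n = ∫ ρ in Ioi (0 : ℝ), (ρ : ℂ) ^ n * h ρ := by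
  simp only [Measure.volumeIoiPow, ENNReal.ofReal]
  rw [integral_withDensity_eq_integral_smul,
    integral_subtype_comap measurableSet_Ioi fun a ↦ Real.toNNReal (a ^ n) • h a,
    setIntegral_congr_fun measurableSet_Ioi fun x hx ↦ ?_]
  · simp only [NNReal.smul_def, Real.coe_toNNReal _ (pow_nonneg (le_of_lt hx.out) _), Complex.real_smul,
      Complex.ofReal_pow]
  · exact (measurable_subtype_coe.pow_const _).real_toNNReal

/-- The integral of a homogeneous function times a function of the radius. -/
theorem integral_spacelike_homogeneous {d : ℕ} (φ : ℝ → ℂ) (g : Mink d → ℂ) (k : ℤ)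
    (hg : ∀ c : ℝ, 0 < c → ∀ X, mdot X X < 0 → g (c • X) = (c : ℂ) ^ k * g X) :
    ∫ X in {X : Mink d | mdot X X < 0}, φ (rad X) * g X =
      (∫ X : dS d, g X ∂dSmeas d) * ∫ ρ in Ioi (0 : ℝ), (ρ : ℂ) ^ d * (φ ρ * (ρ : ℂ) ^ k) := by
  rw [← integral_volumeIoiPow d (fun ρ => φ ρ * (ρ : ℂ) ^ k), ← integral_prod_mul,
    ← (measurePreserving_polar d).integral_comp (polar d).measurableEmbedding,
    ← integral_subtype_comap measurableSet_spacelike]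
  refine integral_congr_ae (Eventually.of_forall fun X => ?_)
  change φ (rad X.1) * g X.1 = g (dSproj X : Mink d) * (φ (rad X.1) * ((rad X.1 : ℝ) : ℂ) ^ k)
  have h1 : X.1 = rad X.1 • (dSproj X : Mink d) := by
    rw [dSproj_coe, smul_inv_smul₀ (rad_pos X.2).ne']
  have h2 := hg (rad X.1) (rad_pos X.2) (dSproj X : Mink d) (spacelike_dS _)
  rw [← h1] at h2
  rw [h2]; ring

theorem fderiv_comp_smul_of_homogeneous {d : ℕ} {w : Mink d → ℂ} {c : ℝ} {C : ℂ}
    (hw : ∀ X, mdot X X < 0 → w (c • X) = C * w X) {X : Mink d} (hX : mdot X X < 0)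
    (hdX : DifferentiableAt ℝ w X) (v : Mink d) :
    (c : ℂ) * fderiv ℝ w (c • X) v = C * fderiv ℝ w X v := by
  have h1 : (fun Y => w (c • Y)) =ᶠ[𝓝 X] fun Y => C * w Y := by
    filter_upwards [isOpen_spacelike.mem_nhds hX] with Y hY using hw Y hY
  have h2 := h1.fderiv_eq (𝕜 := ℝ)
  rw [fderiv_const_mul hdX, fderiv_comp_smul (𝕜 := ℝ)] at h2
  have h3 := congrArg (fun L : Mink d →L[ℝ] ℂ => L v) h2
  simpa using h3

/-- The cone over a compact subset of `dS_d`, cut off in the radius. -/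
theorem isCompact_truncCone {d : ℕ} {K : Set (dS d)} (hK : IsCompact K) (a b : ℝ) :
    IsCompact ((fun z : ℝ × dS d => z.1 • (z.2 : Mink d)) '' (Icc a b ×ˢ K)) :=
  (isCompact_Icc.prod hK).image (by fun_prop)

theorem truncCone_subset {d : ℕ} {K : Set (dS d)} {a b : ℝ} (ha : 0 < a) :
    ((fun z : ℝ × dS d => z.1 • (z.2 : Mink d)) '' (Icc a b ×ˢ K)) ⊆ {X | mdot X X < 0} := by
  rintro _ ⟨z, hz, rfl⟩
  exact spacelike_smul (ha.trans_le hz.1.1) (spacelike_dS z.2)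

theorem mem_truncCone {d : ℕ} {K : Set (dS d)} {a b : ℝ} (X : Spacelike d) (hK : dSproj X ∈ K)
    (hr : rad X.1 ∈ Icc a b) :
    X.1 ∈ ((fun z : ℝ × dS d => z.1 • (z.2 : Mink d)) '' (Icc a b ×ˢ K)) := by
  refine ⟨(rad X.1, dSproj X), ⟨hr, hK⟩, ?_⟩
  change rad X.1 • (dSproj X : Mink d) = X.1
  rw [dSproj_coe, smul_inv_smul₀ (rad_pos X.2).ne']

/-- The integrand lives on the cone over `K` with radii in `[a, b]`. This set is compact and, as `0
< a`, stays inside the open set of spacelike vectors, where the integrand is continuous. -/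
theorem integrableOn_spacelike {d : ℕ} {K : Set (dS d)} (hK : IsCompact K) {a b : ℝ} (ha : 0 < a)
    {φ : ℝ → ℂ} (hφ : Continuous φ) (hφ0 : ∀ ρ, ρ ∉ Icc a b → φ ρ = 0) {g : Mink d → ℂ}
    (hg : ContinuousOn g {X | mdot X X < 0})
    (hg0 : ∀ X : Spacelike d, dSproj X ∉ K → g X.1 = 0) :
    IntegrableOn (fun X => φ (rad X) * g X) {X : Mink d | mdot X X < 0} := by
  set S := ((fun z : ℝ × dS d => z.1 • (z.2 : Mink d)) '' (Icc a b ×ˢ K))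
  have hS : IsCompact S := isCompact_truncCone hK a b
  have hSs : S ⊆ {X | mdot X X < 0} := truncCone_subset ha
  have h1 : IntegrableOn (fun X => φ (rad X) * g X) S :=
    (((hφ.comp continuous_rad).continuousOn.mul (hg.mono hSs))).integrableOn_compact hS
  refine h1.of_forall_sdiff_eq_zero measurableSet_spacelike fun X hX => ?_
  by_cases hr : rad X ∈ Icc a b
  · rw [hg0 ⟨X, hX.1⟩ fun h => hX.2 (mem_truncCone ⟨X, hX.1⟩ h hr), mul_zero]
  · rw [hφ0 _ hr, zero_mul]

/-- The derivative in a constant direction of a function of degree `-d` has integral `0`. -/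
theorem integral_dS_fderiv_eq_zero {d : ℕ} {w : Mink d → ℂ}
    (hw : ContDiffOn ℝ 1 w {X | mdot X X < 0})
    (hh : ∀ c : ℝ, 0 < c → ∀ X, mdot X X < 0 → w (c • X) = (c : ℂ) ^ (-(d : ℤ)) * w X)
    {K : Set (dS d)} (hK : IsCompact K) (h0 : ∀ X : Spacelike d, dSproj X ∉ K → w X.1 = 0)
    (v : Mink d) : ∫ X : dS d, fderiv ℝ w X v ∂dSmeas d = 0 := by
  -- The radial cutoff is `φ ρ = ρ b(ρ)`, supported in `[1, 3]`. With `w` of degree `-d` and the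
  -- volume factor `ρ^d`, the radial integral next to the derivative of `w` is that of `φ ρ / ρ =
  -- b(ρ)`, which is positive, and the one that comes from differentiating the cutoff is that of
  -- `φ'`, which is `0`.
  let b : ContDiffBump (2 : ℝ) := ⟨1 / 2, 1, by norm_num, by norm_num⟩
  let φ : ℝ → ℝ := fun ρ => ρ * b ρ
  have hφ : ContDiff ℝ 1 φ := contDiff_id.mul b.contDiff
  have hb0 : ∀ ρ, ρ ∉ Icc (1 : ℝ) 3 → b ρ = 0 := fun ρ hρ => by
    refine b.zero_of_le_dist ?_
    by_contra hc
    apply hρ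
    rw [Real.dist_eq] at hc
    have := abs_lt.mp (not_le.mp hc)
    simp only [b] at this
    constructor <;> linarith
  have hφ0 : ∀ ρ, ρ ∉ Icc (1 : ℝ) 3 → φ ρ = 0 := fun ρ hρ => by simp [φ, hb0 ρ hρ]
  have hφ'0 : ∀ ρ, ρ ∉ Icc (1 : ℝ) 3 → deriv φ ρ = 0 := fun ρ hρ => by
    have : φ =ᶠ[𝓝 ρ] fun _ => 0 := by
      filter_upwards [isClosed_Icc.isOpen_compl.mem_nhds hρ] with x hx using hφ0 x hx
    rw [this.deriv_eq, deriv_const]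
  have hφs : HasCompactSupport φ := HasCompactSupport.intro isCompact_Icc hφ0
  have hφ'c : Continuous (deriv φ) := hφ.continuous_deriv le_rfl
  set S := ((fun z : ℝ × dS d => z.1 • (z.2 : Mink d)) '' (Icc 1 3 ×ˢ K)) with hSdef
  have hS : IsCompact S := isCompact_truncCone hK 1 3
  have hSs : S ⊆ {X | mdot X X < 0} := truncCone_subset one_pos
  let Ω : Set (Mink d) := {X | mdot X X < 0}
  -- Cut off in the radius, `w` extends by zero to a `C¹` function with compact support on the whole
  -- space, so its derivative has integral `0` there.
  let W : Mink d → ℂ := Ω.indicator fun X => (φ (rad X) : ℂ) * w X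
  have hW0 : ∀ X, X ∉ S → W X = 0 := by
    intro X hX
    by_cases hXΩ : X ∈ Ω
    · simp only [W, indicator_of_mem hXΩ]
      by_cases hr : rad X ∈ Icc (1 : ℝ) 3
      · rw [h0 ⟨X, hXΩ⟩ fun h => hX (mem_truncCone ⟨X, hXΩ⟩ h hr), mul_zero]
      · rw [hφ0 _ hr, Complex.ofReal_zero, zero_mul]
    · simp [W, indicator_of_notMem hXΩ]
  have hWΩ : ∀ X ∈ Ω, W =ᶠ[𝓝 X] fun X => (φ (rad X) : ℂ) * w X := fun X hX => by
    filter_upwards [isOpen_spacelike.mem_nhds hX] with Y hY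
    exact indicator_of_mem (s := Ω) hY _
  have hWc : ContDiff ℝ 1 W := by
    rw [contDiff_iff_contDiffAt]
    intro X
    by_cases hX : X ∈ S
    · have hXΩ : X ∈ Ω := hSs hX
      refine ContDiffAt.congr_of_eventuallyEq ?_ (hWΩ X hXΩ)
      refine ContDiffAt.mul ?_ ((hw X hXΩ).contDiffAt (isOpen_spacelike.mem_nhds hXΩ))
      exact Complex.ofRealCLM.contDiff.contDiffAt.comp X
        ((hφ.contDiffAt).comp X (contDiffAt_rad hXΩ))
    · have : W =ᶠ[𝓝 X] fun _ => 0 := by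
        filter_upwards [hS.isClosed.isOpen_compl.mem_nhds hX] with Y hY using hW0 Y hY
      exact contDiffAt_const.congr_of_eventuallyEq this
  have hWs : HasCompactSupport W := HasCompactSupport.intro hS hW0
  have hW's : HasCompactSupport (fun X => fderiv ℝ W X v) :=
    (hWs.fderiv (𝕜 := ℝ)).comp_left (g := fun L : Mink d →L[ℝ] ℂ => L v) (by simp)
  have hW'c : Continuous (fun X => fderiv ℝ W X v) :=
    (hWc.continuous_fderiv one_ne_zero).clm_apply continuous_const
  have hint : ∫ X, fderiv ℝ W X v = 0 := by
    have h := integral_mul_fderiv_eq_neg_fderiv_mul_of_integrable (μ := (volume : Measure (Mink d)))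
      (f := fun _ => (1 : ℂ)) (g := W) (v := v) (by simp)
      (by simpa using hW'c.integrable_of_hasCompactSupport hW's)
      (by simpa using hWc.continuous.integrable_of_hasCompactSupport hWs)
      (fun _ _ => differentiableAt_const _) (fun X _ => (hWc.differentiable one_ne_zero) X)
    simpa using h
  have hwd : ∀ X ∈ Ω, DifferentiableAt ℝ w X := fun X hX =>
    ((hw X hX).contDiffAt (isOpen_spacelike.mem_nhds hX)).differentiableAt one_ne_zero
  -- The derivative of `rad` in the direction `v` is `-(X · v) / rad`, of degree `0`; hence `G` has
  -- the degree `-d` of `w`.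
  let G : Mink d → ℂ := fun X => ((-(mdot X v) / rad X : ℝ) : ℂ) * w X
  have hderiv : ∀ X ∈ Ω, fderiv ℝ W X v =
      (φ (rad X) : ℂ) * fderiv ℝ w X v + ((deriv φ (rad X) : ℝ) : ℂ) * G X := by
    intro X hX
    rw [(hWΩ X hX).fderiv_eq]
    obtain ⟨L, hL, hLv⟩ := hasFDerivAt_rad hX
    have h1 : HasFDerivAt (fun X => ((φ (rad X) : ℝ) : ℂ))
        (Complex.ofRealCLM.comp (deriv φ (rad X) • L)) X :=
      Complex.ofRealCLM.hasFDerivAt.comp X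
        (((hφ.differentiable one_ne_zero) (rad X)).hasDerivAt.comp_hasFDerivAt X hL)
    rw [HasFDerivAt.fderiv (h1.fun_mul (hwd X hX).hasFDerivAt)]
    simp only [add_apply, smul_apply, ContinuousLinearMap.comp_apply,
      hLv, smul_eq_mul, Complex.ofRealCLM_apply, G]
    push_cast
    ring
  have hout : ∀ X, X ∉ Ω → fderiv ℝ W X v = 0 := fun X hX => by
    have : W =ᶠ[𝓝 X] fun _ => 0 := by
      filter_upwards [hS.isClosed.isOpen_compl.mem_nhds fun h => hX (hSs h)] with Y hY using hW0 Y hY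
    rw [this.fderiv_eq]; simp
  have hsplit : ∫ X in Ω, ((φ (rad X) : ℂ) * fderiv ℝ w X v +
      ((deriv φ (rad X) : ℝ) : ℂ) * G X) = 0 := by
    rw [← hint, ← setIntegral_eq_integral_of_forall_compl_eq_zero hout]
    exact setIntegral_congr_fun measurableSet_spacelike fun X hX => (hderiv X hX).symm
  have hw' : ContinuousOn (fun X => fderiv ℝ w X v) Ω :=
    (hw.continuousOn_fderiv_of_isOpen isOpen_spacelike le_rfl).clm_apply continuousOn_const
  have hGc : ContinuousOn G Ω := by
    refine ContinuousOn.mul ?_ hw.continuousOn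
    refine Complex.continuous_ofReal.comp_continuousOn ?_
    refine ContinuousOn.div ?_ continuous_rad.continuousOn fun X hX => (rad_pos hX).ne'
    exact (continuous_mdot.comp (continuous_id.prodMk continuous_const)).neg.continuousOn
  have hw'0 : ∀ X : Spacelike d, dSproj X ∉ K → fderiv ℝ w X.1 v = 0 := by
    intro X hX
    have : w =ᶠ[𝓝 X.1] fun _ => 0 := by
      have h1 : {Y : Spacelike d | dSproj Y ∉ K} ∈ 𝓝 X :=
        (hK.isClosed.isOpen_compl.preimage continuous_dSproj).mem_nhds hX
      have h2 := (isOpen_spacelike.isOpenEmbedding_subtypeVal.image_mem_nhds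
        (x := X)).mpr h1
      filter_upwards [h2] with Y hY
      obtain ⟨Z, hZ, rfl⟩ := hY
      exact h0 Z hZ
    rw [this.fderiv_eq]; simp
  have hφC : Continuous fun ρ => (φ ρ : ℂ) := Complex.continuous_ofReal.comp hφ.continuous
  have hφ'C : Continuous fun ρ => ((deriv φ ρ : ℝ) : ℂ) := Complex.continuous_ofReal.comp hφ'c
  rw [integral_add
    (integrableOn_spacelike hK (a := 1) (b := 3) one_pos (φ := fun ρ => (φ ρ : ℂ)) hφC
      (fun ρ hρ => by simp [hφ0 ρ hρ]) hw' hw'0)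
    (integrableOn_spacelike hK (a := 1) (b := 3) one_pos (φ := fun ρ => ((deriv φ ρ : ℝ) : ℂ)) hφ'C
      (fun ρ hρ => by simp [hφ'0 ρ hρ]) hGc (fun X hX => by simp [G, h0 X hX])),
    integral_spacelike_homogeneous (fun ρ => (φ ρ : ℂ)) (fun X => fderiv ℝ w X v) (-(d : ℤ) - 1) ?_,
    integral_spacelike_homogeneous (fun ρ => ((deriv φ ρ : ℝ) : ℂ)) G (-(d : ℤ)) ?_] at hsplit
  · have e1 : ∫ ρ in Ioi (0 : ℝ), (ρ : ℂ) ^ d * (((deriv φ ρ : ℝ) : ℂ) * (ρ : ℂ) ^ (-(d : ℤ))) = 0 := by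
      have : ∀ ρ ∈ Ioi (0 : ℝ), (ρ : ℂ) ^ d * (((deriv φ ρ : ℝ) : ℂ) * (ρ : ℂ) ^ (-(d : ℤ))) =
          ((deriv φ ρ : ℝ) : ℂ) := fun ρ hρ => by
        have : (ρ : ℂ) ≠ 0 := by exact_mod_cast (ne_of_gt hρ)
        rw [zpow_neg, zpow_natCast]; field_simp
      rw [setIntegral_congr_fun measurableSet_Ioi this, integral_complex_ofReal,
        hφs.integral_Ioi_deriv_eq hφ]
      simp [φ]
    have e2 : ∫ ρ in Ioi (0 : ℝ), (ρ : ℂ) ^ d * ((φ ρ : ℂ) * (ρ : ℂ) ^ (-(d : ℤ) - 1)) ≠ 0 := by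
      have : ∀ ρ ∈ Ioi (0 : ℝ), (ρ : ℂ) ^ d * ((φ ρ : ℂ) * (ρ : ℂ) ^ (-(d : ℤ) - 1)) =
          ((b ρ : ℝ) : ℂ) := fun ρ hρ => by
        have : (ρ : ℂ) ≠ 0 := by exact_mod_cast (ne_of_gt hρ)
        rw [zpow_sub₀ this, zpow_neg, zpow_natCast, zpow_one]
        simp only [φ]
        push_cast
        field_simp
      rw [setIntegral_congr_fun measurableSet_Ioi this, integral_complex_ofReal,
        setIntegral_eq_integral_of_forall_compl_eq_zero (s := Ioi (0 : ℝ))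
          (fun ρ hρ => hb0 ρ fun h => hρ (lt_of_lt_of_le one_pos h.1))]
      exact_mod_cast (b.integral_pos (μ := volume)).ne'
    rw [e1, mul_zero, add_zero] at hsplit
    exact (mul_eq_zero.mp hsplit).resolve_right e2
  · intro c hc X hX
    have hc' : (c : ℂ) ≠ 0 := by exact_mod_cast hc.ne'
    simp only [G]
    rw [hh c hc X hX, rad_smul hc, mdot_smul_left, ← mul_neg, mul_div_mul_left _ _ hc.ne']
    ring
  · intro c hc X hX
    have hc' : (c : ℂ) ≠ 0 := by exact_mod_cast hc.ne'
    have := fderiv_comp_smul_of_homogeneous (hh c hc) hX (hwd X hX) v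
    rw [zpow_sub₀ hc', zpow_one, div_mul_eq_mul_div, ← this]
    field_simp

/-! ### Test functions on de Sitter space -/

theorem hext_apply {d : ℕ} (F : dS d → ℂ) (X : Spacelike d) : hext F X.1 = F (dSproj X) := by
  simp [hext, X.2]

theorem hext_dS {d : ℕ} (F : dS d → ℂ) (X : dS d) : hext F (X : Mink d) = F X := by
  rw [hext_apply F ⟨X, spacelike_dS X⟩, dSproj_dS]

theorem hext_smul {d : ℕ} (F : dS d → ℂ) {c : ℝ} (hc : 0 < c) {X : Mink d} (hX : mdot X X < 0) :
    hext F (c • X) = hext F X := by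
  rw [hext_apply F ⟨_, spacelike_smul hc hX⟩, hext_apply F ⟨X, hX⟩]
  exact congrArg F (dSproj_smul hc ⟨X, hX⟩)

/-- A function of degree `0` is determined by its values on `dS_d`. Homogeneous extensions are
computed by guessing them and checking the degree. -/
theorem hext_eq_of {d : ℕ} (F : dS d → ℂ) {G : Mink d → ℂ} (h1 : ∀ X : dS d, G X = F X)
    (h2 : ∀ c : ℝ, 0 < c → ∀ X, mdot X X < 0 → G (c • X) = G X) {X : Mink d} (hX : mdot X X < 0) :
    hext F X = G X := by
  rw [hext_apply F ⟨X, hX⟩, ← h1, dSproj_coe, h2 _ (inv_pos.mpr (rad_pos hX)) _ hX]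

theorem TestFn.contDiffAt {d : ℕ} {F : dS d → ℂ} (hF : F ∈ TestFn d) {X : Mink d}
    (hX : mdot X X < 0) : ContDiffAt ℝ (⊤ : ℕ∞) (hext F) X :=
  (hF.1 X hX).contDiffAt (isOpen_spacelike.mem_nhds hX)

theorem TestFn.differentiableAt {d : ℕ} {F : dS d → ℂ} (hF : F ∈ TestFn d) {X : Mink d}
    (hX : mdot X X < 0) : DifferentiableAt ℝ (hext F) X :=
  (TestFn.contDiffAt hF hX).differentiableAt (by simp)

theorem TestFn.continuous {d : ℕ} {F : dS d → ℂ} (hF : F ∈ TestFn d) : Continuous F := by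
  have h : F = fun X : dS d => hext F (X : Mink d) := funext fun X => (hext_dS F X).symm
  rw [h, continuous_iff_continuousAt]
  intro X
  exact ((TestFn.contDiffAt hF (spacelike_dS X)).continuousAt).comp
    continuous_subtype_val.continuousAt

theorem TestFn.mk {d : ℕ} {F : dS d → ℂ} {G : Mink d → ℂ} {K : Set (dS d)} (hK : IsCompact K)
    (h0 : ∀ X, X ∉ K → F X = 0)
    (hG : ContDiffOn ℝ (⊤ : ℕ∞) G {X | mdot X X < 0}) (h1 : ∀ X : dS d, G X = F X)
    (h2 : ∀ c : ℝ, 0 < c → ∀ X, mdot X X < 0 → G (c • X) = G X) : F ∈ TestFn d :=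
  ⟨hG.congr fun _ hX => hext_eq_of F h1 h2 hX, HasCompactSupport.intro hK h0⟩

/-- The derivative of the homogeneous extension in a constant direction. -/
noncomputable def dirD {d : ℕ} (v : Mink d) (F : dS d → ℂ) (X : dS d) : ℂ :=
  fderiv ℝ (hext F) (X : Mink d) v

theorem fderiv_hext_smul {d : ℕ} {F : dS d → ℂ} (hF : F ∈ TestFn d) {c : ℝ} (hc : 0 < c)
    {X : Mink d} (hX : mdot X X < 0) (v : Mink d) :
    (c : ℂ) * fderiv ℝ (hext F) (c • X) v = fderiv ℝ (hext F) X v := by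
  have := fderiv_comp_smul_of_homogeneous (w := hext F) (c := c) (C := 1)
    (fun X hX => by rw [one_mul]; exact hext_smul F hc hX) hX (TestFn.differentiableAt hF hX) v
  rwa [one_mul] at this

/-- Euler's relation in degree `0`. It shows that `dirD v F` is the derivative of `F` along the
tangential part `v + (X · v) X` of `v`. -/
theorem fderiv_hext_self {d : ℕ} {F : dS d → ℂ} (hF : F ∈ TestFn d) {X : Mink d}
    (hX : mdot X X < 0) : fderiv ℝ (hext F) X X = 0 := by
  have h1 : HasDerivAt (fun c : ℝ => c • X) X 1 := by
    simpa using (hasDerivAt_id (1 : ℝ)).smul_const X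
  have h2 : HasFDerivAt (hext F) (fderiv ℝ (hext F) X) ((1 : ℝ) • X) := by
    rw [one_smul]; exact (TestFn.differentiableAt hF hX).hasFDerivAt
  have h3 := h2.comp_hasDerivAt 1 h1
  have h4 : (hext F ∘ fun c : ℝ => c • X) =ᶠ[𝓝 1] fun _ => hext F X := by
    filter_upwards [lt_mem_nhds (one_pos : (0 : ℝ) < 1)] with c hc using hext_smul F hc hX
  have h5 := (hasDerivAt_const (1 : ℝ) (hext F X)).congr_of_eventuallyEq h4
  exact h3.unique h5

theorem dirD_eq_zero {d : ℕ} {F : dS d → ℂ} (v : Mink d) {X : dS d} (hX : X ∉ tsupport F) :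
    dirD v F X = 0 := by
  have : hext F =ᶠ[𝓝 (X : Mink d)] fun _ => 0 := by
    have h1 : {Y : Spacelike d | dSproj Y ∉ tsupport F} ∈ 𝓝 (⟨X, spacelike_dS X⟩ : Spacelike d) :=
      ((isClosed_tsupport F).isOpen_compl.preimage continuous_dSproj).mem_nhds (by
        change dSproj _ ∉ _
        rwa [dSproj_dS])
    have h2 := (isOpen_spacelike.isOpenEmbedding_subtypeVal.image_mem_nhds).mpr h1
    filter_upwards [h2] with Y hY
    obtain ⟨Z, hZ, rfl⟩ := hY
    rw [hext_apply]
    exact image_eq_zero_of_notMem_tsupport hZ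
  rw [dirD, this.fderiv_eq]; simp

theorem contDiffOn_fderiv_hext {d : ℕ} {F : dS d → ℂ} (hF : F ∈ TestFn d) (v : Mink d) :
    ContDiffOn ℝ (⊤ : ℕ∞) (fun X => fderiv ℝ (hext F) X v) {X | mdot X X < 0} :=
  (hF.1.fderiv_of_isOpen isOpen_spacelike (by simp)).clm_apply contDiffOn_const

theorem contDiffOn_ofReal_rad {d : ℕ} {n : WithTop ℕ∞} :
    ContDiffOn ℝ n (fun X : Mink d => (rad X : ℂ)) {X | mdot X X < 0} :=
  Complex.ofRealCLM.contDiff.comp_contDiffOn contDiffOn_rad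

/-- The derivative of a function of degree `0` has degree `-1`. The factor `rad`, which is `1` on
`dS_d`, restores the degree `0`. -/
theorem TestFn.dirD {d : ℕ} {F : dS d → ℂ} (hF : F ∈ TestFn d) (v : Mink d) :
    dirD v F ∈ TestFn d := by
  refine TestFn.mk (G := fun X => (rad X : ℂ) * fderiv ℝ (hext F) X v) hF.2
    (fun X hX => dirD_eq_zero v hX)
    (contDiffOn_ofReal_rad.mul (contDiffOn_fderiv_hext hF v)) (fun X => ?_) fun c hc X hX => ?_
  · rw [rad_dS]; simp [_root_.dirD]
  · rw [← fderiv_hext_smul hF hc hX, rad_smul hc]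
    push_cast; ring

theorem hext_dirD {d : ℕ} {F : dS d → ℂ} (hF : F ∈ TestFn d) (v : Mink d) {X : Mink d}
    (hX : mdot X X < 0) : hext (dirD v F) X = (rad X : ℂ) * fderiv ℝ (hext F) X v := by
  refine hext_eq_of (dirD v F) (G := fun X => (rad X : ℂ) * fderiv ℝ (hext F) X v) (fun X => ?_)
    (fun c hc X hX => ?_) hX
  · rw [rad_dS]; simp [_root_.dirD]
  · rw [← fderiv_hext_smul hF hc hX, rad_smul hc]
    push_cast; ring

/-- Multiplication by the linear function `X ↦ X · v`. -/
noncomputable def coordMul {d : ℕ} (v : Mink d) (F : dS d → ℂ) (X : dS d) : ℂ :=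
  (mdot (X : Mink d) v : ℂ) * F X

theorem hext_coordMul {d : ℕ} (F : dS d → ℂ) (v : Mink d) {X : Mink d}
    (hX : mdot X X < 0) : hext (coordMul v F) X = ((mdot X v / rad X : ℝ) : ℂ) * hext F X := by
  refine hext_eq_of (coordMul v F) (G := fun X => ((mdot X v / rad X : ℝ) : ℂ) * hext F X)
    (fun X => ?_) (fun c hc X hX => ?_) hX
  · rw [rad_dS, hext_dS]; simp [coordMul]
  · rw [hext_smul F hc hX, rad_smul hc, mdot_smul_left, mul_div_mul_left _ _ hc.ne']

theorem contDiffOn_coord {d : ℕ} (v : Mink d) {n : WithTop ℕ∞} :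
    ContDiffOn ℝ n (fun X : Mink d => ((mdot X v / rad X : ℝ) : ℂ)) {X | mdot X X < 0} :=
  Complex.ofRealCLM.contDiff.comp_contDiffOn
    ((contDiff_mdot_left v).contDiffOn.div contDiffOn_rad fun _ hX => (rad_pos hX).ne')

theorem TestFn.coordMul {d : ℕ} {F : dS d → ℂ} (hF : F ∈ TestFn d) (v : Mink d) :
    coordMul v F ∈ TestFn d := by
  refine ⟨((contDiffOn_coord v).mul hF.1).congr fun X hX => hext_coordMul F v hX, ?_⟩
  exact hF.2.mul_left (f := fun X : dS d => (mdot (X : Mink d) v : ℂ))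

/-- Integration by parts on `dS_d` against the kernel `(X · P + iη)^s`. -/
theorem integral_dS_by_parts {d : ℕ} {H : dS d → ℂ} (hH : H ∈ TestFn d) (v P : Mink d) {η : ℝ}
    (hη : 0 < η) (s : ℂ) :
    ∫ X : dS d, ((dirD v H X + d * (mdot (X : Mink d) v : ℂ) * H X) *
      ((mdot (X : Mink d) P : ℂ) + Complex.I * η) ^ s +
      H X * (s * ((mdot (X : Mink d) P : ℂ) + Complex.I * η) ^ (s - 1) *
        ((mdot v P : ℂ) + mdot (X : Mink d) P * mdot (X : Mink d) v))) ∂dSmeas d = 0 := by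
  -- `u` extends `X · P + iη` with degree `0`. The power of `rad` in `w` below gives the integrand
  -- the degree `-d` that `integral_dS_fderiv_eq_zero` requires.
  let u : Mink d → ℂ := fun X => ((mdot X P / rad X : ℝ) : ℂ) + Complex.I * η
  have hu : ∀ X, u X ∈ Complex.slitPlane := fun X => by
    right; simp [u, hη.ne']
  let w : Mink d → ℂ := fun X => hext H X * ((rad X : ℂ) ^ (-(d : ℤ)) * u X ^ s)
  have hr0 : ∀ X : Mink d, mdot X X < 0 → (rad X : ℂ) ≠ 0 := fun X hX => by
    exact_mod_cast (rad_pos hX).ne'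
  have hrp : ContDiffOn ℝ 1 (fun X : Mink d => (rad X : ℂ) ^ (-(d : ℤ))) {X | mdot X X < 0} := by
    simp only [zpow_neg, zpow_natCast]
    exact (contDiffOn_ofReal_rad.pow d).inv fun X hX => pow_ne_zero _ (hr0 X hX)
  have hcd : ContDiffOn ℝ 1 w {X | mdot X X < 0} := by
    refine (hH.1.of_le (by exact_mod_cast le_top)).mul (hrp.mul ?_)
    intro X hX
    have h1 : ContDiffAt ℂ 1 (fun z : ℂ => z ^ s) (u X) :=
      AnalyticAt.contDiffAt (AnalyticAt.cpow analyticAt_id analyticAt_const (hu X))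
    have h2 : ContDiffWithinAt ℝ 1 u {X | mdot X X < 0} X :=
      (contDiffOn_coord P X hX).add contDiffWithinAt_const
    exact (h1.restrict_scalars ℝ).comp_contDiffWithinAt X h2
  have key := integral_dS_fderiv_eq_zero (w := w) hcd (fun c hc X hX => by
    have hc' : (c : ℂ) ≠ 0 := by exact_mod_cast hc.ne'
    simp only [w, u]
    rw [hext_smul H hc hX, rad_smul hc, mdot_smul_left, mul_div_mul_left _ _ hc.ne']
    push_cast
    rw [mul_zpow]; ring) hH.2 (fun X hX => by
      simp only [w]
      rw [hext_apply, image_eq_zero_of_notMem_tsupport hX, zero_mul]) v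
  rw [← key]
  -- It remains to apply the product rule to `w` at a point with `rad = 1`. The derivative of `rad ^
  -- (-d)` is `d (X · v)`, and that of `u` is `v · P + (X · P) (X · v)`.
  refine integral_congr_ae (Eventually.of_forall fun X => ?_)
  have hX := spacelike_dS X
  obtain ⟨L, hL, hLv⟩ := hasFDerivAt_rad hX
  obtain ⟨M, hM, hMv⟩ := hasFDerivAt_mdot_left P (X : Mink d)
  have hX0 : (X : Mink d) + (0 : ℝ) • v = X := by simp
  have hr1 : rad (X : Mink d) = 1 := rad_dS X
  have e1 := (TestFn.differentiableAt hH hX).hasFDerivAt.hasLineDerivAt v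
  have e2 : HasDerivAt (fun τ : ℝ => rad ((X : Mink d) + τ • v)) _ 0 := hL.hasLineDerivAt v
  have e3 : HasDerivAt (fun τ : ℝ => mdot ((X : Mink d) + τ • v) P) _ 0 := hM.hasLineDerivAt v
  have e4 : HasDerivAt (fun τ : ℝ => (rad ((X : Mink d) + τ • v) : ℂ) ^ (-(d : ℤ))) _ 0 :=
    HasDerivAt.comp (h₂ := fun z : ℂ => z ^ (-(d : ℤ))) (0 : ℝ)
      (hasDerivAt_zpow (-(d : ℤ)) (rad ((X : Mink d) + (0 : ℝ) • v) : ℂ)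
        (Or.inl (by rw [hX0]; exact hr0 _ hX))) e2.ofReal_comp
  have e5 : HasDerivAt (fun τ : ℝ => u ((X : Mink d) + τ • v)) _ 0 :=
    (e3.div e2 (by rw [hX0]; exact (rad_pos hX).ne')).ofReal_comp.add_const (Complex.I * η)
  have e6 : HasDerivAt (fun τ : ℝ => u ((X : Mink d) + τ • v) ^ s) _ 0 :=
    HasDerivAt.comp (h₂ := fun z : ℂ => z ^ s) (0 : ℝ)
      ((hasDerivAt_id _).cpow_const (hu _)) e5
  have e7 : HasDerivAt (fun τ : ℝ => w ((X : Mink d) + τ • v)) _ 0 := HasDerivAt.fun_mul e1 (e4.fun_mul e6)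
  have hwX : DifferentiableAt ℝ w X :=
    ((hcd X hX).contDiffAt (isOpen_spacelike.mem_nhds hX)).differentiableAt one_ne_zero
  have e8 := (hwX.hasFDerivAt.hasLineDerivAt v).unique e7
  beta_reduce
  rw [e8, hX0, hr1, hLv, hMv, hr1, hext_dS]
  simp only [u, hr1, dirD, id]
  push_cast
  simp only [one_zpow, div_one, mul_one, one_pow]
  ring

/-! ### Symmetries of de Sitter space -/

theorem abs_det_SOup {d : ℕ} (Λ : SOup d) : LinearMap.det (Λ.1 : Mink d →ₗ[ℝ] Mink d) = 1 := by
  rw [← LinearEquiv.coe_det, Λ.2.2.1, Units.val_one]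

theorem mdot_SOup {d : ℕ} (Λ : SOup d) (X Y : Mink d) : mdot (Λ.1 X) (Λ.1 Y) = mdot X Y :=
  Λ.2.1 X Y

theorem SOup_apply_inv {d : ℕ} (Λ : SOup d) (X : Mink d) : Λ.1 ((Λ⁻¹).1 X) = X :=
  Λ.1.apply_symm_apply X

theorem SOup_inv_apply {d : ℕ} (Λ : SOup d) (X : Mink d) : (Λ⁻¹).1 (Λ.1 X) = X :=
  Λ.1.symm_apply_apply X

theorem continuous_SOup {d : ℕ} (Λ : SOup d) : Continuous (Λ.1 : Mink d → Mink d) :=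
  LinearMap.continuous_of_finiteDimensional (Λ.1 : Mink d →ₗ[ℝ] Mink d)

theorem mdot_SOup_inv {d : ℕ} (Λ : SOup d) (X Y : Mink d) :
    mdot ((Λ⁻¹).1 X) Y = mdot X (Λ.1 Y) := by
  rw [← mdot_SOup Λ, SOup_apply_inv]

theorem continuous_dSact {d : ℕ} (Λ : SOup d) : Continuous (dSact Λ) :=
  ((continuous_SOup Λ).comp continuous_subtype_val).subtype_mk _

/-- The action of a Lorentz transformation on `dS_d` as a homeomorphism. -/
noncomputable def dSactHomeo {d : ℕ} (Λ : SOup d) : dS d ≃ₜ dS d where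
  toFun := dSact Λ
  invFun := dSact Λ⁻¹
  left_inv X := Subtype.ext (SOup_inv_apply Λ X)
  right_inv X := Subtype.ext (SOup_apply_inv Λ X)
  continuous_toFun := continuous_dSact Λ
  continuous_invFun := continuous_dSact Λ⁻¹

theorem rad_SOup {d : ℕ} (Λ : SOup d) (X : Mink d) : rad (Λ.1 X) = rad X := by
  rw [rad, rad, mdot_SOup]

theorem dSproj_SOup {d : ℕ} (Λ : SOup d) (X : Spacelike d) :
    dSproj ⟨Λ.1 X.1, by rw [mdot_SOup]; exact X.2⟩ = dSact Λ (dSproj X) := by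
  apply Subtype.ext
  rw [dSproj_coe, rad_SOup]
  exact (map_smul Λ.1 _ _).symm

/-- A Lorentz transformation preserves `rad`, hence maps truncated cones to truncated cones, and it
has determinant `1`. -/
theorem measurePreserving_dSact {d : ℕ} (Λ : SOup d) :
    MeasurePreserving (dSact Λ) (dSmeas d) (dSmeas d) := by
  refine ⟨(continuous_dSact Λ).measurable, ?_⟩
  ext A hA
  rw [Measure.map_apply (continuous_dSact Λ).measurable hA,
    dSmeas_apply ((continuous_dSact Λ).measurable hA), dSmeas_apply hA]
  have h : sector (dSact Λ ⁻¹' A) 1 = (Λ.1 : Mink d →ₗ[ℝ] Mink d) ⁻¹' sector A 1 := by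
    ext X
    simp only [sector, mem_image, mem_preimage, mem_ofPred_eq]
    constructor
    · rintro ⟨Y, ⟨h1, h2⟩, rfl⟩
      refine ⟨⟨Λ.1 Y.1, by rw [mdot_SOup]; exact Y.2⟩, ⟨?_, ?_⟩, rfl⟩
      · rwa [dSproj_SOup]
      · rwa [rad_SOup]
    · rintro ⟨Y, ⟨h1, h2⟩, h⟩
      have hX : Λ.1 X = Y.1 := h.symm
      have hY : mdot X X < 0 := by rw [← mdot_SOup Λ, hX]; exact Y.2
      refine ⟨⟨X, hY⟩, ⟨?_, ?_⟩, rfl⟩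
      · rw [← dSproj_SOup]
        simpa only [hX] using h1
      · change rad X < 1
        rwa [← rad_SOup Λ, hX]
  rw [h, Measure.addHaar_preimage_linearMap _ (by rw [abs_det_SOup]; exact one_ne_zero),
    abs_det_SOup]
  simp

theorem hext_comp_dSact {d : ℕ} (Λ : SOup d) (F : dS d → ℂ) (X : Mink d) :
    hext (fun X => F (dSact Λ X)) X = hext F (Λ.1 X) := by
  by_cases hX : mdot X X < 0
  · rw [hext_apply _ ⟨X, hX⟩, ← dSproj_SOup]
    exact (hext_apply F ⟨Λ.1 X, by rw [mdot_SOup]; exact hX⟩).symm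
  · have hX' : ¬ mdot (Λ.1 X) (Λ.1 X) < 0 := by rwa [mdot_SOup]
    simp [hext, hX, hX']

theorem TestFn.comp_dSact {d : ℕ} {F : dS d → ℂ} (hF : F ∈ TestFn d) (Λ : SOup d) :
    (fun X => F (dSact Λ X)) ∈ TestFn d := by
  refine ⟨?_, hF.2.comp_homeomorph (dSactHomeo Λ)⟩
  have h1 : hext (fun X => F (dSact Λ X)) = hext F ∘ Λ.1 := funext (hext_comp_dSact Λ F)
  have h2 : ContDiff ℝ (⊤ : ℕ∞) (Λ.1 : Mink d → Mink d) :=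
    (LinearMap.toContinuousLinearMap (Λ.1 : Mink d →ₗ[ℝ] Mink d)).contDiff
  rw [h1]
  exact hF.1.comp h2.contDiffOn fun X hX => by
    change mdot _ _ < 0
    rw [mdot_SOup]; exact hX

theorem dSneg_dSneg {d : ℕ} (X : dS d) : dSneg (dSneg X) = X := Subtype.ext (neg_neg X.1)

theorem continuous_dSneg {d : ℕ} : Continuous (dSneg : dS d → dS d) :=
  continuous_subtype_val.neg.subtype_mk _

/-- The reflection of `dS_d` as a homeomorphism. -/
noncomputable def dSnegHomeo (d : ℕ) : dS d ≃ₜ dS d where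
  toFun := dSneg
  invFun := dSneg
  left_inv := dSneg_dSneg
  right_inv := dSneg_dSneg
  continuous_toFun := continuous_dSneg
  continuous_invFun := continuous_dSneg

theorem conjNeg_conjNeg {d : ℕ} (F : dS d → ℂ) : conjNeg (conjNeg F) = F := by
  funext X; simp [conjNeg, dSneg_dSneg]

theorem rad_neg {d : ℕ} (X : Mink d) : rad (-X) = rad X := by rw [rad, rad, mdot_neg_neg]

theorem hext_conjNeg {d : ℕ} (F : dS d → ℂ) (X : Mink d) :
    hext (conjNeg F) X = (starRingEnd ℂ) (hext F (-X)) := by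
  by_cases hX : mdot X X < 0
  · have hX' : mdot (-X) (-X) < 0 := by rwa [mdot_neg_neg]
    rw [hext_apply _ ⟨X, hX⟩, hext_apply F ⟨-X, hX'⟩, conjNeg]
    congr 2
    apply Subtype.ext
    change -((rad X)⁻¹ • X) = (rad (-X))⁻¹ • (-X)
    rw [rad_neg, smul_neg]
  · have hX' : ¬ mdot (-X) (-X) < 0 := by rwa [mdot_neg_neg]
    simp [hext, hX, hX']

theorem hext_conjNeg_eq {d : ℕ} (F : dS d → ℂ) :
    hext (conjNeg F) = Complex.conjLIE ∘ (hext F ∘ LinearIsometryEquiv.neg ℝ) :=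
  funext (hext_conjNeg F)

theorem norm_iteratedFDeriv_conjNeg {d : ℕ} (F : dS d → ℂ) (j : ℕ) (X : Mink d) :
    ‖iteratedFDeriv ℝ j (hext (conjNeg F)) X‖ = ‖iteratedFDeriv ℝ j (hext F) (-X)‖ := by
  rw [hext_conjNeg_eq, LinearIsometryEquiv.norm_iteratedFDeriv_comp_left,
    LinearIsometryEquiv.norm_iteratedFDeriv_comp_right]
  rfl

theorem TestFn.conjNeg {d : ℕ} {F : dS d → ℂ} (hF : F ∈ TestFn d) : conjNeg F ∈ TestFn d := by
  refine ⟨?_, (hF.2.comp_homeomorph (dSnegHomeo d)).comp_left (map_zero (starRingEnd ℂ))⟩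
  rw [hext_conjNeg_eq]
  refine Complex.conjLIE.contDiff.comp_contDiffOn (hF.1.comp
    (LinearIsometryEquiv.neg ℝ (E := Mink d)).contDiff.contDiffOn fun X hX => ?_)
  change mdot (-X) (-X) < 0
  rw [mdot_neg_neg]; exact hX

/-- The sign is the chain rule for `X ↦ -X`. It occurs twice, and cancels, in the second order
operator `box`. -/
theorem dirD_conjNeg {d : ℕ} {F : dS d → ℂ} (hF : F ∈ TestFn d) (v : Mink d) :
    dirD v (conjNeg F) = fun X => -conjNeg (dirD v F) X := by
  funext X
  have hX : mdot (-(X : Mink d)) (-(X : Mink d)) < 0 := by rw [mdot_neg_neg]; exact spacelike_dS X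
  have e : HasFDerivAt (hext F) _ (-(X : Mink d)) := (TestFn.differentiableAt hF hX).hasFDerivAt
  have e1 : HasFDerivAt (fun Y : Mink d => -Y) (-ContinuousLinearMap.id ℝ (Mink d)) (X : Mink d) :=
    (hasFDerivAt_id _).neg
  have e2 := (Complex.conjCLE.toContinuousLinearMap.hasFDerivAt).comp (X : Mink d)
    (e.comp (X : Mink d) e1)
  have e3 : hext (conjNeg F) = (Complex.conjCLE.toContinuousLinearMap ∘ (hext F ∘ fun Y => -Y)) :=
    funext (hext_conjNeg F)
  simp only [dirD, conjNeg]
  rw [e3, e2.fderiv]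
  simp [dSneg]

/-! ### The d'Alembert operator -/

/-- The signs of the Minkowski metric. -/
def msign (d : ℕ) : Fin (d + 1) → ℝ := Fin.cons 1 fun _ => -1

theorem mdot_single {d : ℕ} (X : Mink d) (a : Fin (d + 1)) :
    mdot X (Pi.single a 1) = msign d a * X a := by
  refine Fin.cases ?_ (fun i => ?_) a
  · simp [mdot, msign]
  · simp only [mdot, msign, Fin.cons_succ]
    rw [Finset.sum_eq_single i]
    · simp [(Fin.succ_ne_zero i).symm]
    · intro j _ hj
      simp [hj]
    · simp

theorem msign_mul_self {d : ℕ} (a : Fin (d + 1)) : msign d a * msign d a = 1 := by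
  refine Fin.cases ?_ (fun i => ?_) a <;> simp [msign]

theorem sum_coord_dirD {d : ℕ} (F : dS d → ℂ) (v : Mink d) (X : dS d) :
    ∑ a, (v a : ℂ) * dirD (Pi.single a 1) F X = dirD v F X := by
  have hv : v = ∑ a, v a • (Pi.single a (1 : ℝ) : Mink d) := by
    exact pi_eq_sum_univ' v
  conv_rhs => rw [dirD, hv, map_sum]
  refine Finset.sum_congr rfl fun a _ => ?_
  rw [map_smul, Complex.real_smul]; rfl

theorem dirD_self {d : ℕ} {F : dS d → ℂ} (hF : F ∈ TestFn d) (X : dS d) :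
    dirD (X : Mink d) F X = 0 := fderiv_hext_self hF (spacelike_dS X)

/-- The second term comes from differentiating the factor `rad` in `hext_dirD`. -/
theorem dirD_dirD {d : ℕ} {F : dS d → ℂ} (hF : F ∈ TestFn d) (v : Mink d) (X : dS d) :
    dirD v (dirD v F) X = fderiv ℝ (fderiv ℝ (hext F)) (X : Mink d) v v -
      (mdot (X : Mink d) v : ℂ) * dirD v F X := by
  have hX := spacelike_dS X
  have h1 : hext (dirD v F) =ᶠ[𝓝 (X : Mink d)] fun Y => (rad Y : ℂ) * fderiv ℝ (hext F) Y v := by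
    filter_upwards [isOpen_spacelike.mem_nhds hX] with Y hY using hext_dirD hF v hY
  obtain ⟨L, hL, hLv⟩ := hasFDerivAt_rad hX
  have h2 : HasFDerivAt (fun X : Mink d => (rad X : ℂ)) (Complex.ofRealCLM.comp L) (X : Mink d) :=
    Complex.ofRealCLM.hasFDerivAt.comp _ hL
  have h3 : DifferentiableAt ℝ (fderiv ℝ (hext F)) (X : Mink d) :=
    (((TestFn.contDiffAt hF hX).fderiv_right (m := 1) (by norm_cast))).differentiableAt one_ne_zero
  have h4 := h3.hasFDerivAt.clm_apply (hasFDerivAt_const v (X : Mink d))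
  have h5 := (h2.mul h4).hasLineDerivAt v
  have h6 : HasFDerivAt (hext (dirD v F)) _ (X : Mink d) :=
    (h2.mul h4).congr_of_eventuallyEq h1
  change fderiv ℝ (hext (dirD v F)) (X : Mink d) v = _
  rw [h6.fderiv]
  simp [hLv, rad_dS, dirD]
  ring

/-- The corrections in `dirD_dirD`, weighted by the metric, add up to the derivative of `F` in the
direction `X`, which vanishes by Euler's relation. In this form `box` is open to integration by
parts. -/
theorem box_eq_sum {d : ℕ} {F : dS d → ℂ} (hF : F ∈ TestFn d) (X : dS d) :
    box F X = ∑ a, (msign d a : ℂ) * dirD (Pi.single a 1) (dirD (Pi.single a 1) F) X := by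
  have h1 : box F X = ∑ a, (msign d a : ℂ) *
      fderiv ℝ (fderiv ℝ (hext F)) (X : Mink d) (Pi.single a 1) (Pi.single a 1) := by
    rw [Fin.sum_univ_succ]
    simp [box, iteratedFDeriv_two_apply, msign, sub_eq_add_neg, Finset.sum_neg_distrib]
  have h2 : ∑ a, (msign d a : ℂ) * ((mdot (X : Mink d) (Pi.single a 1) : ℂ) *
      dirD (Pi.single a 1) F X) = 0 := by
    rw [← dirD_self hF X, ← sum_coord_dirD]
    refine Finset.sum_congr rfl fun a _ => ?_
    rw [mdot_single, ← mul_assoc, ← Complex.ofReal_mul, ← mul_assoc, msign_mul_self, one_mul]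
  rw [h1, ← sub_zero (∑ a, _), ← h2, ← Finset.sum_sub_distrib]
  refine Finset.sum_congr rfl fun a _ => ?_
  rw [dirD_dirD hF]; ring

theorem box_eq {d : ℕ} {F : dS d → ℂ} (hF : F ∈ TestFn d) :
    box F = ∑ a, (msign d a : ℂ) • dirD (Pi.single a 1) (dirD (Pi.single a 1) F) := by
  funext X
  rw [box_eq_sum hF, Finset.sum_apply]; rfl

theorem TestFn.box {d : ℕ} {F : dS d → ℂ} (hF : F ∈ TestFn d) : box F ∈ TestFn d := by
  rw [box_eq hF]
  exact Submodule.sum_mem _ fun a _ => Submodule.smul_mem _ _ (TestFn.dirD (TestFn.dirD hF _) _)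

theorem box_conjNeg {d : ℕ} {F : dS d → ℂ} (hF : F ∈ TestFn d) :
    box (conjNeg F) = conjNeg (box F) := by
  funext X
  have h : ∀ v, dirD v (dirD v (conjNeg F)) X = conjNeg (dirD v (dirD v F)) X := by
    intro v
    have h1 : dirD v (conjNeg F) = (-1 : ℂ) • conjNeg (dirD v F) := by
      rw [dirD_conjNeg hF]; funext X; simp
    have h2 : hext ((-1 : ℂ) • conjNeg (dirD v F)) = (-1 : ℂ) • hext (conjNeg (dirD v F)) := by
      funext Y; by_cases hY : mdot Y Y < 0 <;> simp [hext, hY]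
    rw [h1]
    change fderiv ℝ (hext _) (X : Mink d) v = _
    rw [h2, fderiv_const_smul (TestFn.differentiableAt (TestFn.conjNeg (TestFn.dirD hF v)) (spacelike_dS X))]
    have h3 := congrFun (dirD_conjNeg (TestFn.dirD hF v) v) X
    simp only [smul_apply]
    change (-1 : ℂ) • dirD v (conjNeg (dirD v F)) X = _
    rw [h3]; simp
  rw [box_eq_sum (TestFn.conjNeg hF), conjNeg, box_eq_sum hF, map_sum]
  refine Finset.sum_congr rfl fun a _ => ?_
  rw [h, map_mul, Complex.conj_ofReal]; rfl

/-! ### Boundary values of the regularized transform -/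

/-- The kernel `(X · P + iη)^s`. -/
noncomputable def waveKer {d : ℕ} (s : ℂ) (P : Mink d) (η : ℝ) (X : dS d) : ℂ :=
  ((mdot (X : Mink d) P : ℂ) + Complex.I * η) ^ s

/-- The regularized transform `∫ F(X) (X · P + iη)^s dμ(X)`. -/
noncomputable def regInt {d : ℕ} (s : ℂ) (F : dS d → ℂ) (P : Mink d) (η : ℝ) : ℂ :=
  ∫ X : dS d, F X * waveKer s P η X ∂dSmeas d

theorem mem_slitPlane_of_pos (t : ℝ) {η : ℝ} (hη : 0 < η) :
    (t : ℂ) + Complex.I * η ∈ Complex.slitPlane := by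
  right; simp [hη.ne']

theorem continuous_mdot_dS {d : ℕ} (P : Mink d) : Continuous fun X : dS d => mdot (X : Mink d) P :=
  (contDiff_mdot_left P (n := 0)).continuous.comp continuous_subtype_val

theorem continuous_waveKer {d : ℕ} (s : ℂ) (P : Mink d) {η : ℝ} (hη : 0 < η) :
    Continuous (waveKer s P η) := by
  refine Continuous.cpow ?_ continuous_const fun X => mem_slitPlane_of_pos _ hη
  exact (Complex.continuous_ofReal.comp (continuous_mdot_dS P)).add continuous_const

theorem integrable_mul_of_continuous {d : ℕ} {F : dS d → ℂ} (hF : F ∈ TestFn d) {g : dS d → ℂ}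
    (hg : Continuous g) : Integrable (fun X => F X * g X) (dSmeas d) :=
  ((TestFn.continuous hF).mul hg).integrable_of_hasCompactSupport hF.2.mul_right

theorem integrable_waveKer {d : ℕ} {F : dS d → ℂ} (hF : F ∈ TestFn d) (s : ℂ) (P : Mink d) {η : ℝ}
    (hη : 0 < η) : Integrable (fun X => F X * waveKer s P η X) (dSmeas d) :=
  integrable_mul_of_continuous hF (continuous_waveKer s P hη)

theorem regInt_add {d : ℕ} {F G : dS d → ℂ} (hF : F ∈ TestFn d) (hG : G ∈ TestFn d) (s : ℂ)
    (P : Mink d) {η : ℝ} (hη : 0 < η) :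
    regInt s (F + G) P η = regInt s F P η + regInt s G P η := by
  rw [regInt, regInt, regInt, ← integral_add (integrable_waveKer hF s P hη)
    (integrable_waveKer hG s P hη)]
  exact integral_congr_ae (Eventually.of_forall fun X => add_mul _ _ _)

theorem regInt_smul {d : ℕ} (c : ℂ) (F : dS d → ℂ) (s : ℂ) (P : Mink d) (η : ℝ) :
    regInt s (c • F) P η = c * regInt s F P η := by
  rw [regInt, regInt, ← integral_const_mul]
  exact integral_congr_ae (Eventually.of_forall fun X => mul_assoc _ _ _)

/-- From `X · P = (X · P + iη) - iη`: a factor `X · P` raises the exponent by one, with an error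
that carries a factor `η`. -/
theorem mul_waveKer {d : ℕ} (s : ℂ) (P : Mink d) {η : ℝ} (hη : 0 < η) (X : dS d) :
    (mdot (X : Mink d) P : ℂ) * waveKer (s - 1) P η X =
      waveKer s P η X - Complex.I * η * waveKer (s - 1) P η X := by
  have hz := Complex.slitPlane_ne_zero (mem_slitPlane_of_pos (mdot (X : Mink d) P) hη)
  have : waveKer s P η X =
      ((mdot (X : Mink d) P : ℂ) + Complex.I * η) * waveKer (s - 1) P η X := by
    simp only [waveKer]
    rw [Complex.cpow_sub _ _ hz, Complex.cpow_one]; field_simp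
  rw [this]; ring

/-- The first order operator obtained by integrating by parts in the time direction. -/
noncomputable def timeOp {d : ℕ} (s : ℂ) (F : dS d → ℂ) : dS d → ℂ :=
  dirD (Pi.single 0 1) F + ((d : ℂ) + s) • coordMul (Pi.single 0 1) F

theorem TestFn.timeOp {d : ℕ} {F : dS d → ℂ} (hF : F ∈ TestFn d) (s : ℂ) :
    timeOp s F ∈ TestFn d :=
  Submodule.add_mem _ (TestFn.dirD hF _) (Submodule.smul_mem _ _ (TestFn.coordMul hF _))

theorem mdot_time {d : ℕ} (P : Mink d) : mdot (Pi.single 0 1) P = P 0 := by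
  rw [mdot_comm, mdot_single]; simp [msign]

/-- For `P₀ = 1` the tangential time derivative of `X · P` is `1 + (X · P) X₀`. The first summand
produces the left hand side. In the second one `mul_waveKer` trades `X · P` for a power of the
kernel, which leaves an integral with exponent `s` and a remainder with exponent `s - 1` and a
factor `η`. Thus an integral with the singular exponent `s - 1` is expressed by milder ones. -/
theorem regInt_by_parts {d : ℕ} {F : dS d → ℂ} (hF : F ∈ TestFn d) (s : ℂ) {P : Mink d}
    (hP : P 0 = 1) {η : ℝ} (hη : 0 < η) :
    s * regInt (s - 1) F P η = -regInt s (timeOp s F) P η +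
      Complex.I * η * (s * regInt (s - 1) (coordMul (Pi.single 0 1) F) P η) := by
  have h := integral_dS_by_parts hF (Pi.single 0 1) P hη s
  rw [mdot_time, hP] at h
  have h1 := integrable_waveKer (TestFn.timeOp hF s) s P hη
  have h2 : Integrable (fun X => s * (F X * waveKer (s - 1) P η X)) (dSmeas d) := (integrable_waveKer hF (s - 1) P hη).const_mul s
  have h3 := ((integrable_waveKer (TestFn.coordMul hF (Pi.single 0 1)) (s - 1) P hη).const_mul
    s).const_mul (Complex.I * η)
  have e : regInt s (timeOp s F) P η + s * regInt (s - 1) F P η -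
      Complex.I * η * (s * regInt (s - 1) (coordMul (Pi.single 0 1) F) P η) = 0 := by
    rw [← h]
    simp only [regInt]
    rw [← integral_const_mul, ← integral_const_mul, ← integral_const_mul, ← integral_add h1 h2,
      ← integral_sub (f := fun X => timeOp s F X * waveKer s P η X + _) (h1.add h2) h3]
    refine integral_congr_ae (Eventually.of_forall fun X => ?_)
    have k := mul_waveKer s P hη X
    simp only [timeOp, coordMul, Pi.add_apply, Pi.smul_apply, smul_eq_mul]
    change _ = (_ + _) * waveKer s P η X + F X * (s * waveKer (s - 1) P η X * _)
    rw [show (F X * (s * waveKer (s - 1) P η X * (((1 : ℝ) : ℂ) +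
      (mdot (X : Mink d) P : ℂ) * (mdot (X : Mink d) (Pi.single 0 1) : ℂ)))) =
      F X * s * waveKer (s - 1) P η X + F X * s * (mdot (X : Mink d) (Pi.single 0 1) : ℂ) *
        ((mdot (X : Mink d) P : ℂ) * waveKer (s - 1) P η X) by push_cast; ring, k]
    ring
  linear_combination e

theorem hasDerivAt_waveKer {d : ℕ} (s : ℂ) (P : Mink d) {η : ℝ} (hη : 0 < η) (X : dS d) :
    HasDerivAt (fun η => waveKer s P η X) (Complex.I * (s * waveKer (s - 1) P η X)) η := by
  have h1 : HasDerivAt (fun η : ℝ => (mdot (X : Mink d) P : ℂ) + Complex.I * (η : ℂ)) Complex.I η := by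
    have := ((hasDerivAt_id η).ofReal_comp.const_mul Complex.I).const_add (mdot (X : Mink d) P : ℂ)
    simpa using this
  have h2 := HasDerivAt.comp (h₂ := fun z : ℂ => z ^ s)
    (h := fun η : ℝ => (mdot (X : Mink d) P : ℂ) + Complex.I * (η : ℂ)) η
    ((hasDerivAt_id ((mdot (X : Mink d) P : ℂ) + Complex.I * (η : ℂ))).cpow_const (c := s) (mem_slitPlane_of_pos (mdot (X : Mink d) P) hη)) h1
  refine h2.congr_deriv ?_
  simp only [waveKer, id]; ring

/-- Differentiation under the integral sign. For `η` in a compact interval of positive numbers and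
`X` in the support of `F`, the derivative of the integrand is bounded by compactness. -/
theorem hasDerivAt_regInt {d : ℕ} {F : dS d → ℂ} (hF : F ∈ TestFn d) (s : ℂ) (P : Mink d) {η : ℝ}
    (hη : 0 < η) :
    HasDerivAt (regInt s F P) (Complex.I * (s * regInt (s - 1) F P η)) η := by
  let F' : ℝ → dS d → ℂ := fun η X => F X * (Complex.I * (s * waveKer (s - 1) P η X))
  have hc : ContinuousOn (fun Z : ℝ × dS d => F' Z.1 Z.2) (Icc (η / 2) (2 * η) ×ˢ tsupport F) := by
    refine ContinuousOn.mul ((TestFn.continuous hF).comp continuous_snd).continuousOn ?_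
    refine continuousOn_const.mul (continuousOn_const.mul ?_)
    refine ContinuousOn.cpow ?_ continuousOn_const fun Z hZ => mem_slitPlane_of_pos _ ?_
    · refine Continuous.continuousOn ?_
      exact (Complex.continuous_ofReal.comp ((continuous_mdot_dS P).comp continuous_snd)).add
        (continuous_const.mul (Complex.continuous_ofReal.comp continuous_fst))
    · have := hZ.1.1; linarith
  obtain ⟨C, hC⟩ := (isCompact_Icc.prod hF.2).exists_bound_of_continuousOn hc
  have hmem : Ioo (η / 2) (2 * η) ∈ 𝓝 η := Ioo_mem_nhds (by linarith) (by linarith)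
  have key := hasDerivAt_integral_of_dominated_loc_of_deriv_le (μ := dSmeas d) (𝕜 := ℝ)
    (F := fun η X => F X * waveKer s P η X) (F' := F') (x₀ := η)
    (bound := (tsupport F).indicator fun _ => C) hmem
    (by
      filter_upwards [lt_mem_nhds hη] with x hx
      exact (integrable_waveKer hF s P hx).aestronglyMeasurable)
    (integrable_waveKer hF s P hη)
    (integrable_mul_of_continuous hF (continuous_const.mul
      (continuous_const.mul (continuous_waveKer (s - 1) P hη)))).aestronglyMeasurable
    (Eventually.of_forall fun X x hx => by
      by_cases hX : X ∈ tsupport F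
      · rw [indicator_of_mem hX]
        exact hC (x, X) ⟨Ioo_subset_Icc_self hx, hX⟩
      · rw [indicator_of_notMem hX]
        simp [F', image_eq_zero_of_notMem_tsupport hX])
    ((integrable_indicator_iff (isClosed_tsupport F).measurableSet).mpr
      (integrableOn_const hF.2.measure_lt_top.ne))
    (Eventually.of_forall fun X x hx => by
      exact (hasDerivAt_waveKer s P (by linarith [hx.1]) X).const_mul (F X))
  have e : ∫ X, F' η X ∂dSmeas d = Complex.I * (s * regInt (s - 1) F P η) := by
    rw [regInt, ← integral_const_mul, ← integral_const_mul]
    refine integral_congr_ae (Eventually.of_forall fun X => ?_)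
    simp only [F']; ring
  rw [← e]
  exact key.2

/-! ### Test functions bounded in the `C^N` norms, and the operations on them. -/

/-- The test functions supported in `K` whose derivatives up to order `N` are bounded by `A`. -/
structure BoundedOn {d : ℕ} (K : Set (dS d)) (N : ℕ) (A : ℝ) (F : dS d → ℂ) : Prop where
  mem : F ∈ TestFn d
  supp : tsupport F ⊆ K
  bound : ∀ j ≤ N, ∀ X ∈ K, ‖iteratedFDeriv ℝ j (hext F) (X : Mink d)‖ ≤ A

theorem BoundedOn.mono {d : ℕ} {K : Set (dS d)} {N M : ℕ} {A B : ℝ} {F : dS d → ℂ}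
    (h : BoundedOn K N A F) (hM : M ≤ N) (hAB : A ≤ B) : BoundedOn K M B F :=
  ⟨h.mem, h.supp, fun j hj X hX => (h.bound j (hj.trans hM) X hX).trans hAB⟩

theorem BoundedOn.norm_le {d : ℕ} {K : Set (dS d)} {N : ℕ} {A : ℝ} {F : dS d → ℂ}
    (h : BoundedOn K N A F) {X : dS d} (hX : X ∈ K) : ‖F X‖ ≤ A := by
  have := h.bound 0 (Nat.zero_le _) X hX
  rwa [norm_iteratedFDeriv_zero, hext_dS] at this

theorem TestFn.exists_boundedOn {d : ℕ} {F : dS d → ℂ} (hF : F ∈ TestFn d) {K : Set (dS d)}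
    (hK : IsCompact K) (hFK : tsupport F ⊆ K) (N : ℕ) : ∃ A, 0 ≤ A ∧ BoundedOn K N A F := by
  have h : ∀ j : ℕ, ∃ A, ∀ X ∈ K, ‖iteratedFDeriv ℝ j (hext F) (X : Mink d)‖ ≤ A := by
    intro j
    have h1 : ContinuousOn (fun X : dS d => iteratedFDeriv ℝ j (hext F) (X : Mink d)) K := by
      have h2 := hF.1.continuousOn_iteratedFDerivWithin (m := j) (by exact_mod_cast le_top)
        isOpen_spacelike.uniqueDiffOn
      have h3 := h2.congr (g := iteratedFDeriv ℝ j (hext F)) fun X hX =>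
        (iteratedFDerivWithin_of_isOpen j isOpen_spacelike hX).symm
      exact h3.comp continuous_subtype_val.continuousOn fun X _ => spacelike_dS X
    exact hK.exists_bound_of_continuousOn h1
  choose A hA using h
  refine ⟨∑ j ∈ Finset.range (N + 1), |A j|, Finset.sum_nonneg fun _ _ => abs_nonneg _, hF, hFK,
    fun j hj X hX => ?_⟩
  exact ((hA j X hX).trans (le_abs_self _)).trans (Finset.single_le_sum (f := fun j => |A j|)
    (fun _ _ => abs_nonneg _) (Finset.mem_range.mpr (by omega)))

/-- Multiplication by a fixed smooth function is bounded in the `C^N` norms. -/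
theorem exists_bound_iteratedFDeriv_mul {d : ℕ} {K : Set (dS d)} (hK : IsCompact K) (N : ℕ)
    {a : Mink d → ℂ} (ha : ContDiffOn ℝ (⊤ : ℕ∞) a {X | mdot X X < 0}) :
    ∃ C, 0 ≤ C ∧ ∀ (G : Mink d → ℂ) (A : ℝ), ContDiffOn ℝ (⊤ : ℕ∞) G {X | mdot X X < 0} → 0 ≤ A →
      (∀ j ≤ N, ∀ X ∈ K, ‖iteratedFDeriv ℝ j G ((X : dS d) : Mink d)‖ ≤ A) →
      ∀ j ≤ N, ∀ X ∈ K, ‖iteratedFDeriv ℝ j (fun Y => a Y * G Y) ((X : dS d) : Mink d)‖ ≤ C * A := by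
  have h : ∀ j : ℕ, ∃ B, ∀ X ∈ K, ‖iteratedFDerivWithin ℝ j a {X | mdot X X < 0}
      ((X : dS d) : Mink d)‖ ≤ B := by
    intro j
    exact hK.exists_bound_of_continuousOn ((ha.continuousOn_iteratedFDerivWithin (m := j)
      (by exact_mod_cast le_top) isOpen_spacelike.uniqueDiffOn).comp
        continuous_subtype_val.continuousOn fun X _ => spacelike_dS X)
  choose B hB using h
  let C : ℕ → ℝ := fun j => ∑ i ∈ Finset.range (j + 1), (j.choose i : ℝ) * |B i|
  have hC0 : ∀ j, 0 ≤ C j := fun j => Finset.sum_nonneg fun _ _ => by positivity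
  refine ⟨∑ j ∈ Finset.range (N + 1), C j, Finset.sum_nonneg fun j _ => hC0 j,
    fun G A hG hA h j hj X hX => ?_⟩
  have hXΩ : (X : Mink d) ∈ {X : Mink d | mdot X X < 0} := spacelike_dS X
  rw [← iteratedFDerivWithin_of_isOpen j isOpen_spacelike hXΩ]
  refine (norm_iteratedFDerivWithin_mul_le ha hG isOpen_spacelike.uniqueDiffOn hXΩ
    (by exact_mod_cast le_top)).trans ?_
  calc _ ≤ ∑ i ∈ Finset.range (j + 1), (j.choose i : ℝ) * |B i| * A := by
        refine Finset.sum_le_sum fun i hi => ?_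
        gcongr
        · exact (hB i X hX).trans (le_abs_self _)
        · rw [iteratedFDerivWithin_of_isOpen _ isOpen_spacelike hXΩ]
          exact h _ (by omega) X hX
    _ = C j * A := by rw [← Finset.sum_mul]
    _ ≤ _ := by
        gcongr
        exact Finset.single_le_sum (f := C) (fun j _ => hC0 j) (Finset.mem_range.mpr (by omega))

theorem iteratedFDeriv_congr_spacelike {d : ℕ} {f g : Mink d → ℂ}
    (h : ∀ X, mdot X X < 0 → f X = g X) (j : ℕ) (X : dS d) :
    iteratedFDeriv ℝ j f (X : Mink d) = iteratedFDeriv ℝ j g (X : Mink d) := by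
  have : f =ᶠ[𝓝 (X : Mink d)] g := by
    filter_upwards [isOpen_spacelike.mem_nhds (spacelike_dS X)] with Y hY using h Y hY
  exact (this.iteratedFDeriv ℝ j).eq_of_nhds

theorem tsupport_subset_of_eq_zero {d : ℕ} {F G : dS d → ℂ} (h : ∀ X, X ∉ tsupport F → G X = 0) :
    tsupport G ⊆ tsupport F :=
  closure_minimal (fun X hX => by
    by_contra hc
    exact hX (h X hc)) (isClosed_tsupport F)

theorem exists_boundedOn_coordMul {d : ℕ} {K : Set (dS d)} (hK : IsCompact K) (N : ℕ) (v : Mink d) :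
    ∃ C, 0 ≤ C ∧ ∀ F A, 0 ≤ A → BoundedOn K N A F → BoundedOn K N (C * A) (coordMul v F) := by
  obtain ⟨C, hC, h⟩ := exists_bound_iteratedFDeriv_mul hK N (contDiffOn_coord v)
  refine ⟨C, hC, fun F A hA hF => ⟨TestFn.coordMul hF.mem v, ?_, fun j hj X hX => ?_⟩⟩
  · exact (tsupport_subset_of_eq_zero fun X hX => by
      simp [coordMul, image_eq_zero_of_notMem_tsupport hX]).trans hF.supp
  · rw [iteratedFDeriv_congr_spacelike (fun X hX => hext_coordMul F v hX)]
    exact h _ A hF.mem.1 hA hF.bound j hj X hX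

theorem exists_boundedOn_dirD {d : ℕ} {K : Set (dS d)} (hK : IsCompact K) (N : ℕ) (v : Mink d) :
    ∃ C, 0 ≤ C ∧ ∀ F A, 0 ≤ A → BoundedOn K (N + 1) A F → BoundedOn K N (C * A) (dirD v F) := by
  obtain ⟨C, hC, h⟩ := exists_bound_iteratedFDeriv_mul hK N contDiffOn_ofReal_rad
  refine ⟨C * ‖v‖, by positivity, fun F A hA hF => ⟨TestFn.dirD hF.mem v, ?_, fun j hj X hX => ?_⟩⟩
  · exact (tsupport_subset_of_eq_zero fun X hX => dirD_eq_zero v hX).trans hF.supp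
  · rw [iteratedFDeriv_congr_spacelike (fun X hX => hext_dirD hF.mem v hX), mul_assoc]
    -- The extension of `dirD v F` is `rad` times a derivative of `hext F`: the factor `rad` only
    -- changes the constant, and the derivative costs one order.
    refine h _ (‖v‖ * A) (contDiffOn_fderiv_hext hF.mem v) (by positivity) (fun i hi Y hY => ?_) j hj X hX
    have h1 : ContDiffAt ℝ (⊤ : ℕ∞) (fderiv ℝ (hext F)) (Y : Mink d) :=
      (TestFn.contDiffAt hF.mem (spacelike_dS Y)).fderiv_right (by simp)
    refine (norm_iteratedFDeriv_clm_apply_const h1 (by exact_mod_cast le_top)).trans ?_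
    rw [norm_iteratedFDeriv_fderiv]
    gcongr
    exact hF.bound _ (by omega) Y hY

theorem BoundedOn.add {d : ℕ} {K : Set (dS d)} {N : ℕ} {A B : ℝ} {F G : dS d → ℂ}
    (hF : BoundedOn K N A F) (hG : BoundedOn K N B G) : BoundedOn K N (A + B) (F + G) := by
  refine ⟨Submodule.add_mem _ hF.mem hG.mem, ?_, fun j hj X hX => ?_⟩
  · exact (tsupport_add F G).trans (union_subset hF.supp hG.supp)
  · have e : hext (F + G) = hext F + hext G := by
      funext X; by_cases hX : mdot X X < 0 <;> simp [hext, hX]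
    rw [e, iteratedFDeriv_add_apply
      ((TestFn.contDiffAt hF.mem (spacelike_dS X)).of_le (by exact_mod_cast le_top))
      ((TestFn.contDiffAt hG.mem (spacelike_dS X)).of_le (by exact_mod_cast le_top))]
    exact (norm_add_le _ _).trans (add_le_add (hF.bound j hj X hX) (hG.bound j hj X hX))

theorem BoundedOn.smul {d : ℕ} {K : Set (dS d)} {N : ℕ} {A : ℝ} {F : dS d → ℂ}
    (hF : BoundedOn K N A F) (c : ℂ) : BoundedOn K N (‖c‖ * A) (c • F) := by
  refine ⟨Submodule.smul_mem _ _ hF.mem, ?_, fun j hj X hX => ?_⟩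
  · exact (tsupport_subset_of_eq_zero fun X hX => by
      simp [image_eq_zero_of_notMem_tsupport hX]).trans hF.supp
  · have e : hext (c • F) = c • hext F := by
      funext X; by_cases hX : mdot X X < 0 <;> simp [hext, hX]
    rw [e, iteratedFDeriv_const_smul_apply
      ((TestFn.contDiffAt hF.mem (spacelike_dS X)).of_le (by exact_mod_cast le_top)), norm_smul]
    gcongr
    exact hF.bound j hj X hX

theorem exists_boundedOn_timeOp {d : ℕ} {K : Set (dS d)} (hK : IsCompact K) (N : ℕ) (s : ℂ) :
    ∃ C, 0 ≤ C ∧ ∀ F A, 0 ≤ A → BoundedOn K (N + 1) A F → BoundedOn K N (C * A) (timeOp s F) := by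
  obtain ⟨C₁, h₁, k₁⟩ := exists_boundedOn_dirD hK N (Pi.single 0 1)
  obtain ⟨C₂, h₂, k₂⟩ := exists_boundedOn_coordMul hK N (Pi.single 0 1)
  refine ⟨C₁ + ‖(d : ℂ) + s‖ * C₂, by positivity, fun F A hA hF => ?_⟩
  exact ((k₁ F A hA hF).add ((k₂ F A hA (hF.mono (Nat.le_succ N) le_rfl)).smul _)).mono le_rfl
    (by rw [add_mul, mul_assoc])

/-! ### Rates in the regulator, and the bootstrap to the boundary value. -/

theorem norm_cpow_le_rpow {t η T : ℝ} (hη : 0 < η) (hη1 : η ≤ 1) (ht : |t| ≤ T) (s : ℂ) {b : ℝ}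
    (hb : 0 ≤ b) (hsb : -s.re ≤ b) :
    ‖((t : ℂ) + Complex.I * η) ^ s‖ ≤ Real.exp (Real.pi * |s.im|) * (T + 1) ^ |s.re| * η ^ (-b) := by
  set z : ℂ := (t : ℂ) + Complex.I * η
  have hT : 0 ≤ T := (abs_nonneg t).trans ht
  have hz1 : η ≤ ‖z‖ := by
    have := Complex.abs_im_le_norm z
    simp only [z, Complex.add_im, Complex.ofReal_im, Complex.mul_im, Complex.I_re, Complex.I_im,
      Complex.ofReal_re, zero_mul, one_mul, zero_add] at this
    exact (le_abs_self η).trans this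
  have hz2 : ‖z‖ ≤ T + 1 := by
    refine (norm_add_le _ _).trans (add_le_add (by simpa using ht) ?_)
    simp [abs_of_pos hη, hη1]
  have hz0 : 0 < ‖z‖ := hη.trans_le hz1
  -- The modulus of `z^s` is `|z|^{Re s}` times an exponential of `-arg z · Im s`, and `|arg z| ≤
  -- π`.
  have h1 : ‖z ^ s‖ ≤ ‖z‖ ^ s.re * Real.exp (Real.pi * |s.im|) := by
    refine (Complex.norm_cpow_le z s).trans ?_
    rw [div_eq_mul_inv, ← Real.exp_neg]
    gcongr
    calc -(z.arg * s.im) ≤ |z.arg * s.im| := neg_le_abs _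
      _ = |z.arg| * |s.im| := abs_mul _ _
      _ ≤ _ := by gcongr; exact Complex.abs_arg_le_pi z
  have hηb : 1 ≤ η ^ (-b) := Real.one_le_rpow_of_pos_of_le_one_of_nonpos hη hη1 (by linarith)
  have hTs : 1 ≤ (T + 1) ^ |s.re| := Real.one_le_rpow (by linarith) (abs_nonneg _)
  -- As `η ≤ |z| ≤ T + 1`, the upper bound serves for `Re s ≥ 0` and the lower one for `Re s ≤ 0`.
  have h2 : ‖z‖ ^ s.re ≤ (T + 1) ^ |s.re| * η ^ (-b) := by
    rcases le_total 0 s.re with h | h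
    · calc ‖z‖ ^ s.re ≤ (T + 1) ^ s.re := Real.rpow_le_rpow hz0.le hz2 h
        _ = (T + 1) ^ |s.re| * 1 := by rw [abs_of_nonneg h, mul_one]
        _ ≤ _ := by gcongr
    · calc ‖z‖ ^ s.re ≤ η ^ s.re := Real.rpow_le_rpow_of_nonpos hη hz1 h
        _ ≤ η ^ (-b) := Real.rpow_le_rpow_of_exponent_ge hη hη1 (by linarith)
        _ ≤ (T + 1) ^ |s.re| * η ^ (-b) := le_mul_of_one_le_left (by positivity) hTs
  calc ‖z ^ s‖ ≤ ((T + 1) ^ |s.re| * η ^ (-b)) * Real.exp (Real.pi * |s.im|) := by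
        refine h1.trans ?_
        gcongr
    _ = _ := by ring

/-- A family of functions of the regulator that is bounded by `η^{-b}`, uniformly on the sphere and
locally in the topology of test functions. -/
def HasRate {d : ℕ} (K : Set (dS d)) (J : (dS d → ℂ) → Mink d → ℝ → ℂ) (b : ℝ) : Prop :=
  ∃ (C : ℝ) (N : ℕ), 0 ≤ C ∧ ∀ F A, 0 ≤ A → BoundedOn K N A F → ∀ (p : Sph d) (η : ℝ), 0 < η →
    η ≤ 1 → ‖J F (basePt p : Mink d) η‖ ≤ C * A * η ^ (-b)

theorem exists_bound_mdot {d : ℕ} {K : Set (dS d)} (hK : IsCompact K) :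
    ∃ T, 0 ≤ T ∧ ∀ X ∈ K, ∀ p : Sph d, |mdot (X : Mink d) (basePt p : Mink d)| ≤ T := by
  have h : Continuous fun Z : dS d × Sph d => mdot (Z.1 : Mink d) (basePt Z.2 : Mink d) :=
    continuous_mdot.comp ((continuous_subtype_val.comp continuous_fst).prodMk
      (continuous_subtype_val.comp (continuous_basePt.comp continuous_snd)))
  obtain ⟨T, hT⟩ := (hK.prod isCompact_univ).exists_bound_of_continuousOn h.continuousOn
  refine ⟨|T|, abs_nonneg T, fun X hX p => ?_⟩
  exact (hT (X, p) ⟨hX, mem_univ p⟩).trans (le_abs_self T)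

/-- The crude bound from which the bootstrap starts: the kernel is of order `η^{-b}` uniformly on
`K`, and `K` has finite volume. Only the supremum of `F` enters, hence `N = 0`. -/
theorem hasRate_regInt_of_le {d : ℕ} {K : Set (dS d)} (hK : IsCompact K) (s : ℂ) {b : ℝ}
    (hb : 0 ≤ b) (hsb : -s.re ≤ b) : HasRate K (regInt s) b := by
  obtain ⟨T, hT0, hT⟩ := exists_bound_mdot hK
  set M := Real.exp (Real.pi * |s.im|) * (T + 1) ^ |s.re|
  have hM : 0 ≤ M := by positivity
  refine ⟨M * (dSmeas d).real K, 0, by positivity, fun F A hA hF p η hη hη1 => ?_⟩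
  have h1 : regInt s F (basePt p : Mink d) η =
      ∫ X in K, F X * waveKer s (basePt p : Mink d) η X ∂dSmeas d := by
    rw [regInt, setIntegral_eq_integral_of_forall_compl_eq_zero]
    intro X hX
    rw [image_eq_zero_of_notMem_tsupport fun h => hX (hF.supp h), zero_mul]
  rw [h1]
  calc _ ≤ (A * (M * η ^ (-b))) * (dSmeas d).real K := by
        refine norm_setIntegral_le_of_norm_le_const hK.measure_lt_top fun X hX => ?_
        rw [norm_mul]
        exact mul_le_mul (hF.norm_le hX) (norm_cpow_le_rpow hη hη1 (hT X hX p) s hb hsb)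
          (norm_nonneg _) hA
    _ = _ := by ring

/-- In `regInt_by_parts` the first term is an integral with exponent `s`, of rate `b`, and the
second one has the rate `b + 1` but carries a factor `η`. The price is one more derivative of `F`.
-/
theorem HasRate.deriv_improve {d : ℕ} {K : Set (dS d)} (hK : IsCompact K) {s : ℂ} {b : ℝ}
    (h : HasRate K (regInt s) b) (h' : HasRate K (fun F P η => s * regInt (s - 1) F P η) (b + 1)) :
    HasRate K (fun F P η => s * regInt (s - 1) F P η) b := by
  obtain ⟨C, N, hC, k⟩ := h
  obtain ⟨C', N', hC', k'⟩ := h'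
  obtain ⟨D, hD, l⟩ := exists_boundedOn_timeOp hK N s
  obtain ⟨D', hD', l'⟩ := exists_boundedOn_coordMul hK N' (Pi.single 0 1)
  refine ⟨C * D + C' * D', max (N + 1) N', by positivity, fun F A hA hF p η hη hη1 => ?_⟩
  have hp : (basePt p : Mink d) 0 = 1 := by simp [basePt]
  beta_reduce
  rw [regInt_by_parts hF.mem s hp hη]
  have k1 := k _ _ (by positivity) (l F A hA (hF.mono (le_max_left _ _) le_rfl)) p η hη hη1
  have k2 := k' _ _ (by positivity) (l' F A hA (hF.mono (le_max_right _ _) le_rfl)) p η hη hη1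
  have hpow : η * η ^ (-(b + 1)) = η ^ (-b) := by
    nth_rewrite 1 [← Real.rpow_one η]
    rw [← Real.rpow_add hη]; ring_nf
  calc _ ≤ C * (D * A) * η ^ (-b) + η * (C' * (D' * A) * η ^ (-(b + 1))) := by
        refine (norm_add_le _ _).trans (add_le_add (by rwa [norm_neg]) ?_)
        rw [norm_mul, norm_mul, Complex.norm_I, one_mul, Complex.norm_real, Real.norm_eq_abs,
          abs_of_pos hη]
        gcongr
    _ = (C * D + C' * D') * A * η ^ (-b) := by rw [← hpow]; ring

/-- The mean value inequality for the regularized transform. -/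
theorem norm_regInt_sub_le {d : ℕ} {F : dS d → ℂ} (hF : F ∈ TestFn d) (s : ℂ) (P : Mink d)
    {B B' : ℝ → ℝ} {x y : ℝ} (hx : 0 < x) (hxy : x ≤ y)
    (hB : ∀ η ∈ Icc x y, HasDerivAt B (B' η) η)
    (h : ∀ η ∈ Ico x y, ‖s * regInt (s - 1) F P η‖ ≤ B' η) :
    ‖regInt s F P y - regInt s F P x‖ ≤ B y - B x := by
  have hd : ∀ η ∈ Icc x y, HasDerivAt (fun η => regInt s F P η - regInt s F P x)
      (Complex.I * (s * regInt (s - 1) F P η)) η := fun η hη =>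
    (hasDerivAt_regInt hF s P (hx.trans_le hη.1)).sub_const _
  refine image_norm_le_of_norm_deriv_right_le_deriv_boundary'
    (f := fun η => regInt s F P η - regInt s F P x)
    (f' := fun η => Complex.I * (s * regInt (s - 1) F P η)) (B := fun η => B η - B x) (B' := B')
    (fun η hη => (hd η hη).continuousAt.continuousWithinAt)
    (fun η hη => (hd η (Ico_subset_Icc_self hη)).hasDerivWithinAt) (by simp)
    (fun η hη => ((hB η hη).sub_const _).continuousAt.continuousWithinAt)
    (fun η hη => ((hB η (Ico_subset_Icc_self hη)).sub_const _).hasDerivWithinAt)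
    (fun η hη => ?_) (right_mem_Icc.mpr hxy)
  rw [norm_mul, Complex.norm_I, one_mul]
  exact h η hη

/-- Integrate the derivative from `η` to `1`. As `1 < b`, the primitive of `x^{-b}` is of order
`η^{-(b-1)}`, and the value at `1` is under control by the crude bound. -/
theorem HasRate.integrate {d : ℕ} {K : Set (dS d)} (hK : IsCompact K) {s : ℂ} {b : ℝ} (hb : 1 < b)
    (h : HasRate K (fun F P η => s * regInt (s - 1) F P η) b) : HasRate K (regInt s) (b - 1) := by
  obtain ⟨C, N, hC, k⟩ := h
  obtain ⟨C', N', hC', k'⟩ := hasRate_regInt_of_le hK s (abs_nonneg s.re) (neg_le_abs s.re)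
  have hb1 : 0 < b - 1 := by linarith
  refine ⟨C' + C / (b - 1), max N N', by positivity, fun F A hA hF p η hη hη1 => ?_⟩
  have h1 := k' F A hA (hF.mono (le_max_right _ _) le_rfl) p 1 one_pos le_rfl
  rw [Real.one_rpow, mul_one] at h1
  have hA' : 0 ≤ C * A := by positivity
  have h2 := norm_regInt_sub_le hF.mem s (basePt p : Mink d)
    (B := fun x => C * A * (-(x ^ (-(b - 1))) / (b - 1))) (B' := fun x => C * A * x ^ (-b)) hη hη1
    (fun x hx => by
      have hx0 : x ≠ 0 := (hη.trans_le hx.1).ne'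
      have := (((Real.hasDerivAt_rpow_const (p := -(b - 1)) (Or.inl hx0)).neg).div_const
        (b - 1)).const_mul (C * A)
      refine this.congr_deriv ?_
      rw [show -(b - 1) - 1 = -b by ring]
      field_simp)
    (fun x hx => k F A hA (hF.mono (le_max_left _ _) le_rfl) p x (hη.trans_le hx.1) hx.2.le)
  have hη' : 1 ≤ η ^ (-(b - 1)) :=
    Real.one_le_rpow_of_pos_of_le_one_of_nonpos hη hη1 (by linarith)
  have h3 : ‖regInt s F (basePt p : Mink d) η‖ ≤ C' * A + (C * A * (η ^ (-(b - 1)) / (b - 1))) := by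
    have h4 := norm_sub_norm_le (regInt s F (basePt p : Mink d) η) (regInt s F (basePt p : Mink d) 1)
    rw [norm_sub_rev] at h4
    have h5 : 0 ≤ C * A * (1 / (b - 1)) := by positivity
    simp only [Real.one_rpow] at h2
    have : C * A * (-1 / (b - 1)) - C * A * (-η ^ (-(b - 1)) / (b - 1)) =
      C * A * (η ^ (-(b - 1)) / (b - 1)) - C * A * (1 / (b - 1)) := by ring
    linarith
  refine h3.trans ?_
  calc _ ≤ C' * A * η ^ (-(b - 1)) + C * A * (η ^ (-(b - 1)) / (b - 1)) := by
        refine add_le_add ?_ le_rfl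
        exact le_mul_of_one_le_right (by positivity) hη'
    _ = _ := by ring

/-- Improving the derivative by parts and integrating it again lowers both rates by one, so the
rates descend through the numbers `n + 1/2`. Half-integers avoid the rate `1`, whose integral is a
logarithm, and end at `1/2`, which is integrable at `0`. -/
theorem hasRate_deriv_half {d : ℕ} {K : Set (dS d)} (hK : IsCompact K) (s : ℂ) :
    HasRate K (fun F P η => s * regInt (s - 1) F P η) (1 / 2) := by
  have key : ∀ n : ℕ, HasRate K (regInt s) (n + 1 / 2) →
      HasRate K (fun F P η => s * regInt (s - 1) F P η) (n + 1 / 2 + 1) →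
      HasRate K (fun F P η => s * regInt (s - 1) F P η) (1 / 2) := by
    intro n
    induction n with
    | zero => intro h h'; simpa using h.deriv_improve hK h'
    | succ n ih =>
      intro h h'
      have h1 := h.deriv_improve hK h'
      have h2 := HasRate.integrate hK (by push_cast; linarith [(Nat.cast_nonneg n : (0 : ℝ) ≤ n)]) h1
      refine ih ?_ ?_
      · convert h2 using 1; push_cast; ring
      · convert h1 using 1; push_cast; ring
  -- The descent starts at `n + 1/2` with `n ≥ |Re s|`, where the crude bound applies to the
  -- exponents `s` and `s - 1`.
  obtain ⟨n, hn⟩ := exists_nat_ge |s.re|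
  have hs := neg_le_abs s.re
  refine key n (hasRate_regInt_of_le hK s (by positivity) (by linarith)) ?_
  obtain ⟨C, N, hC, k⟩ := hasRate_regInt_of_le hK (s - 1) (b := n + 1 / 2 + 1) (by positivity)
    (by simp; linarith)
  refine ⟨‖s‖ * C, N, by positivity, fun F A hA hF p η hη hη1 => ?_⟩
  rw [norm_mul, mul_assoc, mul_assoc, ← mul_assoc C]
  gcongr
  exact k F A hA hF p η hη hη1

/-- The boundary values of the regularized transform exist, for all exponents, and are bounded by a
`C^N` norm uniformly on the sphere. -/
theorem exists_tendsto_regInt {d : ℕ} {K : Set (dS d)} (hK : IsCompact K) (s : ℂ) :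
    ∃ (C : ℝ) (N : ℕ), 0 ≤ C ∧ ∀ F A, 0 ≤ A → BoundedOn K N A F → ∀ p : Sph d,
      ∃ L, Tendsto (regInt s F (basePt p : Mink d)) (𝓝[>] 0) (𝓝 L) ∧ ‖L‖ ≤ C * A := by
  obtain ⟨C, N, hC, k⟩ := hasRate_deriv_half hK s
  obtain ⟨C', N', hC', k'⟩ := hasRate_regInt_of_le hK s (abs_nonneg s.re) (neg_le_abs s.re)
  refine ⟨C' + 2 * C, max N N', by positivity, fun F A hA hF p => ?_⟩
  -- The rate `η^{-1/2}` of the derivative integrates to `2√η`. This makes the family Cauchy at `0`;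
  -- taking `y = 1` it also bounds the limit.
  have hsub : ∀ x y : ℝ, 0 < x → x ≤ y → y ≤ 1 →
      ‖regInt s F (basePt p : Mink d) y - regInt s F (basePt p : Mink d) x‖ ≤
        2 * C * A * √y - 2 * C * A * √x := by
    intro x y hx hxy hy
    refine norm_regInt_sub_le hF.mem s (basePt p : Mink d)
      (B := fun x => 2 * C * A * √x) (B' := fun x => C * A * x ^ (-(1 / 2 : ℝ))) hx hxy
      (fun z hz => ?_)
      (fun z hz => k F A hA (hF.mono (le_max_left _ _) le_rfl) p z (hx.trans_le hz.1)
        (hz.2.le.trans hy))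
    have hz0 : 0 < z := hx.trans_le hz.1
    have := (Real.hasDerivAt_sqrt hz0.ne').const_mul (2 * C * A)
    refine this.congr_deriv ?_
    rw [Real.rpow_neg hz0.le, ← Real.sqrt_eq_rpow]
    field_simp
  have hM : 0 ≤ 2 * C * A := by positivity
  have hex : ∃ L, Tendsto (regInt s F (basePt p : Mink d)) (𝓝[>] 0) (𝓝 L) := by
    rw [← cauchy_map_iff_exists_tendsto, Metric.cauchy_iff]
    refine ⟨inferInstance, fun ε hε => ?_⟩
    have ht : Tendsto (fun x => 2 * C * A * √x) (𝓝[>] 0) (𝓝 0) := by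
      have : Continuous fun x => 2 * C * A * √x := by fun_prop
      have := (this.tendsto 0).mono_left (nhdsWithin_le_nhds (s := Ioi (0 : ℝ)))
      simpa using this
    have hev : ∀ᶠ x in 𝓝[>] (0 : ℝ), 2 * C * A * √x < ε ∧ 0 < x ∧ x ≤ 1 := by
      filter_upwards [ht.eventually (gt_mem_nhds hε), self_mem_nhdsWithin,
        nhdsWithin_le_nhds (Iic_mem_nhds (zero_lt_one' ℝ))] with x h1 h2 h3 using ⟨h1, h2, h3⟩
    refine ⟨_, image_mem_map hev, ?_⟩
    have aux : ∀ x y : ℝ, x ≤ y → 0 < x → y ≤ 1 → 2 * C * A * √y < ε →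
        ‖regInt s F (basePt p : Mink d) y - regInt s F (basePt p : Mink d) x‖ < ε := by
      intro x y hxy hx hy h
      have := hsub x y hx hxy hy
      have h0 : 0 ≤ 2 * C * A * √x := by positivity
      linarith
    rintro _ ⟨x, ⟨h1, h2, h3⟩, rfl⟩ _ ⟨y, ⟨k1, k2, k3⟩, rfl⟩
    rw [dist_eq_norm]
    rcases le_total x y with h | h
    · rw [norm_sub_rev]; exact aux x y h h2 k3 k1
    · exact aux y x h k2 h3 h1
  obtain ⟨L, hL⟩ := hex
  refine ⟨L, hL, ?_⟩
  refine le_of_tendsto hL.norm ?_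
  filter_upwards [self_mem_nhdsWithin, nhdsWithin_le_nhds (Iic_mem_nhds (zero_lt_one' ℝ))]
    with x hx hx1
  have h1 := k' F A hA (hF.mono (le_max_right _ _) le_rfl) p 1 one_pos le_rfl
  rw [Real.one_rpow, mul_one] at h1
  have h2 := hsub x 1 hx hx1 le_rfl
  have h3 := norm_sub_norm_le (regInt s F (basePt p : Mink d) x) (regInt s F (basePt p : Mink d) 1)
  rw [norm_sub_rev] at h3
  have h0 : 0 ≤ 2 * C * A * √x := by positivity
  rw [Real.sqrt_one, mul_one] at h2
  have : (C' + 2 * C) * A = C' * A + 2 * C * A := by ring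
  linarith

/-! ### The Fourier-Helgason transform -/

theorem ofReal_mul_cpow {c : ℝ} (hc : 0 < c) {z : ℂ} (hz : z ≠ 0) (s : ℂ) :
    ((c : ℂ) * z) ^ s = (c : ℂ) ^ s * z ^ s := by
  have hc' : (c : ℂ) ≠ 0 := by exact_mod_cast hc.ne'
  rw [Complex.cpow_def_of_ne_zero (mul_ne_zero hc' hz), Complex.cpow_def_of_ne_zero hc',
    Complex.cpow_def_of_ne_zero hz, Complex.log_ofReal_mul hc hz, add_mul, Complex.exp_add,
    Complex.ofReal_log hc.le]

/-- The regulator has to be scaled along with `P`. This is why the regulator `ε P₀` of `fhReg` gives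
homogeneous functions. -/
theorem regInt_scale {d : ℕ} (s : ℂ) (F : dS d → ℂ) (P : Mink d) {c η : ℝ} (hc : 0 < c)
    (hη : 0 < η) : regInt s F (c • P) (c * η) = (c : ℂ) ^ s * regInt s F P η := by
  rw [regInt, regInt, ← integral_const_mul]
  refine integral_congr_ae (Eventually.of_forall fun X => ?_)
  have hz := Complex.slitPlane_ne_zero (mem_slitPlane_of_pos (mdot (X : Mink d) P) hη)
  simp only [waveKer]
  rw [mdot_smul_right, show ((c * mdot (X : Mink d) P : ℝ) : ℂ) + Complex.I * ((c * η : ℝ) : ℂ) =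
    (c : ℂ) * ((mdot (X : Mink d) P : ℂ) + Complex.I * (η : ℂ)) by push_cast; ring,
    ofReal_mul_cpow hc hz]
  ring

theorem tendsto_mul_const_nhdsGT {c : ℝ} (hc : 0 < c) :
    Tendsto (fun ε : ℝ => ε * c) (𝓝[>] 0) (𝓝[>] 0) := by
  refine tendsto_nhdsWithin_of_tendsto_nhds_of_eventually_within _ ?_ ?_
  · have : Continuous fun ε : ℝ => ε * c := by fun_prop
    simpa using (this.tendsto 0).mono_left (nhdsWithin_le_nhds (s := Ioi (0 : ℝ)))
  · filter_upwards [self_mem_nhdsWithin] with ε hε using mul_pos hε hc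

theorem exists_tendsto_regInt_cone {d : ℕ} {F : dS d → ℂ} (hF : F ∈ TestFn d) (s : ℂ) (P : Cone d) :
    ∃ L, Tendsto (regInt s F (P : Mink d)) (𝓝[>] 0) (𝓝 L) := by
  obtain ⟨C, N, hC, h⟩ := exists_tendsto_regInt hF.2 s
  obtain ⟨A, hA, hFA⟩ := TestFn.exists_boundedOn hF hF.2 subset_rfl N
  obtain ⟨p, hp⟩ := Cone.exists_base P
  obtain ⟨L, hL, -⟩ := h F A hA hFA p
  set c := (P : Mink d) 0
  have hc : 0 < c := P.2.2
  refine ⟨(c : ℂ) ^ s * L, ?_⟩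
  have h1 := (hL.comp (tendsto_mul_const_nhdsGT (inv_pos.mpr hc))).const_mul ((c : ℂ) ^ s)
  refine h1.congr' ?_
  filter_upwards [self_mem_nhdsWithin] with η hη
  have hPp : (P : Mink d) = c • (basePt p : Mink d) := congrArg Subtype.val hp
  have h2 := regInt_scale s F (basePt p : Mink d) hc (mul_pos hη (inv_pos.mpr hc))
  rw [← hPp, mul_comm c, mul_assoc, inv_mul_cancel₀ hc.ne', mul_one] at h2
  exact h2.symm

theorem fhReg_eq {d : ℕ} (ν : ℂ) (F : dS d → ℂ) (P : Cone d) (ε : ℝ) :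
    fhReg ν F P ε = regInt (deg d ν) F (P : Mink d) (ε * (P : Mink d) 0) := rfl

theorem tendsto_fhReg {d : ℕ} {F : dS d → ℂ} (hF : F ∈ TestFn d) (ν : ℂ) (P : Cone d) :
    Tendsto (fhReg ν F P) (𝓝[>] 0) (𝓝 (fourierHelgason ν F P)) := by
  obtain ⟨L, hL⟩ := exists_tendsto_regInt_cone hF (deg d ν) P
  exact tendsto_nhds_limUnder ⟨L, hL.comp (tendsto_mul_const_nhdsGT P.2.2)⟩

/-- The regulators `ε P₀` and `η` differ by a positive factor at fixed `P`, hence give the same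
limit. The second one is needed for Lorentz covariance, because `P₀` is not invariant. -/
theorem tendsto_regInt {d : ℕ} {F : dS d → ℂ} (hF : F ∈ TestFn d) (ν : ℂ) (P : Cone d) :
    Tendsto (regInt (deg d ν) F (P : Mink d)) (𝓝[>] 0) (𝓝 (fourierHelgason ν F P)) := by
  obtain ⟨L, hL⟩ := exists_tendsto_regInt_cone hF (deg d ν) P
  have h1 : Tendsto (fhReg ν F P) (𝓝[>] 0) (𝓝 L) := hL.comp (tendsto_mul_const_nhdsGT P.2.2)
  rwa [tendsto_nhds_unique (tendsto_fhReg hF ν P) h1]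

theorem fourierHelgason_eq_of_tendsto {d : ℕ} {F : dS d → ℂ} (hF : F ∈ TestFn d) {ν : ℂ}
    {P : Cone d} {L : ℂ} (h : Tendsto (regInt (deg d ν) F (P : Mink d)) (𝓝[>] 0) (𝓝 L)) :
    fourierHelgason ν F P = L :=
  tendsto_nhds_unique (tendsto_regInt hF ν P) h

theorem fourierHelgason_scale {d : ℕ} {F : dS d → ℂ} (hF : F ∈ TestFn d) (ν : ℂ) {t : ℝ}
    (ht : 0 < t) (P : Cone d) :
    fourierHelgason ν F (Cone.scale t ht P) = (t : ℂ) ^ deg d ν * fourierHelgason ν F P := by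
  refine tendsto_nhds_unique (tendsto_fhReg hF ν _)
    (((tendsto_fhReg hF ν P).const_mul ((t : ℂ) ^ deg d ν)).congr' ?_)
  filter_upwards [self_mem_nhdsWithin] with ε hε
  rw [fhReg_eq, fhReg_eq, ← regInt_scale _ _ _ ht (mul_pos hε P.2.2)]
  simp only [Cone.scale, Pi.smul_apply, smul_eq_mul]
  ring_nf

theorem regInt_comp_dSact {d : ℕ} (s : ℂ) (F : dS d → ℂ) (Λ : SOup d) (P : Mink d) (η : ℝ) :
    regInt s (fun X => F (dSact Λ⁻¹ X)) P η = regInt s F ((Λ⁻¹).1 P) η := by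
  have h := (measurePreserving_dSact Λ⁻¹).integral_comp (dSactHomeo Λ⁻¹).measurableEmbedding
    (fun X => F X * waveKer s ((Λ⁻¹).1 P) η X)
  rw [regInt, regInt, ← h]
  refine integral_congr_ae (Eventually.of_forall fun X => ?_)
  simp only [waveKer]
  rw [show mdot (dSact Λ⁻¹ X : Mink d) ((Λ⁻¹).1 P) = mdot (X : Mink d) P from mdot_SOup Λ⁻¹ X P]

theorem fourierHelgason_comp_dSact {d : ℕ} {F : dS d → ℂ} (hF : F ∈ TestFn d) (ν : ℂ) (Λ : SOup d)
    (P : Cone d) :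
    fourierHelgason ν (fun X => F (dSact Λ⁻¹ X)) P = fourierHelgason ν F (coneAct Λ⁻¹ P) := by
  refine fourierHelgason_eq_of_tendsto (TestFn.comp_dSact hF Λ⁻¹) ?_
  exact (tendsto_regInt hF ν (coneAct Λ⁻¹ P)).congr fun η =>
    (regInt_comp_dSact (deg d ν) F Λ (P : Mink d) η).symm

theorem fourierHelgason_add {d : ℕ} {F G : dS d → ℂ} (hF : F ∈ TestFn d) (hG : G ∈ TestFn d)
    (ν : ℂ) : fourierHelgason ν (F + G) = fourierHelgason ν F + fourierHelgason ν G := by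
  funext P
  refine fourierHelgason_eq_of_tendsto (Submodule.add_mem _ hF hG)
    (((tendsto_regInt hF ν P).add (tendsto_regInt hG ν P)).congr' ?_)
  filter_upwards [self_mem_nhdsWithin] with η hη using (regInt_add hF hG _ _ hη).symm

theorem fourierHelgason_smul {d : ℕ} {F : dS d → ℂ} (hF : F ∈ TestFn d) (c : ℂ)
    (ν : ℂ) : fourierHelgason ν (c • F) = c • fourierHelgason ν F := by
  funext P
  exact fourierHelgason_eq_of_tendsto (Submodule.smul_mem _ c hF)
    (((tendsto_regInt hF ν P).const_mul c).congr fun η => (regInt_smul c F _ _ η).symm)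

/-- A pointwise limit, along `ε = 1/(n+1)`, of integrals that depend on `P` as a parameter through a
continuous integrand. -/
theorem measurable_fourierHelgason {d : ℕ} {F : dS d → ℂ} (hF : F ∈ TestFn d) (ν : ℂ) :
    Measurable (fourierHelgason ν F) := by
  have hε : ∀ n : ℕ, 0 < 1 / ((n : ℝ) + 1) := fun n => by positivity
  have hlim : Tendsto (fun n : ℕ => 1 / ((n : ℝ) + 1)) atTop (𝓝[>] 0) :=
    tendsto_nhdsWithin_of_tendsto_nhds_of_eventually_within _ tendsto_one_div_add_atTop_nhds_zero_nat
      (Eventually.of_forall hε)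
  refine measurable_of_tendsto_metrizable (f := fun (n : ℕ) P => fhReg ν F P (1 / ((n : ℝ) + 1)))
    (fun n => ?_) (tendsto_pi_nhds.mpr fun P => (tendsto_fhReg hF ν P).comp hlim)
  have hc : Continuous fun Z : Cone d × dS d => F Z.2 *
      (((mdot (Z.2 : Mink d) Z.1 : ℝ) : ℂ) +
        Complex.I * ((1 / ((n : ℝ) + 1) * (Z.1 : Mink d) 0 : ℝ) : ℂ)) ^ deg d ν := by
    refine ((TestFn.continuous hF).comp continuous_snd).mul
      (Continuous.cpow ?_ continuous_const fun Z => mem_slitPlane_of_pos _ (mul_pos (hε n) Z.1.2.2))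
    refine (Complex.continuous_ofReal.comp (continuous_mdot.comp
      ((continuous_subtype_val.comp continuous_snd).prodMk
        (continuous_subtype_val.comp continuous_fst)))).add
      (continuous_const.mul (Complex.continuous_ofReal.comp ?_))
    exact continuous_const.mul ((continuous_apply 0).comp (continuous_subtype_val.comp continuous_fst))
  exact (hc.stronglyMeasurable.integral_prod_right' (ν := dSmeas d)).measurable

/-- The transform is bounded on the sphere by a `C^N` norm. -/
theorem exists_norm_fourierHelgason_le {d : ℕ} {K : Set (dS d)} (hK : IsCompact K) (ν : ℂ) :
    ∃ (C : ℝ) (N : ℕ), 0 ≤ C ∧ ∀ F A, 0 ≤ A → BoundedOn K N A F → ∀ p : Sph d,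
      ‖fourierHelgason ν F (basePt p)‖ ≤ C * A := by
  obtain ⟨C, N, hC, h⟩ := exists_tendsto_regInt hK (deg d ν)
  refine ⟨C, N, hC, fun F A hA hF p => ?_⟩
  obtain ⟨L, hL, hLC⟩ := h F A hA hF p
  rwa [fourierHelgason_eq_of_tendsto hF.mem hL]

/-! ### The Klein-Gordon equation -/

/-- Integrate by parts once in each coordinate direction `e_a` and sum with the signs of the metric.
The terms with the factor `X · e_a` add up to the derivative of `F` in the direction `X`, which is
`0`, and those with `e_a · P` to the derivative in the direction `P`. -/
theorem regInt_box {d : ℕ} {F : dS d → ℂ} (hF : F ∈ TestFn d) (s : ℂ) (P : Mink d) {η : ℝ}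
    (hη : 0 < η) : regInt s (box F) P η = -(s * regInt (s - 1) (dirD P F) P η) := by
  let e : Fin (d + 1) → Mink d := fun a => Pi.single a 1
  let g : Fin (d + 1) → dS d → ℂ := fun a X =>
    (dirD (e a) (dirD (e a) F) X + d * (mdot (X : Mink d) (e a) : ℂ) * dirD (e a) F X) *
      waveKer s P η X + dirD (e a) F X * (s * waveKer (s - 1) P η X *
        ((mdot (e a) P : ℂ) + mdot (X : Mink d) P * mdot (X : Mink d) (e a)))
  have hg0 : ∀ a, ∫ X, g a X ∂dSmeas d = 0 := fun a =>
    integral_dS_by_parts (TestFn.dirD hF (e a)) (e a) P hη s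
  have hgi : ∀ a, Integrable (g a) (dSmeas d) := fun a => by
    have h1 := integrable_waveKer (Submodule.add_mem _ (TestFn.dirD (TestFn.dirD hF (e a)) (e a))
      (Submodule.smul_mem _ (d : ℂ) (TestFn.coordMul (TestFn.dirD hF (e a)) (e a)))) s P hη
    have h2 := integrable_mul_of_continuous (TestFn.dirD hF (e a))
      (g := fun X => s * waveKer (s - 1) P η X *
        ((mdot (e a) P : ℂ) + mdot (X : Mink d) P * mdot (X : Mink d) (e a)))
      ((continuous_const.mul (continuous_waveKer (s - 1) P hη)).mul (continuous_const.add
        ((Complex.continuous_ofReal.comp (continuous_mdot_dS P)).mul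
          (Complex.continuous_ofReal.comp (continuous_mdot_dS (e a))))))
    refine (h1.add h2).congr (Eventually.of_forall fun X => ?_)
    simp only [g, coordMul, Pi.add_apply, Pi.smul_apply, smul_eq_mul, mul_assoc]
  have hsum : ∫ X, ∑ a, (msign d a : ℂ) * g a X ∂dSmeas d = 0 := by
    rw [integral_finsetSum _ fun a _ => (hgi a).const_mul _]
    refine Finset.sum_eq_zero fun a _ => ?_
    rw [integral_const_mul, hg0, mul_zero]
  have h1 := integrable_waveKer (TestFn.box hF) s P hη
  have h2 := (integrable_waveKer (TestFn.dirD hF P) (s - 1) P hη).const_mul s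
  have key : regInt s (box F) P η + s * regInt (s - 1) (dirD P F) P η = 0 := by
    rw [← hsum, regInt, regInt, ← integral_const_mul, ← integral_add h1 h2]
    refine integral_congr_ae (Eventually.of_forall fun X => ?_)
    have k1 := box_eq_sum hF X
    have k2 : ∑ a, (msign d a : ℂ) * (mdot (X : Mink d) (e a) : ℂ) * dirD (e a) F X = 0 := by
      rw [← dirD_self hF X, ← sum_coord_dirD]
      refine Finset.sum_congr rfl fun a _ => ?_
      rw [mdot_single, ← Complex.ofReal_mul, ← mul_assoc, msign_mul_self, one_mul]
    have k3 : ∑ a, (msign d a : ℂ) * (mdot (e a) P : ℂ) * dirD (e a) F X = dirD P F X := by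
      rw [← sum_coord_dirD]
      refine Finset.sum_congr rfl fun a _ => ?_
      rw [mdot_comm, mdot_single, ← Complex.ofReal_mul, ← mul_assoc, msign_mul_self, one_mul]
    have k4 : ∑ a, (msign d a : ℂ) * g a X =
        (∑ a, (msign d a : ℂ) * dirD (e a) (dirD (e a) F) X) * waveKer s P η X +
        (d * waveKer s P η X + s * waveKer (s - 1) P η X * mdot (X : Mink d) P) *
          (∑ a, (msign d a : ℂ) * (mdot (X : Mink d) (e a) : ℂ) * dirD (e a) F X) +
        s * waveKer (s - 1) P η X *
          (∑ a, (msign d a : ℂ) * (mdot (e a) P : ℂ) * dirD (e a) F X) := by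
      rw [Finset.sum_mul, Finset.mul_sum, Finset.mul_sum, ← Finset.sum_add_distrib,
        ← Finset.sum_add_distrib]
      refine Finset.sum_congr rfl fun a _ => ?_
      simp only [g]; ring
    beta_reduce
    rw [k4, k2, k3, ← k1]; ring
  linear_combination key

/-- Here `P` is also the direction of the derivative. Since `P · P = 0`, the tangential derivative
of `X · P` is `(X · P)²`, so that all terms are kernels with a polynomial in `X · P`. Expanding in
`X · P + iη` leaves the exponent `s + 1` and errors with factors `η` and `η²`. -/
theorem regInt_dirD_null {d : ℕ} {F : dS d → ℂ} (hF : F ∈ TestFn d) (s : ℂ) {P : Mink d}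
    (hP : mdot P P = 0) {η : ℝ} (hη : 0 < η) :
    regInt s (dirD P F) P η = -((d + s) * regInt (s + 1) F P η) +
      Complex.I * η * (d + 2 * s) * regInt s F P η + η ^ 2 * s * regInt (s - 1) F P η := by
  have h := integral_dS_by_parts hF P P hη s
  have h0 := integrable_waveKer (TestFn.dirD hF P) s P hη
  have h1 := (integrable_waveKer hF (s + 1) P hη).const_mul (d + s : ℂ)
  have h2 := (integrable_waveKer hF s P hη).const_mul (Complex.I * η * (d + 2 * s))
  have h3 := (integrable_waveKer hF (s - 1) P hη).const_mul ((η : ℂ) ^ 2 * s)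
  have e : regInt s (dirD P F) P η + (d + s) * regInt (s + 1) F P η -
      Complex.I * η * (d + 2 * s) * regInt s F P η - η ^ 2 * s * regInt (s - 1) F P η = 0 := by
    rw [← h]
    simp only [regInt]
    rw [← integral_const_mul, ← integral_const_mul, ← integral_const_mul, ← integral_add h0 h1,
      ← integral_sub (f := fun X => dirD P F X * waveKer s P η X + _) (h0.add h1) h2,
      ← integral_sub (f := fun X => dirD P F X * waveKer s P η X + _ - _) ((h0.add h1).sub h2) h3]
    refine integral_congr_ae (Eventually.of_forall fun X => ?_)
    have k1 := mul_waveKer s P hη X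
    have k2 := mul_waveKer (s + 1) P hη X
    rw [add_sub_cancel_right] at k2
    beta_reduce
    rw [hP]
    change _ = (_ + _) * waveKer s P η X + F X * (s * waveKer (s - 1) P η X * _)
    set t : ℂ := (mdot (X : Mink d) P : ℂ)
    have k3 : waveKer (s + 1) P η X = t * waveKer s P η X + Complex.I * η * waveKer s P η X := by
      linear_combination -k2
    have k4 : waveKer s P η X = t * waveKer (s - 1) P η X + Complex.I * η * waveKer (s - 1) P η X := by
      linear_combination -k1
    rw [k3, k4]
    push_cast
    linear_combination (F X * s * η ^ 2 * waveKer (s - 1) P η X) * (-Complex.I_sq)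
  linear_combination e

/-- For `η > 0` the identities `regInt_box` and `regInt_dirD_null` give the coefficient `s (s + d -
1) + α² + ν²`, which is `0` for `s = -α - iν` and `d = 2α + 1`. The remaining terms carry factors
`η` and `η²` in front of integrals with exponents `s - 1` and `s - 2`. They tend to `0` because
boundary values exist for all exponents. -/
theorem fourierHelgason_kleinGordon {d : ℕ} {F : dS d → ℂ} (hF : F ∈ TestFn d) (ν : ℂ) :
    fourierHelgason ν (fun X => box F X + ((alpha d : ℂ) ^ 2 + ν ^ 2) * F X) = 0 := by
  funext P
  set s := deg d ν with hs
  have hG : (fun X => box F X + ((alpha d : ℂ) ^ 2 + ν ^ 2) * F X) =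
      box F + ((alpha d : ℂ) ^ 2 + ν ^ 2) • F := rfl
  rw [hG]
  have hm := Submodule.smul_mem _ ((alpha d : ℂ) ^ 2 + ν ^ 2) hF
  refine fourierHelgason_eq_of_tendsto (Submodule.add_mem _ (TestFn.box hF) hm) ?_
  obtain ⟨L₁, hL₁⟩ := exists_tendsto_regInt_cone hF (s - 1) P
  obtain ⟨L₂, hL₂⟩ := exists_tendsto_regInt_cone hF (s - 1 - 1) P
  have hη : Tendsto (fun η : ℝ => (η : ℂ)) (𝓝[>] 0) (𝓝 0) := by
    have := (Complex.continuous_ofReal.tendsto 0).mono_left (nhdsWithin_le_nhds (s := Ioi (0 : ℝ)))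
    simpa using this
  have hlim := ((hη.mul hL₁).const_mul (-(Complex.I * s * (d + 2 * (s - 1))))).add
    (((hη.mul hη).mul hL₂).const_mul (-(s * (s - 1))))
  simp only [zero_mul, mul_zero, add_zero] at hlim
  refine hlim.congr' ?_
  filter_upwards [self_mem_nhdsWithin] with η hη0
  rw [regInt_add (TestFn.box hF) hm _ _ hη0, regInt_smul, regInt_box hF _ _ hη0,
    regInt_dirD_null hF _ P.2.1 hη0, sub_add_cancel]
  have hd : (d : ℂ) = 2 * (alpha d : ℂ) + 1 := by simp only [alpha]; push_cast; ring
  have hq : s * (d + (s - 1)) + ((alpha d : ℂ) ^ 2 + ν ^ 2) = 0 := by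
    rw [hd, hs, deg]
    linear_combination ν ^ 2 * Complex.I_sq
  linear_combination -regInt s F (P : Mink d) η * hq

/-! ### The conformal action on the sphere -/

/-- The direction of a vector of the light cone. -/
noncomputable def Cone.dir {d : ℕ} (P : Cone d) : Sph d := (Cone.exists_base P).choose

theorem Cone.scale_dir {d : ℕ} (P : Cone d) :
    Cone.scale ((P : Mink d) 0) P.2.2 (basePt (Cone.dir P)) = P :=
  (Cone.exists_base P).choose_spec.symm

theorem Cone.dir_apply {d : ℕ} (P : Cone d) (i : Fin d) :
    (Cone.dir P : Euc d) i = ((P : Mink d) 0)⁻¹ * (P : Mink d) i.succ := by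
  have h := congrArg (fun Q : Cone d => (Q : Mink d) i.succ) (Cone.scale_dir P)
  simp only [Cone.scale, basePt, Pi.smul_apply, Fin.cons_succ, smul_eq_mul] at h
  rw [← h, ← mul_assoc, inv_mul_cancel₀ P.2.2.ne', one_mul]

theorem Cone.continuous_dir {d : ℕ} : Continuous (Cone.dir : Cone d → Sph d) := by
  refine Continuous.subtype_mk (f := fun P : Cone d => (Cone.dir P : Euc d)) ?_ _
  refine (PiLp.continuous_toLp 2 _).comp (continuous_pi fun i => ?_)
  change Continuous fun P : Cone d => (Cone.dir P : Euc d) i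
  simp_rw [Cone.dir_apply]
  have h : ∀ k, Continuous fun P : Cone d => (P : Mink d) k := fun k =>
    (continuous_apply k).comp continuous_subtype_val
  exact ((h 0).inv₀ fun P => P.2.2.ne').mul (h i.succ)

theorem basePt_zero {d : ℕ} (p : Sph d) : (basePt p : Mink d) 0 = 1 := rfl

theorem basePt_succ {d : ℕ} (p : Sph d) (i : Fin d) : (basePt p : Mink d) i.succ = (p : Euc d) i :=
  rfl

theorem Cone.dir_scale {d : ℕ} (t : ℝ) (ht : 0 < t) (P : Cone d) :
    Cone.dir (Cone.scale t ht P) = Cone.dir P := by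
  refine Subtype.ext (PiLp.ext fun i => ?_)
  rw [Cone.dir_apply, Cone.dir_apply]
  simp only [Cone.scale, Pi.smul_apply, smul_eq_mul]
  rw [mul_inv, mul_mul_mul_comm, inv_mul_cancel₀ ht.ne', one_mul]

theorem Cone.dir_basePt {d : ℕ} (p : Sph d) : Cone.dir (basePt p) = p := by
  refine Subtype.ext (PiLp.ext fun i => ?_)
  rw [Cone.dir_apply, basePt_zero, inv_one, one_mul, basePt_succ]

theorem coneAct_inv_coneAct {d : ℕ} (Λ : SOup d) (P : Cone d) : coneAct Λ⁻¹ (coneAct Λ P) = P :=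
  Subtype.ext (SOup_inv_apply Λ P)

/-- The conformal action of a Lorentz transformation on the sphere of null directions. -/
noncomputable def sphAct {d : ℕ} (Λ : SOup d) (p : Sph d) : Sph d := Cone.dir (coneAct Λ (basePt p))

/-- The conformal factor of a Lorentz transformation. -/
noncomputable def confFactor {d : ℕ} (Λ : SOup d) (p : Sph d) : ℝ :=
  (coneAct Λ (basePt p) : Mink d) 0

theorem confFactor_pos {d : ℕ} (Λ : SOup d) (p : Sph d) : 0 < confFactor Λ p :=
  (coneAct Λ (basePt p)).2.2

theorem continuous_confFactor {d : ℕ} (Λ : SOup d) : Continuous (confFactor Λ) :=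
  (continuous_apply 0).comp (continuous_subtype_val.comp
    ((continuous_coneAct Λ).comp continuous_basePt))

theorem continuous_sphAct {d : ℕ} (Λ : SOup d) : Continuous (sphAct Λ) :=
  Cone.continuous_dir.comp ((continuous_coneAct Λ).comp continuous_basePt)

theorem coneAct_basePt {d : ℕ} (Λ : SOup d) (p : Sph d) :
    coneAct Λ (basePt p) = Cone.scale (confFactor Λ p) (confFactor_pos Λ p) (basePt (sphAct Λ p)) :=
  (Cone.scale_dir _).symm

theorem dir_coneAct {d : ℕ} (Λ : SOup d) (P : Cone d) :
    Cone.dir (coneAct Λ P) = sphAct Λ (Cone.dir P) := by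
  conv_lhs => rw [← Cone.scale_dir P, coneAct_scale, Cone.dir_scale]
  rfl

theorem sphAct_inv_sphAct {d : ℕ} (Λ : SOup d) (p : Sph d) : sphAct Λ⁻¹ (sphAct Λ p) = p := by
  change sphAct Λ⁻¹ (Cone.dir (coneAct Λ (basePt p))) = p
  rw [← dir_coneAct, coneAct_inv_coneAct, Cone.dir_basePt]

/-- The conformal action as a homeomorphism. -/
noncomputable def sphActHomeo {d : ℕ} (Λ : SOup d) : Sph d ≃ₜ Sph d where
  toFun := sphAct Λ
  invFun := sphAct Λ⁻¹
  left_inv := sphAct_inv_sphAct Λ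
  right_inv p := by simpa using sphAct_inv_sphAct Λ⁻¹ p
  continuous_toFun := continuous_sphAct Λ
  continuous_invFun := continuous_sphAct Λ⁻¹

theorem mdot_sphAct {d : ℕ} (Λ : SOup d) (p q : Sph d) :
    mdot (basePt p : Mink d) (basePt q) = confFactor Λ p * confFactor Λ q *
      mdot (basePt (sphAct Λ p) : Mink d) (basePt (sphAct Λ q)) := by
  rw [← mdot_SOup Λ]
  have h : ∀ p : Sph d, Λ.1 (basePt p : Mink d) = confFactor Λ p • (basePt (sphAct Λ p) : Mink d) :=
    fun p => congrArg Subtype.val (coneAct_basePt Λ p)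
  rw [h, h, mdot_smul_left, mdot_smul_right, mul_assoc]

/-! ### The invariance of the surface measure -/

/-- The spatial part of a vector. -/
noncomputable def spat (d : ℕ) : Mink d →L[ℝ] Euc d :=
  LinearMap.toContinuousLinearMap
    { toFun := fun X => WithLp.toLp 2 fun i => X i.succ
      map_add' := fun _ _ => rfl
      map_smul' := fun _ _ => rfl }

theorem spat_apply {d : ℕ} (X : Mink d) (i : Fin d) : spat d X i = X i.succ := rfl

/-- The vector with spatial part `h` and time component `n · h`. -/
noncomputable def liftLin {d : ℕ} (n : Euc d) : Euc d →L[ℝ] Mink d :=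
  LinearMap.toContinuousLinearMap
    { toFun := fun h => Fin.cons (inner ℝ n h) fun i => h i
      map_add' := fun x y => by
        funext i; refine Fin.cases ?_ (fun j => ?_) i <;> simp [inner_add_right]
      map_smul' := fun c x => by
        funext i; refine Fin.cases ?_ (fun j => ?_) i <;> simp [inner_smul_right] }

theorem liftLin_apply {d : ℕ} (n h : Euc d) :
    liftLin n h = Fin.cons (inner ℝ n h) fun i => h i := rfl

/-- The Lorentz transformation as a continuous linear map. -/
noncomputable def SOupL {d : ℕ} (Λ : SOup d) : Mink d →L[ℝ] Mink d :=
  LinearMap.toContinuousLinearMap (Λ.1 : Mink d →ₗ[ℝ] Mink d)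

/-- The light-like vector with spatial part `x`. -/
noncomputable def nullVec {d : ℕ} (x : Euc d) : Mink d := Fin.cons ‖x‖ fun i => x i

theorem hasFDerivAt_nullVec {d : ℕ} {x : Euc d} (hx : x ≠ 0) :
    HasFDerivAt nullVec (liftLin (‖x‖⁻¹ • x)) x := by
  have hx' : ‖x‖ ≠ 0 := norm_ne_zero_iff.mpr hx
  have hn : HasFDerivAt (fun y : Euc d => ‖y‖) (innerSL ℝ (‖x‖⁻¹ • x)) x := by
    have h1 : HasFDerivAt (fun y : Euc d => ‖y‖ ^ 2) (2 • innerSL ℝ x) x :=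
      (hasStrictFDerivAt_norm_sq x).hasFDerivAt
    have h2 := h1.sqrt (pow_ne_zero 2 hx')
    simp only [Real.sqrt_sq (norm_nonneg _)] at h2
    refine h2.congr_fderiv ?_
    ext h
    simp
    field_simp
  rw [hasFDerivAt_pi']
  intro i
  refine Fin.cases ?_ (fun j => ?_) i
  · refine hn.congr_fderiv ?_
    ext h; rfl
  · have h3 : HasFDerivAt (fun y : Euc d => y j) (EuclideanSpace.proj j : Euc d →L[ℝ] ℝ) x :=
      (EuclideanSpace.proj j : Euc d →L[ℝ] ℝ).hasFDerivAt
    refine h3.congr_fderiv ?_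
    ext h; rfl

/-- The Jacobian of the action of a Lorentz transformation on the spatial parts of the null
vectors. -/
theorem det_spat_SOup_liftLin {d : ℕ} (Λ : SOup d) (n : Euc d) :
    LinearMap.det ((spat d ∘L SOupL Λ ∘L liftLin n : Euc d →L[ℝ] Euc d) : Euc d →ₗ[ℝ] Euc d) =
      Λ.1 (Fin.cons 1 fun i => n i) 0 := by
  set m : Mink d := Fin.cons 1 fun i => n i with hm
  -- `N` is `Λ` with its time row replaced by `m ·`, where `m = (1, n)`. Its determinant is
  -- evaluated in two ways.
  let N : Mink d →ₗ[ℝ] Mink d :=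
    { toFun := fun X => Fin.cons (mdot m X) fun i => Λ.1 X i.succ
      map_add' := fun X Y => by
        funext i; refine Fin.cases ?_ (fun j => ?_) i
        · simp [mdot_comm m, mdot_add_left]
        · simp
      map_smul' := fun c X => by
        funext i; refine Fin.cases ?_ (fun j => ?_) i
        · simp [mdot_smul_right]
        · simp }
  -- First evaluation: `N Λ⁻¹` differs from the identity only in the time row, so it is triangular,
  -- and its corner entry is `m · Λ⁻¹e₀ = (Λm)₀`. Since `Λ` has determinant `1`, this is the
  -- determinant of `N`.
  let K : Mink d →ₗ[ℝ] Mink d := N ∘ₗ ((Λ⁻¹).1 : Mink d →ₗ[ℝ] Mink d)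
  have hK : ∀ X, K X = Fin.cons (mdot m ((Λ⁻¹).1 X)) fun i => X i.succ := fun X => by
    change (Fin.cons (mdot m ((Λ⁻¹).1 X)) (fun i => Λ.1 ((Λ⁻¹).1 X) i.succ) : Mink d) = _
    rw [SOup_apply_inv]
  have hdK : LinearMap.det K = Λ.1 m 0 := by
    rw [← LinearMap.det_toMatrix', Matrix.det_of_isUpperTriangular]
    · rw [Fin.prod_univ_succ]
      simp only [LinearMap.toMatrix'_apply, hK, Fin.cons_zero, Fin.cons_succ]
      rw [Finset.prod_eq_one fun i _ => by simp, mul_one]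
      have h1 : mdot m ((Λ⁻¹).1 (Pi.single 0 1)) = Λ.1 m 0 := by
        rw [mdot_comm, mdot_SOup_inv]
        simp [mdot]
      rw [← h1]
    · intro i j hij
      simp only [LinearMap.toMatrix'_apply, hK]
      revert hij
      refine Fin.cases ?_ (fun k => ?_) i
      · intro h; exact absurd h (by simp)
      · intro h
        have h' : j < k.succ := h
        simp [h'.ne']
  have hdN : LinearMap.det N = Λ.1 m 0 := by
    have h1 : LinearMap.det K = LinearMap.det N * 1 := by
      rw [← abs_det_SOup Λ⁻¹, ← LinearMap.det_comp]
    rw [← hdK, h1, mul_one]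
  rw [← hdN, ← LinearMap.det_toMatrix (EuclideanSpace.basisFun (Fin d) ℝ).toBasis,
    ← LinearMap.det_toMatrix' N]
  -- Second evaluation: with the time coordinate put last, the lower right entry of `N` is `m · e₀ =
  -- 1`, and the determinant is that of the Schur complement `A - BC`. This is the matrix of `spat ∘
  -- Λ ∘ liftLin n`.
  let e : Fin d ⊕ Unit ≃ Fin (d + 1) := (Equiv.optionEquivSumPUnit (Fin d)).symm.trans (finSuccEquiv d).symm
  have e1 : ∀ i, e (Sum.inl i) = i.succ := fun i => by simp [e]
  have e2 : ∀ u, e (Sum.inr u) = 0 := fun u => by simp [e]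
  rw [← Matrix.det_submatrix_equiv_self e]
  let B : Matrix (Fin d) Unit ℝ := Matrix.of fun i _ => Λ.1 (Pi.single 0 1) i.succ
  let C : Matrix Unit (Fin d) ℝ := Matrix.of fun _ j => -n j
  let A : Matrix (Fin d) (Fin d) ℝ := Matrix.of fun i j => Λ.1 (Pi.single j.succ 1) i.succ
  have h1 : (LinearMap.toMatrix' N).submatrix e e = Matrix.fromBlocks A B C 1 := by
    have hs : ∀ b : Fin (d + 1), (fun j' : Fin (d+1) => if j' = b then (1:ℝ) else 0) = Pi.single b 1 :=
      fun b => by funext j; simp [Pi.single_apply]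
    ext a b
    rcases a with a | a <;> rcases b with b | b
    · simp [e1, LinearMap.toMatrix'_apply, N, A]
    · simp [e1, e2, LinearMap.toMatrix'_apply, N, B]
    · simp [e1, e2, LinearMap.toMatrix'_apply, N, C, mdot, hm, Pi.single_apply]
    · simp [e2, LinearMap.toMatrix'_apply, N, mdot, hm]
  rw [h1, Matrix.det_fromBlocks_one₂₂]
  congr 1
  ext i j
  rw [LinearMap.toMatrix_apply]
  simp only [OrthonormalBasis.coe_toBasis, OrthonormalBasis.coe_toBasis_repr_apply,
    EuclideanSpace.basisFun_repr, EuclideanSpace.basisFun_apply]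
  change Λ.1 (liftLin n (EuclideanSpace.single j 1)) i.succ = _
  have h2 : liftLin n (EuclideanSpace.single j 1) =
      n j • Pi.single 0 1 + (Pi.single j.succ 1 : Mink d) := by
    rw [liftLin_apply]
    funext k
    refine Fin.cases ?_ (fun k => ?_) k
    · simp [EuclideanSpace.inner_single_right]
    · simp [Pi.single_apply]
  rw [h2, map_add, map_smul]
  simp [A, B, C, Matrix.mul_apply]
  ring

theorem nullVec_mem_cone {d : ℕ} {x : Euc d} (hx : x ≠ 0) : nullVec x ∈ Cone d := by
  refine ⟨?_, norm_pos_iff.mpr hx⟩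
  have h := EuclideanSpace.real_norm_sq_eq x
  simp only [mdot, nullVec, Fin.cons_zero, Fin.cons_succ, ← pow_two]
  rw [h, sub_self]

theorem nullVec_spat {d : ℕ} (P : Cone d) : nullVec (spat d P) = P := by
  have h : ‖spat d P‖ = (P : Mink d) 0 := by
    rw [EuclideanSpace.norm_eq, Real.sqrt_eq_iff_mul_self_eq_of_pos P.2.2]
    have h1 : mdot (P : Mink d) P = 0 := P.2.1
    simp only [mdot, ← pow_two] at h1
    simp only [spat_apply, Real.norm_eq_abs, sq_abs]
    nlinarith
  funext i
  refine Fin.cases ?_ (fun j => ?_) i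
  · exact h
  · rfl

/-- Polar coordinates for a star-shaped region. -/
theorem lintegral_polar_sph {d : ℕ} (hd : 1 ≤ d) (f : Sph d → ENNReal) (hf : Measurable f)
    (b : Sph d → ℝ) (hb : Measurable b) (hb0 : ∀ p, 0 < b p) (h : Euc d → ENNReal)
    (hh : ∀ x (hx : x ≠ 0), h x = f (Cone.dir ⟨nullVec x, nullVec_mem_cone hx⟩) *
      (if ‖x‖ < b (Cone.dir ⟨nullVec x, nullVec_mem_cone hx⟩) then 1 else 0)) :
    ∫⁻ x in {0}ᶜ, h x = ∫⁻ p, f p * ENNReal.ofReal (b p ^ d / d) ∂sphMeas d := by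
  have hpol := (volume : Measure (Euc d)).measurePreserving_homeomorphUnitSphereProd
  have hdim : Module.finrank ℝ (Euc d) - 1 = d - 1 := by simp
  rw [hdim] at hpol
  let G : Sph d × Ioi (0:ℝ) → ENNReal := fun z => f z.1 * (if (z.2 : ℝ) < b z.1 then 1 else 0)
  have hG : Measurable G := by
    refine (hf.comp measurable_fst).mul (Measurable.ite ?_ measurable_const measurable_const)
    exact measurableSet_lt (measurable_subtype_coe.comp measurable_snd) (hb.comp measurable_fst)
  rw [← lintegral_subtype_comap (measurableSet_singleton (0 : Euc d)).compl]
  have h1 : ∀ x : ({0}ᶜ : Set (Euc d)), h x = G (homeomorphUnitSphereProd (Euc d) x) := by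
    intro x
    have hx : (x : Euc d) ≠ 0 := x.2
    have h2 : Cone.dir ⟨nullVec (x : Euc d), nullVec_mem_cone hx⟩ =
        (homeomorphUnitSphereProd (Euc d) x).1 := by
      refine Subtype.ext (PiLp.ext fun i => ?_)
      rw [Cone.dir_apply, homeomorphUnitSphereProd_apply_fst_coe]
      rfl
    rw [hh x hx, h2]
    simp only [G, homeomorphUnitSphereProd_apply_snd_coe]
  simp_rw [h1]
  rw [hpol.lintegral_comp hG, lintegral_prod _ hG.aemeasurable]
  refine lintegral_congr fun p => ?_
  simp only [G]
  rw [lintegral_const_mul _ (Measurable.ite (measurableSet_lt measurable_subtype_coe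
    measurable_const) measurable_const measurable_const)]
  congr 1
  have h3 : (fun r : Ioi (0:ℝ) => if (r : ℝ) < b p then (1 : ENNReal) else 0) =
      (Iio (⟨b p, hb0 p⟩ : Ioi (0:ℝ))).indicator 1 := by
    funext r
    simp [indicator, ← Subtype.coe_lt_coe]
  rw [h3, lintegral_indicator_one measurableSet_Iio, Measure.volumeIoiPow_apply_Iio]
  congr 1
  rw [Nat.sub_add_cancel hd]
  push_cast [Nat.cast_sub hd]
  ring_nf

/-- Let `Λ` act on `ℝ^d ∖ {0}`, identified with the cone by `x ↦ (|x|, x)`. In the direction `p` its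
Jacobian is `c(p)`, the conformal factor, and it stretches lengths by `c(p)`. Change variables in
the integral of `f(x/|x|)` over the unit ball: the preimage of the ball is the region `|x| < 1/c`,
and the radial integrals give `c · c^{-d} / d` on one side and `1/d` on the other. -/
theorem lintegral_sphAct {d : ℕ} (hd : 1 ≤ d) (Λ : SOup d) (f : Sph d → ENNReal)
    (hf : Measurable f) :
    ∫⁻ p, f (sphAct Λ p) * ENNReal.ofReal (confFactor Λ p ^ (-((d : ℝ) - 1))) ∂sphMeas d =
      ∫⁻ p, f p ∂sphMeas d := by
  have hd0 : (0:ℝ) < d := by exact_mod_cast hd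
  let Φ : SOup d → Euc d → Euc d := fun Λ x => spat d (Λ.1 (nullVec x))
  let h : Euc d → ENNReal := fun x => if hx : x ≠ 0 then
    f (Cone.dir ⟨nullVec x, nullVec_mem_cone hx⟩) * (if ‖x‖ < 1 then 1 else 0) else 0
  have hh : ∀ x (hx : x ≠ 0), h x = f (Cone.dir ⟨nullVec x, nullVec_mem_cone hx⟩) *
      (if ‖x‖ < 1 then 1 else 0) := fun x hx => by simp only [h]; rw [dif_pos hx]
  have hnv : ∀ (Λ : SOup d) x (hx : x ≠ 0),
      nullVec (Φ Λ x) = (coneAct Λ ⟨nullVec x, nullVec_mem_cone hx⟩ : Cone d) :=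
    fun Λ x hx => nullVec_spat (coneAct Λ ⟨nullVec x, nullVec_mem_cone hx⟩)
  have hΦ0 : ∀ (Λ : SOup d) x, x ≠ 0 → Φ Λ x ≠ 0 := fun Λ x hx h0 => by
    have h1 := (coneAct Λ ⟨nullVec x, nullVec_mem_cone hx⟩).2.2
    rw [← hnv Λ x hx, h0] at h1
    simp [nullVec] at h1
  have hsp : ∀ x : Euc d, spat d (nullVec x) = x := fun x => rfl
  have hinv : ∀ (Λ : SOup d) x, x ≠ 0 → Φ Λ⁻¹ (Φ Λ x) = x := fun Λ x hx => by
    change spat d ((Λ⁻¹).1 (nullVec (Φ Λ x))) = x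
    rw [hnv Λ x hx]
    change spat d ((Λ⁻¹).1 (Λ.1 (nullVec x))) = x
    rw [SOup_inv_apply, hsp]
  have himg : Φ Λ '' {0}ᶜ = {0}ᶜ := by
    ext y
    constructor
    · rintro ⟨x, hx, rfl⟩; exact hΦ0 Λ x hx
    · intro hy
      refine ⟨Φ Λ⁻¹ y, hΦ0 Λ⁻¹ y hy, ?_⟩
      simpa using hinv Λ⁻¹ y hy
  have hinj : InjOn (Φ Λ) {0}ᶜ := fun x hx y hy hxy => by
    rw [← hinv Λ x hx, hxy, hinv Λ y hy]
  have hder : ∀ x ∈ ({0}ᶜ : Set (Euc d)), HasFDerivWithinAt (Φ Λ)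
      (spat d ∘L SOupL Λ ∘L liftLin (‖x‖⁻¹ • x)) {0}ᶜ x := fun x hx =>
    ((spat d).hasFDerivAt.comp x ((SOupL Λ).hasFDerivAt.comp x
      (hasFDerivAt_nullVec hx))).hasFDerivWithinAt
  have key := lintegral_image_eq_lintegral_abs_det_fderiv_mul volume
    (measurableSet_singleton (0 : Euc d)).compl hder hinj h
  rw [himg] at key
  have hL := lintegral_polar_sph hd f hf (fun _ => 1) measurable_const (fun _ => one_pos) h hh
  have hR := lintegral_polar_sph hd (fun p => ENNReal.ofReal (confFactor Λ p) * f (sphAct Λ p))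
    ((ENNReal.measurable_ofReal.comp (continuous_confFactor Λ).measurable).mul
      (hf.comp (continuous_sphAct Λ).measurable)) (fun p => (confFactor Λ p)⁻¹)
    (continuous_confFactor Λ).measurable.inv (fun p => inv_pos.mpr (confFactor_pos Λ p))
    (fun x => ENNReal.ofReal |(spat d ∘L SOupL Λ ∘L liftLin (‖x‖⁻¹ • x)).det| * h (Φ Λ x)) (by
      intro x hx
      set P : Cone d := ⟨nullVec x, nullVec_mem_cone hx⟩ with hP
      have h1 : (spat d ∘L SOupL Λ ∘L liftLin (‖x‖⁻¹ • x)).det = confFactor Λ (Cone.dir P) := by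
        refine (det_spat_SOup_liftLin Λ (‖x‖⁻¹ • x)).trans ?_
        have h5 : (Fin.cons 1 fun i => (‖x‖⁻¹ • x) i : Mink d) = basePt (Cone.dir P) := by
          funext i
          refine Fin.cases rfl (fun j => ?_) i
          rw [basePt_succ, Cone.dir_apply]
          rfl
        rw [h5]
        rfl
      have h2 : (⟨nullVec (Φ Λ x), nullVec_mem_cone (hΦ0 Λ x hx)⟩ : Cone d) = coneAct Λ P :=
        Subtype.ext (hnv Λ x hx)
      have h3 : ‖Φ Λ x‖ = ‖x‖ * confFactor Λ (Cone.dir P) := by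
        have h4 : ‖Φ Λ x‖ = (coneAct Λ P : Mink d) 0 := congrArg (fun Q : Cone d => (Q : Mink d) 0) h2
        rw [h4]
        conv_lhs => rw [← Cone.scale_dir P, coneAct_scale]
        rfl
      rw [h1, hh _ (hΦ0 Λ x hx), h2, dir_coneAct, abs_of_pos (confFactor_pos _ _), h3, mul_assoc]
      congr 3
      rw [← lt_div_iff₀ (confFactor_pos _ _), one_div])
  rw [key, hR] at hL
  have hne : ENNReal.ofReal ((d:ℝ)⁻¹) ≠ 0 := by simpa using hd0.ne'
  -- The Jacobian `c` and the radial integral `c^{-d} / d` combine to the weight `c^{-(d-1)}`, with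
  -- the constant `1/d` to be cancelled against the other side.
  have e1 : ∀ p, ENNReal.ofReal (confFactor Λ p) * f (sphAct Λ p) *
      ENNReal.ofReal ((confFactor Λ p)⁻¹ ^ d / d) =
      f (sphAct Λ p) * ENNReal.ofReal (confFactor Λ p ^ (-((d : ℝ) - 1))) *
        ENNReal.ofReal ((d:ℝ)⁻¹) := by
    intro p
    have hc := confFactor_pos Λ p
    rw [mul_comm (ENNReal.ofReal _), mul_assoc, mul_assoc, ← ENNReal.ofReal_mul hc.le,
      ← ENNReal.ofReal_mul (by positivity)]
    congr 2
    rw [neg_sub, Real.rpow_sub hc, Real.rpow_one, Real.rpow_natCast, inv_pow]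
    field_simp
  simp only [e1, one_pow, one_div] at hL
  have hm : Measurable fun p =>
      f (sphAct Λ p) * ENNReal.ofReal (confFactor Λ p ^ (-((d : ℝ) - 1))) :=
    (hf.comp (continuous_sphAct Λ).measurable).mul
      (ENNReal.measurable_ofReal.comp ((continuous_confFactor Λ).measurable.pow_const _))
  rw [lintegral_mul_const _ hm, lintegral_mul_const _ hf] at hL
  exact (ENNReal.mul_left_inj hne ENNReal.ofReal_ne_top).mp hL

theorem measurePreserving_sphAct {d : ℕ} (hd : 1 ≤ d) (Λ : SOup d) :
    MeasurePreserving (sphAct Λ) ((sphMeas d).withDensity fun p =>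
      ENNReal.ofReal (confFactor Λ p ^ (-((d : ℝ) - 1)))) (sphMeas d) := by
  have hm : Measurable (sphAct Λ) := (continuous_sphAct Λ).measurable
  have hw : Measurable fun p => ENNReal.ofReal (confFactor Λ p ^ (-((d : ℝ) - 1))) :=
    ENNReal.measurable_ofReal.comp ((continuous_confFactor Λ).measurable.pow_const _)
  refine ⟨hm, Measure.ext fun s hs => ?_⟩
  rw [Measure.map_apply hm hs, withDensity_apply _ (hm hs), ← lintegral_indicator (hm hs),
    ← lintegral_indicator_one hs, ← lintegral_sphAct hd Λ _ (measurable_one.indicator hs)]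
  refine lintegral_congr fun p => ?_
  by_cases h : sphAct Λ p ∈ s
  · rw [indicator_of_mem (show p ∈ sphAct Λ ⁻¹' s from h), indicator_of_mem h, Pi.one_apply, one_mul]
  · rw [indicator_of_notMem (show p ∉ sphAct Λ ⁻¹' s from h), indicator_of_notMem h, zero_mul]

/-! ### The invariance of the inner product of wave functions -/

theorem MeasureTheory.MeasurePreserving.withDensity_comp {X Y : Type*} [MeasurableSpace X]
    [MeasurableSpace Y] {μ : Measure X} {ν : Measure Y} {T : X → Y} (hT : MeasurePreserving T μ ν)
    {k : Y → ENNReal} (hk : Measurable k) :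
    MeasurePreserving T (μ.withDensity fun x => k (T x)) (ν.withDensity k) := by
  refine ⟨hT.measurable, Measure.ext fun s hs => ?_⟩
  rw [Measure.map_apply hT.measurable hs, withDensity_apply _ (hT.measurable hs),
    withDensity_apply _ hs, hT.setLIntegral_comp_preimage hs hk]

theorem mdot_basePt_nonneg {d : ℕ} (p q : Sph d) : 0 ≤ mdot (basePt p : Mink d) (basePt q) := by
  rw [mdot_basePt]
  linarith [(abs_le.mp (abs_inner_sph p q)).2]

/-- The weight by which the inner product measure transforms. -/
noncomputable def pairWeight {d : ℕ} (ν : ℂ) (Λ : SOup d) (y : Sph d × Sph d) : ENNReal :=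
  ENNReal.ofReal ((confFactor Λ y.1 * confFactor Λ y.2) ^ (-alpha d + ν.im))

theorem measurable_pairWeight {d : ℕ} (ν : ℂ) (Λ : SOup d) : Measurable (pairWeight ν Λ) :=
  ENNReal.measurable_ofReal.comp ((((continuous_confFactor Λ).measurable.comp measurable_fst).mul
    ((continuous_confFactor Λ).measurable.comp measurable_snd)).pow_const _)

/-- Surface measure contributes the exponent `-(d-1) = -2α` of the conformal factor. On the diagonal
this is `pairWeight` itself. In the complementary series the density, a power `-α - Im ν` of `P ·
Q`, takes up part of it by `mdot_sphAct`, and the remaining exponent of `c(p) c(q)` is `-α + Im ν`.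
-/
theorem measurePreserving_pairMeas {d : ℕ} (hd : 1 ≤ d) (ν : ℂ) (Λ : SOup d) :
    MeasurePreserving (Prod.map (sphAct Λ) (sphAct Λ))
      ((pairMeas d ν).withDensity (pairWeight ν Λ)) (pairMeas d ν) := by
  have hm : Measurable (sphAct Λ) := (continuous_sphAct Λ).measurable
  have hT : Measurable (Prod.map (sphAct Λ) (sphAct Λ)) := hm.prodMap hm
  have hw : Measurable fun p => ENNReal.ofReal (confFactor Λ p ^ (-((d : ℝ) - 1))) :=
    ENNReal.measurable_ofReal.comp ((continuous_confFactor Λ).measurable.pow_const _)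
  have hMP := measurePreserving_sphAct hd Λ
  by_cases hp : IsPrincipal ν
  · have hdiag : Measurable fun p : Sph d => (p, p) := measurable_id.prodMk measurable_id
    refine ⟨hT, Measure.ext fun s hs => ?_⟩
    rw [Measure.map_apply hT hs, withDensity_apply _ (hT hs), ← lintegral_indicator (hT hs), pairMeas,
      if_pos hp, lintegral_map ((measurable_pairWeight ν Λ).indicator (hT hs)) hdiag,
      Measure.map_apply hdiag hs, ← hMP.measure_preimage (hdiag hs).nullMeasurableSet,
      withDensity_apply _ (hm (hdiag hs)), ← lintegral_indicator (hm (hdiag hs))]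
    refine lintegral_congr fun p => ?_
    have e : pairWeight ν Λ (p, p) = ENNReal.ofReal (confFactor Λ p ^ (-((d : ℝ) - 1))) := by
      have hc := confFactor_pos Λ p
      have hp' : ν.im = 0 := hp
      rw [pairWeight, Real.mul_rpow hc.le hc.le, ← Real.rpow_add hc, hp', alpha]
      congr 2
      ring
    by_cases h : (sphAct Λ p, sphAct Λ p) ∈ s
    · rw [indicator_of_mem (show (p, p) ∈ Prod.map (sphAct Λ) (sphAct Λ) ⁻¹' s from h),
        indicator_of_mem (show p ∈ sphAct Λ ⁻¹' ((fun p => (p, p)) ⁻¹' s) from h), e]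
    · rw [indicator_of_notMem (show (p, p) ∉ Prod.map (sphAct Λ) (sphAct Λ) ⁻¹' s from h),
        indicator_of_notMem (show p ∉ sphAct Λ ⁻¹' ((fun p => (p, p)) ⁻¹' s) from h)]
  · set k : Sph d × Sph d → ENNReal := fun y => ENNReal.ofReal
      ((2 * Real.pi) ^ (-alpha d) * (Real.Gamma (alpha d + ν.im) / Real.Gamma (-ν.im)) *
        (mdot (basePt y.1 : Mink d) (basePt y.2)) ^ (-alpha d - ν.im)) with hk
    have hkm : Measurable k := by
      refine ENNReal.measurable_ofReal.comp (Measurable.const_mul (Measurable.pow_const ?_ _) _)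
      exact (continuous_mdot.comp ((continuous_subtype_val.comp
        (continuous_basePt.comp continuous_fst)).prodMk
        (continuous_subtype_val.comp (continuous_basePt.comp continuous_snd)))).measurable
    have hMM := (hMP.prod hMP).withDensity_comp hkm
    have hww : Measurable fun z : Sph d × Sph d =>
        ENNReal.ofReal (confFactor Λ z.1 ^ (-((d : ℝ) - 1))) *
          ENNReal.ofReal (confFactor Λ z.2 ^ (-((d : ℝ) - 1))) :=
      (hw.comp measurable_fst).mul (hw.comp measurable_snd)
    have hkT : Measurable fun z => k (Prod.map (sphAct Λ) (sphAct Λ) z) := hkm.comp hT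
    rw [prod_withDensity hw hw, ← withDensity_mul _ hww hkT] at hMM
    rw [pairMeas, if_neg hp, ← withDensity_mul _ hkm (measurable_pairWeight ν Λ)]
    convert hMM using 2
    funext y
    simp only [Pi.mul_apply, hk, pairWeight, Prod.map_fst, Prod.map_snd]
    have h1 := confFactor_pos Λ y.1
    have h2 := confFactor_pos Λ y.2
    have hm' := mdot_basePt_nonneg (sphAct Λ y.1) (sphAct Λ y.2)
    have n1 : 0 ≤ (confFactor Λ y.1 * confFactor Λ y.2) ^ (-alpha d + ν.im) := by positivity
    have n2 : 0 ≤ confFactor Λ y.1 ^ (-((d:ℝ) - 1)) := by positivity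
    have n3 : 0 ≤ confFactor Λ y.2 ^ (-((d:ℝ) - 1)) := by positivity
    rw [← ENNReal.ofReal_mul' n1, ← ENNReal.ofReal_mul n2, ← ENNReal.ofReal_mul (mul_nonneg n2 n3),
      mdot_sphAct Λ y.1 y.2,
      Real.mul_rpow (by positivity) hm', ← Real.mul_rpow h1.le h2.le]
    congr 1
    have h3 : (confFactor Λ y.1 * confFactor Λ y.2) ^ (-((d:ℝ) - 1)) =
        (confFactor Λ y.1 * confFactor Λ y.2) ^ (-alpha d - ν.im) *
          (confFactor Λ y.1 * confFactor Λ y.2) ^ (-alpha d + ν.im) := by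
      rw [← Real.rpow_add (mul_pos h1 h2), alpha]
      congr 1
      ring
    rw [h3]
    ring

/-- The action on pairs of `n`-particle variables, as a measurable equivalence. -/
noncomputable def pairMomAct {d n : ℕ} (l : ℝ) (Λ : SOup d) : PairMom d n ≃ᵐ PairMom d n :=
  MeasurableEquiv.piCongrRight fun _ => (MeasurableEquiv.addRight (-l)).prodCongr
    ((sphActHomeo Λ).toMeasurableEquiv.prodCongr (sphActHomeo Λ).toMeasurableEquiv)

theorem pairMomAct_apply {d n : ℕ} (l : ℝ) (Λ : SOup d) (y : PairMom d n) (i : Fin n) :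
    pairMomAct l Λ y i = ((y i).1 - l, (sphAct Λ (y i).2.1, sphAct Λ (y i).2.2)) :=
  Prod.ext (sub_eq_add_neg _ _).symm rfl

theorem measurePreserving_pairMomAct {d n : ℕ} (hd : 1 ≤ d) (par : SeriesParam d) (l : ℝ)
    (Λ : SOup d) : MeasurePreserving (pairMomAct l Λ)
      ((pairMomMeas d n par.ν).withDensity fun y => ∏ i, pairWeight par.ν Λ (y i).2)
      (pairMomMeas d n par.ν) := by
  have hfin := pairMeas_finite par
  have hMP := measurePreserving_pairMeas hd par.ν Λ
  have hfin' : IsFiniteMeasure ((pairMeas d par.ν).withDensity (pairWeight par.ν Λ)) := by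
    refine ⟨?_⟩
    rw [← preimage_univ (f := Prod.map (sphAct Λ) (sphAct Λ)),
      hMP.measure_preimage MeasurableSet.univ.nullMeasurableSet]
    exact measure_lt_top _ _
  rw [pairMomMeas, ← pairMom_withDensity _ _ (measurable_pairWeight par.ν Λ)]
  have h := measurePreserving_pi (ι := Fin n)
    (fun _ => (volume : Measure ℝ).prod ((pairMeas d par.ν).withDensity (pairWeight par.ν Λ)))
    (fun _ => (volume : Measure ℝ).prod (pairMeas d par.ν))
    (fun _ => (measurePreserving_sub_right (volume : Measure ℝ) l).prod hMP)
  convert h using 1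
  funext y i
  exact pairMomAct_apply l Λ y i

/-- Unitarity rests on this: the homogeneity factors of the two wave functions reproduce the weight
of the inner product measure. In the principal series the measure lives on the diagonal, where the
phases cancel; in the complementary series the degree is real. -/
theorem ae_conj_cpow_mul {d : ℕ} (par : SeriesParam d) (Λ : SOup d) :
    ∀ᵐ y ∂pairMeas d par.ν, (starRingEnd ℂ) ((confFactor Λ y.1 : ℂ) ^ deg d par.ν) *
      (confFactor Λ y.2 : ℂ) ^ deg d par.ν = ((pairWeight par.ν Λ y).toReal : ℂ) := by
  have hW : ∀ y : Sph d × Sph d, (pairWeight par.ν Λ y).toReal =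
      (confFactor Λ y.1 * confFactor Λ y.2) ^ (-alpha d + par.ν.im) := fun y =>
    ENNReal.toReal_ofReal (Real.rpow_nonneg
      (mul_pos (confFactor_pos Λ y.1) (confFactor_pos Λ y.2)).le _)
  have hre : (deg d par.ν).re = -alpha d + par.ν.im := by simp [deg]
  by_cases hp : IsPrincipal par.ν
  · have h2 : ∀ᵐ q ∂(pairMeas d par.ν), q.1 = q.2 := by
      rw [pairMeas, if_pos hp]
      have hm : Measurable fun p : Sph d => (p, p) := measurable_id.prodMk measurable_id
      rw [ae_map_iff hm.aemeasurable (measurableSet_eq_fun measurable_fst measurable_snd)]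
      exact Eventually.of_forall fun _ => rfl
    filter_upwards [h2] with y hy
    have hc := confFactor_pos Λ y.2
    rw [hW, hy, ← Complex.normSq_eq_conj_mul_self, Complex.normSq_eq_norm_sq,
      Complex.norm_cpow_eq_rpow_re_of_pos hc, hre, Real.mul_rpow hc.le hc.le, pow_two]
  · obtain ⟨h1, -, -⟩ := par.adm.resolve_left hp
    refine Eventually.of_forall fun y => ?_
    have c1 := confFactor_pos Λ y.1
    have c2 := confFactor_pos Λ y.2
    have hdeg : deg d par.ν = ((-alpha d + par.ν.im : ℝ) : ℂ) := by
      refine Complex.ext ?_ ?_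
      · rw [hre, Complex.ofReal_re]
      · simp [deg, h1]
    rw [hW, hdeg, ← Complex.ofReal_cpow c1.le, ← Complex.ofReal_cpow c2.le, Complex.conj_ofReal,
      ← Complex.ofReal_mul, Real.mul_rpow c1.le c2.le]

/-- Functions that are homogeneous of degree `-α - iν` in each momentum. -/
def IsHomog {d n : ℕ} (ν : ℂ) (Ψ : Mom d n → ℂ) : Prop :=
  ∀ (t : Fin n → ℝ) (ht : ∀ i, 0 < t i) (y : Mom d n),
    Ψ (fun i => ((y i).1, Cone.scale (t i) (ht i) (y i).2)) = (∏ i, (t i : ℂ) ^ deg d ν) * Ψ y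

/-- The phase factor of the translations. -/
noncomputable def phase {n : ℕ} (x : ℝ) (θ : Fin n → ℝ) : ℂ :=
  Complex.exp (Complex.I * ((x * ∑ j, Real.exp (θ j) : ℝ) : ℂ))

theorem norm_phase {n : ℕ} (x : ℝ) (θ : Fin n → ℝ) : ‖phase x θ‖ = 1 := by
  rw [phase, mul_comm Complex.I, Complex.norm_exp_ofReal_mul_I]

theorem conj_phase_mul {n : ℕ} (x : ℝ) (θ : Fin n → ℝ) :
    (starRingEnd ℂ) (phase x θ) * phase x θ = 1 := by
  rw [← Complex.normSq_eq_conj_mul_self, Complex.normSq_eq_norm_sq, norm_phase]; simp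

theorem actFun_basePt {d n : ℕ} {ν : ℂ} {Ψ : Mom d n → ℂ} (h : IsHomog ν Ψ) (g : Po × SOup d)
    (θ : Fin n → ℝ) (p : Fin n → Sph d) :
    actFun g Ψ (fun i => (θ i, basePt (p i))) = phase g.1.x θ *
      ((∏ i, (confFactor g.2⁻¹ (p i) : ℂ) ^ deg d ν) *
        Ψ fun i => (θ i - g.1.l, basePt (sphAct g.2⁻¹ (p i)))) := by
  rw [← h (fun i => confFactor g.2⁻¹ (p i)) (fun i => confFactor_pos g.2⁻¹ (p i))
    (fun i => (θ i - g.1.l, basePt (sphAct g.2⁻¹ (p i))))]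
  simp only [actFun, phase, coneAct_basePt]

theorem toReal_prod_pairWeight_pos {d n : ℕ} (ν : ℂ) (Λ : SOup d) (y : PairMom d n) :
    ∏ i, pairWeight ν Λ (y i).2 < ⊤ :=
  ENNReal.prod_lt_top fun _ _ => ENNReal.ofReal_lt_top

theorem ae_actFun_mul {d n : ℕ} (par : SeriesParam d) {Ψ Φ : Mom d n → ℂ} (h : IsHomog par.ν Ψ)
    (k : IsHomog par.ν Φ) (g : Po × SOup d) :
    (fun y => (starRingEnd ℂ) (actFun g Ψ (leftMom y)) * actFun g Φ (rightMom y)) =ᵐ[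
      pairMomMeas d n par.ν] fun y => (∏ i, pairWeight par.ν g.2⁻¹ (y i).2).toReal •
        ((starRingEnd ℂ) (Ψ (leftMom (pairMomAct g.1.l g.2⁻¹ y))) *
          Φ (rightMom (pairMomAct g.1.l g.2⁻¹ y))) := by
  have hfin := pairMeas_finite par
  have h1 := Measure.quasiMeasurePreserving_snd (μ := (volume : Measure ℝ)) (ν := pairMeas d par.ν) |>.ae
    (ae_conj_cpow_mul par g.2⁻¹)
  have h2 : ∀ᵐ y ∂pairMomMeas d n par.ν, ∀ i : Fin n, _ :=
    ae_all_iff.mpr fun i => (Measure.quasiMeasurePreserving_eval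
      (fun _ : Fin n => (volume : Measure ℝ).prod (pairMeas d par.ν)) i).ae h1
  filter_upwards [h2] with y hy
  have eL : leftMom (pairMomAct g.1.l g.2⁻¹ y) =
      fun i => ((y i).1 - g.1.l, basePt (sphAct g.2⁻¹ (y i).2.1)) := by
    funext i; simp only [leftMom, pairMomAct_apply]
  have eR : rightMom (pairMomAct g.1.l g.2⁻¹ y) =
      fun i => ((y i).1 - g.1.l, basePt (sphAct g.2⁻¹ (y i).2.2)) := by
    funext i; simp only [rightMom, pairMomAct_apply]
  have hL := actFun_basePt h g (fun i => (y i).1) (fun i => (y i).2.1)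
  have hR := actFun_basePt k g (fun i => (y i).1) (fun i => (y i).2.2)
  rw [← eL] at hL
  rw [← eR] at hR
  change (starRingEnd ℂ) (actFun g Ψ (fun i => ((y i).1, basePt (y i).2.1))) *
    actFun g Φ (fun i => ((y i).1, basePt (y i).2.2)) = _
  rw [hL, hR, ENNReal.toReal_prod, Complex.real_smul, Complex.ofReal_prod]
  rw [← Finset.prod_congr rfl fun i _ => hy i, Finset.prod_mul_distrib, ← map_prod, map_mul, map_mul]
  linear_combination ((starRingEnd ℂ) (∏ i, (confFactor g.2⁻¹ (y i).2.1 : ℂ) ^ deg d par.ν) *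
    (∏ i, (confFactor g.2⁻¹ (y i).2.2 : ℂ) ^ deg d par.ν) *
    (starRingEnd ℂ) (Ψ (leftMom (pairMomAct g.1.l g.2⁻¹ y))) *
    Φ (rightMom (pairMomAct g.1.l g.2⁻¹ y))) * conj_phase_mul g.1.x fun i => (y i).1

theorem measurable_prod_pairWeight {d n : ℕ} (ν : ℂ) (Λ : SOup d) :
    Measurable fun y : PairMom d n => ∏ i, pairWeight ν Λ (y i).2 :=
  Finset.measurable_prod _ fun i _ => (measurable_pairWeight ν Λ).comp (measurable_pi_apply i).snd

/-- A change of variables along a measurable equivalence. Only homogeneity is assumed, so that it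
also applies to images under `R`, which need not be wave functions. -/
theorem waveForm_act {d n : ℕ} (hd : 1 ≤ d) (par : SeriesParam d) {Ψ Φ : Mom d n → ℂ}
    (h : IsHomog par.ν Ψ) (k : IsHomog par.ν Φ) (g : Po × SOup d) :
    waveForm par.ν (actFun g Ψ) (actFun g Φ) = waveForm par.ν Ψ Φ := by
  have hMP := measurePreserving_pairMomAct (n := n) hd par g.1.l g.2⁻¹
  unfold waveForm
  rw [integral_congr_ae (ae_actFun_mul par h k g),
    ← integral_withDensity_eq_integral_toReal_smul (measurable_prod_pairWeight par.ν g.2⁻¹)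
      (Eventually.of_forall (toReal_prod_pairWeight_pos par.ν g.2⁻¹))]
  exact hMP.integral_comp (MeasurableEquiv.measurableEmbedding _) fun y =>
    (starRingEnd ℂ) (Ψ (leftMom y)) * Φ (rightMom y)

theorem integrable_act {d n : ℕ} (hd : 1 ≤ d) (par : SeriesParam d) {Ψ Φ : Mom d n → ℂ}
    (h : IsHomog par.ν Ψ) (k : IsHomog par.ν Φ) (g : Po × SOup d)
    (hi : Integrable (fun y => (starRingEnd ℂ) (Ψ (leftMom y)) * Φ (rightMom y))
      (pairMomMeas d n par.ν)) :
    Integrable (fun y => (starRingEnd ℂ) (actFun g Ψ (leftMom y)) * actFun g Φ (rightMom y))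
      (pairMomMeas d n par.ν) := by
  have hMP := measurePreserving_pairMomAct (n := n) hd par g.1.l g.2⁻¹
  rw [integrable_congr (ae_actFun_mul par h k g),
    ← integrable_withDensity_iff_integrable_smul' (measurable_prod_pairWeight par.ν g.2⁻¹)
      (Eventually.of_forall (toReal_prod_pairWeight_pos par.ν g.2⁻¹))]
  have h1 := (hMP.integrable_comp_emb (MeasurableEquiv.measurableEmbedding _)
    (g := fun y => (starRingEnd ℂ) (Ψ (leftMom y)) * Φ (rightMom y))).mpr hi
  exact h1

/-! ### The unitary representation on the unsymmetrized spaces -/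

theorem IsWave.isHomog {d n : ℕ} {ν : ℂ} {Ψ : Mom d n → ℂ} (h : IsWave ν Ψ) : IsHomog ν Ψ := h.homog

/-- The product law of `𝒫_o` is the one that the phases require, since `e^{θ-λ} = e^{-λ} e^θ`. -/
theorem actFun_mul {d n : ℕ} (g h : Po × SOup d) (Ψ : Mom d n → ℂ) :
    actFun (g * h) Ψ = actFun g (actFun h Ψ) := by
  funext y
  have e1 : (g * h).1.x = g.1.x + Real.exp (-g.1.l) * h.1.x := rfl
  have e2 : (g * h).1.l = g.1.l + h.1.l := rfl
  have e3 : (g * h).2⁻¹ = h.2⁻¹ * g.2⁻¹ := mul_inv_rev _ _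
  simp only [actFun]
  rw [← mul_assoc, ← Complex.exp_add, e1, e2, e3]
  congr 1
  · congr 1
    have e4 : ∀ j, Real.exp ((y j).1 - g.1.l) = Real.exp (-g.1.l) * Real.exp (y j).1 := fun j => by
      rw [← Real.exp_add]; congr 1; ring
    simp only [e4, ← Finset.mul_sum]
    push_cast
    ring
  · congr 1
    funext j
    refine Prod.ext ?_ ?_
    · exact (sub_sub _ _ _).symm
    · rfl

theorem actFun_one {d n : ℕ} (Ψ : Mom d n → ℂ) : actFun (1 : Po × SOup d) Ψ = Ψ := by
  funext y
  have e1 : (1 : Po × SOup d).1.x = 0 := rfl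
  have e2 : (1 : Po × SOup d).1.l = 0 := rfl
  have e3 : (1 : Po × SOup d).2⁻¹ = 1 := inv_one
  simp only [actFun, e1, e2, e3, zero_mul, Complex.ofReal_zero, mul_zero, Complex.exp_zero, one_mul,
    sub_zero]
  rfl

/-- The action on wave functions as a linear isometry. -/
noncomputable def waveActL {d n : ℕ} (hd : 1 ≤ d) {par : SeriesParam d} (g : Po × SOup d) :
    WaveFn par n →ₗᵢ[ℂ] WaveFn par n where
  toFun := waveAct g
  map_add' Ψ Φ := Subtype.ext (funext fun y => by
    change _ * (Ψ.fn _ + Φ.fn _) = _ * Ψ.fn _ + _ * Φ.fn _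
    ring)
  map_smul' c Ψ := Subtype.ext (funext fun y => by
    change _ * (c * Ψ.fn _) = c * (_ * Ψ.fn _)
    ring)
  norm_map' Ψ := by
    have h : ∀ Χ : WaveFn par n, ‖Χ‖ ^ 2 = (waveForm par.ν Χ.fn Χ.fn).re := fun Χ =>
      norm_sq_eq_re_inner (𝕜 := ℂ) Χ
    refine (sq_eq_sq₀ (norm_nonneg _) (norm_nonneg _)).mp ((h _).trans (Eq.trans ?_ (h Ψ).symm))
    change (waveForm par.ν (actFun g Ψ.fn) (actFun g Ψ.fn)).re = _
    rw [waveForm_act hd par Ψ.isWave.isHomog Ψ.isWave.isHomog]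

/-- The action on `ℋ₁^{⊗ n}` as a continuous linear map. -/
noncomputable def nActL {d n : ℕ} (hd : 1 ≤ d) {par : SeriesParam d} (g : Po × SOup d) :
    NPart par n →L[ℂ] NPart par n :=
  ContinuousLinearMap.completion (waveActL hd g).toContinuousLinearMap

theorem nActL_coe {d n : ℕ} (hd : 1 ≤ d) {par : SeriesParam d} (g : Po × SOup d)
    (Ψ : WaveFn par n) : nActL hd g (Ψ : NPart par n) = ((waveAct g Ψ : WaveFn par n) : NPart par n) :=
  ContinuousLinearMap.completion_apply_coe _ Ψ

theorem nActL_inner {d n : ℕ} (hd : 1 ≤ d) {par : SeriesParam d} (g : Po × SOup d)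
    (v w : NPart par n) : inner ℂ (nActL hd g v) (nActL hd g w) = inner ℂ v w := by
  have hc := (nActL (n := n) (par := par) hd g).continuous
  induction v, w using UniformSpace.Completion.induction_on₂ with
  | hp =>
    exact isClosed_eq ((hc.comp continuous_fst).inner (𝕜 := ℂ) (hc.comp continuous_snd))
      (continuous_fst.inner (𝕜 := ℂ) continuous_snd)
  | ih Ψ Φ =>
    rw [nActL_coe, nActL_coe, UniformSpace.Completion.inner_coe, UniformSpace.Completion.inner_coe,
      WaveFn.inner_def, WaveFn.inner_def]
    exact waveForm_act hd par Ψ.isWave.isHomog Φ.isWave.isHomog g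

theorem nActL_mul {d n : ℕ} (hd : 1 ≤ d) {par : SeriesParam d} (g h : Po × SOup d)
    (v : NPart par n) : nActL hd (g * h) v = nActL hd g (nActL hd h v) := by
  induction v using UniformSpace.Completion.induction_on with
  | hp =>
    exact isClosed_eq (nActL (n := n) (par := par) hd (g * h)).continuous
      ((nActL (n := n) (par := par) hd g).continuous.comp (nActL hd h).continuous)
  | ih Ψ =>
    rw [nActL_coe, nActL_coe, nActL_coe]
    congr 1
    exact Subtype.ext (actFun_mul g h Ψ.fn)

theorem nActL_one {d n : ℕ} (hd : 1 ≤ d) {par : SeriesParam d}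
    (v : NPart par n) : nActL hd (1 : Po × SOup d) v = v := by
  induction v using UniformSpace.Completion.induction_on with
  | hp => exact isClosed_eq (nActL (n := n) (par := par) hd _).continuous continuous_id
  | ih Ψ =>
    rw [nActL_coe]
    congr 1
    exact Subtype.ext (actFun_one Ψ.fn)

theorem nActL_norm {d n : ℕ} (hd : 1 ≤ d) {par : SeriesParam d} (g : Po × SOup d)
    (v : NPart par n) : ‖nActL hd g v‖ = ‖v‖ := by
  have h := nActL_inner hd g v v
  rw [inner_self_eq_norm_sq_to_K, inner_self_eq_norm_sq_to_K] at h
  have h' : ‖nActL hd g v‖ ^ 2 = ‖v‖ ^ 2 := by exact_mod_cast h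
  exact (sq_eq_sq₀ (norm_nonneg _) (norm_nonneg _)).mp h'

theorem nActL_inv_apply {d n : ℕ} (hd : 1 ≤ d) {par : SeriesParam d} (g : Po × SOup d)
    (v : NPart par n) : nActL hd g⁻¹ (nActL hd g v) = v := by
  rw [← nActL_mul, inv_mul_cancel, nActL_one]

theorem nActL_apply_inv {d n : ℕ} (hd : 1 ≤ d) {par : SeriesParam d} (g : Po × SOup d)
    (v : NPart par n) : nActL hd g (nActL hd g⁻¹ v) = v := by
  rw [← nActL_mul, mul_inv_cancel, nActL_one]

theorem nActL_inner_left {d n : ℕ} (hd : 1 ≤ d) {par : SeriesParam d} (g : Po × SOup d)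
    (v w : NPart par n) : inner ℂ (nActL hd g v) w = inner ℂ v (nActL hd g⁻¹ w) := by
  rw [← nActL_inner hd g v, nActL_apply_inv]

/-! ### Homogeneity and covariance of the image under `R` -/

/-- Two momenta are scaled. -/
theorem IsHomog.update₂ {d n : ℕ} {ν : ℂ} {Ψ : Mom d n → ℂ} (h : IsHomog ν Ψ) {i j : Fin n}
    (hij : i ≠ j) (y : Mom d n) (a b : ℝ) (P Q : Cone d) (s t : ℝ) (hs : 0 < s) (ht : 0 < t) :
    Ψ (Function.update (Function.update y i (a, Cone.scale s hs P)) j (b, Cone.scale t ht Q)) =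
      (s : ℂ) ^ deg d ν * (t : ℂ) ^ deg d ν *
        Ψ (Function.update (Function.update y i (a, P)) j (b, Q)) := by
  have hτ : ∀ k, 0 < Function.update (Function.update (fun _ : Fin n => (1:ℝ)) i s) j t k := by
    intro k
    rcases eq_or_ne k j with rfl | hj
    · simpa using ht
    rcases eq_or_ne k i with rfl | hi
    · simpa [hj] using hs
    · simp [hj, hi]
  have h1 := h _ hτ (Function.update (Function.update y i (a, P)) j (b, Q))
  have e1 : ∏ k, ((Function.update (Function.update (fun _ : Fin n => (1:ℝ)) i s) j t k : ℝ) : ℂ) ^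
      deg d ν = (s : ℂ) ^ deg d ν * (t : ℂ) ^ deg d ν := by
    rw [Finset.prod_eq_mul i j hij]
    · simp [hij]
    · intro k _ hk
      simp [hk.1, hk.2]
    · simp
    · simp
  rw [e1] at h1
  rw [← h1]
  congr 1
  funext k
  rcases eq_or_ne k j with rfl | hj
  · refine Prod.ext ?_ (Subtype.ext ?_) <;> simp [Cone.scale]
  rcases eq_or_ne k i with rfl | hi
  · refine Prod.ext ?_ (Subtype.ext ?_) <;> simp [Cone.scale, hj]
  · refine Prod.ext ?_ (Subtype.ext ?_) <;> simp [Cone.scale, hj, hi]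

theorem mdot_scale_left {d : ℕ} (t : ℝ) (ht : 0 < t) (P Q : Cone d) :
    mdot (Cone.scale t ht P : Mink d) Q = t * mdot (P : Mink d) Q := mdot_smul_left t _ _

theorem mdot_scale_right {d : ℕ} (t : ℝ) (ht : 0 < t) (P Q : Cone d) :
    mdot (P : Mink d) (Cone.scale t ht Q) = t * mdot (P : Mink d) Q := mdot_smul_right t _ _

theorem mdot_cone_nonneg {d : ℕ} (P Q : Cone d) : 0 ≤ mdot (P : Mink d) Q := by
  rw [← Cone.scale_dir P, ← Cone.scale_dir Q, mdot_scale_left, mdot_scale_right]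
  exact mul_nonneg P.2.2.le (mul_nonneg Q.2.2.le (mdot_basePt_nonneg _ _))

theorem cpow_mul_mdot {d : ℕ} {t : ℝ} (ht : 0 < t) (P Q : Cone d) (s : ℂ) :
    ((t * mdot (P : Mink d) Q : ℝ) : ℂ) ^ s = (t : ℂ) ^ s * ((mdot (P : Mink d) Q : ℝ) : ℂ) ^ s := by
  rw [Complex.ofReal_mul, Complex.mul_cpow_ofReal_nonneg ht.le (mdot_cone_nonneg P Q)]

/-- Each outer momentum occurs in two factors, with exponents that add up to `(-iθ - iν) + (-α + iθ)
= -α - iν`. -/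
theorem Rker_scale_left {d : ℕ} (ν θ : ℂ) {s t : ℝ} (hs : 0 < s) (ht : 0 < t)
    (P₁ P₂ P₁' P₂' : Cone d) :
    Rker ν θ (Cone.scale s hs P₁) (Cone.scale t ht P₂) P₁' P₂' =
      (s : ℂ) ^ deg d ν * (t : ℂ) ^ deg d ν * Rker ν θ P₁ P₂ P₁' P₂' := by
  have hs' : (s : ℂ) ≠ 0 := Complex.ofReal_ne_zero.mpr hs.ne'
  have ht' : (t : ℂ) ≠ 0 := Complex.ofReal_ne_zero.mpr ht.ne'
  have e : deg d ν = (-Complex.I * θ - Complex.I * ν) + (-(alpha d : ℂ) + Complex.I * θ) := by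
    rw [deg]; ring
  have e0 : mdot (Cone.scale s hs P₁ : Mink d) (Cone.scale t ht P₂) =
      s * mdot (P₁ : Mink d) (Cone.scale t ht P₂) := mdot_scale_left _ _ _ _
  simp only [Rker]
  rw [e]
  generalize -Complex.I * θ - Complex.I * ν = A
  generalize -(alpha d : ℂ) + Complex.I * θ = B
  generalize -Complex.I * θ + Complex.I * ν = C
  rw [e0, cpow_mul_mdot hs, mdot_scale_right, mdot_scale_left, mdot_scale_left, cpow_mul_mdot ht,
    cpow_mul_mdot hs, cpow_mul_mdot ht, Complex.cpow_add _ _ hs', Complex.cpow_add _ _ ht']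
  ring

/-- Here the exponents add up to `-α + iν`. Together with the degree `-α - iν` of a wave function
this is `-2α = -(d-1)`, the degree for which an integral over the base is Lorentz invariant. -/
theorem Rker_scale_right {d : ℕ} (ν θ : ℂ) {s t : ℝ} (hs : 0 < s) (ht : 0 < t)
    (P₁ P₂ P₁' P₂' : Cone d) :
    Rker ν θ P₁ P₂ (Cone.scale s hs P₁') (Cone.scale t ht P₂') =
      (s : ℂ) ^ (-(alpha d : ℂ) + Complex.I * ν) * (t : ℂ) ^ (-(alpha d : ℂ) + Complex.I * ν) *
        Rker ν θ P₁ P₂ P₁' P₂' := by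
  have hs' : (s : ℂ) ≠ 0 := Complex.ofReal_ne_zero.mpr hs.ne'
  have ht' : (t : ℂ) ≠ 0 := Complex.ofReal_ne_zero.mpr ht.ne'
  have e : -(alpha d : ℂ) + Complex.I * ν = (-(alpha d : ℂ) + Complex.I * θ) +
      (-Complex.I * θ + Complex.I * ν) := by ring
  have e0 : mdot (Cone.scale s hs P₁' : Mink d) (Cone.scale t ht P₂') =
      s * mdot (P₁' : Mink d) (Cone.scale t ht P₂') := mdot_scale_left _ _ _ _
  simp only [Rker]
  rw [e]
  generalize -Complex.I * θ - Complex.I * ν = A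
  generalize -(alpha d : ℂ) + Complex.I * θ = B
  generalize -Complex.I * θ + Complex.I * ν = C
  rw [e0, cpow_mul_mdot hs, mdot_scale_right, mdot_scale_right, mdot_scale_right, cpow_mul_mdot ht,
    cpow_mul_mdot hs, cpow_mul_mdot ht, Complex.cpow_add _ _ hs', Complex.cpow_add _ _ ht']
  ring

theorem Rker_act {d : ℕ} (ν θ : ℂ) (Λ : SOup d) (P₁ P₂ P₁' P₂' : Cone d) :
    Rker ν θ (coneAct Λ P₁) (coneAct Λ P₂) (coneAct Λ P₁') (coneAct Λ P₂') =
      Rker ν θ P₁ P₂ P₁' P₂' := by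
  have h : ∀ P Q : Cone d, mdot (coneAct Λ P : Mink d) (coneAct Λ Q) = mdot (P : Mink d) Q :=
    fun P Q => mdot_SOup Λ P Q
  simp only [Rker, h]

/-- The image under `R` inherits homogeneity. -/
theorem isHomog_applyReg {d n : ℕ} {ν : ℂ} {i j : Fin n} (hij : i ≠ j) {Ψ : Mom d n → ℂ}
    (h : IsHomog ν Ψ) (ε : ℝ) : IsHomog ν fun y => applyReg ν i j Ψ y ε := by
  intro t ht y
  simp only [applyReg]
  rw [mul_left_comm (∏ i, (t i : ℂ) ^ deg d ν),
    ← integral_const_mul (∏ i, (t i : ℂ) ^ deg d ν)]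
  congr 2
  funext p
  rw [Rker_scale_left]
  set z := Function.update (Function.update y i ((y j).1, basePt p.1)) j ((y i).1, basePt p.2)
  -- Under the integral the momenta `i` and `j` of `Ψ` are points of the base and are not scaled;
  -- their factors come from the kernel.
  let τ : Fin n → ℝ := fun k => if k = i ∨ k = j then 1 else t k
  have hτ : ∀ k, 0 < τ k := fun k => by
    simp only [τ]; split_ifs
    · exact one_pos
    · exact ht k
  have e1 : Function.update (Function.update (fun k => ((y k).1, Cone.scale (t k) (ht k) (y k).2)) i
      ((y j).1, basePt p.1)) j ((y i).1, basePt p.2) =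
      fun k => ((z k).1, Cone.scale (τ k) (hτ k) (z k).2) := by
    funext k
    rcases eq_or_ne k j with rfl | hj
    · refine Prod.ext ?_ (Subtype.ext ?_) <;> simp [z, τ, Cone.scale]
    rcases eq_or_ne k i with rfl | hi
    · refine Prod.ext ?_ (Subtype.ext ?_) <;> simp [z, τ, Cone.scale, hj]
    · refine Prod.ext ?_ (Subtype.ext ?_) <;> simp [z, τ, Cone.scale, hj, hi]
  have e2 : ∏ k, (t k : ℂ) ^ deg d ν = (t i : ℂ) ^ deg d ν * (t j : ℂ) ^ deg d ν *
      ∏ k, (τ k : ℂ) ^ deg d ν := by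
    have e3 : ∀ k, (t k : ℂ) ^ deg d ν =
        (if k = i ∨ k = j then (t k : ℂ) ^ deg d ν else 1) * (τ k : ℂ) ^ deg d ν := fun k => by
      simp only [τ]; split_ifs <;> simp
    rw [Finset.prod_congr rfl fun k _ => e3 k, Finset.prod_mul_distrib]
    congr 1
    rw [Finset.prod_eq_mul i j hij]
    · simp
    · intro k _ hk
      simp [hk.1, hk.2]
    · simp
    · simp
  rw [e1, h τ hτ z, e2]
  ring

/-- For a function of degree `-(d-1)` in each momentum the homogeneity factors are exactly the
Jacobian of the conformal action on both spheres. -/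
theorem integral_sphAct_prod {d : ℕ} (hd : 1 ≤ d) (Λ : SOup d) (H : Cone d → Cone d → ℂ)
    (hH : ∀ (s t : ℝ) (hs : 0 < s) (ht : 0 < t) (P Q : Cone d),
      H (Cone.scale s hs P) (Cone.scale t ht Q) =
        ((s ^ (-((d : ℝ) - 1)) * t ^ (-((d : ℝ) - 1)) : ℝ) : ℂ) * H P Q) :
    ∫ p : Sph d × Sph d, H (coneAct Λ (basePt p.1)) (coneAct Λ (basePt p.2))
      ∂(sphMeas d).prod (sphMeas d) =
    ∫ p : Sph d × Sph d, H (basePt p.1) (basePt p.2) ∂(sphMeas d).prod (sphMeas d) := by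
  have hMP := measurePreserving_sphAct hd Λ
  have hw : Measurable fun p => ENNReal.ofReal (confFactor Λ p ^ (-((d : ℝ) - 1))) :=
    ENNReal.measurable_ofReal.comp ((continuous_confFactor Λ).measurable.pow_const _)
  have hww : Measurable fun z : Sph d × Sph d =>
      ENNReal.ofReal (confFactor Λ z.1 ^ (-((d : ℝ) - 1))) *
        ENNReal.ofReal (confFactor Λ z.2 ^ (-((d : ℝ) - 1))) :=
    (hw.comp measurable_fst).mul (hw.comp measurable_snd)
  have hMM := hMP.prod hMP
  rw [prod_withDensity hw hw] at hMM
  have he : MeasurableEmbedding (Prod.map (sphAct Λ) (sphAct Λ)) :=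
    ((sphActHomeo Λ).toMeasurableEquiv.prodCongr
      (sphActHomeo Λ).toMeasurableEquiv).measurableEmbedding
  rw [← hMM.integral_comp he (fun p : Sph d × Sph d => H (basePt p.1) (basePt p.2)),
    integral_withDensity_eq_integral_toReal_smul hww (Eventually.of_forall fun _ =>
      ENNReal.mul_lt_top ENNReal.ofReal_lt_top ENNReal.ofReal_lt_top)]
  refine integral_congr_ae (Eventually.of_forall fun p => ?_)
  beta_reduce
  rw [coneAct_basePt, coneAct_basePt, hH, ENNReal.toReal_mul, ENNReal.toReal_ofReal
    (Real.rpow_nonneg (confFactor_pos Λ _).le _), ENNReal.toReal_ofReal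
    (Real.rpow_nonneg (confFactor_pos Λ _).le _), Complex.real_smul]
  rfl

/-- The rapidities enter the kernel by their difference, the kernel is invariant if all four momenta
are transformed, and the integrand has the degree of `integral_sphAct_prod`. This holds at every
`ε`, so it passes to the boundary value. -/
theorem applyReg_act {d n : ℕ} (hd : 1 ≤ d) {ν : ℂ} {i j : Fin n} (hij : i ≠ j) {Ψ : Mom d n → ℂ}
    (h : IsHomog ν Ψ) (g : Po × SOup d) (y : Mom d n) (ε : ℝ) :
    applyReg ν i j (actFun g Ψ) y ε = actFun g (fun y => applyReg ν i j Ψ y ε) y := by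
  set x : Mom d n := fun k => ((y k).1 - g.1.l, coneAct g.2⁻¹ (y k).2) with hx
  have hth : (x i).1 - (x j).1 = (y i).1 - (y j).1 := by simp [hx]
  set t : ℝ := -(alpha d / Real.pi) * ((y i).1 - (y j).1) with ht
  let H : Cone d → Cone d → ℂ := fun P Q =>
    Rker ν ((t : ℂ) - Complex.I * (ε : ℂ)) (x i).2 (x j).2 P Q *
      Ψ (Function.update (Function.update x i ((x j).1, P)) j ((x i).1, Q))
  have hH : ∀ (s t : ℝ) (hs : 0 < s) (ht : 0 < t) (P Q : Cone d),
      H (Cone.scale s hs P) (Cone.scale t ht Q) =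
        ((s ^ (-((d : ℝ) - 1)) * t ^ (-((d : ℝ) - 1)) : ℝ) : ℂ) * H P Q := by
    intro s t hs ht P Q
    have e : ∀ s : ℝ, 0 < s → ((s ^ (-((d : ℝ) - 1)) : ℝ) : ℂ) =
        (s : ℂ) ^ (-(alpha d : ℂ) + Complex.I * ν) * (s : ℂ) ^ deg d ν := fun s hs => by
      rw [← Complex.cpow_add _ _ (Complex.ofReal_ne_zero.mpr hs.ne'), Complex.ofReal_cpow hs.le]
      congr 1
      rw [deg, alpha]; push_cast; ring
    simp only [H]
    rw [Rker_scale_right, h.update₂ hij, Complex.ofReal_mul (s ^ (-((d : ℝ) - 1))), e s hs, e t ht]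
    ring
  have key := integral_sphAct_prod hd g.2⁻¹ H hH
  have hup : ∀ P Q : Cone d, actFun g Ψ (Function.update (Function.update y i ((y j).1, P)) j
      ((y i).1, Q)) = phase g.1.x (fun k => (y k).1) *
      Ψ (Function.update (Function.update x i ((x j).1, coneAct g.2⁻¹ P)) j
        ((x i).1, coneAct g.2⁻¹ Q)) := by
    intro P Q
    simp only [actFun, phase]
    congr 1
    · congr 4
      -- The phase is a symmetric function of the rapidities, hence unchanged by the exchange of
      -- `θ_i` and `θ_j`.
      rw [← Equiv.sum_comp (Equiv.swap i j) fun k => Real.exp (y k).1]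
      refine Finset.sum_congr rfl fun k _ => ?_
      rcases eq_or_ne k j with rfl | hj
      · simp
      rcases eq_or_ne k i with rfl | hi
      · simp [hj]
      · simp [hj, hi, Equiv.swap_apply_of_ne_of_ne hi hj]
    · congr 1
      funext k
      rcases eq_or_ne k j with rfl | hj
      · simp [hx]
      rcases eq_or_ne k i with rfl | hi
      · simp [hj, hx]
      · simp [hj, hi, hx]
  have hL : ∀ p : Sph d × Sph d,
      Rker ν ((t : ℂ) - Complex.I * (ε : ℂ)) (y i).2 (y j).2 (basePt p.1) (basePt p.2) *
        actFun g Ψ (Function.update (Function.update y i ((y j).1, basePt p.1)) j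
          ((y i).1, basePt p.2)) = phase g.1.x (fun k => (y k).1) *
      H (coneAct g.2⁻¹ (basePt p.1)) (coneAct g.2⁻¹ (basePt p.2)) := by
    intro p
    simp only [H]
    rw [hup, hx, Rker_act]
    ring
  change crossFactor d ν t * ∫ p : Sph d × Sph d, _ ∂_ = phase g.1.x (fun k => (y k).1) *
    applyReg ν i j Ψ x ε
  simp only [applyReg]
  rw [hth, ← ht]
  simp_rw [hL]
  rw [integral_const_mul, key]
  ring

/-! ### The invariance of the symmetric subspaces -/

/-- The homogeneous extension of the restriction of a function to the spherical base. -/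
noncomputable def homogExt {d n : ℕ} (ν : ℂ) (χ : Mom d n → ℂ) : Mom d n → ℂ := fun y =>
  (∏ k, (((y k).2 : Mink d) 0 : ℂ) ^ deg d ν) * χ fun k => ((y k).1, basePt (Cone.dir (y k).2))

theorem isHomog_homogExt {d n : ℕ} (ν : ℂ) (χ : Mom d n → ℂ) : IsHomog ν (homogExt ν χ) := by
  intro t ht y
  simp only [homogExt, Cone.dir_scale]
  rw [← mul_assoc, ← Finset.prod_mul_distrib]
  congr 1
  refine Finset.prod_congr rfl fun k _ => ?_
  rw [← Complex.mul_cpow_ofReal_nonneg (ht k).le (y k).2.2.2.le, ← Complex.ofReal_mul]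
  rfl

theorem homogExt_basePt {d n : ℕ} (ν : ℂ) (χ : Mom d n → ℂ) (θ : Fin n → ℝ) (p : Fin n → Sph d) :
    homogExt ν χ (fun k => (θ k, basePt (p k))) = χ fun k => (θ k, basePt (p k)) := by
  simp only [homogExt, Cone.dir_basePt, basePt_zero]
  simp

theorem IsHomog.eq_homogExt {d n : ℕ} {ν : ℂ} {χ : Mom d n → ℂ} (h : IsHomog ν χ) :
    homogExt ν χ = χ := by
  funext y
  rw [homogExt, ← h (fun k => ((y k).2 : Mink d) 0) (fun k => (y k).2.2.2)]
  congr 1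
  funext k
  exact Prod.ext rfl (Cone.scale_dir _)

/-- The inner product only involves values on the base. The representing function may therefore be
made homogeneous, as the change of variables requires. -/
theorem Represents.homogExt {d n : ℕ} {par : SeriesParam d} {v : NPart par n} {χ : Mom d n → ℂ}
    (h : Represents v χ) : Represents v (homogExt par.ν χ) := by
  intro Φ
  have e : ∀ y : PairMom d n, _root_.homogExt par.ν χ (rightMom y) = χ (rightMom y) := fun y =>
    homogExt_basePt par.ν χ (fun k => (y k).1) fun k => (y k).2.2
  simp only [waveForm, e]
  exact h Φ

/-- Off the excluded set the limit is homogeneous, because `applyReg` is at every `ε`. On the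
excluded set `χ` is arbitrary, and this is where the replacement makes a difference. -/
theorem IsImageR.homogExt {d n : ℕ} {ν : ℂ} {i j : Fin n} (hij : i ≠ j) {Ψ χ : Mom d n → ℂ}
    (hΨ : IsHomog ν Ψ) (h : IsImageR ν i j Ψ χ) : IsImageR ν i j Ψ (homogExt ν χ) := by
  intro y h1 h2
  have e : applyReg ν i j Ψ y = fun ε => (∏ k, (((y k).2 : Mink d) 0 : ℂ) ^ deg d ν) *
      applyReg ν i j Ψ (fun k => ((y k).1, basePt (Cone.dir (y k).2))) ε := by
    funext ε
    exact (congrFun (isHomog_applyReg hij hΨ ε).eq_homogExt y).symm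
  rw [e]
  refine Tendsto.const_mul _ (h _ h1 fun h3 => h2 ?_)
  rw [← Cone.scale_dir (y i).2, ← Cone.scale_dir (y j).2, mdot_scale_left, mdot_scale_right]
  simp only at h3
  rw [h3, mul_zero, mul_zero]

theorem IsImageR.act {d n : ℕ} (hd : 1 ≤ d) {ν : ℂ} {i j : Fin n} (hij : i ≠ j) {Ψ χ : Mom d n → ℂ}
    (hΨ : IsHomog ν Ψ) (h : IsImageR ν i j Ψ χ) (g : Po × SOup d) :
    IsImageR ν i j (actFun g Ψ) (actFun g χ) := by
  intro y h1 h2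
  have e : applyReg ν i j (actFun g Ψ) y = fun ε => actFun g (fun y => applyReg ν i j Ψ y ε) y :=
    funext fun ε => applyReg_act hd hij hΨ g y ε
  rw [e]
  refine Tendsto.const_mul _ (h _ (fun h3 => h1 (sub_left_injective h3)) fun h3 => h2 ?_)
  exact (mdot_SOup g.2⁻¹ _ _).symm.trans h3

theorem Represents.act {d n : ℕ} (hd : 1 ≤ d) {par : SeriesParam d} {v : NPart par n}
    {χ : Mom d n → ℂ} (hχ : IsHomog par.ν χ) (h : Represents v χ) (g : Po × SOup d) :
    Represents (nActL hd g v) (actFun g χ) := by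
  intro Φ
  have e : Φ.fn = actFun g (waveAct g⁻¹ Φ).fn := by
    change _ = actFun g (actFun g⁻¹ Φ.fn)
    rw [← actFun_mul, mul_inv_cancel, actFun_one]
  obtain ⟨h1, h2⟩ := h (waveAct g⁻¹ Φ)
  constructor
  · rw [e]
    exact integrable_act hd par (waveAct g⁻¹ Φ).isWave.isHomog hχ g h1
  · conv_rhs => rw [e, waveForm_act hd par (waveAct g⁻¹ Φ).isWave.isHomog hχ g, ← h2]
    rw [← nActL_coe hd, nActL_inner_left, inv_inv]

theorem contDiffOn_ofReal_cpow {E : Type*} [NormedAddCommGroup E] [NormedSpace ℝ E] {s : Set E}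
    {r : E → ℝ} {n : WithTop ℕ∞} (hr : ContDiffOn ℝ n r s) (h : ∀ x ∈ s, 0 < r x) (c : ℂ) :
    ContDiffOn ℝ n (fun x => (r x : ℂ) ^ c) s := by
  have h1 : ContDiffOn ℝ n (fun x => Complex.exp ((Real.log (r x) : ℂ) * c)) s := by
    refine ContDiffOn.cexp (ContDiffOn.mul ?_ contDiffOn_const)
    exact Complex.ofRealCLM.contDiff.comp_contDiffOn (hr.log fun x hx => (h x hx).ne')
  refine h1.congr fun x hx => ?_
  rw [Complex.cpow_def_of_ne_zero (Complex.ofReal_ne_zero.mpr (h x hx).ne'),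
    Complex.ofReal_log (h x hx).le]

/-- A smooth extension of the transformed function is obtained from `G` by composition with the
ambient map that applies `Λ⁻¹` and rescales to time component `1`. This map is smooth where that
component is positive, an open set that contains the base. -/
theorem IsRegularAt.act {d n : ℕ} {ν : ℂ} {i j : Fin n} {Ψ : Mom d n → ℂ}
    (hΨ : IsHomog ν Ψ) (h : IsRegularAt i j Ψ) (g : Po × SOup d) :
    IsRegularAt i j (actFun g Ψ) := by
  obtain ⟨⟨U, G, hU, hG, hUG⟩, M, δ, hδ, hM⟩ := h
  let L : Mink d →L[ℝ] Mink d := SOupL g.2⁻¹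
  let r : Fin n → (Fin n → ℝ × Mink d) → ℝ := fun k x => L (x k).2 0
  let T : (Fin n → ℝ × Mink d) → (Fin n → ℝ × Mink d) := fun x k =>
    ((x k).1 - g.1.l, (r k x)⁻¹ • L (x k).2)
  let W : Set (Fin n → ℝ × Mink d) := {x | ∀ k, 0 < r k x}
  have hL : ∀ k, ContDiff ℝ (⊤ : ℕ∞) fun x : Fin n → ℝ × Mink d => L (x k).2 := fun k =>
    L.contDiff.comp (contDiff_snd.comp (contDiff_apply ℝ (ℝ × Mink d) k))
  have hr : ∀ k, ContDiff ℝ (⊤ : ℕ∞) (r k) := fun k => (contDiff_apply ℝ ℝ 0).comp (hL k)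
  have hθ : ∀ k, ContDiff ℝ (⊤ : ℕ∞) fun x : Fin n → ℝ × Mink d => (x k).1 := fun k =>
    contDiff_fst.comp (contDiff_apply ℝ (ℝ × Mink d) k)
  have hW : IsOpen W := by
    simp only [W, ofPred_forall]
    exact isOpen_iInter_of_finite fun k => isOpen_lt continuous_const (hr k).continuous
  have hT : ContDiffOn ℝ (⊤ : ℕ∞) T W := by
    refine contDiffOn_pi.mpr fun k => ((hθ k).contDiffOn.sub contDiffOn_const).prodMk ?_
    exact ((hr k).contDiffOn.inv fun x hx => (hx k).ne').smul (hL k).contDiffOn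
  have hTp : ∀ (θ : Fin n → ℝ) (p : Fin n → Sph d), T (fun k => (θ k, (basePt (p k) : Mink d))) =
      fun k => (θ k - g.1.l, (basePt (sphAct g.2⁻¹ (p k)) : Mink d)) := by
    intro θ p
    funext k
    refine Prod.ext rfl ?_
    change (confFactor g.2⁻¹ (p k))⁻¹ • (coneAct g.2⁻¹ (basePt (p k)) : Mink d) = _
    rw [coneAct_basePt]
    exact inv_smul_smul₀ (confFactor_pos _ _).ne' _
  refine ⟨⟨W ∩ T ⁻¹' U, fun x => phase g.1.x (fun k => (x k).1) *
    ((∏ k, (r k x : ℂ) ^ deg d ν) * G (T x)), hT.continuousOn.isOpen_inter_preimage hW hU, ?_, ?_⟩,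
    ?_⟩
  · refine ContDiffOn.mul ?_ (ContDiffOn.mul ?_ ?_)
    · refine ContDiffOn.cexp (contDiffOn_const.mul ?_)
      refine Complex.ofRealCLM.contDiff.comp_contDiffOn (contDiffOn_const.mul ?_)
      exact ContDiffOn.sum fun k _ => (hθ k).contDiffOn.exp
    · exact contDiffOn_prod fun k _ => contDiffOn_ofReal_cpow (hr k).contDiffOn
        (fun x hx => hx.1 k) _
    · exact hG.comp (hT.mono inter_subset_left) fun x hx => hx.2
  · intro θ p
    refine ⟨⟨fun k => confFactor_pos g.2⁻¹ (p k), ?_⟩, ?_⟩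
    · rw [mem_preimage, hTp]
      exact (hUG (fun k => θ k - g.1.l) fun k => sphAct g.2⁻¹ (p k)).1
    · beta_reduce
      rw [actFun_basePt hΨ, hTp, (hUG (fun k => θ k - g.1.l) fun k => sphAct g.2⁻¹ (p k)).2]
      rfl
  -- The conformal factor has a positive lower bound `c` on the compact sphere, so the distance from
  -- `P_i ∥ P_j` shrinks at most to `c² δ`; the bound on the rapidities is shifted by `|λ|`.
  · obtain ⟨c, hc, hc'⟩ := isCompact_univ.exists_forall_le' (a := (0:ℝ))
      (continuous_confFactor g.2⁻¹).continuousOn fun p _ => confFactor_pos _ p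
    refine ⟨M + |g.1.l|, c * c * δ, by positivity, fun θ p hne => ?_⟩
    rw [actFun_basePt hΨ] at hne
    obtain ⟨h1, h2⟩ := hM _ _ (right_ne_zero_of_mul (right_ne_zero_of_mul hne))
    refine ⟨fun k => ?_, ?_⟩
    · have h3 := h1 k
      calc |θ k| = |(θ k - g.1.l) + g.1.l| := by rw [sub_add_cancel]
        _ ≤ |θ k - g.1.l| + |g.1.l| := abs_add_le _ _
        _ ≤ _ := by gcongr
    · rw [mdot_sphAct g.2⁻¹ (p i) (p j)]
      have hi := hc' (p i) (mem_univ _)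
      have hj := hc' (p j) (mem_univ _)
      have hb := mul_le_mul hi hj hc.le (hc.le.trans hi)
      exact mul_le_mul hb h2 hδ.le ((mul_pos hc hc).le.trans hb)

/-- Generators are mapped to generators, once `χ` is replaced by its homogeneous extension. -/
theorem nActL_mem_defect {d n : ℕ} (hd : 1 ≤ d) {par : SeriesParam d} (g : Po × SOup d)
    {w : NPart par n} (hw : w ∈ defect par n) : nActL hd g w ∈ defect par n := by
  have h : defect par n ≤ (defect par n).comap ((nActL hd g : NPart par n →L[ℂ] NPart par n) :
      NPart par n →ₗ[ℂ] NPart par n) := by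
    refine Submodule.span_le.mpr ?_
    rintro w ⟨i, j, Ψ, χ, v, hj, h1, h2, h3, rfl⟩
    have hij : i ≠ j := by rintro rfl; omega
    refine Submodule.subset_span ⟨i, j, waveAct g Ψ, actFun g (homogExt par.ν χ), nActL hd g v, hj,
      h1.act Ψ.isWave.isHomog g, (h2.homogExt hij Ψ.isWave.isHomog).act hd hij Ψ.isWave.isHomog g,
      h3.homogExt.act hd (isHomog_homogExt par.ν χ) g, ?_⟩
    change nActL hd g (v - (Ψ : NPart par n)) = _
    rw [map_sub, nActL_coe]
  exact h hw

/-- The orthogonal complement of an invariant subspace of a unitary representation is invariant. -/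
theorem nActL_mem_HR {d n : ℕ} (hd : 1 ≤ d) {par : SeriesParam d} (g : Po × SOup d)
    {v : NPart par n} (hv : v ∈ HR par n) : nActL hd g v ∈ HR par n := by
  refine (Submodule.mem_orthogonal _ _).mpr fun w hw => ?_
  have h := nActL_inner_left hd g⁻¹ w v
  rw [inv_inv] at h
  rw [← h]
  exact (Submodule.mem_orthogonal _ _).mp hv _ (nActL_mem_defect hd g⁻¹ hw)

/-- The action on the symmetric `n`-particle space. -/
noncomputable def hrAct {d n : ℕ} (hd : 1 ≤ d) {par : SeriesParam d} (g : Po × SOup d) :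
    HR par n →ₗ[ℂ] HR par n :=
  ((nActL hd g : NPart par n →L[ℂ] NPart par n) : NPart par n →ₗ[ℂ] NPart par n).restrict
    fun _ => nActL_mem_HR hd g

theorem hrAct_coe {d n : ℕ} (hd : 1 ≤ d) {par : SeriesParam d} (g : Po × SOup d) (v : HR par n) :
    (hrAct hd g v : NPart par n) = nActL hd g (v : NPart par n) := rfl

theorem hrAct_inner_left {d n : ℕ} (hd : 1 ≤ d) {par : SeriesParam d} (g : Po × SOup d)
    (v w : HR par n) : inner ℂ (hrAct hd g v) w = inner ℂ v (hrAct hd g⁻¹ w) :=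
  nActL_inner_left hd g _ _

theorem hrAct_proj {d n : ℕ} (hd : 1 ≤ d) {par : SeriesParam d} (g : Po × SOup d) (v : NPart par n) :
    (HR par n).orthogonalProjectionOnto (nActL hd g v) =
      hrAct hd g ((HR par n).orthogonalProjectionOnto v) := by
  refine ext_inner_left ℂ fun w => ?_
  have h := hrAct_inner_left hd g⁻¹ w ((HR par n).orthogonalProjectionOnto v)
  rw [inv_inv] at h
  have h' := nActL_inner_left hd g⁻¹ (w : NPart par n) v
  rw [inv_inv] at h'
  rw [← h, Submodule.inner_orthogonalProjectionOnto_eq_of_mem_left,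
    Submodule.inner_orthogonalProjectionOnto_eq_of_mem_left, ← h', hrAct_coe]

/-! ### The rapidity wave functions -/

theorem integral_exp_mul_eq_fourier (f : SchwartzMap ℝ ℂ) (s : ℝ) :
    ∫ u : ℝ, Complex.exp (Complex.I * ((u * s : ℝ) : ℂ)) * f u =
      (FourierTransform.fourier f : SchwartzMap ℝ ℂ) (-s / (2 * Real.pi)) := by
  rw [SchwartzMap.fourier_coe, Real.fourier_real_eq_integral_exp_smul]
  refine integral_congr_ae (Eventually.of_forall fun u => ?_)
  beta_reduce
  rw [smul_eq_mul, mul_comm Complex.I]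
  congr 4
  field_simp

theorem integral_exp_neg_mul_eq_fourier (f : SchwartzMap ℝ ℂ) (s : ℝ) :
    ∫ u : ℝ, Complex.exp (-Complex.I * ((u * s : ℝ) : ℂ)) * f u =
      (FourierTransform.fourier f : SchwartzMap ℝ ℂ) (s / (2 * Real.pi)) := by
  have h := integral_exp_mul_eq_fourier f (-s)
  rw [neg_neg] at h
  rw [← h]
  refine integral_congr_ae (Eventually.of_forall fun u => ?_)
  beta_reduce
  congr 2
  push_cast
  ring

/-- For `θ ≤ 0` the factor `e^θ` is the decay and the supremum of the transform suffices; for `θ ≥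
0` its second moment gives `e^θ · e^{-2θ}`. These seminorms of the transform are dominated by
seminorms of `f`, as the Fourier transform is continuous on Schwartz space. -/
theorem exists_norm_fourier_le : ∃ (C : ℝ) (k l : ℕ), 0 ≤ C ∧ ∀ (f : SchwartzMap ℝ ℂ) (θ σ : ℝ),
    |σ| = 1 → Real.exp θ *
      ‖(FourierTransform.fourier f : SchwartzMap ℝ ℂ) (σ * Real.exp θ / (2 * Real.pi))‖ ≤
      C * ((Finset.Iic (k, l)).sup (schwartzSeminormFamily ℂ ℝ ℂ)) f * Real.exp (-|θ|) := by
  let L : SchwartzMap ℝ ℂ →L[ℂ] SchwartzMap ℝ ℂ :=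
    (FourierTransform.fourierCLE ℂ (SchwartzMap ℝ ℂ) : SchwartzMap ℝ ℂ ≃L[ℂ] SchwartzMap ℝ ℂ)
  have hL : ∀ f, L f = (FourierTransform.fourier f : SchwartzMap ℝ ℂ) := fun f => rfl
  let q : Seminorm ℂ (SchwartzMap ℝ ℂ) :=
    (SchwartzMap.seminorm ℂ 0 0 ⊔ SchwartzMap.seminorm ℂ 2 0).comp
      (L : SchwartzMap ℝ ℂ →ₗ[ℂ] SchwartzMap ℝ ℂ)
  have hp := schwartz_withSeminorms ℂ ℝ ℂ
  have hq : Continuous q := by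
    have h1 : Continuous fun f : SchwartzMap ℝ ℂ =>
        max (SchwartzMap.seminorm ℂ 0 0 f) (SchwartzMap.seminorm ℂ 2 0 f) :=
      (hp.continuous_seminorm (0, 0)).max (hp.continuous_seminorm (2, 0))
    exact h1.comp L.continuous
  obtain ⟨s, C, -, hC⟩ := Seminorm.bound_of_continuous hp q hq
  -- The finite set of seminorm indices is enlarged to a lower set `Iic (k, l)`, the form in which
  -- the distribution bound is stated.
  let k := s.sup Prod.fst
  let l := s.sup Prod.snd
  have hs : s ⊆ Finset.Iic (k, l) := fun x hx => Finset.mem_Iic.mpr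
    (Prod.mk_le_mk.mpr ⟨Finset.le_sup (f := Prod.fst) hx, Finset.le_sup (f := Prod.snd) hx⟩)
  refine ⟨(2 * Real.pi) ^ 2 * C, k, l, by positivity, fun f θ σ hσ => ?_⟩
  set S := ((Finset.Iic (k, l)).sup (schwartzSeminormFamily ℂ ℝ ℂ)) f with hS
  have hqf : q f ≤ C * S := by
    refine (hC f).trans ?_
    change (C : ℝ) * (s.sup (schwartzSeminormFamily ℂ ℝ ℂ)) f ≤ _
    have hm := Finset.sup_mono (f := schwartzSeminormFamily ℂ ℝ ℂ) hs
    exact mul_le_mul_of_nonneg_left (hm f) C.2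
  set ξ : ℝ := σ * Real.exp θ / (2 * Real.pi) with hξ
  set z := (FourierTransform.fourier f : SchwartzMap ℝ ℂ) with hz
  have hpi : 1 ≤ (2 * Real.pi) ^ 2 := by nlinarith [Real.pi_gt_three]
  have h0 : ‖z ξ‖ ≤ q f := (SchwartzMap.norm_le_seminorm ℂ z ξ).trans (le_max_left _ _)
  have h2 : ‖ξ‖ ^ 2 * ‖z ξ‖ ≤ q f :=
    (SchwartzMap.norm_pow_mul_le_seminorm ℂ z 2 ξ).trans (le_max_right _ _)
  have hξ2 : ‖ξ‖ ^ 2 = Real.exp θ ^ 2 / (2 * Real.pi) ^ 2 := by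
    rw [hξ, norm_div, norm_mul, Real.norm_eq_abs, hσ, one_mul, div_pow, Real.norm_eq_abs,
      Real.norm_eq_abs, sq_abs, sq_abs]
  have hq0 : 0 ≤ q f := (norm_nonneg _).trans h0
  have he := Real.exp_pos θ
  have hkey : Real.exp θ * ‖z ξ‖ ≤ (2 * Real.pi) ^ 2 * q f * Real.exp (-|θ|) := by
    rcases le_total 0 θ with hθ | hθ
    · rw [abs_of_nonneg hθ, Real.exp_neg]
      rw [hξ2, div_mul_eq_mul_div, div_le_iff₀ (by positivity)] at h2
      rw [← div_eq_mul_inv, le_div_iff₀ he]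
      linarith
    · rw [abs_of_nonpos hθ, neg_neg, mul_comm]
      refine mul_le_mul_of_nonneg_right (h0.trans ?_) he.le
      nlinarith
  refine hkey.trans (mul_le_mul_of_nonneg_right ?_ (Real.exp_pos _).le)
  rw [mul_assoc]
  exact mul_le_mul_of_nonneg_left hqf (by positivity)

theorem fPlus_eq_fourier (f : SchwartzMap ℝ ℂ) (θ : ℝ) : fPlus f θ = Complex.I * (Real.exp θ : ℂ) *
    (FourierTransform.fourier f : SchwartzMap ℝ ℂ) (-1 * Real.exp θ / (2 * Real.pi)) := by
  rw [fPlus, integral_exp_mul_eq_fourier, neg_one_mul]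

theorem fMinus_eq_fourier (f : SchwartzMap ℝ ℂ) (θ : ℝ) :
    fMinus f θ = -Complex.I * (Real.exp θ : ℂ) *
      (FourierTransform.fourier f : SchwartzMap ℝ ℂ) (1 * Real.exp θ / (2 * Real.pi)) := by
  rw [fMinus, integral_exp_neg_mul_eq_fourier, one_mul]

theorem exists_norm_fPlus_le : ∃ (C : ℝ) (k l : ℕ), 0 ≤ C ∧ ∀ (f : SchwartzMap ℝ ℂ) (θ : ℝ),
    ‖fPlus f θ‖ ≤ C * ((Finset.Iic (k, l)).sup (schwartzSeminormFamily ℂ ℝ ℂ)) f *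
      Real.exp (-|θ|) ∧
    ‖(starRingEnd ℂ) (fMinus f θ)‖ ≤
      C * ((Finset.Iic (k, l)).sup (schwartzSeminormFamily ℂ ℝ ℂ)) f * Real.exp (-|θ|) := by
  obtain ⟨C, k, l, hC, h⟩ := exists_norm_fourier_le
  have he : ∀ θ, ‖(Real.exp θ : ℂ)‖ = Real.exp θ := fun θ => by
    rw [Complex.norm_real, Real.norm_of_nonneg (Real.exp_pos θ).le]
  refine ⟨C, k, l, hC, fun f θ => ⟨?_, ?_⟩⟩
  · rw [fPlus_eq_fourier, norm_mul, norm_mul, Complex.norm_I, one_mul, he]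
    exact h f θ (-1) (by simp)
  · rw [RCLike.norm_conj, fMinus_eq_fourier, norm_mul, norm_mul, norm_neg, Complex.norm_I, one_mul,
      he]
    exact h f θ 1 (by simp)

theorem continuous_fPlus (f : SchwartzMap ℝ ℂ) : Continuous (fPlus f) := by
  have e : fPlus f = fun θ => _ := funext (fPlus_eq_fourier f)
  rw [e]
  have h : Continuous fun θ : ℝ => -1 * Real.exp θ / (2 * Real.pi) := by fun_prop
  exact (continuous_const.mul (Complex.continuous_ofReal.comp Real.continuous_exp)).mul
    ((FourierTransform.fourier f : SchwartzMap ℝ ℂ).continuous.comp h)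

theorem continuous_fMinus (f : SchwartzMap ℝ ℂ) : Continuous (fMinus f) := by
  have e : fMinus f = fun θ => _ := funext (fMinus_eq_fourier f)
  rw [e]
  have h : Continuous fun θ : ℝ => 1 * Real.exp θ / (2 * Real.pi) := by fun_prop
  exact (continuous_const.mul (Complex.continuous_ofReal.comp Real.continuous_exp)).mul
    ((FourierTransform.fourier f : SchwartzMap ℝ ℂ).continuous.comp h)

theorem fPlus_add (f g : SchwartzMap ℝ ℂ) (θ : ℝ) :
    fPlus (f + g : SchwartzMap ℝ ℂ) θ = fPlus f θ + fPlus g θ := by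
  rw [fPlus_eq_fourier, fPlus_eq_fourier, fPlus_eq_fourier, FourierTransform.fourier_add,
    add_apply]
  ring

theorem fPlus_smul (c : ℂ) (f : SchwartzMap ℝ ℂ) (θ : ℝ) :
    fPlus (c • f : SchwartzMap ℝ ℂ) θ = c * fPlus f θ := by
  rw [fPlus_eq_fourier, fPlus_eq_fourier, FourierTransform.fourier_smul, smul_apply,
    smul_eq_mul]
  ring

theorem fMinus_add (f g : SchwartzMap ℝ ℂ) (θ : ℝ) :
    fMinus (f + g : SchwartzMap ℝ ℂ) θ = fMinus f θ + fMinus g θ := by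
  rw [fMinus_eq_fourier, fMinus_eq_fourier, fMinus_eq_fourier, FourierTransform.fourier_add,
    add_apply]
  ring

theorem fMinus_smul (c : ℂ) (f : SchwartzMap ℝ ℂ) (θ : ℝ) :
    fMinus (c • f : SchwartzMap ℝ ℂ) θ = c * fMinus f θ := by
  rw [fMinus_eq_fourier, fMinus_eq_fourier, FourierTransform.fourier_smul, smul_apply,
    smul_eq_mul]
  ring

/-- This identity is behind neutrality. It also reduces the annihilation part of the field to
statements about `fPlus`. -/
theorem conj_fMinus (f : ℝ → ℂ) (θ : ℝ) :
    (starRingEnd ℂ) (fMinus f θ) = fPlus (fun u => (starRingEnd ℂ) (f u)) θ := by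
  rw [fMinus, fPlus, map_mul, map_mul, ← integral_conj, map_neg, Complex.conj_I, neg_neg,
    Complex.conj_ofReal]
  congr 1
  refine integral_congr_ae (Eventually.of_forall fun u => ?_)
  beta_reduce
  rw [map_mul, ← Complex.exp_conj, map_mul, map_neg, Complex.conj_I, neg_neg, Complex.conj_ofReal]

/-- The action of a translation and dilation on a rapidity wave function. -/
theorem fPlus_translate (f : ℝ → ℂ) (x l θ : ℝ) :
    Complex.exp (Complex.I * ((x * Real.exp θ : ℝ) : ℂ)) * fPlus f (θ - l) = (Real.exp (-l) : ℂ) *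
      fPlus (fun u => (Real.exp l : ℂ) * f (Real.exp l * (u - x))) θ := by
  have hl := Real.exp_pos l
  let K : ℝ → ℂ := fun u => Complex.exp (Complex.I * ((u * Real.exp (θ - l) : ℝ) : ℂ)) * f u
  have e1 : ∀ u : ℝ, Complex.exp (Complex.I * ((u * Real.exp θ : ℝ) : ℂ)) *
      ((Real.exp l : ℂ) * f (Real.exp l * (u - x))) =
      (Complex.exp (Complex.I * ((x * Real.exp θ : ℝ) : ℂ)) * (Real.exp l : ℂ)) *
        (fun w => K (Real.exp l * w)) (u - x) := by
    intro u
    have e2 : Complex.exp (Complex.I * ((u * Real.exp θ : ℝ) : ℂ)) =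
        Complex.exp (Complex.I * ((x * Real.exp θ : ℝ) : ℂ)) *
        Complex.exp (Complex.I * ((Real.exp l * (u - x) * Real.exp (θ - l) : ℝ) : ℂ)) := by
      rw [← Complex.exp_add, ← mul_add, ← Complex.ofReal_add]
      congr 4
      rw [Real.exp_sub]
      field_simp
      ring
    rw [e2]
    simp only [K]
    ring
  have e3 : ∫ u : ℝ, Complex.exp (Complex.I * ((u * Real.exp θ : ℝ) : ℂ)) *
      ((Real.exp l : ℂ) * f (Real.exp l * (u - x))) =
      Complex.exp (Complex.I * ((x * Real.exp θ : ℝ) : ℂ)) * ∫ u, K u := by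
    simp_rw [e1]
    rw [integral_const_mul, integral_sub_right_eq_self (fun w => K (Real.exp l * w)) x,
      Measure.integral_comp_mul_left, abs_of_pos (inv_pos.mpr hl), Complex.real_smul, mul_assoc,
      ← mul_assoc (Real.exp l : ℂ), ← Complex.ofReal_mul, mul_inv_cancel₀ hl.ne']
    simp
  have e4 : fPlus f (θ - l) = Complex.I * (Real.exp (θ - l) : ℂ) * ∫ u, K u := rfl
  rw [e4, fPlus, e3, sub_eq_add_neg, Real.exp_add, Complex.ofReal_mul (Real.exp θ)]
  ring

/-! ### One-particle wave functions -/

theorem integrable_exp_neg_abs_sq : Integrable fun x : ℝ => Real.exp (-|x|) ^ 2 := by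
  refine integrable_inv_one_add_sq.mono'
    (Continuous.aestronglyMeasurable (by fun_prop)) (Eventually.of_forall fun x => ?_)
  rw [Real.norm_of_nonneg (by positivity), Real.exp_neg, inv_pow]
  refine inv_anti₀ (by positivity) ?_
  have h := Real.add_one_le_exp |x|
  nlinarith [abs_nonneg x, sq_abs x]

/-- Measurable functions of the rapidity with an exponential bound. -/
structure RapidBound (A : ℝ) (a : ℝ → ℂ) : Prop where
  meas : Measurable a
  bound : ∀ θ, ‖a θ‖ ≤ A * Real.exp (-|θ|)

/-- Measurable homogeneous functions on the cone that are bounded on the base. -/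
structure ConeBound {d : ℕ} (ν : ℂ) (B : ℝ) (b : Cone d → ℂ) : Prop where
  meas : Measurable b
  homog : ∀ (t : ℝ) (ht : 0 < t) (P : Cone d), b (Cone.scale t ht P) = (t : ℂ) ^ deg d ν * b P
  bound : ∀ p, ‖b (basePt p)‖ ≤ B

theorem isWave_oneFun {d : ℕ} {ν : ℂ} {A B : ℝ} {a : ℝ → ℂ} {b : Cone d → ℂ} (ha : RapidBound A a)
    (hb : ConeBound ν B b) : IsWave ν (oneFun a b) := by
  refine ⟨?_, fun t ht y => ?_, fun θ => A * Real.exp (-|θ 0|) * B, ?_, fun θ p => ?_⟩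
  · exact (ha.meas.comp (measurable_pi_apply 0).fst).mul (hb.meas.comp (measurable_pi_apply 0).snd)
  · simp only [oneFun]
    rw [hb.homog]
    simp
    ring
  · have e2 := volume_preserving_funUnique (Fin 1) ℝ
    have h : MemLp (fun x : ℝ => A * Real.exp (-|x|) * B) 2 volume := by
      have h1 : MemLp (fun x : ℝ => Real.exp (-|x|)) 2 volume :=
        (memLp_two_iff_integrable_sq (Continuous.aestronglyMeasurable (by fun_prop))).mpr
          integrable_exp_neg_abs_sq
      exact (h1.const_mul A).mul_const B
    exact h.comp_measurePreserving e2
  · simp only [oneFun, norm_mul]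
    exact mul_le_mul (ha.bound _) (hb.bound _) (norm_nonneg _) ((norm_nonneg _).trans (ha.bound _))

theorem onePart_fn {d : ℕ} {par : SeriesParam d} {a : ℝ → ℂ} {b : Cone d → ℂ}
    (h : IsWave par.ν (oneFun a b)) : (onePart par a b).fn = oneFun a b := by
  have e : onePart par a b = (⟨oneFun a b, h⟩ : waveSub d 1 par.ν) := dif_pos h
  exact congrArg WaveFn.fn e

/-- The inner product is an integral against a positive measure, finite in the momenta, so that
pointwise bounds suffice: the constant is the square root of the integral of `e^{-2|θ|}`. -/
theorem exists_norm_onePart_le {d : ℕ} (par : SeriesParam d) : ∃ C : ℝ, 0 ≤ C ∧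
    ∀ (A B : ℝ) (a : ℝ → ℂ) (b : Cone d → ℂ), 0 ≤ A → 0 ≤ B → RapidBound A a →
      ConeBound par.ν B b → ‖onePart par a b‖ ≤ C * (A * B) := by
  have hfin := pairMeas_finite par
  have hi : Integrable (fun y : PairMom d 1 => Real.exp (-|(y 0).1|) ^ 2)
      (pairMomMeas d 1 par.ν) := by
    have e2 := volume_preserving_funUnique (Fin 1) ℝ
    have h : Integrable (fun θ : Fin 1 → ℝ => Real.exp (-|θ 0|) ^ 2) :=
      (e2.integrable_comp_emb (MeasurableEquiv.measurableEmbedding _)).mpr integrable_exp_neg_abs_sq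
    exact integrable_rapidity (pairMeas d par.ν) h
  set I := ∫ y : PairMom d 1, Real.exp (-|(y 0).1|) ^ 2 ∂pairMomMeas d 1 par.ν with hI
  have hI0 : 0 ≤ I := integral_nonneg fun _ => by positivity
  refine ⟨√I, Real.sqrt_nonneg _, fun A B a b hA hB ha hb => ?_⟩
  have hw := isWave_oneFun ha hb
  have h : ‖onePart par a b‖ ^ 2 = (waveForm par.ν (onePart par a b).fn (onePart par a b).fn).re :=
    norm_sq_eq_re_inner (𝕜 := ℂ) (onePart par a b)
  rw [onePart_fn hw] at h
  refine abs_le_of_sq_le_sq' ?_ (by positivity) |>.2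
  rw [h, mul_pow, Real.sq_sqrt hI0]
  refine (Complex.re_le_norm _).trans ?_
  have h2 : ‖waveForm par.ν (oneFun a b) (oneFun a b)‖ ≤
      ∫ y : PairMom d 1, (A * B) ^ 2 * Real.exp (-|(y 0).1|) ^ 2 ∂pairMomMeas d 1 par.ν := by
    refine norm_integral_le_of_norm_le (hi.const_mul _) (Eventually.of_forall fun y => ?_)
    have h3 : ∀ p : Sph d, ‖a (y 0).1 * b (basePt p)‖ ≤ A * Real.exp (-|(y 0).1|) * B := fun p => by
      rw [norm_mul]
      exact mul_le_mul (ha.bound _) (hb.bound p) (norm_nonneg _) (by positivity)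
    rw [norm_mul, RCLike.norm_conj]
    calc _ ≤ (A * Real.exp (-|(y 0).1|) * B) * (A * Real.exp (-|(y 0).1|) * B) :=
          mul_le_mul (h3 _) (h3 _) (norm_nonneg _) (by positivity)
      _ = _ := by ring
  rw [integral_const_mul, ← hI] at h2
  linarith

/-! ### Creation and annihilation operators -/

/-- The wave function `ξ ⊗ Ψ`. -/
noncomputable def tensorWave {d n : ℕ} {par : SeriesParam d} (ξ : WaveFn par 1) (Ψ : WaveFn par n) :
    WaveFn par (n + 1) :=
  (⟨tensorFun ξ.fn Ψ.fn, ξ.isWave.tensor Ψ.isWave⟩ : waveSub d (n + 1) par.ν)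

theorem tensorLeft_coe {d n : ℕ} {par : SeriesParam d} (ξ : WaveFn par 1) (Ψ : WaveFn par n) :
    tensorLeft ξ n (Ψ : NPart par n) = ((tensorWave ξ Ψ : WaveFn par (n + 1)) : NPart par (n + 1)) :=
  ContinuousLinearMap.completion_apply_coe _ Ψ

theorem norm_tensorLeft_le {d n : ℕ} {par : SeriesParam d} (ξ : WaveFn par 1) :
    ‖tensorLeft ξ n‖ ≤ ‖ξ‖ := by
  refine ContinuousLinearMap.opNorm_le_bound _ (norm_nonneg _) fun v => ?_
  induction v using UniformSpace.Completion.induction_on with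
  | hp =>
    exact isClosed_le (tensorLeft ξ n).continuous.norm (continuous_const.mul continuous_norm)
  | ih Ψ =>
    rw [tensorLeft_coe, UniformSpace.Completion.norm_coe, UniformSpace.Completion.norm_coe]
    have h : ∀ {k : ℕ} (Χ : WaveFn par k), ‖Χ‖ ^ 2 = (waveForm par.ν Χ.fn Χ.fn).re := fun Χ =>
      norm_sq_eq_re_inner (𝕜 := ℂ) Χ
    have him : (waveForm par.ν ξ.fn ξ.fn).im = 0 := inner_self_im (𝕜 := ℂ) ξ
    refine abs_le_of_sq_le_sq' ?_ (by positivity) |>.2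
    rw [mul_pow, h, h, h]
    change (waveForm par.ν (tensorFun ξ.fn Ψ.fn) (tensorFun ξ.fn Ψ.fn)).re ≤ _
    rw [waveForm_tensor, Complex.mul_re, him]
    simp

theorem tensorLeft_add {d n : ℕ} {par : SeriesParam d} (ξ η : WaveFn par 1) :
    tensorLeft (ξ + η) n = tensorLeft ξ n + tensorLeft η n := by
  refine ContinuousLinearMap.ext fun v => ?_
  induction v using UniformSpace.Completion.induction_on with
  | hp => exact isClosed_eq (tensorLeft (ξ + η) n).continuous
            (tensorLeft ξ n + tensorLeft η n).continuous
  | ih Ψ =>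
    rw [add_apply, tensorLeft_coe, tensorLeft_coe, tensorLeft_coe, ← UniformSpace.Completion.coe_add]
    congr 1
    exact Subtype.ext (funext fun y => add_mul _ _ _)

theorem tensorLeft_smul {d n : ℕ} {par : SeriesParam d} (c : ℂ) (ξ : WaveFn par 1) :
    tensorLeft (c • ξ) n = c • tensorLeft ξ n := by
  refine ContinuousLinearMap.ext fun v => ?_
  induction v using UniformSpace.Completion.induction_on with
  | hp => exact isClosed_eq (tensorLeft (c • ξ) n).continuous (c • tensorLeft ξ n).continuous
  | ih Ψ =>
    rw [smul_apply, tensorLeft_coe, tensorLeft_coe, ← UniformSpace.Completion.coe_smul]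
    congr 1
    exact Subtype.ext (funext fun y => mul_assoc _ _ _)

theorem create_apply {d n : ℕ} {par : SeriesParam d} (ξ : WaveFn par 1) (v : HR par n) :
    create ξ n v = ((√((n : ℝ) + 1) : ℝ) : ℂ) • (HR par (n + 1)).orthogonalProjectionOnto
      (tensorLeft ξ n (v : NPart par n)) := rfl

theorem create_add {d n : ℕ} {par : SeriesParam d} (ξ η : WaveFn par 1) :
    create (ξ + η) n = create ξ n + create η n := by
  refine ContinuousLinearMap.ext fun v => ?_
  rw [add_apply, create_apply, create_apply, create_apply, tensorLeft_add, add_apply, map_add,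
    smul_add]

theorem create_smul {d n : ℕ} {par : SeriesParam d} (c : ℂ) (ξ : WaveFn par 1) :
    create (c • ξ) n = c • create ξ n := by
  refine ContinuousLinearMap.ext fun v => ?_
  rw [smul_apply, create_apply, create_apply, tensorLeft_smul, smul_apply, map_smul, smul_comm]

theorem norm_create_le {d n : ℕ} {par : SeriesParam d} (ξ : WaveFn par 1) :
    ‖create ξ n‖ ≤ √((n : ℝ) + 1) * ‖ξ‖ := by
  refine ContinuousLinearMap.opNorm_le_bound _ (by positivity) fun v => ?_
  rw [create_apply, norm_smul, Complex.norm_real, Real.norm_of_nonneg (Real.sqrt_nonneg _),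
    mul_assoc]
  refine mul_le_mul_of_nonneg_left ?_ (Real.sqrt_nonneg _)
  refine (ContinuousLinearMap.le_of_opNorm_le _
    (Submodule.orthogonalProjectionOnto_norm_le (HR par (n + 1))) _).trans ?_
  rw [one_mul]
  exact (tensorLeft ξ n).le_of_opNorm_le (norm_tensorLeft_le ξ) _

theorem annih_add {d n : ℕ} {par : SeriesParam d} (ξ η : WaveFn par 1) :
    annih (ξ + η) n = annih ξ n + annih η n := by
  rw [annih, create_add, map_add]; rfl

theorem annih_smul {d n : ℕ} {par : SeriesParam d} (c : ℂ) (ξ : WaveFn par 1) :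
    annih (c • ξ) n = (starRingEnd ℂ) c • annih ξ n := by
  rw [annih, create_smul, map_smulₛₗ]; rfl

theorem norm_annih_le {d n : ℕ} {par : SeriesParam d} (ξ : WaveFn par 1) :
    ‖annih ξ n‖ ≤ √((n : ℝ) + 1) * ‖ξ‖ := by
  rw [annih, LinearIsometryEquiv.norm_map]
  exact norm_create_le ξ

theorem zDag_add {d : ℕ} {par : SeriesParam d} (ξ η : WaveFn par 1) :
    zDag (ξ + η) = zDag ξ + zDag η := by
  refine LinearMap.ext fun Ψ => finDom_ext fun n => ?_
  rcases n with _ | n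
  · exact (add_zero _).symm
  · exact congrArg (fun T : HR par n →L[ℂ] HR par (n + 1) => T ((Ψ : Fock par) n)) (create_add ξ η)

theorem zDag_smul {d : ℕ} {par : SeriesParam d} (c : ℂ) (ξ : WaveFn par 1) :
    zDag (c • ξ) = c • zDag ξ := by
  refine LinearMap.ext fun Ψ => finDom_ext fun n => ?_
  rcases n with _ | n
  · exact (smul_zero c).symm
  · exact congrArg (fun T : HR par n →L[ℂ] HR par (n + 1) => T ((Ψ : Fock par) n)) (create_smul c ξ)

theorem zAnn_add {d : ℕ} {par : SeriesParam d} (ξ η : WaveFn par 1) :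
    zAnn (ξ + η) = zAnn ξ + zAnn η := by
  refine LinearMap.ext fun Ψ => finDom_ext fun n => ?_
  exact congrArg (fun T : HR par (n + 1) →L[ℂ] HR par n => T ((Ψ : Fock par) (n + 1)))
    (annih_add ξ η)

theorem zAnn_smul {d : ℕ} {par : SeriesParam d} (c : ℂ) (ξ : WaveFn par 1) :
    zAnn (c • ξ) = (starRingEnd ℂ) c • zAnn ξ := by
  refine LinearMap.ext fun Ψ => finDom_ext fun n => ?_
  exact congrArg (fun T : HR par (n + 1) →L[ℂ] HR par n => T ((Ψ : Fock par) (n + 1)))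
    (annih_smul c ξ)

theorem norm_fock_le_sum {d : ℕ} {par : SeriesParam d} (Ψ : Fock par) (S : Finset ℕ)
    (h : ∀ n ∉ S, Ψ n = 0) : ‖Ψ‖ ≤ ∑ n ∈ S, ‖Ψ n‖ := by
  have e : Ψ = ∑ n ∈ S, lp.single 2 n (Ψ n) := by
    refine lp.ext (funext fun m => ?_)
    rw [lp.coeFn_sum, Finset.sum_apply]
    simp only [lp.single_apply]
    rw [Finset.sum_pi_single]
    split_ifs with hm
    · rfl
    · exact h m hm
  conv_lhs => rw [e]
  refine (norm_sum_le _ _).trans (le_of_eq (Finset.sum_congr rfl fun n _ => ?_))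
  exact lp.norm_single (E := fun n => HR par n) (p := 2) (by norm_num) n (Ψ n)

/-- The bound `√(n+1) ‖ξ‖` grows with the particle number, but a vector of `finDom` has finitely
many components. The constant depends on the vector and not on `ξ`. -/
theorem exists_bound_zDag {d : ℕ} {par : SeriesParam d} (Ψ : finDom par) :
    ∃ C, 0 ≤ C ∧ ∀ ξ : WaveFn par 1, ‖zDag ξ Ψ‖ ≤ C * ‖ξ‖ := by
  classical
  set S := Ψ.2.toFinset with hS
  refine ⟨∑ n ∈ S, √((n : ℝ) + 1) * ‖(Ψ : Fock par) n‖,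
    Finset.sum_nonneg fun n _ => by positivity, fun ξ => ?_⟩
  have h := norm_fock_le_sum (zDag ξ Ψ : Fock par) (S.image Nat.succ) (fun n hn => by
    rcases n with _ | n
    · rfl
    · have h0 : (Ψ : Fock par) n = 0 := by
        by_contra hc
        exact hn (Finset.mem_image.mpr ⟨n, Ψ.2.mem_toFinset.mpr hc, rfl⟩)
      change create ξ n ((Ψ : Fock par) n) = 0
      rw [h0, map_zero])
  refine h.trans ?_
  rw [Finset.sum_image (Nat.succ_injective.injOn), Finset.sum_mul]
  refine Finset.sum_le_sum fun n _ => ?_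
  refine ((create ξ n).le_of_opNorm_le (norm_create_le ξ) _).trans (le_of_eq ?_)
  ring

theorem exists_bound_zAnn {d : ℕ} {par : SeriesParam d} (Ψ : finDom par) :
    ∃ C, 0 ≤ C ∧ ∀ ξ : WaveFn par 1, ‖zAnn ξ Ψ‖ ≤ C * ‖ξ‖ := by
  classical
  set S := Ψ.2.toFinset with hS
  -- If the vacuum index `0` is in `S`, then `Nat.pred` leaves it at `0`; at most this adds a
  -- nonnegative term.
  refine ⟨∑ n ∈ S.image Nat.pred, √((n : ℝ) + 1) * ‖(Ψ : Fock par) (n + 1)‖,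
    Finset.sum_nonneg fun n _ => by positivity, fun ξ => ?_⟩
  have h := norm_fock_le_sum (zAnn ξ Ψ : Fock par) (S.image Nat.pred) (fun n hn => by
    have h0 : (Ψ : Fock par) (n + 1) = 0 := by
      by_contra hc
      exact hn (Finset.mem_image.mpr ⟨n + 1, Ψ.2.mem_toFinset.mpr hc, rfl⟩)
    change annih ξ n ((Ψ : Fock par) (n + 1)) = 0
    rw [h0, map_zero])
  refine h.trans ?_
  rw [Finset.sum_mul]
  refine Finset.sum_le_sum fun n _ => ?_
  refine ((annih ξ n).le_of_opNorm_le (norm_annih_le ξ) _).trans (le_of_eq ?_)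
  ring

theorem dense_finDom {d : ℕ} (par : SeriesParam d) : Dense (finDom par : Set (Fock par)) := by
  classical
  intro Ψ
  refine mem_closure_of_tendsto (lp.hasSum_single (by norm_num) Ψ) (Eventually.of_forall fun S => ?_)
  refine Submodule.sum_mem _ fun n _ => ?_
  refine (Set.finite_singleton n).subset fun m hm => ?_
  by_contra hc
  refine hm ?_
  rw [lp.single_apply]
  exact Pi.single_eq_of_ne hc _

theorem inner_zDag {d : ℕ} {par : SeriesParam d} (ξ : WaveFn par 1) (Ψ Φ : finDom par) :
    inner ℂ (zDag ξ Ψ : Fock par) (Φ : Fock par) = inner ℂ (Ψ : Fock par) (zAnn ξ Φ : Fock par) := by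
  have hs : Summable fun n => inner ℂ ((zDag ξ Ψ : Fock par) n) ((Φ : Fock par) n) :=
    lp.summable_inner _ _
  -- The zero-particle component of `zDag ξ Ψ` vanishes. After splitting it off, both series run
  -- over the same pairs `n + 1`, `n`.
  rw [lp.inner_eq_tsum, lp.inner_eq_tsum, hs.tsum_eq_zero_add]
  have h0 : (zDag ξ Ψ : Fock par) 0 = 0 := rfl
  rw [h0, inner_zero_left, zero_add]
  refine tsum_congr fun n => ?_
  exact (ContinuousLinearMap.adjoint_inner_right (create ξ n) _ _).symm

theorem inner_zAnn {d : ℕ} {par : SeriesParam d} (ξ : WaveFn par 1) (Ψ Φ : finDom par) :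
    inner ℂ (zAnn ξ Ψ : Fock par) (Φ : Fock par) = inner ℂ (Ψ : Fock par) (zDag ξ Φ : Fock par) := by
  rw [← inner_conj_symm, ← inner_zDag, inner_conj_symm]

/-! ### The representation on the Fock space -/

theorem hrAct_norm {d n : ℕ} (hd : 1 ≤ d) {par : SeriesParam d} (g : Po × SOup d) (v : HR par n) :
    ‖hrAct hd g v‖ = ‖v‖ := nActL_norm hd g _

theorem hrAct_mul {d n : ℕ} (hd : 1 ≤ d) {par : SeriesParam d} (g h : Po × SOup d) (v : HR par n) :
    hrAct hd (g * h) v = hrAct hd g (hrAct hd h v) := Subtype.ext (nActL_mul hd g h _)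

theorem hrAct_one {d n : ℕ} (hd : 1 ≤ d) {par : SeriesParam d} (v : HR par n) :
    hrAct hd (1 : Po × SOup d) v = v := Subtype.ext (nActL_one hd _)

theorem hrAct_inv_apply {d n : ℕ} (hd : 1 ≤ d) {par : SeriesParam d} (g : Po × SOup d)
    (v : HR par n) : hrAct hd g⁻¹ (hrAct hd g v) = v := Subtype.ext (nActL_inv_apply hd g _)

theorem hrAct_apply_inv {d n : ℕ} (hd : 1 ≤ d) {par : SeriesParam d} (g : Po × SOup d)
    (v : HR par n) : hrAct hd g (hrAct hd g⁻¹ v) = v := Subtype.ext (nActL_apply_inv hd g _)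

/-- The componentwise action on the Fock space. -/
noncomputable def fockFun {d : ℕ} (hd : 1 ≤ d) {par : SeriesParam d} (g : Po × SOup d)
    (Ψ : Fock par) : Fock par :=
  ⟨fun n => hrAct hd g (Ψ n), memℓp_gen (by
    simp only [hrAct_norm]
    exact (lp.memℓp Ψ).summable (by norm_num))⟩

theorem fockFun_apply {d : ℕ} (hd : 1 ≤ d) {par : SeriesParam d} (g : Po × SOup d) (Ψ : Fock par)
    (n : ℕ) : fockFun hd g Ψ n = hrAct hd g (Ψ n) := rfl

/-- The unitary representation on the Fock space. -/
noncomputable def fockRep {d : ℕ} (hd : 1 ≤ d) (par : SeriesParam d) :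
    Po × SOup d →* (Fock par ≃ₗᵢ[ℂ] Fock par) where
  toFun g :=
    { toFun := fockFun hd g
      invFun := fockFun hd g⁻¹
      map_add' := fun Ψ Φ => lp.ext (funext fun n => map_add (hrAct hd g) _ _)
      map_smul' := fun c Ψ => lp.ext (funext fun n => map_smul (hrAct hd g) _ _)
      left_inv := fun Ψ => lp.ext (funext fun n => hrAct_inv_apply hd g _)
      right_inv := fun Ψ => lp.ext (funext fun n => hrAct_apply_inv hd g _)
      norm_map' := fun Ψ => by
        change ‖fockFun hd g Ψ‖ = ‖Ψ‖
        rw [lp.norm_eq_tsum_rpow (by norm_num), lp.norm_eq_tsum_rpow (by norm_num)]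
        simp only [fockFun_apply, hrAct_norm] }
  map_one' := LinearIsometryEquiv.ext fun Ψ => lp.ext (funext fun n => hrAct_one hd _)
  map_mul' g h := LinearIsometryEquiv.ext fun Ψ => lp.ext (funext fun n => hrAct_mul hd g h _)

theorem fockRep_apply {d : ℕ} (hd : 1 ≤ d) {par : SeriesParam d} (g : Po × SOup d) (Ψ : Fock par)
    (n : ℕ) : fockRep hd par g Ψ n = hrAct hd g (Ψ n) := rfl

theorem fockRep_mem_finDom {d : ℕ} (hd : 1 ≤ d) {par : SeriesParam d} (g : Po × SOup d)
    {Ψ : Fock par} (h : Ψ ∈ finDom par) : fockRep hd par g Ψ ∈ finDom par :=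
  Set.Finite.subset h fun n hn hc => hn (by rw [fockRep_apply, hc, map_zero])

theorem actFun_tensorFun {d n : ℕ} (g : Po × SOup d) (ξ : Mom d 1 → ℂ) (Ψ : Mom d n → ℂ) :
    actFun g (tensorFun ξ Ψ) = tensorFun (actFun g ξ) (actFun g Ψ) := by
  funext y
  simp only [actFun, tensorFun]
  rw [Fin.sum_univ_succ fun j => Real.exp (y j).1, mul_add, Complex.ofReal_add, mul_add,
    Complex.exp_add]
  simp only [Finset.univ_unique, Finset.sum_const, Finset.card_singleton, one_smul]
  ring

theorem nActL_tensorLeft {d n : ℕ} (hd : 1 ≤ d) {par : SeriesParam d} (g : Po × SOup d)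
    (ξ : WaveFn par 1) (v : NPart par n) :
    nActL hd g (tensorLeft ξ n v) = tensorLeft (waveAct g ξ) n (nActL hd g v) := by
  induction v using UniformSpace.Completion.induction_on with
  | hp =>
    exact isClosed_eq ((nActL hd g).continuous.comp (tensorLeft ξ n).continuous)
      ((tensorLeft (waveAct g ξ) n).continuous.comp (nActL hd g).continuous)
  | ih Ψ =>
    rw [tensorLeft_coe, nActL_coe, nActL_coe, tensorLeft_coe]
    congr 1
    exact Subtype.ext (actFun_tensorFun g ξ.fn Ψ.fn)

/-- The action commutes with tensor products and with the projection onto `HR`. -/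
theorem hrAct_create {d n : ℕ} (hd : 1 ≤ d) {par : SeriesParam d} (g : Po × SOup d)
    (ξ : WaveFn par 1) (v : HR par n) :
    hrAct hd g (create ξ n v) = create (waveAct g ξ) n (hrAct hd g v) := by
  rw [create_apply, create_apply, map_smul, hrAct_coe, ← nActL_tensorLeft, hrAct_proj]

/-- The adjoint of `hrAct_create`, by unitarity of the action. -/
theorem hrAct_annih {d n : ℕ} (hd : 1 ≤ d) {par : SeriesParam d} (g : Po × SOup d)
    (ξ : WaveFn par 1) (v : HR par (n + 1)) :
    hrAct hd g (annih ξ n v) = annih (waveAct g ξ) n (hrAct hd g v) := by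
  refine ext_inner_left ℂ fun w => ?_
  have h : ∀ {k : ℕ} (w v : HR par k), inner ℂ w (hrAct hd g v) = inner ℂ (hrAct hd g⁻¹ w) v :=
    fun w v => by rw [hrAct_inner_left, inv_inv]
  rw [h, annih, annih, ContinuousLinearMap.adjoint_inner_right,
    ContinuousLinearMap.adjoint_inner_right, h]
  congr 1
  have h2 := hrAct_create hd g ξ (hrAct hd g⁻¹ w)
  rw [hrAct_apply_inv] at h2
  rw [← h2, hrAct_inv_apply]

theorem fockRep_zDag {d : ℕ} (hd : 1 ≤ d) {par : SeriesParam d} (g : Po × SOup d)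
    (ξ : WaveFn par 1) (Ψ : finDom par) :
    fockRep hd par g (zDag ξ Ψ : Fock par) =
      zDag (waveAct g ξ) ⟨fockRep hd par g Ψ, fockRep_mem_finDom hd g Ψ.2⟩ := by
  refine lp.ext (funext fun n => ?_)
  rcases n with _ | n
  · exact map_zero (hrAct hd g)
  · exact hrAct_create hd g ξ _

theorem fockRep_zAnn {d : ℕ} (hd : 1 ≤ d) {par : SeriesParam d} (g : Po × SOup d)
    (ξ : WaveFn par 1) (Ψ : finDom par) :
    fockRep hd par g (zAnn ξ Ψ : Fock par) =
      zAnn (waveAct g ξ) ⟨fockRep hd par g Ψ, fockRep_mem_finDom hd g Ψ.2⟩ :=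
  lp.ext (funext fun _ => hrAct_annih hd g ξ _)

/-! ### The field -/

theorem WaveFn.ext_fn {d n : ℕ} {par : SeriesParam d} {Ψ Φ : WaveFn par n} (h : Ψ.fn = Φ.fn) :
    Ψ = Φ := Subtype.ext h

theorem onePart_eq_add {d : ℕ} {par : SeriesParam d} {a a₁ a₂ : ℝ → ℂ} {b b₁ b₂ : Cone d → ℂ}
    (h₁ : IsWave par.ν (oneFun a₁ b₁)) (h₂ : IsWave par.ν (oneFun a₂ b₂))
    (h : oneFun a b = oneFun a₁ b₁ + oneFun a₂ b₂) :
    onePart par a b = onePart par a₁ b₁ + onePart par a₂ b₂ := by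
  refine WaveFn.ext_fn ?_
  change _ = (onePart par a₁ b₁).fn + (onePart par a₂ b₂).fn
  rw [onePart_fn h₁, onePart_fn h₂, onePart_fn (h ▸ h₁.add h₂), h]

theorem onePart_eq_smul {d : ℕ} {par : SeriesParam d} {a a₁ : ℝ → ℂ} {b b₁ : Cone d → ℂ} {c : ℂ}
    (h₁ : IsWave par.ν (oneFun a₁ b₁)) (h : oneFun a b = c • oneFun a₁ b₁) :
    onePart par a b = c • onePart par a₁ b₁ := by
  refine WaveFn.ext_fn ?_
  change _ = c • (onePart par a₁ b₁).fn
  rw [onePart_fn h₁, onePart_fn (h ▸ h₁.smul c), h]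

theorem onePart_zero {d : ℕ} (par : SeriesParam d) (a : ℝ → ℂ) : onePart par a 0 = 0 := by
  have h : oneFun a (0 : Cone d → ℂ) = 0 := funext fun y => mul_zero _
  refine WaveFn.ext_fn ?_
  rw [onePart_fn (h ▸ (waveSub d 1 par.ν).zero_mem), h]
  rfl

theorem exists_coneBound {d : ℕ} {F : dS d → ℂ} (hF : F ∈ TestFn d) (ν : ℂ) :
    ∃ B, ConeBound ν B (fourierHelgason ν F) := by
  obtain ⟨C, N, hC, h⟩ := exists_norm_fourierHelgason_le hF.2 ν
  obtain ⟨A, hA, hFA⟩ := TestFn.exists_boundedOn hF hF.2 subset_rfl N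
  exact ⟨C * A, measurable_fourierHelgason hF ν, fun t ht P => fourierHelgason_scale hF ν ht P,
    h F A hA hFA⟩

theorem exists_rapidBound : ∃ (C : ℝ) (k l : ℕ), 0 ≤ C ∧ ∀ f : SchwartzMap ℝ ℂ,
    RapidBound (C * ((Finset.Iic (k, l)).sup (schwartzSeminormFamily ℂ ℝ ℂ)) f) (fPlus f) ∧
    RapidBound (C * ((Finset.Iic (k, l)).sup (schwartzSeminormFamily ℂ ℝ ℂ)) f)
      fun θ => (starRingEnd ℂ) (fMinus f θ) := by
  obtain ⟨C, k, l, hC, h⟩ := exists_norm_fPlus_le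
  exact ⟨C, k, l, hC, fun f => ⟨⟨(continuous_fPlus f).measurable, fun θ => (h f θ).1⟩,
    ⟨(Complex.continuous_conj.comp (continuous_fMinus f)).measurable, fun θ => (h f θ).2⟩⟩⟩

theorem isWave_fPlus {d : ℕ} (ν : ℂ) (f : SchwartzMap ℝ ℂ) {F : dS d → ℂ} (hF : F ∈ TestFn d) :
    IsWave ν (oneFun (fPlus f) (fourierHelgason ν F)) := by
  obtain ⟨C, k, l, -, h⟩ := exists_rapidBound
  obtain ⟨B, hB⟩ := exists_coneBound hF ν
  exact isWave_oneFun (h f).1 hB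

theorem isWave_fMinus {d : ℕ} (ν : ℂ) (f : SchwartzMap ℝ ℂ) {F : dS d → ℂ} (hF : F ∈ TestFn d) :
    IsWave ν (oneFun (fun θ => (starRingEnd ℂ) (fMinus f θ)) (fourierHelgason ν F)) := by
  obtain ⟨C, k, l, -, h⟩ := exists_rapidBound
  obtain ⟨B, hB⟩ := exists_coneBound hF ν
  exact isWave_oneFun (h f).2 hB

theorem fieldWellDefined {d : ℕ} (par : SeriesParam d) : FieldWellDefined par :=
  ⟨fun _ hF P => ⟨fun _ hε => integrable_waveKer hF (deg d par.ν) P (mul_pos hε P.2.2),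
    tendsto_fhReg hF par.ν P⟩,
    fun f _ hF => ⟨isWave_fPlus par.ν f hF, isWave_fMinus par.ν f hF⟩⟩

/-! ### Bilinearity and continuity of the field. -/

theorem conjNeg_add {d : ℕ} (F G : dS d → ℂ) : conjNeg (F + G) = conjNeg F + conjNeg G :=
  funext fun _ => map_add _ _ _

theorem conjNeg_smul {d : ℕ} (c : ℂ) (F : dS d → ℂ) :
    conjNeg (c • F) = (starRingEnd ℂ) c • conjNeg F :=
  funext fun _ => map_mul _ _ _

theorem BoundedOn.conjNeg {d : ℕ} {K : Set (dS d)} (hK : IsCompact K) {N : ℕ} {A : ℝ} {F : dS d → ℂ}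
    (h : BoundedOn K N A F) : BoundedOn (dSneg ⁻¹' K) N A (conjNeg F) := by
  refine ⟨TestFn.conjNeg h.mem, ?_, fun j hj X hX => ?_⟩
  · refine closure_minimal (fun X hX => h.supp (subset_tsupport F ?_))
      (hK.isClosed.preimage continuous_dSneg)
    intro h0
    exact hX (by simp only [_root_.conjNeg, h0, map_zero])
  · rw [norm_iteratedFDeriv_conjNeg]
    exact h.bound j hj (dSneg X) hX

theorem field_add_left {d : ℕ} (par : SeriesParam d) (f g : SchwartzMap ℝ ℂ) {F : dS d → ℂ}
    (hF : F ∈ TestFn d) :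
    field par (f + g : SchwartzMap ℝ ℂ) F = field par f F + field par g F := by
  have hF' := TestFn.conjNeg hF
  have k₁ := onePart_eq_add (a := fPlus (f + g : SchwartzMap ℝ ℂ)) (b := fourierHelgason par.ν F)
    (isWave_fPlus par.ν f hF) (isWave_fPlus par.ν g hF)
    (by funext y; simp only [oneFun, fPlus_add, Pi.add_apply, add_mul])
  have k₂ := onePart_eq_add (a := fun θ => (starRingEnd ℂ) (fMinus (f + g : SchwartzMap ℝ ℂ) θ))
    (b := fourierHelgason par.ν (conjNeg F))
    (isWave_fMinus par.ν f hF') (isWave_fMinus par.ν g hF')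
    (by funext y; simp only [oneFun, fMinus_add, map_add, Pi.add_apply, add_mul])
  rw [field, field, field, k₁, k₂, zDag_add, zAnn_add]
  abel

theorem field_smul_left {d : ℕ} (par : SeriesParam d) (c : ℂ) (f : SchwartzMap ℝ ℂ) {F : dS d → ℂ}
    (hF : F ∈ TestFn d) : field par (c • f : SchwartzMap ℝ ℂ) F = c • field par f F := by
  have hF' := TestFn.conjNeg hF
  have k₁ := onePart_eq_smul (a := fPlus (c • f : SchwartzMap ℝ ℂ)) (b := fourierHelgason par.ν F)
    (c := c) (isWave_fPlus par.ν f hF)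
    (by funext y; simp only [oneFun, fPlus_smul, Pi.smul_apply, smul_eq_mul, mul_assoc])
  have k₂ := onePart_eq_smul (a := fun θ => (starRingEnd ℂ) (fMinus (c • f : SchwartzMap ℝ ℂ) θ))
    (b := fourierHelgason par.ν (conjNeg F)) (c := (starRingEnd ℂ) c)
    (isWave_fMinus par.ν f hF')
    (by funext y; simp only [oneFun, fMinus_smul, map_mul, Pi.smul_apply, smul_eq_mul, mul_assoc])
  rw [field, field, k₁, k₂, zDag_smul, zAnn_smul, Complex.conj_conj, smul_add]

theorem field_add_right {d : ℕ} (par : SeriesParam d) (f : SchwartzMap ℝ ℂ) {F G : dS d → ℂ}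
    (hF : F ∈ TestFn d) (hG : G ∈ TestFn d) :
    field par f (F + G) = field par f F + field par f G := by
  have hF' := TestFn.conjNeg hF
  have hG' := TestFn.conjNeg hG
  have k₁ := onePart_eq_add (a := fPlus f) (b := fourierHelgason par.ν (F + G))
    (isWave_fPlus par.ν f hF) (isWave_fPlus par.ν f hG)
    (by funext y; simp only [oneFun, fourierHelgason_add hF hG, Pi.add_apply, mul_add])
  have k₂ := onePart_eq_add (a := fun θ => (starRingEnd ℂ) (fMinus f θ))
    (b := fourierHelgason par.ν (conjNeg (F + G)))
    (isWave_fMinus par.ν f hF') (isWave_fMinus par.ν f hG')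
    (by funext y; simp only [oneFun, conjNeg_add, fourierHelgason_add hF' hG', Pi.add_apply, mul_add])
  rw [field, field, field, k₁, k₂, zDag_add, zAnn_add]
  abel

theorem field_smul_right {d : ℕ} (par : SeriesParam d) (c : ℂ) (f : SchwartzMap ℝ ℂ) {F : dS d → ℂ}
    (hF : F ∈ TestFn d) : field par f (c • F) = c • field par f F := by
  have hF' := TestFn.conjNeg hF
  have k₁ := onePart_eq_smul (a := fPlus f) (b := fourierHelgason par.ν (c • F))
    (c := c) (isWave_fPlus par.ν f hF)
    (by
      funext y
      simp only [oneFun, fourierHelgason_smul hF, Pi.smul_apply, smul_eq_mul]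
      ring)
  have k₂ := onePart_eq_smul (a := fun θ => (starRingEnd ℂ) (fMinus f θ))
    (b := fourierHelgason par.ν (conjNeg (c • F))) (c := (starRingEnd ℂ) c)
    (isWave_fMinus par.ν f hF')
    (by
      funext y
      simp only [oneFun, conjNeg_smul, fourierHelgason_smul hF', Pi.smul_apply, smul_eq_mul]
      ring)
  rw [field, field, k₁, k₂, zDag_smul, zAnn_smul, Complex.conj_conj, smul_add]

/-- The annihilation term contains `conj F_-`, which is supported in `-K`, so the transform is
estimated once for `K` and once for `-K`. -/
theorem exists_norm_field_le {d : ℕ} (par : SeriesParam d) (Ψ : finDom par) {K : Set (dS d)}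
    (hK : IsCompact K) : ∃ (C : ℝ) (k l N : ℕ), ∀ (f : SchwartzMap ℝ ℂ) (F : dS d → ℂ) (A : ℝ),
      0 ≤ A → BoundedOn K N A F →
      ‖field par f F Ψ‖ ≤ C * ((Finset.Iic (k, l)).sup (schwartzSeminormFamily ℂ ℝ ℂ)) f * A := by
  obtain ⟨C₁, hC₁, h₁⟩ := exists_bound_zDag Ψ
  obtain ⟨C₂, hC₂, h₂⟩ := exists_bound_zAnn Ψ
  obtain ⟨C₃, hC₃, h₃⟩ := exists_norm_onePart_le par
  obtain ⟨C₄, k, l, hC₄, h₄⟩ := exists_rapidBound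
  have hK' : IsCompact (dSneg ⁻¹' K) := (dSnegHomeo d).isCompact_preimage.mpr hK
  obtain ⟨C₅, N₅, hC₅, h₅⟩ := exists_norm_fourierHelgason_le hK par.ν
  obtain ⟨C₆, N₆, hC₆, h₆⟩ := exists_norm_fourierHelgason_le hK' par.ν
  refine ⟨C₁ * C₃ * C₄ * C₅ + C₂ * C₃ * C₄ * C₆, k, l, max N₅ N₆, fun f F A hA hF => ?_⟩
  set S := ((Finset.Iic (k, l)).sup (schwartzSeminormFamily ℂ ℝ ℂ)) f with hS
  have hS0 : 0 ≤ S := apply_nonneg _ _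
  have c₅ : ConeBound par.ν (C₅ * A) (fourierHelgason par.ν F) :=
    ⟨measurable_fourierHelgason hF.mem par.ν, fun t ht P => fourierHelgason_scale hF.mem par.ν ht P,
      h₅ F A hA (hF.mono (le_max_left _ _) le_rfl)⟩
  have hF' := (hF.mono (le_max_right N₅ N₆) le_rfl).conjNeg hK
  have c₆ : ConeBound par.ν (C₆ * A) (fourierHelgason par.ν (conjNeg F)) :=
    ⟨measurable_fourierHelgason hF'.mem par.ν, fun t ht P => fourierHelgason_scale hF'.mem par.ν ht P,
      h₆ _ A hA hF'⟩
  have b₁ := h₃ _ _ _ _ (by positivity) (by positivity) (h₄ f).1 c₅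
  have b₂ := h₃ _ _ _ _ (by positivity) (by positivity) (h₄ f).2 c₆
  rw [field, LinearMap.add_apply]
  refine (norm_add_le _ _).trans ?_
  calc _ ≤ C₁ * (C₃ * (C₄ * S * (C₅ * A))) + C₂ * (C₃ * (C₄ * S * (C₆ * A))) := by
        gcongr
        · exact (h₁ _).trans (mul_le_mul_of_nonneg_left b₁ hC₁)
        · exact (h₂ _).trans (mul_le_mul_of_nonneg_left b₂ hC₂)
    _ = _ := by ring

theorem isOperatorValuedDistribution_field {d : ℕ} (par : SeriesParam d) :
    IsOperatorValuedDistribution (finDom par) (field par) := by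
  refine ⟨dense_finDom par, ⟨LinearMap.mk₂ ℂ (fun (f : SchwartzMap ℝ ℂ) (F : TestFn d) =>
      field par f F) (fun f g F => field_add_left par f g F.2)
      (fun c f F => field_smul_left par c f F.2) (fun f F G => field_add_right par f F.2 G.2)
      (fun c f F => field_smul_right par c f F.2), fun _ _ => rfl⟩, fun Ψ K hK => ?_⟩
  obtain ⟨C, k, l, N, h⟩ := exists_norm_field_le par Ψ hK
  exact ⟨C, k, l, N, fun f F hF hFK A hA hb => h f F A hA ⟨hF, hFK, hb⟩⟩

/-- Replacing `f, F` by `conj f` and `conj F_-` exchanges the arguments of `zDag` and `zAnn`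
exactly, by `conj_fMinus` and because `conjNeg` is an involution. -/
theorem inner_field {d : ℕ} (par : SeriesParam d) (f : ℝ → ℂ) (F : dS d → ℂ) (Ψ Φ : finDom par) :
    inner ℂ (field par f F Ψ : Fock par) (Φ : Fock par) =
      inner ℂ (Ψ : Fock par)
        (field par (fun u => (starRingEnd ℂ) (f u)) (conjNeg F) Φ : Fock par) := by
  have e1 : (fun θ => (starRingEnd ℂ) (fMinus (fun u => (starRingEnd ℂ) (f u)) θ)) = fPlus f := by
    funext θ
    rw [conj_fMinus]
    simp only [Complex.conj_conj]
  have e2 : fPlus (fun u => (starRingEnd ℂ) (f u)) = fun θ => (starRingEnd ℂ) (fMinus f θ) :=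
    funext fun θ => (conj_fMinus f θ).symm
  rw [field, field, conjNeg_conjNeg, e1, e2, LinearMap.add_apply, LinearMap.add_apply,
    Submodule.coe_add, Submodule.coe_add, inner_add_left, inner_add_right, inner_zDag, inner_zAnn,
    add_comm]

theorem fieldOp_conj_le_adjoint {d : ℕ} (par : SeriesParam d) (f : ℝ → ℂ) (F : dS d → ℂ) :
    fieldOp par (fun u => (starRingEnd ℂ) (f u)) (conjNeg F) ≤ (fieldOp par f F).adjoint :=
  LinearPMap.IsFormalAdjoint.le_adjoint (dense_finDom par) fun Ψ Φ => inner_field par f F Ψ Φ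

theorem actFun_oneFun {d : ℕ} {ν : ℂ} (g : Po × SOup d) (f : ℝ → ℂ) {F : dS d → ℂ}
    (hF : F ∈ TestFn d) :
    actFun g (oneFun (fPlus f) (fourierHelgason ν F)) = (Real.exp (-g.1.l) : ℂ) •
      oneFun (fPlus fun u => (Real.exp g.1.l : ℂ) * f (Real.exp g.1.l * (u - g.1.x)))
        (fourierHelgason ν fun X => F (dSact g.2⁻¹ X)) := by
  funext y
  have h := fPlus_translate f g.1.x g.1.l (y 0).1
  simp only [actFun, oneFun, Pi.smul_apply, smul_eq_mul, Finset.univ_unique, Finset.sum_singleton]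
  rw [fourierHelgason_comp_dSact hF, ← mul_assoc, ← mul_assoc]
  exact congrArg (· * fourierHelgason ν F (coneAct g.2⁻¹ (y 0).2)) h

theorem waveAct_onePart {d : ℕ} {par : SeriesParam d} (g : Po × SOup d) (f : ℝ → ℂ) {F : dS d → ℂ}
    (hF : F ∈ TestFn d) (h : IsWave par.ν (oneFun (fPlus f) (fourierHelgason par.ν F))) :
    waveAct g (onePart par (fPlus f) (fourierHelgason par.ν F)) = (Real.exp (-g.1.l) : ℂ) •
      onePart par (fPlus fun u => (Real.exp g.1.l : ℂ) * f (Real.exp g.1.l * (u - g.1.x)))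
        (fourierHelgason par.ν fun X => F (dSact g.2⁻¹ X)) := by
  have hne : (Real.exp (-g.1.l) : ℂ) ≠ 0 := Complex.ofReal_ne_zero.mpr (Real.exp_pos _).ne'
  have e := actFun_oneFun (ν := par.ν) g f hF
  set φ := oneFun (fPlus fun u => (Real.exp g.1.l : ℂ) * f (Real.exp g.1.l * (u - g.1.x)))
    (fourierHelgason par.ν fun X => F (dSact g.2⁻¹ X)) with hφ
  -- The action preserves wave functions and `e^{-λ}` is not `0`, so this follows without showing
  -- that the transformed `f` is a Schwartz function.
  have hw : IsWave par.ν φ := by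
    have e' : φ = (Real.exp (-g.1.l) : ℂ)⁻¹ • actFun g (oneFun (fPlus f) (fourierHelgason par.ν F)) := by
      rw [e, inv_smul_smul₀ hne]
    rw [e']
    exact (h.act g).smul _
  refine WaveFn.ext_fn ?_
  change actFun g (onePart par _ _).fn = (Real.exp (-g.1.l) : ℂ) • (onePart par _ _).fn
  rw [onePart_fn h, onePart_fn hw, e]

theorem conjNeg_comp_dSact {d : ℕ} (F : dS d → ℂ) (Λ : SOup d) :
    conjNeg (fun X => F (dSact Λ X)) = fun X => conjNeg F (dSact Λ X) := by
  funext X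
  have h : dSact Λ (dSneg X) = dSneg (dSact Λ X) := Subtype.ext (map_neg Λ.1 (X : Mink d))
  simp only [conjNeg, h]

/-- Both terms of the field transform by `waveAct_onePart`, the second one with `conj f` in place of
`f`. The annihilation operator is antilinear in its argument, but the factor `e^{-λ}` is real. -/
theorem fockRep_field {d : ℕ} (hd : 1 ≤ d) (par : SeriesParam d) (g : Po × SOup d)
    (f : SchwartzMap ℝ ℂ) {F : dS d → ℂ} (hF : F ∈ TestFn d) (Ψ : finDom par) :
    fockRep hd par g (field par f F Ψ : Fock par) = (Real.exp (-g.1.l) : ℂ) •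
      (field par (fun u => (Real.exp g.1.l : ℂ) * f (Real.exp g.1.l * (u - g.1.x)))
        (fun X => F (dSact g.2⁻¹ X)) ⟨fockRep hd par g Ψ, fockRep_mem_finDom hd g Ψ.2⟩ :
          Fock par) := by
  have hF' := TestFn.conjNeg hF
  have e1 : (fun θ => (starRingEnd ℂ) (fMinus f θ)) = fPlus fun u => (starRingEnd ℂ) (f u) :=
    funext fun θ => conj_fMinus f θ
  have e2 : (fun θ => (starRingEnd ℂ) (fMinus (fun u => (Real.exp g.1.l : ℂ) *
      f (Real.exp g.1.l * (u - g.1.x))) θ)) = fPlus fun u => (Real.exp g.1.l : ℂ) *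
        (fun u => (starRingEnd ℂ) (f u)) (Real.exp g.1.l * (u - g.1.x)) := by
    funext θ
    rw [conj_fMinus]
    simp only [map_mul, Complex.conj_ofReal]
  have hw := isWave_fMinus par.ν f hF'
  rw [e1] at hw
  have k1 := waveAct_onePart (par := par) g f hF (isWave_fPlus par.ν f hF)
  have k2 := waveAct_onePart (par := par) g (fun u => (starRingEnd ℂ) (f u)) hF' hw
  rw [field, field, conjNeg_comp_dSact, e1, e2, LinearMap.add_apply, LinearMap.add_apply,
    Submodule.coe_add, Submodule.coe_add, map_add, fockRep_zDag, fockRep_zAnn, k1, k2, zDag_smul,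
    zAnn_smul, Complex.conj_ofReal, smul_add]
  rfl

/-- The mass term `α² + ν²` is real in both series, as `ν` is real or purely imaginary, and `box`
commutes with `conjNeg`. Hence `fourierHelgason_kleinGordon` applies to both one-particle functions.
-/
theorem field_kleinGordon {d : ℕ} (par : SeriesParam d) (f : ℝ → ℂ) {F : dS d → ℂ}
    (hF : F ∈ TestFn d) :
    field par f (fun X => box F X + ((alpha d : ℂ) ^ 2 + par.ν ^ 2) * F X) = 0 := by
  have hm : (starRingEnd ℂ) ((alpha d : ℂ) ^ 2 + par.ν ^ 2) = (alpha d : ℂ) ^ 2 + par.ν ^ 2 := by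
    rw [map_add, map_pow, map_pow, Complex.conj_ofReal]
    congr 1
    rcases par.adm with h | h
    · rw [Complex.conj_eq_iff_im.mpr h]
    · have h1 : par.ν = Complex.I * par.ν.im := by
        refine Complex.ext ?_ ?_ <;> simp [h.1]
      rw [h1, map_mul, Complex.conj_I, Complex.conj_ofReal]
      ring
  have hc : conjNeg (fun X => box F X + ((alpha d : ℂ) ^ 2 + par.ν ^ 2) * F X) =
      fun X => box (conjNeg F) X + ((alpha d : ℂ) ^ 2 + par.ν ^ 2) * conjNeg F X := by
    funext X
    rw [box_conjNeg hF]
    simp only [conjNeg, map_add, map_mul]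
    rw [← map_add (starRingEnd ℂ) ((alpha d : ℂ) ^ 2), hm]
  have z1 : zDag (0 : WaveFn par 1) = 0 := by simpa using zDag_smul (par := par) 0 0
  have z2 : zAnn (0 : WaveFn par 1) = 0 := by simpa using zAnn_smul (par := par) 0 0
  rw [field, hc, fourierHelgason_kleinGordon hF, fourierHelgason_kleinGordon (TestFn.conjNeg hF),
    onePart_zero, onePart_zero, z1, z2, add_zero]

theorem mainTheorem7 (d : ℕ) (hd : 2 ≤ d) (par : SeriesParam d) :
    -- the field is well defined and an operator-valued distribution
    FieldWellDefined par ∧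
    IsOperatorValuedDistribution (finDom par) (field par) ∧
    -- neutrality
    (∀ f : SchwartzMap ℝ ℂ, ∀ F ∈ TestFn d,
      fieldOp par (fun u => (starRingEnd ℂ) (f u)) (conjNeg F) ≤ (fieldOp par f F).adjoint) ∧
    -- covariance under the unitary representation `V`
    (∃ V : Po × SOup d →* (Fock par ≃ₗᵢ[ℂ] Fock par),
      (∀ g Ψ n, ((V g Ψ) n : NPart par n) = nAct g n (Ψ n : NPart par n)) ∧
      ∀ g, ∀ f : SchwartzMap ℝ ℂ, ∀ F ∈ TestFn d, ∀ Ψ : finDom par,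
        ∃ h : (V g)⁻¹ (Ψ : Fock par) ∈ finDom par,
          V g (field par f F ⟨(V g)⁻¹ (Ψ : Fock par), h⟩ : Fock par) =
            (Real.exp (-g.1.l) : ℂ) •
              (field par (fun u => (Real.exp g.1.l : ℂ) * f (Real.exp g.1.l * (u - g.1.x)))
                (fun X => F (dSact g.2⁻¹ X)) Ψ : Fock par)) ∧
    -- Klein-Gordon equation of mass `m² = α² + ν²`
    (∀ f : SchwartzMap ℝ ℂ, ∀ F ∈ TestFn d, box F ∈ TestFn d ∧
      field par f (fun X => box F X + ((alpha d : ℂ) ^ 2 + par.ν ^ 2) * F X) = 0) := by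
  have hd' : 1 ≤ d := by omega
  refine ⟨fieldWellDefined par, isOperatorValuedDistribution_field par,
    fun f F _ => fieldOp_conj_le_adjoint par f F, ⟨fockRep hd' par, fun _ _ _ => rfl, ?_⟩,
    fun f F hF => ⟨TestFn.box hF, field_kleinGordon par f hF⟩⟩
  intro g f F hF Ψ
  have e : (fockRep hd' par g)⁻¹ = fockRep hd' par g⁻¹ := (map_inv (fockRep hd' par) g).symm
  have h : (fockRep hd' par g)⁻¹ (Ψ : Fock par) ∈ finDom par := by
    rw [e]
    exact fockRep_mem_finDom hd' g⁻¹ Ψ.2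
  refine ⟨h, ?_⟩
  rw [fockRep_field hd' par g f hF]
  congr 3
  exact Subtype.ext ((fockRep hd' par g).apply_symm_apply (Ψ : Fock par))
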